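/- **Conventions.** Let $k$ be a field and let $(H,\Delta,\varepsilon,\Phi,S,\alpha,\beta)$ be a finite-dimensional quasi-Hopf algebra over $k$: $H$ is an associative unital $k$-algebra, $\Delta:H\to H\otimes H$ and $\varepsilon:H\to k$ are unital algebra maps, $\Phi=X^1\otimes X^2\otimes X^3\in H^{\otimes 3}$ is invertible with inverse $\Phi^{-1}=x^1\otimes x^2\otimes x^3$, $S:H\to H$ is a unital algebra anti-morphism, $\alpha,\beta\in H$, and for all $h\in H$ $$(\mathrm{id}\otimes\Delta)(\Delta(h))=\Phi\,(\Delta\otimes \mathrm{id})(\Delta(h))\,\Phi^{-1},\quad (\mathrm{id}\otimes\varepsilon)(\Delta(h))=h=(\varepsilon\otimes \mathrm{id})(\Delta(h)),$$ $$(1\otimes\Phi)(\mathrm{id}\otimes\Delta\otimes \mathrm{id})(\Phi)(\Phi\otimes1)=(\mathrm{id}\otimes \mathrm{id}\otimes\Delta)(\Phi)(\Delta\otimes \mathrm{id}\otimes \mathrm{id})(\Phi),\quad(\mathrm{id}\otimes\varepsilon\otimes \mathrm{id})(\Phi)=1\otimes1,$$ $$S(h_1)\alpha h_2=\varepsilon(h)\alpha,\quad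 h_1\beta S(h_2)=\varepsilon(h)\beta,\quad X^1\beta S(X^2)\alpha X^3=1,\quad S(x^1)\alpha x^2\beta S(x^3)=1 .$$ Here $\Delta(h)=h_1\otimes h_2$, $(\Delta\otimes\mathrm{id})(\Delta(h))=h_{(1,1)}\otimes h_{(1,2)}\otimes h_2$; further letters $Y^i$ and $y^i$ denote second copies of the components of $\Phi$ and of $\Phi^{-1}$. As usual we normalize $\varepsilon(\alpha)=\varepsilon(\beta)=1$. A quasi-Hopf algebra is *involutory* if $S^2(h)=S(\beta)\alpha h\beta S(\alpha)$ for all $h$; then $S$ is bijective. Let $A^1\otimes A^2\otimes A^3\otimes A^4=(\Phi\otimes1)(\Delta\otimes \mathrm{id}\otimes \mathrm{id})(\Phi^{-1})$, $B^1\otimes B^2\otimes B^3\otimes B^4=(\Delta\otimes \mathrm{id}\otimes \mathrm{id})(\Phi)(\Phi^{-1}\otimes1)$, $\gamma=S(A^2)\alpha A^3\otimes S(A^1)\alpha A^4$ and $\delta=B^1\beta S(B^4)\otimes B^2\beta S(B^3)$. With $\Delta^{\rm cop}(h)=h_2\otimes h_1$, the Drinfeld twist $f=f^1\otimes f^2$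 and its inverse $f^{-1}=g^1\otimes g^2$ are $$f=(S\otimes S)(\Delta^{\rm cop}(x^1))\,\gamma\,\Delta(x^2\beta S(x^3)),\qquad f^{-1}=\Delta(S(x^1)\alpha x^2)\,\delta\,(S\otimes S)(\Delta^{\rm cop}(x^3)).$$ Put $f_{21}=f^2\otimes f^1$, $p^1\otimes p^2=x^1\otimes x^2\beta S(x^3)$, $q^1\otimes q^2=X^1\otimes S^{-1}(\alpha X^3)X^2$, $U^1\otimes U^2=g^1S(q^2)\otimes g^2S(q^1)$ and $$\Omega^1\otimes\cdots\otimes\Omega^5=X^1_{(1,1)}y^1x^1\otimes X^1_{(1,2)}y^2x^2_1\otimes X^1_2y^3x^2_2\otimes S^{-1}(f^1X^2x^3)\otimes S^{-1}(f^2X^3).$$ On $H^*$ put $\langle h\rightharpoonup\varphi,h'\rangle=\varphi(h'h)$, $\langle\varphi\leftharpoonup h,h'\rangle=\varphi(hh')$, $(\varphi\psi)(h)=\varphi(h_1)\psi(h_2)$, and let $\varphi_1\otimes\varphi_2$ be determined by $\varphi(hh')=\varphi_1(h)\varphi_2(h')$. The *quantum double* $D(H)$ is the space $H^*\otimes H$,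 with $\varphi\bowtie h$ written for $\varphi\otimes h$, with unit $\varepsilon\bowtie1$ and the operations $$(\varphi\bowtie h)(\psi\bowtie h')=[(\Omega^1\rightharpoonup\varphi\leftharpoonup\Omega^5)(\Omega^2h_{(1,1)}\rightharpoonup\psi\leftharpoonup S^{-1}(h_2)\Omega^4)]\bowtie\Omega^3h_{(1,2)}h',$$ $$\Delta_D(\varphi\bowtie h)=(\varepsilon\bowtie X^1Y^1)(p^1_1x^1\rightharpoonup\varphi_2\leftharpoonup Y^2S^{-1}(p^2)\bowtie p^1_2x^2h_1)\otimes(X^2_1\rightharpoonup\varphi_1\leftharpoonup S^{-1}(X^3)\bowtie X^2_2Y^3x^3h_2),$$ $$\varepsilon_D(\varphi\bowtie h)=\varepsilon(h)\varphi(S^{-1}(\alpha)),\qquad \Phi_D=(i_D\otimes i_D\otimes i_D)(\Phi)\ \text{ with } i_D(h)=\varepsilon\bowtie h,$$ $$S_D(\varphi\bowtie h)=(\varepsilon\bowtie S(h)f^1)(p^1_1U^1\rightharpoonup\varphi\circ S^{-1}\leftharpoonup f^2S^{-1}(p^2)\bowtie p^1_2U^2),\qquad \alpha_D=\varepsilon\bowtie\alpha,\quad\beta_D=\varepsilon\bowtie\beta.$$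 **Proposition.** Let $H$ be a finite-dimensional involutory quasi-Hopf algebra over $k$ such that $$\Delta(S(\beta)\alpha)=f^{-1}\,(S\otimes S)(f_{21})\,(S(\beta)\alpha\otimes S(\beta)\alpha).$$ Then $D(H)$, with the structure above, is an involutory quasi-Hopf algebra. -/

import Mathlib

open scoped TensorProduct

set_option maxSynthPendingDepth 6

noncomputable section

/-! ## Quasi-Hopf algebras

Tensor powers are bracketed to the right: `A ⊗ A ⊗ A` is `A ⊗[k] (A ⊗[k] A)`, and so on. They carry
the componentwise multiplication. The axioms are formulated for a space with a unit element and a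
bilinear multiplication, associativity and the unit laws being part of the axioms, so that one
can say of an explicitly given multiplication that it makes a space a quasi-Hopf algebra. -/

/-- The structure maps and distinguished elements of a quasi-Hopf algebra (without the axioms). -/
structure QuasiHopfData (k A : Type*) [Field k] [AddCommMonoid A] [Module k A] where
  /-- the comultiplication `Δ` -/
  comul : A →ₗ[k] A ⊗[k] A
  /-- the counit `ε` -/
  counit : A →ₗ[k] k
  /-- the reassociator `Φ = X¹ ⊗ X² ⊗ X³` -/
  Phi : A ⊗[k] (A ⊗[k] A)
  /-- the inverse `Φ⁻¹ = x¹ ⊗ x² ⊗ x³` of the reassociator -/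
  PhiInv : A ⊗[k] (A ⊗[k] A)
  /-- the antipode `S` -/
  S : A →ₗ[k] A
  /-- the distinguished element `α` -/
  α : A
  /-- the distinguished element `β` -/
  β : A

/-- For linear maps `f`, `g` into an algebra `B`, the linear map `m ⊗ n ↦ f m * g n`. -/
def mulMap₂ {k M N B : Type*} [Field k] [AddCommMonoid M] [Module k M]
    [AddCommMonoid N] [Module k N] [NonUnitalNonAssocSemiring B] [Module k B]
    [SMulCommClass k B B] [IsScalarTower k B B] (f : M →ₗ[k] B) (g : N →ₗ[k] B) : M ⊗[k] N →ₗ[k] B :=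
  LinearMap.mul' k B ∘ₗ TensorProduct.map f g

namespace QuasiHopfData

section Axioms

variable {k A : Type*} [Field k] [NonUnitalNonAssocRing A] [One A] [Module k A]
  [SMulCommClass k A A] [IsScalarTower k A A]

/-- The axioms of a quasi-Hopf algebra: `A` is an associative unital algebra, `Δ` and `ε` are
unital algebra maps, `Φ` is an invertible normalized 3-cocycle, `Δ` is counital, and
coassociative up to conjugation by `Φ`, and `S` is an algebra anti-morphism which together with
`α`, `β` satisfies the antipode axioms. Bijectivity of `S` is not required. -/
structure IsQuasiHopf (Q : QuasiHopfData k A) : Prop where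
  mul_assoc : ∀ a b c : A, a * b * c = a * (b * c)
  one_mul : ∀ a : A, 1 * a = a
  mul_one : ∀ a : A, a * 1 = a
  comul_mul : ∀ a b : A, Q.comul (a * b) = Q.comul a * Q.comul b
  comul_one : Q.comul 1 = 1 ⊗ₜ 1
  counit_mul : ∀ a b : A, Q.counit (a * b) = Q.counit a * Q.counit b
  counit_one : Q.counit 1 = 1
  Phi_mul_PhiInv : Q.Phi * Q.PhiInv = 1 ⊗ₜ (1 ⊗ₜ 1)
  PhiInv_mul_Phi : Q.PhiInv * Q.Phi = 1 ⊗ₜ (1 ⊗ₜ 1)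
  /-- `(id ⊗ Δ)(Δ(h)) = Φ (Δ ⊗ id)(Δ(h)) Φ⁻¹` -/
  quasi_coassoc : ∀ h : A, Q.comul.lTensor A (Q.comul h) =
    Q.Phi * TensorProduct.assoc k A A A (Q.comul.rTensor A (Q.comul h)) * Q.PhiInv
  /-- `(id ⊗ ε)(Δ(h)) = h` -/
  lTensor_counit : ∀ h : A, TensorProduct.rid k A (Q.counit.lTensor A (Q.comul h)) = h
  /-- `(ε ⊗ id)(Δ(h)) = h` -/
  rTensor_counit : ∀ h : A, TensorProduct.lid k A (Q.counit.rTensor A (Q.comul h)) = h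
  /-- `(1 ⊗ Φ) (id ⊗ Δ ⊗ id)(Φ) (Φ ⊗ 1) = (id ⊗ id ⊗ Δ)(Φ) (Δ ⊗ id ⊗ id)(Φ)` -/
  cocycle :
    ((1 : A) ⊗ₜ[k] Q.Phi) *
        (((TensorProduct.assoc k A A A).toLinearMap ∘ₗ Q.comul.rTensor A).lTensor A Q.Phi) *
        ((((TensorProduct.mk k A A).flip 1).lTensor A).lTensor A Q.Phi) =
      ((Q.comul.lTensor A).lTensor A Q.Phi) *
        (TensorProduct.assoc k A A (A ⊗[k] A) (Q.comul.rTensor (A ⊗[k] A) Q.Phi))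
  /-- `(id ⊗ ε ⊗ id)(Φ) = 1 ⊗ 1` -/
  Phi_counit :
    ((TensorProduct.lid k A).toLinearMap ∘ₗ Q.counit.rTensor A).lTensor A Q.Phi = 1 ⊗ₜ 1
  S_mul : ∀ a b : A, Q.S (a * b) = Q.S b * Q.S a
  S_one : Q.S 1 = 1
  /-- `S(h₁) α h₂ = ε(h) α` -/
  S_α : ∀ h : A,
    mulMap₂ (LinearMap.mulRight k Q.α ∘ₗ Q.S) LinearMap.id (Q.comul h) = Q.counit h • Q.α
  /-- `h₁ β S(h₂) = ε(h) β` -/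
  β_S : ∀ h : A, mulMap₂ (LinearMap.mulRight k Q.β) Q.S (Q.comul h) = Q.counit h • Q.β
  /-- `X¹ β S(X²) α X³ = 1` -/
  Phi_antipode :
    mulMap₂ (LinearMap.mulRight k Q.β)
      (mulMap₂ (LinearMap.mulRight k Q.α ∘ₗ Q.S) LinearMap.id) Q.Phi = 1
  /-- `S(x¹) α x² β S(x³) = 1` -/
  PhiInv_antipode :
    mulMap₂ (LinearMap.mulRight k Q.α ∘ₗ Q.S)
      (mulMap₂ (LinearMap.mulRight k Q.β) Q.S) Q.PhiInv = 1

/-- The involutory condition `S²(h) = S(β) α h β S(α)` for all `h`. -/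
def IsInvolutory (Q : QuasiHopfData k A) : Prop :=
  ∀ h : A, Q.S (Q.S h) = Q.S Q.β * Q.α * h * Q.β * Q.S Q.α

end Axioms

/-! ## The Drinfeld twist and the elements `p_R`, `q_R`, `U`, `Ω` -/

section Legs

variable (k : Type*) {A B : Type*} [Field k] [AddCommMonoid A] [Module k A] [AddCommMonoid B]
  [Module k B]

/-- `a ↦ a ⊗ 1` -/
def inl [One B] : A →ₗ[k] A ⊗[k] B := (TensorProduct.mk k A B).flip 1

/-- `b ↦ 1 ⊗ b` -/
def inr [One A] : B →ₗ[k] A ⊗[k] B := TensorProduct.mk k A B 1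

end Legs

section Double

variable {k H : Type*} [Field k] [Ring H] [Algebra k H] (Q : QuasiHopfData k H)

/-- The inverse `S⁻¹` of the antipode in the algebra of linear endomorphisms of `H`
(with the value `0` if `S` were not bijective). -/
def SInv : H →ₗ[k] H := Ring.inverse (M₀ := Module.End k H) Q.S

/-- `S ⊗ S` -/
def SS : H ⊗[k] H →ₗ[k] H ⊗[k] H := TensorProduct.map Q.S Q.S

/-- `Δᶜᵒᵖ(h) = h₂ ⊗ h₁` -/
def comulCop : H →ₗ[k] H ⊗[k] H := (TensorProduct.comm k H H).toLinearMap ∘ₗ Q.comul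

/-- `(Δ ⊗ id ⊗ id)` on `H ⊗ H ⊗ H` -/
def comulIdId : H ⊗[k] (H ⊗[k] H) →ₗ[k] H ⊗[k] (H ⊗[k] (H ⊗[k] H)) :=
  (TensorProduct.assoc k H H (H ⊗[k] H)).toLinearMap ∘ₗ Q.comul.rTensor (H ⊗[k] H)

/-- `a ⊗ b ⊗ c ↦ a ⊗ b ⊗ c ⊗ 1` -/
def tmulOne : H ⊗[k] (H ⊗[k] H) →ₗ[k] H ⊗[k] (H ⊗[k] (H ⊗[k] H)) :=
  ((inl k (A := H) (B := H)).lTensor H).lTensor H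

/-- `γ = S(A²) α A³ ⊗ S(A¹) α A⁴`, where
`A¹ ⊗ A² ⊗ A³ ⊗ A⁴ = (Φ ⊗ 1) (Δ ⊗ id ⊗ id)(Φ⁻¹)`. -/
def gam : H ⊗[k] H :=
  mulMap₂ (inr k ∘ₗ Q.S)
    (mulMap₂ (inl k ∘ₗ Q.S)
      (mulMap₂ (inl k ∘ₗ LinearMap.mulLeft k Q.α) (inr k ∘ₗ LinearMap.mulLeft k Q.α)))
    (tmulOne Q.Phi * Q.comulIdId Q.PhiInv)

/-- `δ = B¹ β S(B⁴) ⊗ B² β S(B³)`, where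
`B¹ ⊗ B² ⊗ B³ ⊗ B⁴ = (Δ ⊗ id ⊗ id)(Φ) (Φ⁻¹ ⊗ 1)`. -/
def del : H ⊗[k] H :=
  mulMap₂ (inl k ∘ₗ LinearMap.mulRight k Q.β)
    (mulMap₂ (inr k ∘ₗ LinearMap.mulRight k Q.β)
      (mulMap₂ (inr k ∘ₗ Q.S) (inl k ∘ₗ Q.S)))
    (Q.comulIdId Q.Phi * tmulOne Q.PhiInv)

/-- The Drinfeld twist `f = (S ⊗ S)(Δᶜᵒᵖ(x¹)) γ Δ(x² β S(x³))`. -/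
def twist : H ⊗[k] H :=
  mulMap₂ (LinearMap.mulRight k Q.gam ∘ₗ Q.SS ∘ₗ Q.comulCop)
    (Q.comul ∘ₗ mulMap₂ (LinearMap.mulRight k Q.β) Q.S) Q.PhiInv

/-- The inverse Drinfeld twist `f⁻¹ = Δ(S(x¹) α x²) δ (S ⊗ S)(Δᶜᵒᵖ(x³))`. -/
def twistInv : H ⊗[k] H :=
  mulMap₂
    (LinearMap.mulRight k Q.del ∘ₗ Q.comul ∘ₗ
      mulMap₂ (LinearMap.mulRight k Q.α ∘ₗ Q.S) LinearMap.id)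
    (Q.SS ∘ₗ Q.comulCop)
    ((TensorProduct.assoc k H H H).symm Q.PhiInv)

/-- `f₂₁ = f² ⊗ f¹` -/
def twist21 : H ⊗[k] H := TensorProduct.comm k H H Q.twist

/-- `p_R = p¹ ⊗ p² = x¹ ⊗ x² β S(x³)` -/
def pR : H ⊗[k] H := (mulMap₂ (LinearMap.mulRight k Q.β) Q.S).lTensor H Q.PhiInv

/-- `q_R = q¹ ⊗ q² = X¹ ⊗ S⁻¹(α X³) X²` -/
def qR : H ⊗[k] H :=
  (mulMap₂ (Q.SInv ∘ₗ LinearMap.mulLeft k Q.α) LinearMap.id ∘ₗ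
    (TensorProduct.comm k H H).toLinearMap).lTensor H Q.Phi

/-- `U = g¹ S(q²) ⊗ g² S(q¹)`, where `f⁻¹ = g¹ ⊗ g²` -/
def U : H ⊗[k] H := Q.twistInv * Q.SS (TensorProduct.comm k H H Q.qR)

end Double

/-! The five tensor legs of `H ⊗ H ⊗ H ⊗ H ⊗ H`, and the same for four and seven. -/

section Legs

variable (k H : Type*) [Field k] [Ring H] [Algebra k H]

/-- `H ⊗ H ⊗ H` -/
abbrev T3 : Type _ := H ⊗[k] (H ⊗[k] H)
/-- `H ⊗ H ⊗ H ⊗ H` -/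
abbrev T4 : Type _ := H ⊗[k] (H ⊗[k] (H ⊗[k] H))
/-- `H ⊗ H ⊗ H ⊗ H ⊗ H` -/
abbrev T5 : Type _ := H ⊗[k] (H ⊗[k] (H ⊗[k] (H ⊗[k] H)))

/-- `a ↦ a ⊗ 1 ⊗ 1` -/
def l31 : H →ₗ[k] T3 k H := inl k
/-- `a ↦ 1 ⊗ a ⊗ 1` -/
def l32 : H →ₗ[k] T3 k H := inr k ∘ₗ inl k
/-- `a ↦ 1 ⊗ 1 ⊗ a` -/
def l33 : H →ₗ[k] T3 k H := inr k ∘ₗ inr k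

/-- `a ↦ a ⊗ 1 ⊗ 1 ⊗ 1` -/
def l41 : H →ₗ[k] T4 k H := inl k
/-- `a ↦ 1 ⊗ a ⊗ 1 ⊗ 1` -/
def l42 : H →ₗ[k] T4 k H := inr k ∘ₗ l31 k H
/-- `a ↦ 1 ⊗ 1 ⊗ a ⊗ 1` -/
def l43 : H →ₗ[k] T4 k H := inr k ∘ₗ l32 k H
/-- `a ↦ 1 ⊗ 1 ⊗ 1 ⊗ a` -/
def l44 : H →ₗ[k] T4 k H := inr k ∘ₗ l33 k H

/-- `a ↦ a ⊗ 1 ⊗ 1 ⊗ 1 ⊗ 1` -/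
def l51 : H →ₗ[k] T5 k H := inl k
/-- `a ↦ 1 ⊗ a ⊗ 1 ⊗ 1 ⊗ 1` -/
def l52 : H →ₗ[k] T5 k H := inr k ∘ₗ l41 k H
/-- `a ↦ 1 ⊗ 1 ⊗ a ⊗ 1 ⊗ 1` -/
def l53 : H →ₗ[k] T5 k H := inr k ∘ₗ l42 k H
/-- `a ↦ 1 ⊗ 1 ⊗ 1 ⊗ a ⊗ 1` -/
def l54 : H →ₗ[k] T5 k H := inr k ∘ₗ l43 k H
/-- `a ↦ 1 ⊗ 1 ⊗ 1 ⊗ 1 ⊗ a` -/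
def l55 : H →ₗ[k] T5 k H := inr k ∘ₗ l44 k H

/-- The seven legs of `(H ⊗ H ⊗ H ⊗ H) ⊗ (H ⊗ H ⊗ H)`. -/
abbrev T43 : Type _ := T4 k H ⊗[k] T3 k H

/-- leg 1 of 7 -/
def l71 : H →ₗ[k] T43 k H := inl k ∘ₗ l41 k H
/-- leg 2 of 7 -/
def l72 : H →ₗ[k] T43 k H := inl k ∘ₗ l42 k H
/-- leg 3 of 7 -/
def l73 : H →ₗ[k] T43 k H := inl k ∘ₗ l43 k H
/-- leg 4 of 7 -/
def l74 : H →ₗ[k] T43 k H := inl k ∘ₗ l44 k H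
/-- leg 5 of 7 -/
def l75 : H →ₗ[k] T43 k H := inr k ∘ₗ l31 k H
/-- leg 6 of 7 -/
def l76 : H →ₗ[k] T43 k H := inr k ∘ₗ l32 k H
/-- leg 7 of 7 -/
def l77 : H →ₗ[k] T43 k H := inr k ∘ₗ l33 k H

/-! The operations on the dual space `H^*`. -/

/-- `h ↦ (φ ↦ h ⇀ φ)`, where `⟨h ⇀ φ, h'⟩ = ⟨φ, h' h⟩` -/
def hitL : H →ₗ[k] Module.End k (Module.Dual k H) :=
  (Module.Dual.transpose (R := k)) ∘ₗ (LinearMap.mul k H).flip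

/-- `h ↦ (φ ↦ φ ↼ h)`, where `⟨φ ↼ h, h'⟩ = ⟨φ, h h'⟩` -/
def hitR : H →ₗ[k] Module.End k (Module.Dual k H) :=
  (Module.Dual.transpose (R := k)) ∘ₗ (LinearMap.mul k H)

variable {k H}

theorem hitL_apply (h : H) (φ : Module.Dual k H) (h' : H) : hitL k H h φ h' = φ (h' * h) := rfl

theorem hitR_apply (h : H) (φ : Module.Dual k H) (h' : H) : hitR k H h φ h' = φ (h * h') := rfl

/-- The coproduct `φ ↦ φ₁ ⊗ φ₂` of `H^*` dual to the multiplication of `H`, characterized by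
`φ(h h') = φ₁(h) φ₂(h')`. -/
def dualComul [FiniteDimensional k H] :
    Module.Dual k H →ₗ[k] Module.Dual k H ⊗[k] Module.Dual k H :=
  (TensorProduct.dualDistribEquiv k H H).symm.toLinearMap ∘ₗ
    Module.Dual.transpose (R := k) (LinearMap.mul' k H)

theorem dualComul_apply [FiniteDimensional k H] (φ : Module.Dual k H) (h h' : H) :
    TensorProduct.dualDistrib k H H (dualComul φ) (h ⊗ₜ h') = φ (h * h') := by
  have : TensorProduct.dualDistrib k H H (dualComul φ) =
      TensorProduct.dualDistribEquiv k H H (dualComul φ) := rfl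
  rw [this, dualComul, LinearMap.comp_apply, LinearEquiv.coe_coe, LinearEquiv.apply_symm_apply]
  rfl

end Legs

/-! ## The quantum double -/

section Double

variable {k H : Type*} [Field k] [Ring H] [Algebra k H] (Q : QuasiHopfData k H)

/-- The convolution `φ ⊗ ψ ↦ φ ψ` on `H^*`, where `(φ ψ)(h) = φ(h₁) ψ(h₂)`. -/
def conv : Module.Dual k H ⊗[k] Module.Dual k H →ₗ[k] Module.Dual k H :=
  Module.Dual.transpose (R := k) Q.comul ∘ₗ TensorProduct.dualDistrib k H H

/-- `X¹₍₁,₁₎ ⊗ X¹₍₁,₂₎ ⊗ X¹₂ ⊗ X² ⊗ X³` -/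
def OmegaX : T5 k H :=
  mulMap₂ (mulMap₂ (mulMap₂ (l51 k H) (l52 k H) ∘ₗ Q.comul) (l53 k H) ∘ₗ Q.comul)
    (mulMap₂ (l54 k H) (l55 k H)) Q.Phi

/-- `y¹ ⊗ y² ⊗ y³ ⊗ 1 ⊗ 1`, where `Φ⁻¹ = y¹ ⊗ y² ⊗ y³` -/
def OmegaY : T5 k H :=
  mulMap₂ (l51 k H) (mulMap₂ (l52 k H) (l53 k H)) Q.PhiInv

/-- `x¹ ⊗ x²₁ ⊗ x²₂ ⊗ x³ ⊗ 1` -/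
def OmegaZ : T5 k H :=
  mulMap₂ (l51 k H) (mulMap₂ (mulMap₂ (l52 k H) (l53 k H) ∘ₗ Q.comul) (l54 k H)) Q.PhiInv

/-- `1 ⊗ 1 ⊗ 1 ⊗ f¹ ⊗ f²` -/
def OmegaF : T5 k H := mulMap₂ (l54 k H) (l55 k H) Q.twist

/-- `Ω = X¹₍₁,₁₎ y¹ x¹ ⊗ X¹₍₁,₂₎ y² x²₁ ⊗ X¹₂ y³ x²₂ ⊗ S⁻¹(f¹ X² x³) ⊗ S⁻¹(f² X³)` -/
def Omega : T5 k H :=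
  (((TensorProduct.map Q.SInv Q.SInv).lTensor H).lTensor H).lTensor H
    (Q.OmegaF * Q.OmegaX * Q.OmegaY * Q.OmegaZ)

/-- `h ↦ Ω¹ ⊗ Ω² h₍₁,₁₎ ⊗ Ω³ h₍₁,₂₎ ⊗ S⁻¹(h₂) Ω⁴ ⊗ Ω⁵` -/
def OmegaAt : H →ₗ[k] T5 k H :=
  mulMap₂ (LinearMap.mulRight k Q.Omega ∘ₗ l54 k H ∘ₗ Q.SInv)
      (mulMap₂ (l52 k H) (l53 k H) ∘ₗ Q.comul) ∘ₗ
    Q.comulCop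

/-- The underlying vector space `H^* ⊗ H` of the quantum double; the element `φ ⋈ h` is
`φ ⊗ₜ h`. (The multiplication depends on `Q`.) -/
@[nolint unusedArguments]
def QuantumDouble (_Q : QuasiHopfData k H) : Type _ := Module.Dual k H ⊗[k] H

instance : AddCommGroup Q.QuantumDouble :=
  inferInstanceAs (AddCommGroup (Module.Dual k H ⊗[k] H))

instance : Module k Q.QuantumDouble :=
  inferInstanceAs (Module k (Module.Dual k H ⊗[k] H))

/-- The element `φ ⋈ h`, bilinearly in `φ` and `h`. -/
def bow : Module.Dual k H →ₗ[k] H →ₗ[k] Q.QuantumDouble := TensorProduct.mk k (Module.Dual k H) H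

/-- Linear maps out of the quantum double are the bilinear maps of `(φ, h)`. -/
def doubleLift {V : Type*} [AddCommGroup V] [Module k V]
    (F : Module.Dual k H →ₗ[k] H →ₗ[k] V) : Q.QuantumDouble →ₗ[k] V :=
  TensorProduct.lift F

theorem doubleLift_bow {V : Type*} [AddCommGroup V] [Module k V]
    (F : Module.Dual k H →ₗ[k] H →ₗ[k] V) (φ : Module.Dual k H) (h : H) :
    Q.doubleLift F (Q.bow φ h) = F φ h :=
  TensorProduct.lift.tmul _ _

/-- For `a ∈ End(H^*)`, the map `φ ⋈ h ↦ a(φ) ⋈ h`, linearly in `a`. -/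
def onDual : Module.End k (Module.Dual k H) →ₗ[k] Module.End k Q.QuantumDouble :=
  LinearMap.rTensorHom (R := k) H

/-- `c ↦ (φ ⋈ h ↦ φ ⋈ c h)` -/
def onAlg : H →ₗ[k] Module.End k Q.QuantumDouble :=
  LinearMap.lTensorHom (R := k) (Module.Dual k H) ∘ₗ LinearMap.mul k H

/-- `a ⊗ b ⊗ c ↦ (φ ⋈ h ↦ (a ⇀ φ ↼ b) ⋈ c h)` -/
def act3 : T3 k H →ₗ[k] Module.End k Q.QuantumDouble :=
  mulMap₂ (Q.onDual ∘ₗ hitL k H) (mulMap₂ (Q.onDual ∘ₗ hitR k H) Q.onAlg)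

theorem act3_apply (a b c : H) (φ : Module.Dual k H) (h : H) :
    Q.act3 (a ⊗ₜ (b ⊗ₜ c)) (Q.bow φ h) = Q.bow (hitL k H a (hitR k H b φ)) (c * h) := rfl

/-- `w¹ ⊗ w² ⊗ w³ ⊗ w⁴ ⊗ w⁵ ↦
  (φ ⊗ (ψ ⋈ h) ↦ (w¹ ⇀ φ ↼ w⁵) ⊗ ((w² ⇀ ψ ↼ w⁴) ⋈ w³ h))` -/
def act5 : T5 k H →ₗ[k] Module.End k (Module.Dual k H ⊗[k] Q.QuantumDouble) :=
  mulMap₂ (LinearMap.rTensorHom (R := k) Q.QuantumDouble ∘ₗ hitL k H)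
    (mulMap₂ (LinearMap.lTensorHom (R := k) (Module.Dual k H) ∘ₗ Q.onDual ∘ₗ hitL k H)
      (mulMap₂ (LinearMap.lTensorHom (R := k) (Module.Dual k H) ∘ₗ Q.onAlg)
        (mulMap₂ (LinearMap.lTensorHom (R := k) (Module.Dual k H) ∘ₗ Q.onDual ∘ₗ hitR k H)
          (LinearMap.rTensorHom (R := k) Q.QuantumDouble ∘ₗ hitR k H))))

theorem act5_apply (a b c d e : H) (φ ψ : Module.Dual k H) (h : H) :
    Q.act5 (a ⊗ₜ (b ⊗ₜ (c ⊗ₜ (d ⊗ₜ e)))) (φ ⊗ₜ Q.bow ψ h) =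
      hitL k H a (hitR k H e φ) ⊗ₜ Q.bow (hitL k H b (hitR k H d ψ)) (c * h) := rfl

/-- `φ ⊗ (ψ ⋈ h) ↦ φ ψ ⋈ h` -/
def convBow : Module.Dual k H ⊗[k] Q.QuantumDouble →ₗ[k] Q.QuantumDouble :=
  Q.conv.rTensor H ∘ₗ
    (TensorProduct.assoc k (Module.Dual k H) (Module.Dual k H) H).symm.toLinearMap

theorem convBow_apply (φ ψ : Module.Dual k H) (h : H) :
    Q.convBow (φ ⊗ₜ Q.bow ψ h) = Q.bow (Q.conv (φ ⊗ₜ ψ)) h := rfl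

/-- The multiplication of the quantum double:
`(φ ⋈ h)(ψ ⋈ h') =
  [(Ω¹ ⇀ φ ↼ Ω⁵)(Ω² h₍₁,₁₎ ⇀ ψ ↼ S⁻¹(h₂) Ω⁴)] ⋈ Ω³ h₍₁,₂₎ h'`. -/
def mulD : Q.QuantumDouble →ₗ[k] Q.QuantumDouble →ₗ[k] Q.QuantumDouble :=
  Q.doubleLift <| LinearMap.mk₂ k
    (fun φ h => Q.convBow ∘ₗ Q.act5 (Q.OmegaAt h) ∘ₗ
      TensorProduct.mk k (Module.Dual k H) Q.QuantumDouble φ)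
    (fun φ φ' h => by simp only [map_add, LinearMap.comp_add])
    (fun c φ h => by simp only [map_smul, LinearMap.comp_smul])
    (fun φ h h' => by simp only [map_add, LinearMap.comp_add, LinearMap.add_comp])
    (fun c φ h => by simp only [map_smul, LinearMap.comp_smul, LinearMap.smul_comp])

theorem mulD_apply (φ : Module.Dual k H) (h : H) (y : Q.QuantumDouble) :
    Q.mulD (Q.bow φ h) y = Q.convBow (Q.act5 (Q.OmegaAt h) (φ ⊗ₜ y)) := rfl

instance : NonUnitalNonAssocRing Q.QuantumDouble where
  mul x y := Q.mulD x y
  left_distrib x y z := map_add (Q.mulD x) y z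
  right_distrib x y z := by
    change Q.mulD (x + y) z = Q.mulD x z + Q.mulD y z
    rw [map_add, LinearMap.add_apply]
  zero_mul x := by
    change Q.mulD 0 x = 0
    rw [map_zero, LinearMap.zero_apply]
  mul_zero x := map_zero (Q.mulD x)

theorem mul_def (x y : Q.QuantumDouble) : x * y = Q.mulD x y := rfl

instance : SMulCommClass k Q.QuantumDouble Q.QuantumDouble where
  smul_comm c x y := ((Q.mulD x).map_smul c y).symm

instance : IsScalarTower k Q.QuantumDouble Q.QuantumDouble where
  smul_assoc c x y := by
    change Q.mulD (c • x) y = c • Q.mulD x y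
    rw [map_smul, LinearMap.smul_apply]

/-- `i_D(h) = ε ⋈ h` -/
def iD : H →ₗ[k] Q.QuantumDouble := Q.bow Q.counit

/-- The unit `ε ⋈ 1`. -/
instance : One Q.QuantumDouble := ⟨Q.iD 1⟩

/-- `a ⊗ b ⊗ c ⊗ d ↦ (φ ⋈ h ↦ (ε ⋈ a) ((b ⇀ φ ↼ c) ⋈ d h))` -/
def act4 : T4 k H →ₗ[k] Module.End k Q.QuantumDouble :=
  mulMap₂ (Q.mulD ∘ₗ Q.iD) Q.act3

theorem act4_apply (a b c d : H) (φ : Module.Dual k H) (h : H) :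
    Q.act4 (a ⊗ₜ (b ⊗ₜ (c ⊗ₜ d))) (Q.bow φ h) =
      Q.iD a * Q.bow (hitL k H b (hitR k H c φ)) (d * h) := rfl

/-- `X¹ ⊗ 1 ⊗ 1 ⊗ 1 ⊗ X²₁ ⊗ S⁻¹(X³) ⊗ X²₂` -/
def comulX : T43 k H :=
  mulMap₂ (l71 k H) (mulMap₂ (mulMap₂ (l75 k H) (l77 k H) ∘ₗ Q.comul) (l76 k H ∘ₗ Q.SInv)) Q.Phi

/-- `Y¹ ⊗ 1 ⊗ Y² ⊗ 1 ⊗ 1 ⊗ 1 ⊗ Y³`, where `Φ = Y¹ ⊗ Y² ⊗ Y³` -/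
def comulY : T43 k H := mulMap₂ (l71 k H) (mulMap₂ (l73 k H) (l77 k H)) Q.Phi

/-- `1 ⊗ p¹₁ ⊗ S⁻¹(p²) ⊗ p¹₂ ⊗ 1 ⊗ 1 ⊗ 1` -/
def comulP : T43 k H :=
  mulMap₂ (mulMap₂ (l72 k H) (l74 k H) ∘ₗ Q.comul) (l73 k H ∘ₗ Q.SInv) Q.pR

/-- `1 ⊗ x¹ ⊗ 1 ⊗ x² ⊗ 1 ⊗ 1 ⊗ x³` -/
def comulZ : T43 k H := mulMap₂ (l72 k H) (mulMap₂ (l74 k H) (l77 k H)) Q.PhiInv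

/-- The element of `H^{⊗7}`
`X¹Y¹ ⊗ p¹₁ x¹ ⊗ Y² S⁻¹(p²) ⊗ p¹₂ x² h₁ ⊗ X²₁ ⊗ S⁻¹(X³) ⊗ X²₂ Y³ x³ h₂`, linearly in `h`. -/
def comulElt : H →ₗ[k] T43 k H :=
  LinearMap.mulLeft k (Q.comulX * Q.comulY * Q.comulP * Q.comulZ) ∘ₗ
    mulMap₂ (l74 k H) (l77 k H) ∘ₗ Q.comul

/-- The linear map `φ ⊗ ψ ↦ (ψ ⋈ 1) ⊗ (φ ⋈ 1)`. -/
def swapBow : Module.Dual k H ⊗[k] Module.Dual k H →ₗ[k] Q.QuantumDouble ⊗[k] Q.QuantumDouble :=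
  TensorProduct.map (Q.bow.flip 1) (Q.bow.flip 1) ∘ₗ
    (TensorProduct.comm k (Module.Dual k H) (Module.Dual k H)).toLinearMap

/-- The comultiplication of the quantum double:
`Δ_D(φ ⋈ h) = (ε ⋈ X¹Y¹)(p¹₁ x¹ ⇀ φ₂ ↼ Y² S⁻¹(p²) ⋈ p¹₂ x² h₁)
  ⊗ (X²₁ ⇀ φ₁ ↼ S⁻¹(X³) ⋈ X²₂ Y³ x³ h₂)`. -/
def comulD [FiniteDimensional k H] : Q.QuantumDouble →ₗ[k] Q.QuantumDouble ⊗[k] Q.QuantumDouble :=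
  Q.doubleLift <| LinearMap.flip <|
    LinearMap.lcomp k (Q.QuantumDouble ⊗[k] Q.QuantumDouble) (Q.swapBow ∘ₗ dualComul) ∘ₗ
      TensorProduct.homTensorHomMap (RingHom.id k) _ _ _ _ ∘ₗ
        TensorProduct.map Q.act4 Q.act3 ∘ₗ Q.comulElt

theorem comulD_bow [FiniteDimensional k H] (φ : Module.Dual k H) (h : H) :
    Q.comulD (Q.bow φ h) =
      TensorProduct.homTensorHomMap (RingHom.id k) _ _ _ _ (TensorProduct.map Q.act4 Q.act3 (Q.comulElt h))
        (Q.swapBow (dualComul φ)) := rfl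

/-- The counit of the quantum double: `ε_D(φ ⋈ h) = ε(h) φ(S⁻¹(α))`. -/
def counitD : Q.QuantumDouble →ₗ[k] k :=
  Q.doubleLift ((LinearMap.mul k k).compl₁₂ (Module.Dual.eval k H (Q.SInv Q.α)) Q.counit)

theorem counitD_bow (φ : Module.Dual k H) (h : H) :
    Q.counitD (Q.bow φ h) = φ (Q.SInv Q.α) * Q.counit h := rfl

/-- `f¹ ⊗ 1 ⊗ f² ⊗ 1` -/
def antipodeF : T4 k H := mulMap₂ (l41 k H) (l43 k H) Q.twist

/-- `1 ⊗ p¹₁ ⊗ S⁻¹(p²) ⊗ p¹₂` -/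
def antipodeP : T4 k H :=
  mulMap₂ (mulMap₂ (l42 k H) (l44 k H) ∘ₗ Q.comul) (l43 k H ∘ₗ Q.SInv) Q.pR

/-- `1 ⊗ U¹ ⊗ 1 ⊗ U²` -/
def antipodeU : T4 k H := mulMap₂ (l42 k H) (l44 k H) Q.U

/-- The element `f¹ ⊗ p¹₁ U¹ ⊗ f² S⁻¹(p²) ⊗ p¹₂ U²` of `H^{⊗4}`. -/
def antipodeElt : T4 k H := Q.antipodeF * Q.antipodeP * Q.antipodeU

/-- The antipode of the quantum double:
`S_D(φ ⋈ h) = (ε ⋈ S(h) f¹)(p¹₁ U¹ ⇀ φ ∘ S⁻¹ ↼ f² S⁻¹(p²) ⋈ p¹₂ U²)`. -/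
def antipodeD : Q.QuantumDouble →ₗ[k] Q.QuantumDouble :=
  Q.doubleLift <| LinearMap.flip <|
    LinearMap.lcomp k Q.QuantumDouble (Q.bow.flip 1 ∘ₗ Module.Dual.transpose (R := k) Q.SInv) ∘ₗ
      Q.act4 ∘ₗ LinearMap.mulRight k Q.antipodeElt ∘ₗ l41 k H ∘ₗ Q.S

theorem antipodeD_bow (φ : Module.Dual k H) (h : H) :
    Q.antipodeD (Q.bow φ h) =
      Q.act4 (l41 k H (Q.S h) * Q.antipodeElt) (Q.bow (φ ∘ₗ Q.SInv) 1) := rfl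

/-- The structure maps of the quantum double `D(H)`, with
`Φ_D = (i_D ⊗ i_D ⊗ i_D)(Φ)`, `α_D = ε ⋈ α` and `β_D = ε ⋈ β`. -/
def double [FiniteDimensional k H] : QuasiHopfData k Q.QuantumDouble where
  comul := Q.comulD
  counit := Q.counitD
  Phi := TensorProduct.map Q.iD (TensorProduct.map Q.iD Q.iD) Q.Phi
  PhiInv := TensorProduct.map Q.iD (TensorProduct.map Q.iD Q.iD) Q.PhiInv
  S := Q.antipodeD
  α := Q.iD Q.α
  β := Q.iD Q.β

end Double

end QuasiHopfData

end

/-! The double is understood through the centre of the category of H-modules: a D(H)-module is an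
H-module V together with a half-braiding X ⊗ V → V ⊗ X, natural in X and subject to a hexagon. The
proof gives this a universal form and then reads every structure map of D(H) off the corresponding
construction on half-braidings.

The language is a calculus of legs. An H-module is replaced by an algebra map x : H → B (`Leg`), and
modules that are tensored together by maps with commuting images (`Cm`). Then `tp` is the tensor
product, `un` the unit object, `ph` and `pb` are the associator and its inverse, all of them living
in B, and `Intw` says that an element of B is a morphism. The pentagon and naturality become
identities in a noncommutative ring, and each coherence argument is a linear combination of them.
For duals, B is an algebra of operators in which H acts by multiplications twisted with S or S⁻¹.
The antipode axioms say that evaluating such operators at α or β contracts a dual pair to the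
trivial leg, which is recorded by `SameL` and `SameR`.

A half-braiding r : x ⊗ v → v ⊗ x corresponds to its mate (x ⊗ v) ⊗ x' → v, where x' is the dual
formed with S⁻¹ (`gm`, `rc`, mutually inverse by `rc_gm` and `gm_rc`). Under this bijection the
hexagon becomes a product formula, `gm_mul_gm`, whose coefficients are the Drinfeld twist f and a
combination `psi` of associators. These are exactly the components of Ω, so the product of D(H) is
the one that makes Γ = Σ eᵢ ⊗ (eⁱ ⋈ 1) the mate of a half-braiding R. Associativity
(`double_mul_assoc`) comes from the pentagon, through `psi_coherence`, and from the cocycle equation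
`twist_equation` of f. The pair (i_D, R) is universal among pairs satisfying `IsR`: see
`IsR.leg_theta`, `IsR.lTensor_theta` and `double_hom_ext`.

The maps Δ_D, ε_D and S_D are the ones classified by the tensor product, the trivial half-braiding
and the dual (`comulD_eq_theta`, `unD_eq_theta`, `antipodeD_eq_theta`). Axioms between algebra maps
are therefore compared on H and on R only. For the two antipode axioms that involve Δ_D, the
elements satisfying them form a subalgebra, and D(H) is generated by i_D(H) and the coefficients of
R (`mem_of_generators`). On R they say that evaluation and coevaluation are compatible with
half-braidings (`pair_evaluation`, `pair_coevaluation`). An auxiliary α or β appears there and is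
cancelled, both being invertible.

For the involutory property put u = S(β)α and w = βS(α). The hypothesis at h = 1 reads uw = 1, hence
wu = 1 by finite dimension; so α and β are invertible and S² is conjugation by u. Since (S ⊗ S_D)(R)
= f₂₁Rf⁻¹, applying S ⊗ S_D twice to R gives R flanked by products of f and (S ⊗ S)(f). The
condition on Δ(u) identifies the result with (u ⊗ u)R(w ⊗ w), where u and w are read through i_D in
the second factor. Thus S_D² and conjugation by i_D(u) = S_D(β_D)α_D agree on H and on R, and they
are equal. -/

noncomputable section

namespace QuasiHopfData

section LinearMapInstances

variable {k M N : Type*} [Field k] [AddCommMonoid M] [Module k M] [AddCommMonoid N] [Module k N]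

instance zeroHomClass_linearMap : ZeroHomClass (M →ₗ[k] N) M N := ⟨LinearMap.map_zero⟩

instance addHomClass_linearMap : AddHomClass (M →ₗ[k] N) M N := ⟨LinearMap.map_add⟩

end LinearMapInstances

/-! ### Rearranging products of linear maps out of tensor products. -/

section MulMap

variable {k M N B C : Type*} [Field k] [AddCommMonoid M] [Module k M] [AddCommMonoid N] [Module k N]
  [Ring B] [Algebra k B] [Ring C] [Algebra k C]

@[simp]
theorem mulMap₂_tmul (f : M →ₗ[k] B) (g : N →ₗ[k] B) (m : M) (n : N) :
    mulMap₂ f g (m ⊗ₜ n) = f m * g n := rfl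

theorem mulMap₂_lTensor {N' : Type*} [AddCommMonoid N'] [Module k N'] (f : M →ₗ[k] B)
    (g : N →ₗ[k] B) (u : N' →ₗ[k] N) (w : M ⊗[k] N') :
    mulMap₂ f g (u.lTensor M w) = mulMap₂ f (g ∘ₗ u) w :=
  LinearMap.congr_fun (f := mulMap₂ f g ∘ₗ u.lTensor M) (TensorProduct.ext' fun a b => by simp) w

theorem mulMap₂_rTensor {M' : Type*} [AddCommMonoid M'] [Module k M'] (f : M →ₗ[k] B)
    (g : N →ₗ[k] B) (u : M' →ₗ[k] M) (w : M' ⊗[k] N) :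
    mulMap₂ f g (u.rTensor N w) = mulMap₂ (f ∘ₗ u) g w :=
  LinearMap.congr_fun (f := mulMap₂ f g ∘ₗ u.rTensor N) (TensorProduct.ext' fun a b => by simp) w

theorem mulMap₂_map {M' N' : Type*} [AddCommMonoid M'] [Module k M'] [AddCommMonoid N']
    [Module k N'] (f : M →ₗ[k] B) (g : N →ₗ[k] B) (u : M' →ₗ[k] M) (v : N' →ₗ[k] N)
    (w : M' ⊗[k] N') :
    mulMap₂ f g (TensorProduct.map u v w) = mulMap₂ (f ∘ₗ u) (g ∘ₗ v) w :=
  LinearMap.congr_fun (f := mulMap₂ f g ∘ₗ TensorProduct.map u v)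
    (TensorProduct.ext' fun a b => by simp) w

theorem mulMap₂_assoc {L : Type*} [AddCommMonoid L] [Module k L] (f : L →ₗ[k] B) (g : M →ₗ[k] B)
    (h : N →ₗ[k] B) (w : (L ⊗[k] M) ⊗[k] N) :
    mulMap₂ f (mulMap₂ g h) (TensorProduct.assoc k L M N w) = mulMap₂ (mulMap₂ f g) h w :=
  LinearMap.congr_fun
    (f := mulMap₂ f (mulMap₂ g h) ∘ₗ (TensorProduct.assoc k L M N).toLinearMap)
    (TensorProduct.ext_threefold fun a b c => by simp [mul_assoc]) w

theorem mulMap₂_comm (f : M →ₗ[k] B) (g : N →ₗ[k] B) (h : ∀ a b, f a * g b = g b * f a)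
    (w : N ⊗[k] M) : mulMap₂ f g (TensorProduct.comm k N M w) = mulMap₂ g f w :=
  LinearMap.congr_fun (f := mulMap₂ f g ∘ₗ (TensorProduct.comm k N M).toLinearMap)
    (TensorProduct.ext' fun a b => by simp [h]) w

end MulMap

/-! ### Commuting algebra maps and their intertwiners, in place of modules and morphisms. -/

/-- A linear map between algebras that is a unital algebra map. -/
class Leg {k A B : Type*} [Field k] [Ring A] [Algebra k A] [Ring B] [Algebra k B]
    (x : A →ₗ[k] B) : Prop where
  map_one : x 1 = 1
  map_mul : ∀ a b, x (a * b) = x a * x b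

/-- The images of two linear maps into an algebra commute elementwise. -/
class Cm {k A A' B : Type*} [Field k] [Ring A] [Algebra k A] [Ring A'] [Algebra k A'] [Ring B]
    [Algebra k B] (x : A →ₗ[k] B) (y : A' →ₗ[k] B) : Prop where
  comm : ∀ a b, x a * y b = y b * x a

/-- The element `u` intertwines the linear maps `x` and `y`. -/
class Intw {k A B : Type*} [Field k] [Ring A] [Algebra k A] [Ring B]
    [Algebra k B] (u : B) (x y : A →ₗ[k] B) : Prop where
  intw : ∀ a, u * x a = y a * u

section Legs

variable {k A A' A'' B C : Type*} [Field k] [Ring A] [Algebra k A] [Ring A'] [Algebra k A']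
  [Ring A''] [Algebra k A''] [Ring B] [Algebra k B] [Ring C] [Algebra k C]

theorem Cm.symm' {x : A →ₗ[k] B} {y : A' →ₗ[k] B} (h : Cm x y) : Cm y x :=
  ⟨fun a b => (h.comm b a).symm⟩

instance (priority := 50) Cm.symm {x : A →ₗ[k] B} {y : A' →ₗ[k] B} [h : Cm x y] : Cm y x := h.symm'

instance Leg.id : Leg (LinearMap.id : A →ₗ[k] A) := ⟨rfl, fun _ _ => rfl⟩

instance Leg.comp (x : A →ₗ[k] B) (y : B →ₗ[k] C) [Leg x] [Leg y] : Leg (y ∘ₗ x) :=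
  ⟨by simp [Leg.map_one], fun a b => by simp [Leg.map_mul]⟩

instance Leg.mulMap₂ (x : A →ₗ[k] B) (y : A' →ₗ[k] B) [Leg x] [Leg y] [Cm x y] :
    Leg (_root_.mulMap₂ x y) where
  map_one := by simp [Algebra.TensorProduct.one_def, Leg.map_one]
  map_mul s t := by
    induction s using TensorProduct.induction_on with
    | zero => simp
    | add s s' hs hs' => simp [add_mul, hs, hs']
    | tmul a b =>
      induction t using TensorProduct.induction_on with
      | zero => simp
      | add t t' ht ht' => simp [mul_add, ht, ht']
      | tmul a' b' =>
        simp only [Algebra.TensorProduct.tmul_mul_tmul, mulMap₂_tmul, Leg.map_mul]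
        rw [mul_assoc, mul_assoc, ← mul_assoc (x a') (y b), Cm.comm a' b]
        simp [mul_assoc]

instance Cm.mulMap₂_left (x : A →ₗ[k] B) (y : A' →ₗ[k] B) (z : A'' →ₗ[k] B) [Cm x z] [Cm y z] :
    Cm (_root_.mulMap₂ x y) z where
  comm s c := by
    induction s using TensorProduct.induction_on with
    | zero => simp
    | add s s' hs hs' => simp [add_mul, mul_add, hs, hs']
    | tmul a b => rw [mulMap₂_tmul, mul_assoc, Cm.comm b c, ← mul_assoc, Cm.comm a c, mul_assoc]

instance Cm.mulMap₂_right (x : A →ₗ[k] B) (y : A' →ₗ[k] B) (z : A'' →ₗ[k] B) [h : Cm z x]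
    [h' : Cm z y] : Cm z (_root_.mulMap₂ x y) :=
  have := h.symm'
  have := h'.symm'
  (Cm.mulMap₂_left x y z).symm'

instance Cm.comp_left (w : A'' →ₗ[k] A) (x : A →ₗ[k] B) (y : A' →ₗ[k] B) [Cm x y] :
    Cm (x ∘ₗ w) y := ⟨fun _ _ => Cm.comm (x := x) _ _⟩

instance Cm.comp_right (w : A'' →ₗ[k] A) (x : A →ₗ[k] B) (y : A' →ₗ[k] B) [Cm y x] :
    Cm y (x ∘ₗ w) := ⟨fun _ _ => Cm.comm (y := x) _ _⟩

instance (priority := 60) Cm.map (π : B →ₗ[k] C) (x : A →ₗ[k] B) (y : A' →ₗ[k] B) [Leg π] [Cm x y] :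
    Cm (π ∘ₗ x) (π ∘ₗ y) := ⟨fun a b => by
  simp only [LinearMap.comp_apply, ← Leg.map_mul, Cm.comm (x := x) (y := y) a b]⟩

instance Leg.inl : Leg (inl k : A →ₗ[k] A ⊗[k] A') := ⟨rfl, fun a b => by simp [QuasiHopfData.inl]⟩

instance Leg.inr : Leg (inr k : A' →ₗ[k] A ⊗[k] A') := ⟨rfl, fun a b => by simp [QuasiHopfData.inr]⟩

instance Cm.inl_inr : Cm (inl k : A →ₗ[k] A ⊗[k] A') (inr k) :=
  ⟨fun a b => by simp [QuasiHopfData.inl, QuasiHopfData.inr]⟩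

end Legs

/-! ### The standard legs of the third and fourth tensor powers. -/

section TensorLegs

variable (k H : Type*) [Field k] [Ring H] [Algebra k H]

instance : Leg (l31 k H) := by unfold l31; infer_instance
instance : Leg (l32 k H) := by unfold l32; infer_instance
instance : Leg (l33 k H) := by unfold l33; infer_instance
instance : Leg (l41 k H) := by unfold l41; infer_instance
instance : Leg (l42 k H) := by unfold l42; infer_instance
instance : Leg (l43 k H) := by unfold l43; infer_instance
instance : Leg (l44 k H) := by unfold l44; infer_instance

instance : Cm (l31 k H) (l32 k H) := by unfold l31 l32; infer_instance
instance : Cm (l31 k H) (l33 k H) := by unfold l31 l33; infer_instance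
instance : Cm (l32 k H) (l33 k H) := by unfold l32 l33; infer_instance
instance : Cm (l41 k H) (l42 k H) := by unfold l41 l42; infer_instance
instance : Cm (l41 k H) (l43 k H) := by unfold l41 l43; infer_instance
instance : Cm (l41 k H) (l44 k H) := by unfold l41 l44; infer_instance
instance : Cm (l42 k H) (l43 k H) := by unfold l42 l43; infer_instance
instance : Cm (l42 k H) (l44 k H) := by unfold l42 l44; infer_instance
instance : Cm (l43 k H) (l44 k H) := by unfold l43 l44; infer_instance

variable {k H}

theorem l3_lift (w : T3 k H) : mulMap₂ (l31 k H) (mulMap₂ (l32 k H) (l33 k H)) w = w :=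
  LinearMap.congr_fun (g := LinearMap.id) (TensorProduct.ext_threefold' fun a b c => by
    simp [l31, l32, l33, QuasiHopfData.inl, QuasiHopfData.inr]) w

end TensorLegs

/-- A quasi-Hopf algebra with bijective antipode and with invertible, normalized `α`. -/
class Regular {k H : Type*} [Field k] [Ring H] [Algebra k H] (Q : QuasiHopfData k H) : Prop where
  ax : Q.IsQuasiHopf
  S_SInv : ∀ a, Q.S (Q.SInv a) = a
  SInv_S : ∀ a, Q.SInv (Q.S a) = a
  isUnit_α : IsUnit Q.α
  counit_α : Q.counit Q.α = 1

/-! ### Tensor products and associators of legs. -/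

section Structure

variable {k H B C : Type*} [Field k] [Ring H] [Algebra k H] [Ring B] [Algebra k B]
  [Ring C] [Algebra k C] (Q : QuasiHopfData k H)

/-- The product `h ↦ x(h₁) y(h₂)` of two maps. -/
def tp (x y : H →ₗ[k] B) : H →ₗ[k] B := mulMap₂ x y ∘ₗ Q.comul

/-- `x(X¹) y(X²) z(X³)` -/
def ph (x y z : H →ₗ[k] B) : B := mulMap₂ x (mulMap₂ y z) Q.Phi

/-- `x(x¹) y(x²) z(x³)`, where `Φ⁻¹ = x¹ ⊗ x² ⊗ x³` -/
def pb (x y z : H →ₗ[k] B) : B := mulMap₂ x (mulMap₂ y z) Q.PhiInv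

/-- `h ↦ ε(h) 1` -/
def un : H →ₗ[k] B := (Algebra.linearMap k B) ∘ₗ Q.counit

theorem un_apply (h : H) : (Q.un h : B) = Q.counit h • 1 := by
  simp [un, Algebra.algebraMap_eq_smul_one]

instance Leg.un [hQ : Q.Regular] : Leg (Q.un : H →ₗ[k] B) where
  map_one := by simp [un_apply, hQ.ax.counit_one]
  map_mul a b := by simp [un_apply, hQ.ax.counit_mul, smul_smul, mul_comm]

instance Cm.un_left {A : Type*} [Ring A] [Algebra k A] (x : A →ₗ[k] B) : Cm (Q.un : H →ₗ[k] B) x :=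
  ⟨fun a b => by simp [un_apply]⟩

instance Cm.un_right {A : Type*} [Ring A] [Algebra k A] (x : A →ₗ[k] B) : Cm x (Q.un : H →ₗ[k] B) :=
  ⟨fun a b => by simp [un_apply]⟩

instance Cm.tp_left {A : Type*} [Ring A] [Algebra k A] (x y : H →ₗ[k] B) (z : A →ₗ[k] B) [Cm x z]
    [Cm y z] : Cm (Q.tp x y) z := by unfold tp; infer_instance

instance Cm.tp_right {A : Type*} [Ring A] [Algebra k A] (x y : H →ₗ[k] B) (z : A →ₗ[k] B) [Cm z x]
    [Cm z y] : Cm z (Q.tp x y) := by unfold tp; infer_instance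

instance Leg.comul [hQ : Q.Regular] : Leg Q.comul := ⟨hQ.ax.comul_one, hQ.ax.comul_mul⟩

instance Leg.tp (x y : H →ₗ[k] B) [Leg x] [Leg y] [Cm x y] [Q.Regular] : Leg (Q.tp x y) := by
  unfold QuasiHopfData.tp; infer_instance

@[simp]
theorem tp_un (x : H →ₗ[k] B) [hQ : Q.Regular] : Q.tp x Q.un = x := by
  ext h
  conv_rhs => rw [← hQ.ax.lTensor_counit h]
  simp only [tp, LinearMap.comp_apply]
  generalize Q.comul h = w
  induction w using TensorProduct.induction_on with
  | zero => simp
  | tmul a b => simp [un_apply]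
  | add a b ha hb => simp [ha, hb]

@[simp]
theorem un_tp (x : H →ₗ[k] B) [hQ : Q.Regular] : Q.tp Q.un x = x := by
  ext h
  conv_rhs => rw [← hQ.ax.rTensor_counit h]
  simp only [tp, LinearMap.comp_apply]
  generalize Q.comul h = w
  induction w using TensorProduct.induction_on with
  | zero => simp
  | tmul a b => simp [un_apply]
  | add a b ha hb => simp [ha, hb]

theorem map_mulMap₂ {M N : Type*} [AddCommMonoid M] [Module k M] [AddCommMonoid N] [Module k N]
    (π : B →ₗ[k] C) [Leg π] (x : M →ₗ[k] B) (y : N →ₗ[k] B) :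
    mulMap₂ (π ∘ₗ x) (π ∘ₗ y) = π ∘ₗ mulMap₂ x y :=
  TensorProduct.ext' fun a b => by simp [Leg.map_mul]

theorem comp_tp (π : B →ₗ[k] C) [Leg π] (x y : H →ₗ[k] B) :
    π ∘ₗ Q.tp x y = Q.tp (π ∘ₗ x) (π ∘ₗ y) := by
  rw [tp, tp, map_mulMap₂, LinearMap.comp_assoc]

theorem map_ph (π : B →ₗ[k] C) [Leg π] (x y z : H →ₗ[k] B) :
    π (Q.ph x y z) = Q.ph (π ∘ₗ x) (π ∘ₗ y) (π ∘ₗ z) := by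
  rw [ph, ph, map_mulMap₂, map_mulMap₂]; rfl

theorem map_pb (π : B →ₗ[k] C) [Leg π] (x y z : H →ₗ[k] B) :
    π (Q.pb x y z) = Q.pb (π ∘ₗ x) (π ∘ₗ y) (π ∘ₗ z) := by
  rw [pb, pb, map_mulMap₂, map_mulMap₂]; rfl

variable [hQ : Q.Regular]

theorem ph_mul_pb (x y z : H →ₗ[k] B) [Leg x] [Leg y] [Leg z] [Cm x y] [Cm x z] [Cm y z] :
    Q.ph x y z * Q.pb x y z = 1 := by
  rw [ph, pb, ← Leg.map_mul, hQ.ax.Phi_mul_PhiInv]; simp [Leg.map_one]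

theorem pb_mul_ph (x y z : H →ₗ[k] B) [Leg x] [Leg y] [Leg z] [Cm x y] [Cm x z] [Cm y z] :
    Q.pb x y z * Q.ph x y z = 1 := by
  rw [ph, pb, ← Leg.map_mul, hQ.ax.PhiInv_mul_Phi]; simp [Leg.map_one]

/-- Quasi-coassociativity pushed into `B` along x ⊗ y ⊗ z. In categorical terms the associator is a
morphism from (xy)z to x(yz), products in `B` being composed from right to left. -/
theorem ph_intw (x y z : H →ₗ[k] B) [Leg x] [Leg y] [Leg z] [Cm x y] [Cm x z] [Cm y z] (h : H) :
    Q.ph x y z * Q.tp (Q.tp x y) z h = Q.tp x (Q.tp y z) h * Q.ph x y z := by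
  have := congrArg (mulMap₂ x (mulMap₂ y z)) (hQ.ax.quasi_coassoc h)
  rw [mulMap₂_lTensor, Leg.map_mul, Leg.map_mul, mulMap₂_assoc, mulMap₂_rTensor] at this
  change Q.tp x (Q.tp y z) h = _ at this
  rw [this, mul_assoc]
  change _ = _ * (Q.pb x y z * Q.ph x y z)
  rw [pb_mul_ph, mul_one]
  rfl

theorem pb_intw (x y z : H →ₗ[k] B) [Leg x] [Leg y] [Leg z] [Cm x y] [Cm x z] [Cm y z] (h : H) :
    Q.pb x y z * Q.tp x (Q.tp y z) h = Q.tp (Q.tp x y) z h * Q.pb x y z := by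
  linear_combination (norm := noncomm_ring) -Q.pb x y z * Q.ph_intw x y z h * Q.pb x y z
    - Q.pb x y z * Q.tp x (Q.tp y z) h * Q.ph_mul_pb x y z
    + Q.pb_mul_ph x y z * Q.tp (Q.tp x y) z h * Q.pb x y z

/-- The 3-cocycle axiom pushed into `B` along four legs, which is Mac Lane's pentagon for four
objects. -/
theorem pentagon (x y z w : H →ₗ[k] B) [Leg x] [Leg y] [Leg z] [Leg w] [Cm x y] [Cm x z] [Cm x w]
    [Cm y z] [Cm y w] [Cm z w] :
    Q.ph y z w * Q.ph x (Q.tp y z) w * Q.ph x y z =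
      Q.ph x y (Q.tp z w) * Q.ph (Q.tp x y) z w := by
  have key := congrArg (mulMap₂ x (mulMap₂ y (mulMap₂ z w))) hQ.ax.cocycle
  simp only [Leg.map_mul] at key
  have h1 : mulMap₂ x (mulMap₂ y (mulMap₂ z w)) ((1 : H) ⊗ₜ[k] Q.Phi) = Q.ph y z w := by
    simp [Leg.map_one, ph]
  have h2 : mulMap₂ y (mulMap₂ z w) ∘ₗ
      ((TensorProduct.assoc k H H H).toLinearMap ∘ₗ Q.comul.rTensor H) = mulMap₂ (Q.tp y z) w :=
    TensorProduct.ext' fun a b => by simp [mulMap₂_assoc, tp]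
  have h3 : mulMap₂ z w ∘ₗ (TensorProduct.mk k H H).flip 1 = z := by
    ext a; simp [Leg.map_one]
  have h3' : mulMap₂ y (mulMap₂ z w) ∘ₗ ((TensorProduct.mk k H H).flip 1).lTensor H =
      mulMap₂ y z := TensorProduct.ext' fun a b => by simp [Leg.map_one]
  have h4 : mulMap₂ y (mulMap₂ z w) ∘ₗ Q.comul.lTensor H = mulMap₂ y (Q.tp z w) :=
    TensorProduct.ext' fun a b => by simp [tp]
  rw [h1, mulMap₂_lTensor, h2, mulMap₂_lTensor, h3', mulMap₂_lTensor, h4, mulMap₂_assoc,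
    mulMap₂_rTensor] at key
  exact key

section Variants

variable (x y z w : H →ₗ[k] B) [Leg x] [Leg y] [Leg z] [Leg w] [Cm x y] [Cm x z] [Cm x w]
    [Cm y z] [Cm y w] [Cm z w]

/-- The edges of the pentagon are invertible and can be moved across. Each variant leaves at the
ends of the product the factors that an evaluation is able to absorb. -/
theorem pentagon₁ : Q.ph x (Q.tp y z) w * Q.ph x y z * Q.pb (Q.tp x y) z w =
    Q.pb y z w * Q.ph x y (Q.tp z w) := by
  linear_combination (norm := noncomm_ring)
    Q.pb y z w * Q.pentagon x y z w * Q.pb (Q.tp x y) z w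
    - Q.pb_mul_ph y z w * (Q.ph x (Q.tp y z) w * Q.ph x y z * Q.pb (Q.tp x y) z w)
    + (Q.pb y z w * Q.ph x y (Q.tp z w)) * Q.ph_mul_pb (Q.tp x y) z w

theorem pentagon₂ : Q.ph (Q.tp x y) z w * Q.pb x y z =
    Q.pb x y (Q.tp z w) * Q.ph y z w * Q.ph x (Q.tp y z) w := by
  linear_combination (norm := noncomm_ring)
    -Q.pb x y (Q.tp z w) * Q.pentagon x y z w * Q.pb x y z
    - Q.pb_mul_ph x y (Q.tp z w) * (Q.ph (Q.tp x y) z w * Q.pb x y z)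
    + (Q.pb x y (Q.tp z w) * Q.ph y z w * Q.ph x (Q.tp y z) w) * Q.ph_mul_pb x y z

theorem pentagon₃ : Q.ph x y z * Q.pb (Q.tp x y) z w =
    Q.pb x (Q.tp y z) w * Q.pb y z w * Q.ph x y (Q.tp z w) := by
  linear_combination (norm := noncomm_ring)
    Q.pb x (Q.tp y z) w * Q.pentagon₁ x y z w
    - Q.pb_mul_ph x (Q.tp y z) w * (Q.ph x y z * Q.pb (Q.tp x y) z w)

theorem pentagon₄ : Q.pb x y (Q.tp z w) * Q.ph y z w =
    Q.ph (Q.tp x y) z w * Q.pb x y z * Q.pb x (Q.tp y z) w := by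
  linear_combination (norm := noncomm_ring)
    -Q.pentagon₂ x y z w * Q.pb x (Q.tp y z) w
    - (Q.pb x y (Q.tp z w) * Q.ph y z w) * Q.ph_mul_pb x (Q.tp y z) w

theorem pentagon_inv : Q.pb x y z * Q.pb x (Q.tp y z) w * Q.pb y z w =
    Q.pb (Q.tp x y) z w * Q.pb x y (Q.tp z w) := by
  linear_combination (norm := noncomm_ring)
    -Q.pb (Q.tp x y) z w * Q.pentagon₄ x y z w * Q.pb y z w
    - Q.pb_mul_ph (Q.tp x y) z w * (Q.pb x y z * Q.pb x (Q.tp y z) w * Q.pb y z w)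
    + (Q.pb (Q.tp x y) z w * Q.pb x y (Q.tp z w)) * Q.ph_mul_pb y z w

end Variants

@[simp]
theorem ph_un₂ (x z : H →ₗ[k] B) [Leg x] [Leg z] : Q.ph x Q.un z = 1 := by
  have key := congrArg (mulMap₂ x z) hQ.ax.Phi_counit
  have : z ∘ₗ ((TensorProduct.lid k H).toLinearMap ∘ₗ Q.counit.rTensor H) = mulMap₂ Q.un z :=
    TensorProduct.ext' fun a b => by simp [un_apply]
  rw [mulMap₂_lTensor, this] at key
  simpa [Leg.map_one, ph] using key

@[simp]
-- Only the middle leg of Φ is normalized by the axioms. With the last two legs trivial, the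
-- pentagon says that this invertible element is idempotent, hence it is 1; the first leg is treated
-- in the same way.
theorem ph_un₃ (x y : H →ₗ[k] B) [Leg x] [Leg y] [Cm x y] : Q.ph x y Q.un = 1 := by
  have key := Q.pentagon x y Q.un Q.un
  simp only [ph_un₂, tp_un, one_mul, mul_one] at key
  have h := Q.pb_mul_ph x y Q.un
  linear_combination (norm := noncomm_ring) Q.pb x y Q.un * key + h - h * Q.ph x y Q.un

@[simp]
theorem ph_un₁ (y z : H →ₗ[k] B) [Leg y] [Leg z] [Cm y z] : Q.ph Q.un y z = 1 := by
  have key := Q.pentagon Q.un Q.un y z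
  simp only [ph_un₂, un_tp, tp_un, one_mul, mul_one] at key
  have h := Q.pb_mul_ph Q.un y z
  linear_combination (norm := noncomm_ring) Q.pb Q.un y z * key + h - h * Q.ph Q.un y z

@[simp]
theorem pb_un₁ (y z : H →ₗ[k] B) [Leg y] [Leg z] [Cm y z] : Q.pb Q.un y z = 1 := by
  simpa using Q.pb_mul_ph Q.un y z

@[simp]
theorem pb_un₂ (y z : H →ₗ[k] B) [Leg y] [Leg z] [Cm y z] : Q.pb y Q.un z = 1 := by
  simpa using Q.pb_mul_ph y Q.un z

@[simp]
theorem pb_un₃ (y z : H →ₗ[k] B) [Leg y] [Leg z] [Cm y z] : Q.pb y z Q.un = 1 := by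
  simpa using Q.pb_mul_ph y z Q.un

end Structure

/-! ### Naturality -/

section Naturality

variable {k H B : Type*} [Field k] [Ring H] [Algebra k H] [Ring B] [Algebra k B]
  (Q : QuasiHopfData k H)

theorem intw_mulMap₂ {M N : Type*} [AddCommMonoid M] [Module k M] [AddCommMonoid N] [Module k N]
    (u : B) {x x' : M →ₗ[k] B} {y y' : N →ₗ[k] B} (hx : ∀ a, u * x a = x' a * u)
    (hy : ∀ a, u * y a = y' a * u) (w : M ⊗[k] N) :
    u * mulMap₂ x y w = mulMap₂ x' y' w * u := by
  induction w using TensorProduct.induction_on with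
  | zero => simp
  | add s t hs ht => simp [mul_add, add_mul, hs, ht]
  | tmul a b => rw [mulMap₂_tmul, mulMap₂_tmul, ← mul_assoc, hx, mul_assoc, hy, mul_assoc]

instance Intw.tp (u : B) (x x' y y' : H →ₗ[k] B) [hx : Intw u x x'] [hy : Intw u y y'] :
    Intw u (Q.tp x y) (Q.tp x' y') := ⟨fun _ => intw_mulMap₂ u hx.intw hy.intw _⟩

instance Intw.ph [Q.Regular] (x y z : H →ₗ[k] B) [Leg x] [Leg y] [Leg z] [Cm x y] [Cm x z]
    [Cm y z] : Intw (Q.ph x y z) (Q.tp (Q.tp x y) z) (Q.tp x (Q.tp y z)) := ⟨Q.ph_intw x y z⟩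

instance Intw.pb [Q.Regular] (x y z : H →ₗ[k] B) [Leg x] [Leg y] [Leg z] [Cm x y] [Cm x z]
    [Cm y z] : Intw (Q.pb x y z) (Q.tp x (Q.tp y z)) (Q.tp (Q.tp x y) z) := ⟨Q.pb_intw x y z⟩

variable {A : Type*} [Ring A] [Algebra k A]

instance Intw.ph_comm (x y z : H →ₗ[k] B) (w : A →ₗ[k] B) [Cm x w] [Cm y w] [Cm z w] :
    Intw (Q.ph x y z) w w := ⟨fun a => (intw_mulMap₂ (w a) (fun b => (Cm.comm b a).symm)
      (fun b => intw_mulMap₂ (w a) (fun b => (Cm.comm b a).symm) (fun b => (Cm.comm b a).symm) b)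
      Q.Phi).symm⟩

instance Intw.pb_comm (x y z : H →ₗ[k] B) (w : A →ₗ[k] B) [Cm x w] [Cm y w] [Cm z w] :
    Intw (Q.pb x y z) w w := ⟨fun a => (intw_mulMap₂ (w a) (fun b => (Cm.comm b a).symm)
      (fun b => intw_mulMap₂ (w a) (fun b => (Cm.comm b a).symm) (fun b => (Cm.comm b a).symm) b)
      Q.PhiInv).symm⟩

instance Intw.one (w : A →ₗ[k] B) : Intw (1 : B) w w := ⟨fun a => by simp⟩

instance Intw.apply_comm {A' : Type*} [Ring A'] [Algebra k A'] (x : A →ₗ[k] B) (y : A' →ₗ[k] B)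
    [Cm x y] (a : A) : Intw (x a) y y := ⟨fun b => Cm.comm a b⟩

theorem ph_nat (u : B) (x y z x' y' z' : H →ₗ[k] B) [hx : Intw u x x'] [hy : Intw u y y']
    [hz : Intw u z z'] : u * Q.ph x y z = Q.ph x' y' z' * u :=
  intw_mulMap₂ u hx.intw (intw_mulMap₂ u hy.intw hz.intw) _

theorem pb_nat (u : B) (x y z x' y' z' : H →ₗ[k] B) [hx : Intw u x x'] [hy : Intw u y y']
    [hz : Intw u z z'] : u * Q.pb x y z = Q.pb x' y' z' * u :=
  intw_mulMap₂ u hx.intw (intw_mulMap₂ u hy.intw hz.intw) _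

end Naturality

/-! ### Evaluation functionals -/

/-- Under `K`, the map `p` may be replaced with `q` at the left end of a product. -/
def SameL {k H B M : Type*} [Field k] [Ring H] [Algebra k H] [Ring B] [Algebra k B]
    [AddCommGroup M] [Module k M] (K : B →ₗ[k] M) (p q : H →ₗ[k] B) : Prop :=
  ∀ a b, K (p a * b) = K (q a * b)

/-- Under `K`, the map `p` may be replaced with `q` at the right end of a product. -/
def SameR {k H B M : Type*} [Field k] [Ring H] [Algebra k H] [Ring B] [Algebra k B]
    [AddCommGroup M] [Module k M] (K : B →ₗ[k] M) (p q : H →ₗ[k] B) : Prop :=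
  ∀ a b, K (b * p a) = K (b * q a)

section Same

variable {k H B M : Type*} [Field k] [Ring H] [Algebra k H] [Ring B] [Algebra k B]
    [AddCommGroup M] [Module k M] (Q : QuasiHopfData k H) {K : B →ₗ[k] M} {p q : H →ₗ[k] B}

theorem SameL.trans {r : H →ₗ[k] B} (h : SameL K p q) (h' : SameL K q r) : SameL K p r :=
  fun a b => (h a b).trans (h' a b)

theorem SameR.trans {r : H →ₗ[k] B} (h : SameR K p q) (h' : SameR K q r) : SameR K p r :=
  fun a b => (h a b).trans (h' a b)

theorem SameL.mulMap₂ (h : SameL K p q) {N : Type*} [AddCommGroup N] [Module k N]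
    (y : N →ₗ[k] B) (w : H ⊗[k] N) (b : B) :
    K (_root_.mulMap₂ p y w * b) = K (_root_.mulMap₂ q y w * b) := by
  induction w using TensorProduct.induction_on with
  | zero => simp
  | add s t hs ht => simp [add_mul, hs, ht]
  | tmul a c => simp only [mulMap₂_tmul, mul_assoc, h a]

theorem SameR.mulMap₂ (h : SameR K p q) {N : Type*} [AddCommGroup N] [Module k N]
    (y : N →ₗ[k] B) (w : N ⊗[k] H) (b : B) :
    K (b * _root_.mulMap₂ y p w) = K (b * _root_.mulMap₂ y q w) := by
  induction w using TensorProduct.induction_on with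
  | zero => simp
  | add s t hs ht => simp [mul_add, hs, ht]
  | tmul a c => simp only [mulMap₂_tmul, ← mul_assoc, h c]

/-- A prefix commuting with both maps can be exchanged with them. This is what allows a dual pair to
be contracted in the middle of a long product. -/
theorem SameL.pre (h : SameL K p q) (u : B) [hp : Intw u p p] [hq : Intw u q q] :
    SameL (K ∘ₗ LinearMap.mulLeft k u) p q := fun a b => by
  simp only [LinearMap.comp_apply, LinearMap.mulLeft_apply, ← mul_assoc, hp.intw, hq.intw]
  simpa only [mul_assoc] using h a (u * b)

theorem SameR.post (h : SameR K p q) (u : B) [hp : Intw u p p] [hq : Intw u q q] :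
    SameR (K ∘ₗ LinearMap.mulRight k u) p q := fun a b => by
  simp only [LinearMap.comp_apply, LinearMap.mulRight_apply, mul_assoc, ← hp.intw, ← hq.intw]
  simpa only [mul_assoc] using h a (b * u)

theorem mulMap₂_swap {M N : Type*} [AddCommGroup M] [Module k M] [AddCommGroup N] [Module k N]
    (x : M →ₗ[k] B) (y : N →ₗ[k] B) (hxy : ∀ a b, x a * y b = y b * x a) (w : M ⊗[k] N) :
    _root_.mulMap₂ x y w = _root_.mulMap₂ y x (TensorProduct.comm k M N w) :=
  (mulMap₂_comm y x (fun a b => (hxy b a).symm) w).symm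

theorem mulMap₂_rotate {L M N : Type*} [AddCommGroup L] [Module k L] [AddCommGroup M] [Module k M]
    [AddCommGroup N] [Module k N] (x : L →ₗ[k] B) (y : M →ₗ[k] B) (z : N →ₗ[k] B)
    (w : L ⊗[k] (M ⊗[k] N)) :
    _root_.mulMap₂ x (_root_.mulMap₂ y z) w =
      _root_.mulMap₂ (_root_.mulMap₂ x y) z ((TensorProduct.assoc k L M N).symm w) := by
  rw [← mulMap₂_assoc, LinearEquiv.apply_symm_apply]

section Lift

variable {L N : Type*} [AddCommGroup L] [Module k L] [AddCommGroup N] [Module k N]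
  (y : L →ₗ[k] B) (z : N →ₗ[k] B)

theorem mulMap₂_swap_right (r : H →ₗ[k] B) (hr : ∀ a b, z a * r b = r b * z a)
    (w : L ⊗[k] (N ⊗[k] H)) : _root_.mulMap₂ y (_root_.mulMap₂ z r) w =
      _root_.mulMap₂ y (_root_.mulMap₂ r z)
        ((TensorProduct.comm k N H).toLinearMap.lTensor L w) := by
  rw [mulMap₂_lTensor]
  congr 2
  exact TensorProduct.ext' fun a b => by simp [hr]

/-- The commutation hypotheses bring `p` to the front of each elementary product, where `K` sees it.
-/
theorem SameL.lift₂ (h : SameL K p q) (hp : ∀ a b, y a * p b = p b * y a)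
    (hq : ∀ a b, y a * q b = q b * y a) (w : L ⊗[k] (H ⊗[k] N)) (b : B) :
    K (_root_.mulMap₂ y (_root_.mulMap₂ p z) w * b) =
      K (_root_.mulMap₂ y (_root_.mulMap₂ q z) w * b) := by
  rw [mulMap₂_rotate, mulMap₂_rotate]
  generalize (TensorProduct.assoc k L H N).symm w = v
  induction v using TensorProduct.induction_on with
  | zero => simp
  | add s t hs ht => simp [add_mul, hs, ht]
  | tmul s c =>
    rw [mulMap₂_tmul, mulMap₂_tmul, mulMap₂_swap y p hp, mulMap₂_swap y q hq, mul_assoc, h.mulMap₂,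
      mul_assoc]

theorem SameL.lift₃ (h : SameL K p q) (hp : ∀ a b, y a * p b = p b * y a)
    (hq : ∀ a b, y a * q b = q b * y a) (hp' : ∀ a b, z a * p b = p b * z a)
    (hq' : ∀ a b, z a * q b = q b * z a) (w : L ⊗[k] (N ⊗[k] H)) (b : B) :
    K (_root_.mulMap₂ y (_root_.mulMap₂ z p) w * b) =
      K (_root_.mulMap₂ y (_root_.mulMap₂ z q) w * b) := by
  rw [mulMap₂_swap_right y z p hp', mulMap₂_swap_right y z q hq', h.lift₂ y z hp hq]

theorem SameR.lift₂ (h : SameR K p q) (hp : ∀ a b, z a * p b = p b * z a)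
    (hq : ∀ a b, z a * q b = q b * z a) (w : L ⊗[k] (H ⊗[k] N)) (b : B) :
    K (b * _root_.mulMap₂ y (_root_.mulMap₂ p z) w) =
      K (b * _root_.mulMap₂ y (_root_.mulMap₂ q z) w) := by
  induction w using TensorProduct.induction_on with
  | zero => simp
  | add s t hs ht => simp [mul_add, hs, ht]
  | tmul c s =>
    rw [mulMap₂_tmul, mulMap₂_tmul, mulMap₂_swap p z (fun a b => (hp b a).symm),
      mulMap₂_swap q z (fun a b => (hq b a).symm), ← mul_assoc, h.mulMap₂, ← mul_assoc]

theorem SameR.lift₃ (h : SameR K p q) (w : L ⊗[k] (N ⊗[k] H)) (b : B) :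
    K (b * _root_.mulMap₂ y (_root_.mulMap₂ z p) w) =
      K (b * _root_.mulMap₂ y (_root_.mulMap₂ z q) w) := by
  rw [mulMap₂_rotate, mulMap₂_rotate, h.mulMap₂]

theorem SameR.lift₁ (h : SameR K p q) (hp : ∀ a b, y a * p b = p b * y a)
    (hq : ∀ a b, y a * q b = q b * y a) (hp' : ∀ a b, z a * p b = p b * z a)
    (hq' : ∀ a b, z a * q b = q b * z a) (w : H ⊗[k] (L ⊗[k] N)) (b : B) :
    K (b * _root_.mulMap₂ p (_root_.mulMap₂ y z) w) =
      K (b * _root_.mulMap₂ q (_root_.mulMap₂ y z) w) := by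
  have key : ∀ r : H →ₗ[k] B, (∀ a b, y a * r b = r b * y a) →
      (∀ a b, z a * r b = r b * z a) →
      ∀ a b, r a * _root_.mulMap₂ y z b = _root_.mulMap₂ y z b * r a := fun r hr hr' a b =>
    intw_mulMap₂ (r a) (fun c => (hr c a).symm) (fun c => (hr' c a).symm) b
  rw [mulMap₂_swap p _ (key p hp hp'), mulMap₂_swap q _ (key q hq hq'), h.mulMap₂]

end Lift

section Associator

variable (u : B) (y z : H →ₗ[k] B) (b : B)

theorem SameL.tp₁ (h : SameL K p q) : SameL K (Q.tp p y) (Q.tp q y) :=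
  fun a b => h.mulMap₂ y (Q.comul a) b

theorem SameL.tp₂ (h : SameL K p q) [Cm y p] [Cm y q] : SameL K (Q.tp y p) (Q.tp y q) :=
  fun a b => by
    simp only [tp, LinearMap.comp_apply, mulMap₂_swap y p Cm.comm, mulMap₂_swap y q Cm.comm]
    exact h.mulMap₂ y _ b

theorem SameR.tp₂ (h : SameR K p q) : SameR K (Q.tp y p) (Q.tp y q) :=
  fun a b => h.mulMap₂ y (Q.comul a) b

theorem SameR.tp₁ (h : SameR K p q) [Cm p y] [Cm q y] : SameR K (Q.tp p y) (Q.tp q y) :=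
  fun a b => by
    simp only [tp, LinearMap.comp_apply, mulMap₂_swap p y Cm.comm, mulMap₂_swap q y Cm.comm]
    exact h.mulMap₂ y _ b

/-- Contraction inside a leg of an associator. When the replacing map is `un`, the normalization of
Φ afterwards makes the whole associator disappear. -/
theorem SameL.ph₁ (h : SameL K p q) [Intw u p p] [Intw u q q] :
    K (u * Q.ph p y z * b) = K (u * Q.ph q y z * b) := by
  simpa [mul_assoc, ph] using (h.pre u).mulMap₂ (_root_.mulMap₂ y z) Q.Phi b

theorem SameL.ph₂ (h : SameL K p q) [Intw u p p] [Intw u q q] [Cm y p] [Cm y q] :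
    K (u * Q.ph y p z * b) = K (u * Q.ph y q z * b) := by
  simpa [mul_assoc, ph] using (h.pre u).lift₂ y z Cm.comm Cm.comm Q.Phi b

theorem SameL.ph₃ (h : SameL K p q) [Intw u p p] [Intw u q q] [Cm y p] [Cm y q] [Cm z p] [Cm z q] :
    K (u * Q.ph y z p * b) = K (u * Q.ph y z q * b) := by
  simpa [mul_assoc, ph] using (h.pre u).lift₃ y z Cm.comm Cm.comm Cm.comm Cm.comm Q.Phi b

theorem SameR.ph₁ (h : SameR K p q) [Intw b p p] [Intw b q q] [Cm y p] [Cm y q] [Cm z p] [Cm z q] :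
    K (u * Q.ph p y z * b) = K (u * Q.ph q y z * b) := by
  simpa [mul_assoc, ph] using (h.post b).lift₁ y z Cm.comm Cm.comm Cm.comm Cm.comm Q.Phi u

theorem SameR.ph₂ (h : SameR K p q) [Intw b p p] [Intw b q q] [Cm z p] [Cm z q] :
    K (u * Q.ph y p z * b) = K (u * Q.ph y q z * b) := by
  simpa [mul_assoc, ph] using (h.post b).lift₂ y z Cm.comm Cm.comm Q.Phi u

theorem SameR.ph₃ (h : SameR K p q) [Intw b p p] [Intw b q q] :
    K (u * Q.ph y z p * b) = K (u * Q.ph y z q * b) := by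
  simpa [mul_assoc, ph] using (h.post b).lift₃ y z Q.Phi u

theorem SameL.pb₁ (h : SameL K p q) [Intw u p p] [Intw u q q] :
    K (u * Q.pb p y z * b) = K (u * Q.pb q y z * b) := by
  simpa [mul_assoc, pb] using (h.pre u).mulMap₂ (_root_.mulMap₂ y z) Q.PhiInv b

theorem SameL.pb₂ (h : SameL K p q) [Intw u p p] [Intw u q q] [Cm y p] [Cm y q] :
    K (u * Q.pb y p z * b) = K (u * Q.pb y q z * b) := by
  simpa [mul_assoc, pb] using (h.pre u).lift₂ y z Cm.comm Cm.comm Q.PhiInv b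

theorem SameL.pb₃ (h : SameL K p q) [Intw u p p] [Intw u q q] [Cm y p] [Cm y q] [Cm z p] [Cm z q] :
    K (u * Q.pb y z p * b) = K (u * Q.pb y z q * b) := by
  simpa [mul_assoc, pb] using (h.pre u).lift₃ y z Cm.comm Cm.comm Cm.comm Cm.comm Q.PhiInv b

theorem SameR.pb₁ (h : SameR K p q) [Intw b p p] [Intw b q q] [Cm y p] [Cm y q] [Cm z p] [Cm z q] :
    K (u * Q.pb p y z * b) = K (u * Q.pb q y z * b) := by
  simpa [mul_assoc, pb] using (h.post b).lift₁ y z Cm.comm Cm.comm Cm.comm Cm.comm Q.PhiInv u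

theorem SameR.pb₃ (h : SameR K p q) [Intw b p p] [Intw b q q] :
    K (u * Q.pb y z p * b) = K (u * Q.pb y z q * b) := by
  simpa [mul_assoc, pb] using (h.post b).lift₃ y z Q.PhiInv u

end Associator

end Same

/-! ### Actions by right and left multiplication -/

/-- The opposite of the algebra of linear endomorphisms of `B`. -/
abbrev Op (k B : Type*) [Field k] [Ring B] [Algebra k B] : Type _ := (Module.End k B)ᵐᵒᵖ

section OpInstances

variable {k B : Type*} [Field k] [Ring B] [Algebra k B]

instance Op.instModule : Module k (Op k B) := MulOpposite.instModule k

instance Op.instAlgebra : Algebra k (Op k B) := MulOpposite.instAlgebra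

instance Op.instRing : Ring (Op k B) := MulOpposite.instRing

instance Op.instNonUnitalNonAssocSemiring : NonUnitalNonAssocSemiring (Op k B) :=
  MulOpposite.instNonUnitalNonAssocSemiring

end OpInstances

/-- A linear map between algebras that is a unital algebra anti-morphism. -/
class Anti {k A B : Type*} [Field k] [Ring A] [Algebra k A] [Ring B] [Algebra k B]
    (x : A →ₗ[k] B) : Prop where
  map_one : x 1 = 1
  map_mul : ∀ a b, x (a * b) = x b * x a

section Operators

variable {k A A' B C : Type*} [Field k] [Ring A] [Algebra k A] [Ring A'] [Algebra k A']
  [Ring B] [Algebra k B] [Ring C] [Algebra k C]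

instance Anti.comp_leg (x : A →ₗ[k] B) (y : B →ₗ[k] C) [Anti x] [Leg y] : Anti (y ∘ₗ x) :=
  ⟨by simp [Leg.map_one, Anti.map_one], fun a b => by simp [Leg.map_mul, Anti.map_mul]⟩

theorem Leg.anti_anti (x : A →ₗ[k] B) (y : B →ₗ[k] C) [Anti x] [Anti y] : Leg (y ∘ₗ x) :=
  ⟨by simp [Anti.map_one], fun a b => by simp [Anti.map_mul]⟩

/-- Right multiplication. -/
def rho : B →ₗ[k] Op k B :=
  (MulOpposite.opLinearEquiv k).toLinearMap ∘ₗ (LinearMap.mul k B).flip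

/-- Left multiplication. -/
def lam : B →ₗ[k] Op k B := (MulOpposite.opLinearEquiv k).toLinearMap ∘ₗ LinearMap.mul k B

/-- The value at `e`. -/
def act (e : B) : Op k B →ₗ[k] B :=
  LinearMap.applyₗ e ∘ₗ (MulOpposite.opLinearEquiv k).symm.toLinearMap

@[simp] theorem act_rho (e b : B) : act e (rho b : Op k B) = e * b := rfl

@[simp] theorem act_lam (e b : B) : act e (lam b : Op k B) = b * e := rfl

/-- The opposite of the endomorphism algebra is used so that the leftmost factor acts first.
Evaluations are then absorbed at the left end of a product, as in `SameL`. -/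
theorem act_mul (e : B) (P R : Op k B) : act e (P * R) = act (act e P) R := rfl

@[simp] theorem act_one (e : B) : act e (1 : Op k B) = e := rfl

theorem op_ext {P R : Op k B} (h : ∀ e, act e P = act e R) : P = R :=
  MulOpposite.unop_injective (LinearMap.ext h)

instance Leg.rho : Leg (rho : B →ₗ[k] Op k B) :=
  ⟨op_ext fun e => by simp, fun a b => op_ext fun e => by simp [act_mul, mul_assoc]⟩

instance Anti.lam : Anti (lam : B →ₗ[k] Op k B) :=
  ⟨op_ext fun e => by simp, fun a b => op_ext fun e => by simp [act_mul, mul_assoc]⟩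

/-- Left multiplication reverses products here, so it becomes a leg again after an anti-morphism
such as S or S⁻¹. This is how dual modules enter the calculus. -/
instance Leg.lam_comp (t : A →ₗ[k] B) [Anti t] : Leg (lam ∘ₗ t) := Leg.anti_anti _ _

instance Cm.rho_lam : Cm (QuasiHopfData.rho : B →ₗ[k] Op k B) QuasiHopfData.lam :=
  ⟨fun a b => op_ext fun e => by simp [act_mul, mul_assoc]⟩

instance Cm.lam_lam (s : A →ₗ[k] B) (t : A' →ₗ[k] B) [Cm s t] : Cm (QuasiHopfData.lam ∘ₗ s)
    (QuasiHopfData.lam ∘ₗ t) :=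
  ⟨fun a b => op_ext fun e => by simp [act_mul, ← mul_assoc, Cm.comm a b]⟩

end Operators

/-! ### The antipode as a contraction -/

section End

variable {k A A' B : Type*} [Field k] [Ring A] [Algebra k A] [Ring A'] [Algebra k A']
  [Ring B] [Algebra k B]

/-- Left multiplication, with values in the linear endomorphisms. -/
def lmul : B →ₗ[k] Module.End k B := LinearMap.mul k B

/-- Right multiplication, with values in the linear endomorphisms. -/
def rmul : B →ₗ[k] Module.End k B := (LinearMap.mul k B).flip

/-- The value of an endomorphism at `e`. -/
def ev (e : B) : Module.End k B →ₗ[k] B := LinearMap.applyₗ e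

@[simp] theorem ev_lmul (e b : B) : ev e (lmul b : Module.End k B) = b * e := rfl

@[simp] theorem ev_rmul (e b : B) : ev e (rmul b : Module.End k B) = e * b := rfl

/-- In this algebra the rightmost factor acts first, so that coevaluations are absorbed at the right
end of a product, as in `SameR`. -/
theorem ev_mul (e : B) (P R : Module.End k B) : ev e (P * R) = ev (ev e R) P := rfl

@[simp] theorem ev_one (e : B) : ev e (1 : Module.End k B) = e := rfl

theorem end_ext {P R : Module.End k B} (h : ∀ e, ev e P = ev e R) : P = R := LinearMap.ext h

instance Leg.lmul : Leg (lmul : B →ₗ[k] Module.End k B) :=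
  ⟨end_ext fun e => by simp, fun a b => end_ext fun e => by simp [ev_mul, mul_assoc]⟩

instance Anti.rmul : Anti (rmul : B →ₗ[k] Module.End k B) :=
  ⟨end_ext fun e => by simp, fun a b => end_ext fun e => by simp [ev_mul, mul_assoc]⟩

instance Leg.rmul_comp (t : A →ₗ[k] B) [Anti t] : Leg (rmul ∘ₗ t) := Leg.anti_anti _ _

instance Cm.lmul_rmul : Cm (QuasiHopfData.lmul : B →ₗ[k] Module.End k B) QuasiHopfData.rmul :=
  ⟨fun a b => end_ext fun e => by simp [ev_mul, mul_assoc]⟩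

instance Cm.rmul_rmul (s : A →ₗ[k] B) (t : A' →ₗ[k] B) [Cm s t] : Cm (QuasiHopfData.rmul ∘ₗ s)
    (QuasiHopfData.rmul ∘ₗ t) :=
  ⟨fun a b => end_ext fun e => by simp [ev_mul, mul_assoc, Cm.comm a b]⟩

end End

section Antipode

variable {k H B : Type*} [Field k] [Ring H] [Algebra k H] [Ring B] [Algebra k B]
  (Q : QuasiHopfData k H)

instance Anti.S [hQ : Q.Regular] : Anti Q.S := ⟨hQ.ax.S_one, hQ.ax.S_mul⟩

/-- The axiom S(h₁)αh₂ = ε(h)α, read as invariance of the evaluation of the dual of x against x. The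
extra factor `e'` commutes with x and leaves room for evaluations in other legs. -/
theorem act_tp_S (x : H →ₗ[k] B) [hx : Leg x] [hQ : Q.Regular] (e' : B) [he : Intw e' x x] (z : H) :
    act (x Q.α * e') (Q.tp (lam ∘ₗ x ∘ₗ Q.S) (rho ∘ₗ x) z) = Q.counit z • (x Q.α * e') := by
  have : act (x Q.α * e') ∘ₗ mulMap₂ (lam ∘ₗ x ∘ₗ Q.S) (rho ∘ₗ x) = LinearMap.mulRight k e' ∘ₗ
      x ∘ₗ mulMap₂ (LinearMap.mulRight k Q.α ∘ₗ Q.S) LinearMap.id :=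
    TensorProduct.ext' fun a b => by
      simp [act_mul, Leg.map_mul, mul_assoc, he.intw]
  have h := LinearMap.congr_fun this (Q.comul z)
  simp only [LinearMap.comp_apply, hQ.ax.S_α z] at h
  rw [tp, LinearMap.comp_apply, h]
  simp

theorem ev_tp_S (x : H →ₗ[k] B) [hx : Leg x] [hQ : Q.Regular] (e' : B) [he : Intw e' x x] (z : H) :
    ev (x Q.β * e') (Q.tp (lmul ∘ₗ x) (rmul ∘ₗ x ∘ₗ Q.S) z) = Q.counit z • (x Q.β * e') := by
  have : ev (x Q.β * e') ∘ₗ mulMap₂ (lmul ∘ₗ x) (rmul ∘ₗ x ∘ₗ Q.S) = LinearMap.mulRight k e' ∘ₗ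
      x ∘ₗ mulMap₂ (LinearMap.mulRight k Q.β) Q.S :=
    TensorProduct.ext' fun a b => by
      simp [ev_mul, Leg.map_mul, mul_assoc, he.intw]
  have h := LinearMap.congr_fun this (Q.comul z)
  simp only [LinearMap.comp_apply, hQ.ax.β_S z] at h
  rw [tp, LinearMap.comp_apply, h]
  simp

theorem sameL_act {e : B} {c : H →ₗ[k] Op k B} (h : ∀ z, act e (c z) = Q.counit z • e) :
    SameL (act e) c Q.un := fun a b => by
  rw [act_mul, act_mul, h, un_apply]; simp

theorem sameR_ev {e : B} {c : H →ₗ[k] Module.End k B} (h : ∀ z, ev e (c z) = Q.counit z • e) :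
    SameR (ev e) c Q.un := fun a b => by
  rw [ev_mul, ev_mul, h, un_apply]; simp

theorem sameL_S (x : H →ₗ[k] B) [hx : Leg x] [hQ : Q.Regular] (e' : B) [he : Intw e' x x] :
    SameL (act (x Q.α * e')) (Q.tp (lam ∘ₗ x ∘ₗ Q.S) (rho ∘ₗ x)) Q.un :=
  Q.sameL_act (Q.act_tp_S x e')

theorem sameR_S (x : H →ₗ[k] B) [hx : Leg x] [hQ : Q.Regular] (e' : B) [he : Intw e' x x] :
    SameR (ev (x Q.β * e')) (Q.tp (lmul ∘ₗ x) (rmul ∘ₗ x ∘ₗ Q.S)) Q.un :=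
  Q.sameR_ev (Q.ev_tp_S x e')

/-! ### Four-fold associators -/

/-- The associator `(12)(34) → (1(23))4`. -/
def aa (p q r s : H →ₗ[k] B) : B := Q.ph p q r * Q.pb (Q.tp p q) r s

/-- The associator `(1(23))4 → (12)(34)`. -/
def ab (p q r s : H →ₗ[k] B) : B := Q.ph (Q.tp p q) r s * Q.pb p q r

theorem mulMap₂_tmulOne (p q r s : H →ₗ[k] B) [Leg s] (w : T3 k H) :
    mulMap₂ p (mulMap₂ q (mulMap₂ r s)) (tmulOne w) = mulMap₂ p (mulMap₂ q r) w := by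
  have : mulMap₂ q (mulMap₂ r s) ∘ₗ (inl k (A := H) (B := H)).lTensor H = mulMap₂ q r :=
    TensorProduct.ext' fun a b => by simp [Leg.map_one, inl]
  rw [tmulOne, mulMap₂_lTensor, this]

theorem mulMap₂_comulIdId (p q r s : H →ₗ[k] B) (w : T3 k H) :
    mulMap₂ p (mulMap₂ q (mulMap₂ r s)) (Q.comulIdId w) =
      mulMap₂ (Q.tp p q) (mulMap₂ r s) w := by
  rw [comulIdId, LinearMap.comp_apply, LinearEquiv.coe_coe, mulMap₂_assoc, mulMap₂_rTensor]; rfl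


theorem aa_eq (p q r s : H →ₗ[k] B) [Leg p] [Leg q] [Leg r] [Leg s] [Cm p q] [Cm p r] [Cm p s]
    [Cm q r] [Cm q s] [Cm r s] : mulMap₂ p (mulMap₂ q (mulMap₂ r s))
      (tmulOne Q.Phi * Q.comulIdId Q.PhiInv) = Q.aa p q r s := by
  rw [Leg.map_mul, mulMap₂_tmulOne, mulMap₂_comulIdId]; rfl

theorem ab_eq (p q r s : H →ₗ[k] B) [Leg p] [Leg q] [Leg r] [Leg s] [Cm p q] [Cm p r] [Cm p s]
    [Cm q r] [Cm q s] [Cm r s] : mulMap₂ p (mulMap₂ q (mulMap₂ r s))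
      (Q.comulIdId Q.Phi * tmulOne Q.PhiInv) = Q.ab p q r s := by
  rw [Leg.map_mul, mulMap₂_tmulOne, mulMap₂_comulIdId]; rfl

instance Intw.aa [hQ : Q.Regular] (p q r s : H →ₗ[k] B) [Leg p] [Leg q] [Leg r] [Leg s] [Cm p q] [Cm p r] [Cm p s]
    [Cm q r] [Cm q s] [Cm r s] :
    Intw (Q.aa p q r s) (Q.tp (Q.tp p q) (Q.tp r s)) (Q.tp (Q.tp p (Q.tp q r)) s) := ⟨fun a => by
  rw [QuasiHopfData.aa, mul_assoc, Q.pb_intw, ← mul_assoc,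
    (inferInstance : Intw (Q.ph p q r) (Q.tp (Q.tp (Q.tp p q) r) s)
      (Q.tp (Q.tp p (Q.tp q r)) s)).intw, mul_assoc]⟩

instance Intw.ab [hQ : Q.Regular] (p q r s : H →ₗ[k] B) [Leg p] [Leg q] [Leg r] [Leg s] [Cm p q] [Cm p r] [Cm p s]
    [Cm q r] [Cm q s] [Cm r s] :
    Intw (Q.ab p q r s) (Q.tp (Q.tp p (Q.tp q r)) s) (Q.tp (Q.tp p q) (Q.tp r s)) := ⟨fun a => by
  rw [QuasiHopfData.ab, mul_assoc, (inferInstance : Intw (Q.pb p q r) (Q.tp (Q.tp p (Q.tp q r)) s)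
      (Q.tp (Q.tp (Q.tp p q) r) s)).intw, ← mul_assoc, Q.ph_intw, mul_assoc]⟩

/-- The element γ evaluates x ⊗ y against the product of the duals in reverse order: one
reassociates until x meets its dual in the middle, and both pairs are then evaluated with α. -/
theorem lift_gam [hQ : Q.Regular] (x y : H →ₗ[k] B) [Leg x] [Leg y] [Cm x y] :
    mulMap₂ x y Q.gam = act (x Q.α * y Q.α)
      (Q.aa (lam ∘ₗ y ∘ₗ Q.S) (lam ∘ₗ x ∘ₗ Q.S) (rho ∘ₗ x) (rho ∘ₗ y)) := by
  rw [← aa_eq, gam]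
  generalize tmulOne Q.Phi * Q.comulIdId Q.PhiInv = w
  refine LinearMap.congr_fun (f := mulMap₂ x y ∘ₗ mulMap₂ _ _) (g := act _ ∘ₗ mulMap₂ _ _) ?_ w
  ext a b c d
  simp [inl, inr, act_mul, Leg.map_mul]
  have c (a b t) : y b * (x a * t) = x a * (y b * t) := by
    rw [← mul_assoc, Cm.comm b a, mul_assoc]
  simp only [mul_assoc, c]

/-- Dually, δ is the coevaluation of x ⊗ y, with the pair of y nested inside the pair of x. -/
theorem lift_del [hQ : Q.Regular] (x y : H →ₗ[k] B) [Leg x] [Leg y] [Cm x y] :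
    mulMap₂ x y Q.del = ev (x Q.β * y Q.β)
      (Q.ab (lmul ∘ₗ x) (lmul ∘ₗ y) (rmul ∘ₗ y ∘ₗ Q.S) (rmul ∘ₗ x ∘ₗ Q.S)) := by
  rw [← ab_eq, del]
  generalize Q.comulIdId Q.Phi * tmulOne Q.PhiInv = w
  refine LinearMap.congr_fun (f := mulMap₂ x y ∘ₗ mulMap₂ _ _) (g := ev _ ∘ₗ mulMap₂ _ _) ?_ w
  ext a b c d
  simp [inl, inr, ev_mul, Leg.map_mul]
  have c (a b t) : y b * (x a * t) = x a * (y b * t) := by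
    rw [← mul_assoc, Cm.comm b a, mul_assoc]
  simp only [mul_assoc, c]

/-- The reassociation is a morphism, and the two nested pairs are contracted one after the other,
first x with its dual and then y with its dual. -/
theorem act_gam [hQ : Q.Regular] (x y : H →ₗ[k] B) [Leg x] [Leg y] [Cm x y] (z : H) :
    act (mulMap₂ x y Q.gam) (Q.tp (Q.tp (lam ∘ₗ y ∘ₗ Q.S) (lam ∘ₗ x ∘ₗ Q.S))
      (Q.tp (rho ∘ₗ x) (rho ∘ₗ y)) z) = Q.counit z • mulMap₂ x y Q.gam := by
  have h1 := Q.sameL_S x (y Q.α)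
  have h2 := Q.sameL_S y (x Q.α)
  rw [Cm.comm] at h2
  have h := (((h1.tp₂ Q (lam ∘ₗ y ∘ₗ Q.S)).tp₁ Q (rho ∘ₗ y)))
  rw [tp_un] at h
  rw [lift_gam, ← act_mul, (Intw.aa Q _ _ _ _).intw, h.trans h2, un_apply]
  simp

theorem ev_del [hQ : Q.Regular] (x y : H →ₗ[k] B) [Leg x] [Leg y] [Cm x y] (z : H) :
    ev (mulMap₂ x y Q.del) (Q.tp (Q.tp (lmul ∘ₗ x) (lmul ∘ₗ y))
      (Q.tp (rmul ∘ₗ y ∘ₗ Q.S) (rmul ∘ₗ x ∘ₗ Q.S)) z) = Q.counit z • mulMap₂ x y Q.del := by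
  have h1 := Q.sameR_S x (y Q.β)
  have h2 := Q.sameR_S y (x Q.β)
  rw [Cm.comm] at h2
  have h := (((h2.tp₂ Q (lmul ∘ₗ x)).tp₁ Q (rmul ∘ₗ x ∘ₗ Q.S)))
  rw [tp_un] at h
  rw [lift_del, ← ev_mul, ← (Intw.ab Q _ _ _ _).intw, h.trans h1, un_apply]
  simp

/-- A criterion for concrete functionals: one that factors through an invariant map on H ⊗ H
inherits the invariance. The antipode axioms yield `SameL` and `SameR` on tensor powers of H in this
way. -/
theorem contract_comul {R M : Type*} [Ring R] [Algebra k R] [AddCommGroup M] [Module k M]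
    {P : H ⊗[k] H →ₗ[k] M} {g : H ⊗[k] H →ₗ[k] R} {g₀ : R} {m : M}
    (hg : ∀ z, g (Q.comul z) = Q.counit z • g₀) (G : R →ₗ[k] M)
    (h : ∀ p q, P (p ⊗ₜ q) = G (g (p ⊗ₜ q))) (h₀ : G g₀ = m) (z : H) :
    P (Q.comul z) = Q.counit z • m := by
  have : P = G ∘ₗ g := TensorProduct.ext' h
  rw [this, LinearMap.comp_apply, hg, map_smul, h₀]

theorem sameL_iff_comp {M : Type*} [AddCommGroup M] [Module k M] {K : B →ₗ[k] M}
    {p : H →ₗ[k] B} (h : ∀ z, K ∘ₗ LinearMap.mulLeft k (p z) = Q.counit z • K) :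
    SameL K p Q.un := fun z b => by
  simpa [un_apply] using LinearMap.congr_fun (h z) b

theorem sameR_iff_comp {M : Type*} [AddCommGroup M] [Module k M] {K : B →ₗ[k] M}
    {p : H →ₗ[k] B} (h : ∀ z, K ∘ₗ LinearMap.mulRight k (p z) = Q.counit z • K) :
    SameR K p Q.un := fun z b => by
  simpa [un_apply] using LinearMap.congr_fun (h z) b

theorem map_β_S [hQ : Q.Regular] (X : H →ₗ[k] B) [Leg X] (z : H) :
    X (mulMap₂ (LinearMap.mulRight k Q.β) Q.S (Q.comul z)) = Q.counit z • X Q.β := by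
  rw [hQ.ax.β_S]; simp

/-- `s(x¹) a X(x² β S(x³))` -/
def transfer (X s : H →ₗ[k] B) (a : B) : B :=
  mulMap₂ (LinearMap.mulRight k a ∘ₗ s) (X ∘ₗ mulMap₂ (LinearMap.mulRight k Q.β) Q.S) Q.PhiInv

section Transfer

variable (X s : H →ₗ[k] B) [Leg X] [Anti s] {a : B}

/-- Uniqueness of duals: both s, with evaluation a, and X ∘ S, with evaluation X(α), are duals of X,
and `transfer` compares them. Both sides come from the intertwining property of Φ⁻¹, with β
contracting the last two legs on one side of it and a contracting the first two on the other. -/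
theorem transfer_mul_S [hQ : Q.Regular] (ha : ∀ z, mulMap₂ (LinearMap.mulRight k a ∘ₗ s) X (Q.comul z) =
    Q.counit z • a) (z : H) : Q.transfer X s a * X (Q.S z) = s z * Q.transfer X s a := by
  let K : T3 k H →ₗ[k] B := mulMap₂ (LinearMap.mulRight k a ∘ₗ s)
    (X ∘ₗ mulMap₂ (LinearMap.mulRight k Q.β) Q.S)
  have hK : Q.transfer X s a = K (Q.pb (l31 k H) (l32 k H) (l33 k H)) := by
    rw [pb, l3_lift]; rfl
  have hl : SameL K (Q.tp (l31 k H) (l32 k H)) Q.un := by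
    refine Q.sameL_iff_comp fun z => ?_
    ext b c d
    refine Q.contract_comul (P := K ∘ₗ LinearMap.mulRight k (b ⊗ₜ (c ⊗ₜ d)) ∘ₗ mulMap₂ _ _) ha
      (LinearMap.mulLeft k (s b) ∘ₗ LinearMap.mulRight k (X c * X Q.β * X (Q.S d))) (fun p q => ?_)
      ?_ z
    all_goals simp [K, l31, l32, inl, inr, Anti.map_mul, Leg.map_mul, mul_assoc]
  have hr : SameR K (Q.tp (l32 k H) (l33 k H)) Q.un := by
    refine Q.sameR_iff_comp fun z => ?_
    ext b c d
    refine Q.contract_comul (P := K ∘ₗ LinearMap.mulLeft k (b ⊗ₜ (c ⊗ₜ d)) ∘ₗ mulMap₂ _ _)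
      (Q.map_β_S X) (LinearMap.mulLeft k (s b * a * X c) ∘ₗ LinearMap.mulRight k (X (Q.S d)))
      (g := X ∘ₗ mulMap₂ (LinearMap.mulRight k Q.β) Q.S) (fun p q => ?_) ?_ z
    all_goals simp [K, l32, l33, inl, inr, Anti.map_mul, Leg.map_mul, mul_assoc]
  have h1 : ∀ w : T3 k H, K (w * l31 k H z) = s z * K w := fun w => by
    refine LinearMap.congr_fun (f := K ∘ₗ LinearMap.mulRight k _)
      (g := LinearMap.mulLeft k _ ∘ₗ K) ?_ w
    ext a b c
    simp [K, l31, inl, Anti.map_mul, mul_assoc]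
  have h2 : ∀ w : T3 k H, K (l33 k H z * w) = K w * X (Q.S z) := fun w => by
    refine LinearMap.congr_fun (f := K ∘ₗ LinearMap.mulLeft k _)
      (g := LinearMap.mulRight k _ ∘ₗ K) ?_ w
    ext a b c
    simp [K, l33, inr, Anti.map_mul, Leg.map_mul, mul_assoc]
  rw [hK, ← h1, ← h2]
  have e1 := hr.tp₂ Q (l31 k H) z (Q.pb (l31 k H) (l32 k H) (l33 k H))
  have e2 := hl.tp₁ Q (l33 k H) z (Q.pb (l31 k H) (l32 k H) (l33 k H))
  rw [tp_un] at e1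
  rw [un_tp] at e2
  rw [← e1, ← e2, pb_intw]

/-- The comparison respects evaluations. The pentagon on four legs is arranged so that every
associator except one has a leg containing a contractible pair; the remaining one gives X¹βS(X²)αX³
= 1. -/
theorem transfer_mul_α [hQ : Q.Regular] (ha : ∀ z, mulMap₂ (LinearMap.mulRight k a ∘ₗ s) X (Q.comul z) =
    Q.counit z • a) : Q.transfer X s a * X Q.α = a := by
  let K : T4 k H →ₗ[k] B := mulMap₂ (LinearMap.mulRight k a ∘ₗ s)
    (X ∘ₗ mulMap₂ (LinearMap.mulRight k Q.β) (mulMap₂ Q.S (LinearMap.mulLeft k Q.α)))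
  have hl : SameL K (Q.tp (l41 k H) (l42 k H)) Q.un := by
    refine Q.sameL_iff_comp fun z => ?_
    ext b c d e
    refine Q.contract_comul (P := K ∘ₗ LinearMap.mulRight k (b ⊗ₜ (c ⊗ₜ (d ⊗ₜ e))) ∘ₗ mulMap₂ _ _)
      ha (LinearMap.mulLeft k (s b) ∘ₗ
        LinearMap.mulRight k (X c * X Q.β * X (Q.S d) * X Q.α * X e)) (fun p q => ?_) ?_ z
    all_goals simp [K, l41, l42, l31, inl, inr, Anti.map_mul, Leg.map_mul, mul_assoc]
  have hl' : SameL K (Q.tp (l43 k H) (l44 k H)) Q.un := by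
    refine Q.sameL_iff_comp fun z => ?_
    ext b c d e
    refine Q.contract_comul (P := K ∘ₗ LinearMap.mulRight k (b ⊗ₜ (c ⊗ₜ (d ⊗ₜ e))) ∘ₗ mulMap₂ _ _)
      hQ.ax.S_α (LinearMap.mulLeft k (s b * a * X c * X Q.β * X (Q.S d)) ∘ₗ
        LinearMap.mulRight k (X e) ∘ₗ X) (fun p q => ?_) ?_ z
    all_goals simp [K, l43, l44, l32, l33, inl, inr, Anti.map_mul, Leg.map_mul, mul_assoc]
  have hr : SameR K (Q.tp (l42 k H) (l43 k H)) Q.un := by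
    refine Q.sameR_iff_comp fun z => ?_
    ext b c d e
    refine Q.contract_comul (P := K ∘ₗ LinearMap.mulLeft k (b ⊗ₜ (c ⊗ₜ (d ⊗ₜ e))) ∘ₗ mulMap₂ _ _)
      hQ.ax.β_S (LinearMap.mulLeft k (s b * a * X c) ∘ₗ
        LinearMap.mulRight k (X (Q.S d) * X Q.α * X e) ∘ₗ X) (fun p q => ?_) ?_ z
    all_goals simp [K, l42, l43, l31, l32, inl, inr, Anti.map_mul, Leg.map_mul, mul_assoc]
  have h1 : K (Q.pb (l41 k H) (l42 k H) (l43 k H)) = Q.transfer X s a * X Q.α := by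
    rw [pb, transfer]
    generalize Q.PhiInv = w
    refine LinearMap.congr_fun (f := K ∘ₗ mulMap₂ _ _) (g := LinearMap.mulRight k _ ∘ₗ mulMap₂ _ _)
      ?_ w
    ext b c d
    simp [K, l41, l42, l43, l31, l32, inl, inr, Leg.map_mul, mul_assoc]
  have h2 : K (Q.ph (l42 k H) (l43 k H) (l44 k H)) = a := by
    have := congrArg X hQ.ax.Phi_antipode
    rw [Leg.map_one] at this
    rw [← mul_one a, ← this, ph]
    generalize Q.Phi = w
    refine LinearMap.congr_fun (f := K ∘ₗ mulMap₂ _ _) (g := LinearMap.mulLeft k _ ∘ₗ X ∘ₗ mulMap₂ _ _)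
      ?_ w
    ext b c d
    simp [K, l42, l43, l44, l31, l32, l33, inl, inr, Leg.map_mul, Anti.map_one, mul_assoc]
  have key : Q.ph (Q.tp (l41 k H) (l42 k H)) (l43 k H) (l44 k H) *
      Q.pb (l41 k H) (l42 k H) (l43 k H) = Q.pb (l41 k H) (l42 k H) (Q.tp (l43 k H) (l44 k H)) *
      Q.ph (l42 k H) (l43 k H) (l44 k H) *
        Q.ph (l41 k H) (Q.tp (l42 k H) (l43 k H)) (l44 k H) := by
    have h := Q.pentagon (l41 k H) (l42 k H) (l43 k H) (l44 k H)
    have i1 := Q.pb_mul_ph (l41 k H) (l42 k H) (Q.tp (l43 k H) (l44 k H))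
    have i2 := Q.ph_mul_pb (l41 k H) (l42 k H) (l43 k H)
    linear_combination (norm := noncomm_ring)
      -(Q.pb (l41 k H) (l42 k H) (Q.tp (l43 k H) (l44 k H))) * h * Q.pb (l41 k H) (l42 k H) (l43 k H)
      - i1 * Q.ph (Q.tp (l41 k H) (l42 k H)) (l43 k H) (l44 k H) *
          Q.pb (l41 k H) (l42 k H) (l43 k H)
      + (Q.pb (l41 k H) (l42 k H) (Q.tp (l43 k H) (l44 k H)) *
          Q.ph (l42 k H) (l43 k H) (l44 k H) *
          Q.ph (l41 k H) (Q.tp (l42 k H) (l43 k H)) (l44 k H)) * i2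
  have e1 := hl.ph₁ Q 1 (l43 k H) (l44 k H) (Q.pb (l41 k H) (l42 k H) (l43 k H))
  have e2 := hl'.pb₃ Q 1 (l41 k H) (l42 k H) (Q.ph (l42 k H) (l43 k H) (l44 k H) *
        Q.ph (l41 k H) (Q.tp (l42 k H) (l43 k H)) (l44 k H))
  have e3 := hr.ph₂ Q (Q.ph (l42 k H) (l43 k H) (l44 k H)) (l41 k H) (l44 k H) 1
  simp only [one_mul, mul_one, ph_un₁, pb_un₃, ph_un₂, ← mul_assoc] at e1 e2 e3
  rw [← h1, ← e1, key, e2, e3, h2]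

end Transfer

end Antipode

/-! ### The Drinfeld twist, comparing two duals of a tensor product. -/

section DrinfeldTwist

variable {k H B : Type*} [Field k] [Ring H] [Algebra k H] [Ring B] [Algebra k B]
  (Q : QuasiHopfData k H)

/-- The counterpart of `transfer_mul_α` for coevaluations. It needs the zigzag identity between a
and b, which the pentagon carries to the pair formed by α and β. -/
theorem transfer_β_mul [hQ : Q.Regular] (X s : H →ₗ[k] B) [Leg X] [Anti s] {a b : B}
    (ha : ∀ z, mulMap₂ (LinearMap.mulRight k a ∘ₗ s) X (Q.comul z) = Q.counit z • a)
    (hb : ∀ z, mulMap₂ (LinearMap.mulRight k b ∘ₗ X) s (Q.comul z) = Q.counit z • b)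
    (hz : mulMap₂ (LinearMap.mulRight k b ∘ₗ X) (mulMap₂ (LinearMap.mulRight k a ∘ₗ s) X) Q.Phi = 1) :
    b * Q.transfer X s a = X Q.β := by
  let K : T4 k H →ₗ[k] B := mulMap₂ (LinearMap.mulRight k b ∘ₗ X)
    (mulMap₂ (LinearMap.mulRight k a ∘ₗ s) (X ∘ₗ mulMap₂ (LinearMap.mulRight k Q.β) Q.S))
  have hl : SameL K (Q.tp (l42 k H) (l43 k H)) Q.un := by
    refine Q.sameL_iff_comp fun z => ?_
    ext x c d e
    refine Q.contract_comul (P := K ∘ₗ LinearMap.mulRight k (x ⊗ₜ (c ⊗ₜ (d ⊗ₜ e))) ∘ₗ mulMap₂ _ _)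
      ha (LinearMap.mulLeft k (X x * b * s c) ∘ₗ
        LinearMap.mulRight k (X d * X Q.β * X (Q.S e))) (fun p q => ?_) ?_ z
    all_goals simp [K, l42, l43, l31, l32, inl, inr, Anti.map_mul, Leg.map_mul, mul_assoc]
  have hr' : SameR K (Q.tp (l43 k H) (l44 k H)) Q.un := by
    refine Q.sameR_iff_comp fun z => ?_
    ext x c d e
    refine Q.contract_comul (P := K ∘ₗ LinearMap.mulLeft k (x ⊗ₜ (c ⊗ₜ (d ⊗ₜ e))) ∘ₗ mulMap₂ _ _)
      hQ.ax.β_S (LinearMap.mulLeft k (X x * b * s c * a * X d) ∘ₗ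
        LinearMap.mulRight k (X (Q.S e)) ∘ₗ X) (fun p q => ?_) ?_ z
    all_goals simp [K, l43, l44, l32, l33, inl, inr, Anti.map_mul, Leg.map_mul, mul_assoc]
  have hr : SameR K (Q.tp (l41 k H) (l42 k H)) Q.un := by
    refine Q.sameR_iff_comp fun z => ?_
    ext x c d e
    refine Q.contract_comul (P := K ∘ₗ LinearMap.mulLeft k (x ⊗ₜ (c ⊗ₜ (d ⊗ₜ e))) ∘ₗ mulMap₂ _ _)
      hb (LinearMap.mulLeft k (X x) ∘ₗ
        LinearMap.mulRight k (s c * a * X d * X Q.β * X (Q.S e))) (fun p q => ?_) ?_ z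
    all_goals simp [K, l41, l42, l31, inl, inr, Anti.map_mul, Leg.map_mul, mul_assoc]
  have h1 : K (Q.pb (l42 k H) (l43 k H) (l44 k H)) = b * Q.transfer X s a := by
    rw [pb, transfer]
    generalize Q.PhiInv = w
    refine LinearMap.congr_fun (f := K ∘ₗ mulMap₂ _ _) (g := LinearMap.mulLeft k _ ∘ₗ mulMap₂ _ _)
      ?_ w
    ext x c d
    simp [K, l42, l43, l44, l31, l32, l33, inl, inr, Leg.map_mul, Leg.map_one, mul_assoc]
  have h2 : K (Q.ph (l41 k H) (l42 k H) (l43 k H)) = X Q.β := by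
    rw [← one_mul (X Q.β), ← hz, ph]
    generalize Q.Phi = w
    refine LinearMap.congr_fun (f := K ∘ₗ mulMap₂ _ _) (g := LinearMap.mulRight k _ ∘ₗ mulMap₂ _ _)
      ?_ w
    ext x c d
    simp [K, l41, l42, l43, l31, l32, inl, inr, Leg.map_mul, Anti.map_one, mul_assoc]
  have key : Q.ph (l41 k H) (Q.tp (l42 k H) (l43 k H)) (l44 k H) *
      Q.ph (l41 k H) (l42 k H) (l43 k H) * Q.pb (Q.tp (l41 k H) (l42 k H)) (l43 k H) (l44 k H) =
      Q.pb (l42 k H) (l43 k H) (l44 k H) * Q.ph (l41 k H) (l42 k H) (Q.tp (l43 k H) (l44 k H)) := by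
    have h := Q.pentagon (l41 k H) (l42 k H) (l43 k H) (l44 k H)
    have i1 := Q.pb_mul_ph (l42 k H) (l43 k H) (l44 k H)
    have i2 := Q.ph_mul_pb (Q.tp (l41 k H) (l42 k H)) (l43 k H) (l44 k H)
    linear_combination (norm := noncomm_ring)
      Q.pb (l42 k H) (l43 k H) (l44 k H) * h * Q.pb (Q.tp (l41 k H) (l42 k H)) (l43 k H) (l44 k H)
      - i1 * (Q.ph (l41 k H) (Q.tp (l42 k H) (l43 k H)) (l44 k H) *
      Q.ph (l41 k H) (l42 k H) (l43 k H) * Q.pb (Q.tp (l41 k H) (l42 k H)) (l43 k H) (l44 k H))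
      + (Q.pb (l42 k H) (l43 k H) (l44 k H) *
        Q.ph (l41 k H) (l42 k H) (Q.tp (l43 k H) (l44 k H))) * i2
  have e1 := hl.ph₂ Q 1 (l41 k H) (l44 k H) (Q.ph (l41 k H) (l42 k H) (l43 k H) *
    Q.pb (Q.tp (l41 k H) (l42 k H)) (l43 k H) (l44 k H))
  have e2 := hr.pb₁ Q (Q.ph (l41 k H) (l42 k H) (l43 k H)) (l43 k H) (l44 k H) 1
  have e3 := hr'.ph₃ Q (Q.pb (l42 k H) (l43 k H) (l44 k H)) (l41 k H) (l42 k H) 1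
  simp only [one_mul, mul_one, pb_un₁, ph_un₃, ph_un₂, ← mul_assoc] at e1 e2 e3
  rw [← h1, ← e3, ← key, e1, e2, h2]

/-! ### The triple `(S ⊗ S) Δᶜᵒᵖ, γ, δ` -/

theorem tp_lam (s t : H →ₗ[k] B) [Cm s t] : Q.tp (lam ∘ₗ s) (lam ∘ₗ t) = lam ∘ₗ Q.tp s t := by
  rw [tp, tp, ← LinearMap.comp_assoc]
  congr 1
  exact TensorProduct.ext' fun a b => op_ext fun e => by
    simp [act_mul, mul_assoc, Cm.comm (x := s) (y := t) a b]

theorem tp_rmul (s t : H →ₗ[k] B) [Cm s t] : Q.tp (rmul ∘ₗ s) (rmul ∘ₗ t) = rmul ∘ₗ Q.tp s t := by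
  rw [tp, tp, ← LinearMap.comp_assoc]
  congr 1
  exact TensorProduct.ext' fun a b => end_ext fun e => by
    simp [ev_mul, mul_assoc, Cm.comm (x := s) (y := t) a b]

instance Anti.tp (s t : H →ₗ[k] B) [Anti s] [Anti t] [Cm s t] [Q.Regular] : Anti (Q.tp s t) := by
  have : Leg (QuasiHopfData.lam ∘ₗ Q.tp s t) := by rw [← tp_lam]; infer_instance
  exact ⟨by simpa using congrArg (act 1) this.map_one,
    fun a b => by simpa [act_mul] using congrArg (act 1) (this.map_mul a b)⟩

theorem act_lam_rho (s x : H →ₗ[k] B) (e : B) (w : H ⊗[k] H) :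
    act e (mulMap₂ (lam ∘ₗ s) (rho ∘ₗ x) w) = mulMap₂ (LinearMap.mulRight k e ∘ₗ s) x w :=
  LinearMap.congr_fun (f := act e ∘ₗ mulMap₂ _ _) (TensorProduct.ext' fun a b => by simp [act_mul]) w

theorem ev_lmul_rmul (s x : H →ₗ[k] B) (e : B) (w : H ⊗[k] H) :
    ev e (mulMap₂ (lmul ∘ₗ x) (rmul ∘ₗ s) w) = mulMap₂ (LinearMap.mulRight k e ∘ₗ x) s w :=
  LinearMap.congr_fun (f := ev e ∘ₗ mulMap₂ _ _)
    (TensorProduct.ext' fun a b => by simp [ev_mul, mul_assoc]) w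

theorem lift_inl_inr {A : Type*} [Ring A] [Algebra k A] (w : H ⊗[k] A) :
    mulMap₂ (inl k) (inr k) w = w :=
  LinearMap.congr_fun (g := LinearMap.id) (TensorProduct.ext' fun a b => by simp [inl, inr]) w

theorem tp_inl_inr : Q.tp (inl k) (inr k) = Q.comul := LinearMap.ext fun z => lift_inl_inr _

theorem SS_comulCop : Q.SS ∘ₗ Q.comulCop = Q.tp (inr k ∘ₗ Q.S) (inl k ∘ₗ Q.S) := by
  rw [tp, comulCop, ← LinearMap.comp_assoc]
  congr 1
  exact TensorProduct.ext' fun a b => by simp [SS, inl, inr]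

section Map

variable {B' C C' : Type*} [Ring B'] [Algebra k B'] [Ring C] [Algebra k C] [Ring C'] [Algebra k C']
  {K : B →ₗ[k] C} {K' : B' →ₗ[k] C'}

theorem SameL.map_inl {p q : H →ₗ[k] B} (h : SameL K p q) :
    SameL (TensorProduct.map K K') (inl k ∘ₗ p) (inl k ∘ₗ q) := fun a w => by
  induction w using TensorProduct.induction_on with
  | zero => simp
  | add s t hs ht => simp only [mul_add, map_add, hs, ht]
  | tmul b c => simp [inl, h a b]

theorem SameL.map_inr {p q : H →ₗ[k] B'} (h : SameL K' p q) :
    SameL (TensorProduct.map K K') (inr k ∘ₗ p) (inr k ∘ₗ q) := fun a w => by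
  induction w using TensorProduct.induction_on with
  | zero => simp
  | add s t hs ht => simp only [mul_add, map_add, hs, ht]
  | tmul b c => simp [inr, h a c]

theorem SameR.map_inl {p q : H →ₗ[k] B} (h : SameR K p q) :
    SameR (TensorProduct.map K K') (inl k ∘ₗ p) (inl k ∘ₗ q) := fun a w => by
  induction w using TensorProduct.induction_on with
  | zero => simp
  | add s t hs ht => simp only [add_mul, map_add, hs, ht]
  | tmul b c => simp [inl, h a b]

theorem SameR.map_inr {p q : H →ₗ[k] B'} (h : SameR K' p q) :
    SameR (TensorProduct.map K K') (inr k ∘ₗ p) (inr k ∘ₗ q) := fun a w => by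
  induction w using TensorProduct.induction_on with
  | zero => simp
  | add s t hs ht => simp only [add_mul, map_add, hs, ht]
  | tmul b c => simp [inr, h a c]

end Map

theorem comp_un {C : Type*} [Ring C] [Algebra k C] (π : B →ₗ[k] C) [Leg π] :
    π ∘ₗ (Q.un : H →ₗ[k] B) = Q.un :=
  LinearMap.ext fun a => by simp [un_apply, Leg.map_one]

variable [hQ : Q.Regular]

theorem gam_S (z : H) : mulMap₂ (LinearMap.mulRight k Q.gam ∘ₗ Q.SS ∘ₗ Q.comulCop) Q.comul
    (Q.comul z) = Q.counit z • Q.gam := by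
  have h := Q.act_gam (inl k : H →ₗ[k] H ⊗[k] H) (inr k) z
  rw [tp_lam, ← comp_tp, tp_inl_inr, ← SS_comulCop, lift_inl_inr] at h
  rw [← h, tp, LinearMap.comp_apply, act_lam_rho]

theorem del_S (z : H) : mulMap₂ (LinearMap.mulRight k Q.del ∘ₗ Q.comul) (Q.SS ∘ₗ Q.comulCop)
    (Q.comul z) = Q.counit z • Q.del := by
  have h := Q.ev_del (inl k : H →ₗ[k] H ⊗[k] H) (inr k) z
  rw [tp_rmul, ← comp_tp, tp_inl_inr, ← SS_comulCop, lift_inl_inr] at h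
  rw [← h, tp, LinearMap.comp_apply, ev_lmul_rmul]

instance Anti.SS_comulCop : Anti (Q.SS ∘ₗ Q.comulCop) := by
  rw [QuasiHopfData.SS_comulCop]; infer_instance

/-- By its definition f is the `transfer` for X = Δ, s = (S ⊗ S)Δᶜᵒᵖ and the evaluation γ, so
Drinfeld's relations are instances of the uniqueness of duals. -/
theorem twist_mul_comul_S (z : H) :
    Q.twist * Q.comul (Q.S z) = Q.SS (Q.comulCop z) * Q.twist :=
  Q.transfer_mul_S Q.comul (Q.SS ∘ₗ Q.comulCop) Q.gam_S z

theorem twist_mul_comul_α : Q.twist * Q.comul Q.α = Q.gam :=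
  Q.transfer_mul_α Q.comul (Q.SS ∘ₗ Q.comulCop) Q.gam_S

/-! ### Invertibility of the twist -/

/-- Mac Lane coherence for six strands. The right-hand side is arranged so that the pairs (4,5),
(3,6), (1,4) and (2,3), which are dual in the application, can be contracted successively. -/
theorem strand_coherence (l₁ l₂ l₃ l₄ l₅ l₆ : H →ₗ[k] B) [Leg l₁] [Leg l₂] [Leg l₃] [Leg l₄]
    [Leg l₅] [Leg l₆] [Cm l₁ l₂] [Cm l₁ l₃] [Cm l₁ l₄] [Cm l₁ l₅] [Cm l₁ l₆] [Cm l₂ l₃] [Cm l₂ l₄]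
    [Cm l₂ l₅] [Cm l₂ l₆] [Cm l₃ l₄] [Cm l₃ l₅] [Cm l₃ l₆] [Cm l₄ l₅] [Cm l₄ l₆] [Cm l₅ l₆] :
    Q.aa l₃ l₄ l₅ l₆ * Q.ph (Q.tp l₁ l₂) (Q.tp l₃ l₄) (Q.tp l₅ l₆) * Q.ab l₁ l₂ l₃ l₄ =
      Q.ph (Q.tp l₁ l₂) (Q.tp l₃ (Q.tp l₄ l₅)) l₆ * Q.ph (Q.tp l₁ l₂) l₃ (Q.tp l₄ l₅) *
        Q.pb l₁ l₂ l₃ * Q.ph (Q.tp l₁ (Q.tp l₂ l₃)) l₄ l₅ *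
          Q.pb (Q.tp (Q.tp l₁ (Q.tp l₂ l₃)) l₄) l₅ l₆ := by
  have h1 := Q.pentagon₁ (Q.tp l₁ l₂) (Q.tp l₃ l₄) l₅ l₆
  have h2 := Q.ph_nat (Q.ph l₃ l₄ l₅) (Q.tp l₁ l₂) (Q.tp (Q.tp l₃ l₄) l₅) l₆
    (Q.tp l₁ l₂) (Q.tp l₃ (Q.tp l₄ l₅)) l₆
  have h3 := Q.pentagon (Q.tp l₁ l₂) l₃ l₄ l₅
  have h4 := Q.pb_nat (Q.ph (Q.tp l₁ l₂) l₃ l₄) (Q.tp (Q.tp (Q.tp l₁ l₂) l₃) l₄) l₅ l₆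
    (Q.tp (Q.tp l₁ l₂) (Q.tp l₃ l₄)) l₅ l₆
  have h5 := Q.pb_nat (Q.pb l₁ l₂ l₃) (Q.tp (Q.tp l₁ (Q.tp l₂ l₃)) l₄) l₅ l₆
    (Q.tp (Q.tp (Q.tp l₁ l₂) l₃) l₄) l₅ l₆
  have h6 := Q.ph_nat (Q.pb l₁ l₂ l₃) (Q.tp l₁ (Q.tp l₂ l₃)) l₄ l₅ (Q.tp (Q.tp l₁ l₂) l₃) l₄ l₅
  simp only [aa, ab]
  linear_combination (norm := noncomm_ring)
    -(Q.ph l₃ l₄ l₅ * h1 * (Q.ph (Q.tp l₁ l₂) l₃ l₄ * Q.pb l₁ l₂ l₃))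
    + h2 * (Q.ph (Q.tp l₁ l₂) (Q.tp l₃ l₄) l₅ * Q.pb (Q.tp (Q.tp l₁ l₂) (Q.tp l₃ l₄)) l₅ l₆ *
        Q.ph (Q.tp l₁ l₂) l₃ l₄ * Q.pb l₁ l₂ l₃)
    - (Q.ph (Q.tp l₁ l₂) (Q.tp l₃ (Q.tp l₄ l₅)) l₆ * Q.ph l₃ l₄ l₅ *
        Q.ph (Q.tp l₁ l₂) (Q.tp l₃ l₄) l₅) * h4 * Q.pb l₁ l₂ l₃
    + Q.ph (Q.tp l₁ l₂) (Q.tp l₃ (Q.tp l₄ l₅)) l₆ * h3 *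
        (Q.pb (Q.tp (Q.tp (Q.tp l₁ l₂) l₃) l₄) l₅ l₆ * Q.pb l₁ l₂ l₃)
    - (Q.ph (Q.tp l₁ l₂) (Q.tp l₃ (Q.tp l₄ l₅)) l₆ * Q.ph (Q.tp l₁ l₂) l₃ (Q.tp l₄ l₅) *
        Q.ph (Q.tp (Q.tp l₁ l₂) l₃) l₄ l₅) * h5
    - (Q.ph (Q.tp l₁ l₂) (Q.tp l₃ (Q.tp l₄ l₅)) l₆ * Q.ph (Q.tp l₁ l₂) l₃ (Q.tp l₄ l₅)) * h6 *
        Q.pb (Q.tp (Q.tp l₁ (Q.tp l₂ l₃)) l₄) l₅ l₆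

/-- `a ⊗ b ⊗ c ↦ a β S(b) α c` -/
def zig : T3 k H →ₗ[k] H := mulMap₂ (LinearMap.mulRight k Q.β)
      (mulMap₂ (LinearMap.mulRight k Q.α ∘ₗ Q.S) LinearMap.id)

theorem sameL_zig : SameL Q.zig (Q.tp (l32 k H) (l33 k H)) Q.un := by
  refine Q.sameL_iff_comp fun z => ?_
  ext b c d
  refine Q.contract_comul (P := Q.zig ∘ₗ LinearMap.mulRight k (b ⊗ₜ (c ⊗ₜ d)) ∘ₗ mulMap₂ _ _)
    hQ.ax.S_α (LinearMap.mulLeft k (b * Q.β * Q.S c) ∘ₗ LinearMap.mulRight k d) (fun p q => ?_) ?_ z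
  all_goals simp [zig, l32, l33, inl, inr, Anti.map_mul, mul_assoc]

theorem sameR_zig : SameR Q.zig (Q.tp (l31 k H) (l32 k H)) Q.un := by
  refine Q.sameR_iff_comp fun z => ?_
  ext b c d
  refine Q.contract_comul (P := Q.zig ∘ₗ LinearMap.mulLeft k (b ⊗ₜ (c ⊗ₜ d)) ∘ₗ mulMap₂ _ _)
    hQ.ax.β_S (LinearMap.mulLeft k b ∘ₗ LinearMap.mulRight k (Q.S c * Q.α * d)) (fun p q => ?_) ?_ z
  all_goals simp [zig, l31, l32, inl, inr, Anti.map_mul, mul_assoc]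

/-- A computation on elementary tensors. When R and P are the elements that define δ and γ, the
right-hand side is u δ (S ⊗ S)(v₂₁) γ w. -/
theorem map_zig_aux (P R : T4 k H) (u v w : H ⊗[k] H) :
    TensorProduct.map Q.zig Q.zig
      (mulMap₂ (inr k ∘ₗ l32 k H) (mulMap₂ (inl k ∘ₗ l32 k H) (mulMap₂ (inl k ∘ₗ l33 k H)
        (inr k ∘ₗ l33 k H))) P *
      (mulMap₂ (inl k ∘ₗ l31 k H) (inr k ∘ₗ l31 k H) u *
        (mulMap₂ (inr k ∘ₗ l32 k H) (inl k ∘ₗ l32 k H) v *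
        mulMap₂ (inl k ∘ₗ l33 k H) (inr k ∘ₗ l33 k H) w)) *
      mulMap₂ (inl k ∘ₗ l31 k H) (mulMap₂ (inr k ∘ₗ l31 k H) (mulMap₂ (inr k ∘ₗ l32 k H)
        (inl k ∘ₗ l32 k H))) R) =
    u * mulMap₂ (inl k ∘ₗ LinearMap.mulRight k Q.β) (mulMap₂ (inr k ∘ₗ LinearMap.mulRight k Q.β)
        (mulMap₂ (inr k ∘ₗ Q.S) (inl k ∘ₗ Q.S))) R *
      Q.SS (TensorProduct.comm k H H v) * mulMap₂ (inr k ∘ₗ Q.S) (mulMap₂ (inl k ∘ₗ Q.S)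
      (mulMap₂ (inl k ∘ₗ LinearMap.mulLeft k Q.α) (inr k ∘ₗ LinearMap.mulLeft k Q.α))) P * w := by
  induction u using TensorProduct.induction_on with
  | zero => simp
  | add a b ha hb => simp only [mul_add, add_mul, map_add, ha, hb]
  | tmul u₁ u₂ =>
  induction v using TensorProduct.induction_on with
  | zero => simp
  | add a b ha hb => simp only [mul_add, add_mul, map_add, ha, hb]
  | tmul v₁ v₂ =>
  induction w using TensorProduct.induction_on with
  | zero => simp
  | add a b ha hb => simp only [mul_add, add_mul, map_add, ha, hb]
  | tmul w₁ w₂ =>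
  induction R using TensorProduct.induction_on with
  | zero => simp
  | add a b ha hb => simp only [mul_add, add_mul, map_add, TensorProduct.tmul_add, ha, hb]
  | tmul r₁ R =>
  induction R using TensorProduct.induction_on with
  | zero => simp
  | add a b ha hb => simp only [mul_add, add_mul, map_add, TensorProduct.tmul_add, ha, hb]
  | tmul r₂ R =>
  induction R using TensorProduct.induction_on with
  | zero => simp
  | add a b ha hb => simp only [mul_add, add_mul, map_add, TensorProduct.tmul_add, ha, hb]
  | tmul r₃ r₄ =>
  induction P using TensorProduct.induction_on with
  | zero => simp
  | add a b ha hb => simp only [mul_add, add_mul, map_add, TensorProduct.tmul_add, ha, hb]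
  | tmul p₁ P =>
  induction P using TensorProduct.induction_on with
  | zero => simp
  | add a b ha hb => simp only [mul_add, add_mul, map_add, TensorProduct.tmul_add, ha, hb]
  | tmul p₂ P =>
  induction P using TensorProduct.induction_on with
  | zero => simp
  | add a b ha hb => simp only [mul_add, add_mul, map_add, TensorProduct.tmul_add, ha, hb]
  | tmul p₃ p₄ =>
  simp [zig, l31, l32, l33, inl, inr, SS, Anti.map_mul, mul_assoc]

theorem zig_Phi : Q.zig Q.Phi = 1 := hQ.ax.Phi_antipode

/-- The zigzag identity for the dual pair formed by γ and δ. It consists of two interleaved zigzags,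
on the strands 1, 4, 5 and 2, 3, 6, which are placed in different tensor factors; coherence lets
them be straightened independently. -/
theorem del_gam_antipode : mulMap₂ (LinearMap.mulRight k Q.del ∘ₗ Q.comul)
    (mulMap₂ (LinearMap.mulRight k Q.gam ∘ₗ Q.SS ∘ₗ Q.comulCop) Q.comul) Q.Phi = 1 := by
  set l₁ : H →ₗ[k] T3 k H ⊗[k] T3 k H := inl k ∘ₗ l31 k H with e1
  set l₂ : H →ₗ[k] T3 k H ⊗[k] T3 k H := inr k ∘ₗ l31 k H with e2
  set l₃ : H →ₗ[k] T3 k H ⊗[k] T3 k H := inr k ∘ₗ l32 k H with e3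
  set l₄ : H →ₗ[k] T3 k H ⊗[k] T3 k H := inl k ∘ₗ l32 k H with e4
  set l₅ : H →ₗ[k] T3 k H ⊗[k] T3 k H := inl k ∘ₗ l33 k H with e5
  set l₆ : H →ₗ[k] T3 k H ⊗[k] T3 k H := inr k ∘ₗ l33 k H with e6
  set K := TensorProduct.map Q.zig Q.zig with hK
  have s45 : SameL K (Q.tp l₄ l₅) Q.un := by
    have := (Q.sameL_zig).map_inl (K' := Q.zig)
    rwa [comp_tp, comp_un] at this
  have s36 : SameL K (Q.tp l₃ l₆) Q.un := by
    have := (Q.sameL_zig).map_inr (K := Q.zig)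
    rwa [comp_tp, comp_un] at this
  have s14 : SameR K (Q.tp l₁ l₄) Q.un := by
    have := (Q.sameR_zig).map_inl (K' := Q.zig)
    rwa [comp_tp, comp_un] at this
  have s23 : SameR K (Q.tp l₂ l₃) Q.un := by
    have := (Q.sameR_zig).map_inr (K := Q.zig)
    rwa [comp_tp, comp_un] at this
  have s123 : SameR K (Q.tp l₁ (Q.tp l₂ l₃)) l₁ := by
    simpa using s23.tp₂ Q l₁
  have s1234 : SameR K (Q.tp (Q.tp l₁ (Q.tp l₂ l₃)) l₄) Q.un := (s123.tp₁ Q l₄).trans s14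
  have s345 : SameL K (Q.tp l₃ (Q.tp l₄ l₅)) l₃ := by
    simpa using s45.tp₂ Q l₃
  have start : ∀ w, mulMap₂ (LinearMap.mulRight k Q.del ∘ₗ Q.comul)
      (mulMap₂ (LinearMap.mulRight k Q.gam ∘ₗ Q.SS ∘ₗ Q.comulCop) Q.comul) w =
      K (Q.aa l₃ l₄ l₅ l₆ * mulMap₂ (Q.tp l₁ l₂) (mulMap₂ (Q.tp l₃ l₄) (Q.tp l₅ l₆)) w *
        Q.ab l₁ l₂ l₃ l₄) := by
    intro w
    rw [← aa_eq, ← ab_eq]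
    refine LinearMap.congr_fun (f := mulMap₂ _ _) (g := K ∘ₗ LinearMap.mulRight k _ ∘ₗ
      LinearMap.mulLeft k _ ∘ₗ mulMap₂ _ _) ?_ w
    ext a b c
    have := Q.map_zig_aux (tmulOne Q.Phi * Q.comulIdId Q.PhiInv)
      (Q.comulIdId Q.Phi * tmulOne Q.PhiInv) (Q.comul a) (Q.comul b) (Q.comul c)
    simp only [TensorProduct.AlgebraTensorModule.curry_apply, LinearMap.restrictScalars_self,
      TensorProduct.curry_apply, mulMap₂_tmul, LinearMap.comp_apply, LinearMap.mulRight_apply,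
      LinearMap.mulLeft_apply]
    refine Eq.trans ?_ this.symm
    simp only [mul_assoc]
    rfl
  have c1 := s345.ph₂ Q 1 (Q.tp l₁ l₂) l₆ (Q.ph (Q.tp l₁ l₂) l₃ (Q.tp l₄ l₅) *
        Q.pb l₁ l₂ l₃ * Q.ph (Q.tp l₁ (Q.tp l₂ l₃)) l₄ l₅ *
          Q.pb (Q.tp (Q.tp l₁ (Q.tp l₂ l₃)) l₄) l₅ l₆)
  have c2 := s45.ph₃ Q (Q.ph (Q.tp l₁ l₂) l₃ l₆) (Q.tp l₁ l₂) l₃ (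
        Q.pb l₁ l₂ l₃ * Q.ph (Q.tp l₁ (Q.tp l₂ l₃)) l₄ l₅ *
          Q.pb (Q.tp (Q.tp l₁ (Q.tp l₂ l₃)) l₄) l₅ l₆)
  have c3 := s1234.pb₁ Q (Q.ph (Q.tp l₁ l₂) l₃ l₆ *
        Q.pb l₁ l₂ l₃ * Q.ph (Q.tp l₁ (Q.tp l₂ l₃)) l₄ l₅) l₅ l₆ 1
  have c4 := s123.ph₁ Q (Q.ph (Q.tp l₁ l₂) l₃ l₆ * Q.pb l₁ l₂ l₃) l₄ l₅ 1
  have c5 := s36.pb₃ Q 1 l₁ l₂ (Q.ph l₂ l₃ l₆ * Q.ph l₁ (Q.tp l₂ l₃) l₆ * Q.ph l₁ l₄ l₅)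
  have c6 := s23.ph₂ Q (Q.ph l₂ l₃ l₆) l₁ l₆ (Q.ph l₁ l₄ l₅)
  simp only [one_mul, mul_one, ph_un₁, ph_un₂, ph_un₃, pb_un₁, pb_un₂, pb_un₃, ← mul_assoc]
    at c1 c2 c3 c4 c5 c6
  rw [start, ← ph, strand_coherence, c1, c2, c3, c4, Q.pentagon₂ l₁ l₂ l₃ l₆, c5, c6, e2, e3, e6, e1, e4,
    e5, ← map_ph, ← map_ph, ph, l3_lift, hK]
  simp [inl, inr, zig_Phi, ← Algebra.TensorProduct.one_def]

theorem del_mul_twist : Q.del * Q.twist = Q.comul Q.β :=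
  Q.transfer_β_mul Q.comul (Q.SS ∘ₗ Q.comulCop) Q.gam_S Q.del_S Q.del_gam_antipode

/-- Multiplying by f turns (S ⊗ S)Δᶜᵒᵖ(x³) into Δ(S(x³)) and δ into Δ(β), so the product collapses
to Δ(S(x¹)αx²βS(x³)) = Δ(1). -/
theorem twistInv_mul_twist : Q.twistInv * Q.twist = 1 := by
  have h : ∀ w : (H ⊗[k] H) ⊗[k] H, mulMap₂ (LinearMap.mulRight k Q.del ∘ₗ Q.comul ∘ₗ
      mulMap₂ (LinearMap.mulRight k Q.α ∘ₗ Q.S) LinearMap.id) (Q.SS ∘ₗ Q.comulCop) w * Q.twist =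
      Q.comul (mulMap₂ (mulMap₂ (LinearMap.mulRight k Q.α ∘ₗ Q.S) (LinearMap.mulRight k Q.β))
        Q.S w) := by
    intro w
    refine LinearMap.congr_fun (f := LinearMap.mulRight k _ ∘ₗ mulMap₂ _ _)
      (g := Q.comul ∘ₗ mulMap₂ _ _) ?_ w
    ext a b c
    simp [hQ.ax.comul_mul, mul_assoc, ← twist_mul_comul_S, ← del_mul_twist]
  rw [twistInv, h, ← mulMap₂_assoc, LinearEquiv.apply_symm_apply, hQ.ax.PhiInv_antipode,
    hQ.ax.comul_one]
  rfl

theorem twist_mul_twistInv [FiniteDimensional k H] : Q.twist * Q.twistInv = 1 := by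
  have hinj : Function.Injective (LinearMap.mulLeft k Q.twist) := fun a b h => by
    have := congrArg (Q.twistInv * ·) h
    simpa [← mul_assoc, twistInv_mul_twist] using this
  obtain ⟨t, ht⟩ := LinearMap.injective_iff_surjective.mp hinj 1
  have ht : Q.twist * t = 1 := ht
  rwa [left_inv_eq_right_inv Q.twistInv_mul_twist ht]

end DrinfeldTwist

/-! ### The twist in arbitrary legs and its cocycle equation. -/

section Twist

variable {k H B C : Type*} [Field k] [Ring H] [Algebra k H] [Ring B] [Algebra k B]
  [Ring C] [Algebra k C] (Q : QuasiHopfData k H)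

/-- `x(f¹) y(f²)` -/
def tw (x y : H →ₗ[k] B) : B := mulMap₂ x y Q.twist

/-- `x(g¹) y(g²)`, where `f⁻¹ = g¹ ⊗ g²` -/
def ti (x y : H →ₗ[k] B) : B := mulMap₂ x y Q.twistInv

theorem map_tw (π : B →ₗ[k] C) [Leg π] (x y : H →ₗ[k] B) :
    π (Q.tw x y) = Q.tw (π ∘ₗ x) (π ∘ₗ y) := by
  rw [tw, tw, map_mulMap₂]; rfl

theorem map_ti (π : B →ₗ[k] C) [Leg π] (x y : H →ₗ[k] B) :
    π (Q.ti x y) = Q.ti (π ∘ₗ x) (π ∘ₗ y) := by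
  rw [ti, ti, map_mulMap₂]; rfl

instance Intw.tw_comm {A : Type*} [Ring A] [Algebra k A] (x y : H →ₗ[k] B) (w : A →ₗ[k] B) [Cm x w]
    [Cm y w] : Intw (Q.tw x y) w w := ⟨fun a =>
  (intw_mulMap₂ (w a) (fun b => (Cm.comm b a).symm) (fun b => (Cm.comm b a).symm) Q.twist).symm⟩

instance Intw.ti_comm {A : Type*} [Ring A] [Algebra k A] (x y : H →ₗ[k] B) (w : A →ₗ[k] B) [Cm x w]
    [Cm y w] : Intw (Q.ti x y) w w := ⟨fun a =>
  (intw_mulMap₂ (w a) (fun b => (Cm.comm b a).symm) (fun b => (Cm.comm b a).symm) Q.twistInv).symm⟩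

theorem tw_nat (u : B) (x y x' y' : H →ₗ[k] B) [hx : Intw u x x'] [hy : Intw u y y'] :
    u * Q.tw x y = Q.tw x' y' * u := intw_mulMap₂ u hx.intw hy.intw _

theorem aa_nat (u : B) (p q r s p' q' r' s' : H →ₗ[k] B) [hp : Intw u p p'] [hq : Intw u q q']
    [hr : Intw u r r'] [hs : Intw u s s'] : u * Q.aa p q r s = Q.aa p' q' r' s' * u := by
  rw [aa, aa, ← mul_assoc, Q.ph_nat u p q r p' q' r', mul_assoc,
    Q.pb_nat u (Q.tp p q) r s (Q.tp p' q') r' s', mul_assoc]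

instance Intw.mul_self {A : Type*} [Ring A] [Algebra k A] {u v : B} {x : A →ₗ[k] B}
    [hu : Intw u x x] [hv : Intw v x x] : Intw (u * v) x x :=
  ⟨fun a => by rw [mul_assoc, hv.intw, ← mul_assoc, hu.intw, mul_assoc]⟩

theorem Intw.mul {A : Type*} [Ring A] [Algebra k A] {u v : B} {x y z : A →ₗ[k] B}
    (hu : Intw u y z) (hv : Intw v x y) : Intw (u * v) x z :=
  ⟨fun a => by rw [mul_assoc, hv.intw, ← mul_assoc, hu.intw, mul_assoc]⟩

instance Intw.lam_comm {A : Type*} [Ring A] [Algebra k A] (u : B) (s : A →ₗ[k] B)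
    [h : Intw u s s] : Intw (lam u : Op k B) (lam ∘ₗ s) (lam ∘ₗ s) :=
  ⟨fun z => op_ext fun e => by simp [act_mul, ← mul_assoc, h.intw]⟩

instance Intw.map {A : Type*} [Ring A] [Algebra k A] (π : B →ₗ[k] C) [Leg π] (u : B)
    (s t : A →ₗ[k] B) [h : Intw u s t] : Intw (π u) (π ∘ₗ s) (π ∘ₗ t) :=
  ⟨fun z => by rw [LinearMap.comp_apply, ← Leg.map_mul, h.intw, Leg.map_mul]; rfl⟩

theorem act_mul_left (c e : B) (P : Op k B) (h : lam c * P = P * lam c) :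
    act (c * e) P = c * act e P := by
  have := congrArg (act e) h
  simpa [act_mul] using this

/-- `x(S X³) y(S X²) z(S X¹)` -/
def phS (x y z : H →ₗ[k] B) : B :=
  mulMap₂ (z ∘ₗ Q.S) (mulMap₂ (y ∘ₗ Q.S) (x ∘ₗ Q.S)) Q.Phi

variable [hQ : Q.Regular]

theorem tw_mul_ti [FiniteDimensional k H] (x y : H →ₗ[k] B) [Leg x] [Leg y] [Cm x y] :
    Q.tw x y * Q.ti x y = 1 := by
  rw [tw, ti, ← Leg.map_mul, twist_mul_twistInv, Leg.map_one]

theorem ti_mul_tw (x y : H →ₗ[k] B) [Leg x] [Leg y] [Cm x y] :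
    Q.ti x y * Q.tw x y = 1 := by
  rw [tw, ti, ← Leg.map_mul, twistInv_mul_twist, Leg.map_one]

theorem tw_mul_α (x y : H →ₗ[k] B) [Leg x] [Leg y] [Cm x y] :
    Q.tw x y * Q.tp x y Q.α = mulMap₂ x y Q.gam := by
  rw [tw, tp, LinearMap.comp_apply, ← Leg.map_mul, twist_mul_comul_α]

instance Intw.tw_S (x y : H →ₗ[k] B) [Leg x] [Leg y] [Cm x y] :
    Intw (Q.tw x y) (Q.tp x y ∘ₗ Q.S) (Q.tp (y ∘ₗ Q.S) (x ∘ₗ Q.S)) := ⟨fun z => by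
  rw [QuasiHopfData.tw, QuasiHopfData.tp, LinearMap.comp_apply, LinearMap.comp_apply, ← Leg.map_mul,
    twist_mul_comul_S, Leg.map_mul]
  congr 1
  change (_root_.mulMap₂ x y ∘ₗ (Q.SS ∘ₗ Q.comulCop)) z = _
  rw [SS_comulCop, comp_tp]
  congr 2
  · ext a; simp [inr, Leg.map_one]
  · ext a; simp [inl, Leg.map_one]⟩

/-- Conjugation with a twist, seen by left multiplications. -/
theorem intw_lam {u : B} {s t : H →ₗ[k] B} (h : ∀ z, u * s z = t z * u) :
    Intw (lam u : Op k B) (lam ∘ₗ t) (lam ∘ₗ s) :=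
  ⟨fun z => op_ext fun e => by simp [act_mul, ← mul_assoc, h]⟩

instance Intw.lam_tw_S (x y : H →ₗ[k] B) [Leg x] [Leg y] [Cm x y] :
    Intw (lam (Q.tw x y) : Op k B) (Q.tp (lam ∘ₗ y ∘ₗ Q.S) (lam ∘ₗ x ∘ₗ Q.S))
      (lam ∘ₗ Q.tp x y ∘ₗ Q.S) := by
  have := intw_lam (Intw.tw_S Q x y).intw
  rwa [← tp_lam] at this

theorem ph_lam_S (x y z : H →ₗ[k] B) [Leg x] [Leg y] [Leg z] [Cm x y] [Cm x z] [Cm y z] :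
    Q.ph (lam ∘ₗ z ∘ₗ Q.S) (lam ∘ₗ y ∘ₗ Q.S) (lam ∘ₗ x ∘ₗ Q.S) = lam (Q.phS x y z) := by
  rw [ph, phS]
  refine LinearMap.congr_fun (f := mulMap₂ _ _) (g := (lam : B →ₗ[k] Op k B) ∘ₗ mulMap₂ _ _) ?_ Q.Phi
  ext a b c
  refine op_ext fun e => ?_
  simp only [TensorProduct.AlgebraTensorModule.curry_apply, LinearMap.restrictScalars_self,
      TensorProduct.curry_apply, mulMap₂_tmul, LinearMap.comp_apply, act_mul, act_lam, act_rho]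
  rw [← mul_assoc, ← mul_assoc, Cm.comm (x := x) (y := y), mul_assoc (y _), Cm.comm (x := x) (y := z),
    ← mul_assoc, Cm.comm (x := y) (y := z)]
  simp only [mul_assoc]

section SixLegs

variable (l₁ l₂ l₃ l₄ l₅ l₆ : H →ₗ[k] B) [Leg l₁] [Leg l₂] [Leg l₃] [Leg l₄]
    [Leg l₅] [Leg l₆] [Cm l₁ l₂] [Cm l₁ l₃] [Cm l₁ l₄] [Cm l₁ l₅] [Cm l₁ l₆] [Cm l₂ l₃] [Cm l₂ l₄]
    [Cm l₂ l₅] [Cm l₂ l₆] [Cm l₃ l₄] [Cm l₃ l₅] [Cm l₃ l₆] [Cm l₄ l₅] [Cm l₄ l₆] [Cm l₅ l₆]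

/-- Coherence for six strands with the pairs (3,4), (2,5) and (1,6) nested in each other. The two
sides differ in which two neighbouring pairs are regarded as the evaluation of a single tensor
product. -/
theorem nested_cups_coherence :
    Q.aa l₁ (Q.tp l₂ (Q.tp l₃ l₄)) l₅ l₆ * Q.ph l₁ l₂ (Q.tp l₃ l₄) *
      Q.aa (Q.tp l₁ l₂) l₃ l₄ (Q.tp l₅ l₆) * Q.ph l₄ l₅ l₆ =
    Q.aa l₂ l₃ l₄ l₅ * Q.aa l₁ (Q.tp l₂ l₃) (Q.tp l₄ l₅) l₆ * Q.ph l₁ l₂ l₃ := by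
  have h1 := Q.pentagon l₁ l₂ l₃ l₄
  have h2 := Q.pb_nat (Q.ph l₁ l₂ l₃) (Q.tp (Q.tp l₁ l₂) l₃) l₄ (Q.tp l₅ l₆)
    (Q.tp l₁ (Q.tp l₂ l₃)) l₄ (Q.tp l₅ l₆)
  have h3 := Q.ph_nat (Q.ph l₁ l₂ l₃) l₄ l₅ l₆ l₄ l₅ l₆
  have h4 := Q.pb_nat (Q.ph l₂ l₃ l₄) (Q.tp l₁ (Q.tp (Q.tp l₂ l₃) l₄)) l₅ l₆
    (Q.tp l₁ (Q.tp l₂ (Q.tp l₃ l₄))) l₅ l₆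
  have h5 := Q.ph_nat (Q.ph l₂ l₃ l₄) l₁ (Q.tp (Q.tp l₂ l₃) l₄) l₅
    l₁ (Q.tp l₂ (Q.tp l₃ l₄)) l₅
  have h6 := Q.pb_nat (Q.ph l₁ (Q.tp l₂ l₃) l₄) (Q.tp (Q.tp l₁ (Q.tp l₂ l₃)) l₄) l₅ l₆
    (Q.tp l₁ (Q.tp (Q.tp l₂ l₃) l₄)) l₅ l₆
  have h7 := Q.pentagon l₁ (Q.tp l₂ l₃) l₄ l₅
  have h8 := Q.pentagon_inv (Q.tp l₁ (Q.tp l₂ l₃)) l₄ l₅ l₆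
  have i1 := Q.pb_mul_ph l₄ l₅ l₆
  have i2 := Q.ph_mul_pb (Q.tp l₁ (Q.tp l₂ l₃)) l₄ l₅
  have i3 := Q.pb_mul_ph (Q.tp l₂ l₃) l₄ l₅
  simp only [aa]
  generalize Q.tp l₁ (Q.tp l₂ l₃) = X at *
  linear_combination (norm := noncomm_ring)
    -(Q.ph l₁ (Q.tp l₂ (Q.tp l₃ l₄)) l₅ * Q.pb (Q.tp l₁ (Q.tp l₂ (Q.tp l₃ l₄))) l₅ l₆) * h1 *
        (Q.pb (Q.tp (Q.tp l₁ l₂) l₃) l₄ (Q.tp l₅ l₆) * Q.ph l₄ l₅ l₆)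
    + (Q.ph l₁ (Q.tp l₂ (Q.tp l₃ l₄)) l₅ * Q.pb (Q.tp l₁ (Q.tp l₂ (Q.tp l₃ l₄))) l₅ l₆ *
        Q.ph l₂ l₃ l₄ * Q.ph l₁ (Q.tp l₂ l₃) l₄) * h2 * Q.ph l₄ l₅ l₆
    + (Q.ph l₁ (Q.tp l₂ (Q.tp l₃ l₄)) l₅ * Q.pb (Q.tp l₁ (Q.tp l₂ (Q.tp l₃ l₄))) l₅ l₆ *
        Q.ph l₂ l₃ l₄ * Q.ph l₁ (Q.tp l₂ l₃) l₄ * Q.pb X l₄ (Q.tp l₅ l₆)) * h3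
    - Q.ph l₁ (Q.tp l₂ (Q.tp l₃ l₄)) l₅ * h4 * (Q.ph l₁ (Q.tp l₂ l₃) l₄ * Q.pb X l₄ (Q.tp l₅ l₆) *
        Q.ph l₄ l₅ l₆ * Q.ph l₁ l₂ l₃)
    - h5 * (Q.pb (Q.tp l₁ (Q.tp (Q.tp l₂ l₃) l₄)) l₅ l₆ * Q.ph l₁ (Q.tp l₂ l₃) l₄ *
        Q.pb X l₄ (Q.tp l₅ l₆) * Q.ph l₄ l₅ l₆ * Q.ph l₁ l₂ l₃)
    - Q.ph l₂ l₃ l₄ * Q.ph l₁ (Q.tp (Q.tp l₂ l₃) l₄) l₅ * h6 * (Q.pb X l₄ (Q.tp l₅ l₆) *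
        Q.ph l₄ l₅ l₆ * Q.ph l₁ l₂ l₃)
    + Q.ph l₂ l₃ l₄ * Q.pb (Q.tp l₂ l₃) l₄ l₅ * h7 * (Q.pb (Q.tp X l₄) l₅ l₆ *
        Q.pb X l₄ (Q.tp l₅ l₆) * Q.ph l₄ l₅ l₆ * Q.ph l₁ l₂ l₃)
    - Q.ph l₂ l₃ l₄ * i3 * (Q.ph l₁ (Q.tp (Q.tp l₂ l₃) l₄) l₅ * Q.ph l₁ (Q.tp l₂ l₃) l₄ *
        Q.pb (Q.tp X l₄) l₅ l₆ *
        Q.pb X l₄ (Q.tp l₅ l₆) * Q.ph l₄ l₅ l₆ * Q.ph l₁ l₂ l₃)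
    - Q.ph l₂ l₃ l₄ * Q.pb (Q.tp l₂ l₃) l₄ l₅ * Q.ph l₁ (Q.tp l₂ l₃) (Q.tp l₄ l₅) * Q.ph X l₄ l₅ *
      h8 * (Q.ph l₄ l₅ l₆ * Q.ph l₁ l₂ l₃)
    + Q.ph l₂ l₃ l₄ * Q.pb (Q.tp l₂ l₃) l₄ l₅ * Q.ph l₁ (Q.tp l₂ l₃) (Q.tp l₄ l₅) *
      i2 * (Q.pb X (Q.tp l₄ l₅) l₆ * Q.pb l₄ l₅ l₆ * Q.ph l₄ l₅ l₆ * Q.ph l₁ l₂ l₃)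
    + Q.ph l₂ l₃ l₄ * Q.pb (Q.tp l₂ l₃) l₄ l₅ * Q.ph l₁ (Q.tp l₂ l₃) (Q.tp l₄ l₅) *
      Q.pb X (Q.tp l₄ l₅) l₆ * i1 * Q.ph l₁ l₂ l₃

/-- Once the innermost pair is contracted, the factors of the coherence identity that carry it
reduce or disappear, and the two ways of evaluating a triple tensor product against its dual agree.
-/
theorem nested_cups {M : Type*} [AddCommGroup M] [Module k M] (K : B →ₗ[k] M)
    (h : SameL K (Q.tp l₃ l₄) Q.un) :
    K (Q.aa l₁ l₂ l₅ l₆ * Q.aa (Q.tp l₁ l₂) l₃ l₄ (Q.tp l₅ l₆) * Q.ph l₄ l₅ l₆) =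
    K (Q.aa l₂ l₃ l₄ l₅ * Q.aa l₁ (Q.tp l₂ l₃) (Q.tp l₄ l₅) l₆ * Q.ph l₁ l₂ l₃) := by
  rw [← nested_cups_coherence]
  have s : SameL K (Q.tp l₂ (Q.tp l₃ l₄)) l₂ := by simpa using h.tp₂ Q l₂
  have h' := h.pre (Q.ph l₁ l₂ l₅)
  have s' := (h'.tp₂ Q l₂).tp₂ Q l₁
  have c1 := s.ph₂ Q 1 l₁ l₅ (Q.pb (Q.tp l₁ (Q.tp l₂ (Q.tp l₃ l₄))) l₅ l₆ *
    Q.ph l₁ l₂ (Q.tp l₃ l₄) * Q.aa (Q.tp l₁ l₂) l₃ l₄ (Q.tp l₅ l₆) * Q.ph l₄ l₅ l₆)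
  have c2 := s'.pb₁ Q 1 l₅ l₆ (
    Q.ph l₁ l₂ (Q.tp l₃ l₄) * Q.aa (Q.tp l₁ l₂) l₃ l₄ (Q.tp l₅ l₆) * Q.ph l₄ l₅ l₆)
  have c3 := h.ph₃ Q (Q.ph l₁ l₂ l₅ * Q.pb (Q.tp l₁ l₂) l₅ l₆) l₁ l₂ (
    Q.aa (Q.tp l₁ l₂) l₃ l₄ (Q.tp l₅ l₆) * Q.ph l₄ l₅ l₆)
  simp only [one_mul, mul_one, tp_un, ph_un₃, ← mul_assoc, LinearMap.comp_apply,
    LinearMap.mulLeft_apply] at c1 c2 c3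
  have d₁ : Q.aa l₁ l₂ l₅ l₆ = Q.ph l₁ l₂ l₅ * Q.pb (Q.tp l₁ l₂) l₅ l₆ := rfl
  have d₂ : Q.aa l₁ (Q.tp l₂ (Q.tp l₃ l₄)) l₅ l₆ = Q.ph l₁ (Q.tp l₂ (Q.tp l₃ l₄)) l₅ *
    Q.pb (Q.tp l₁ (Q.tp l₂ (Q.tp l₃ l₄))) l₅ l₆ := rfl
  rw [d₁, d₂, c1, c2, c3]

end SixLegs

theorem isUnit_map_α (x : H →ₗ[k] B) [Leg x] : IsUnit (x Q.α) := by
  obtain ⟨b, h₁, h₂⟩ := isUnit_iff_exists.mp hQ.isUnit_α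
  exact isUnit_iff_exists.mpr ⟨x b, by rw [← Leg.map_mul, h₁, Leg.map_one],
    by rw [← Leg.map_mul, h₂, Leg.map_one]⟩

/-- Multiply by the image of α under (xy)z, which is invertible. Because fΔ(α) = γ, both sides
become evaluations of the triple product against its dual, with y and z grouped on the left and x
and y on the right; these agree by `nested_cups`. -/
theorem twist_equation (x y z : H →ₗ[k] B) [Leg x] [Leg y] [Leg z] [Cm x y] [Cm x z] [Cm y z] :
    Q.tw y z * Q.tw x (Q.tp y z) * Q.ph x y z = Q.phS x y z * Q.tw x y * Q.tw (Q.tp x y) z := by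
  refine (Q.isUnit_map_α (Q.tp (Q.tp x y) z)).mul_right_cancel ?_
  have key := Q.nested_cups (lam ∘ₗ z ∘ₗ Q.S) (lam ∘ₗ y ∘ₗ Q.S) (lam ∘ₗ x ∘ₗ Q.S) (rho ∘ₗ x)
    (rho ∘ₗ y) (rho ∘ₗ z) (act (x Q.α * (y Q.α * z Q.α))) (Q.sameL_S x _)
  have left : Q.tw y z * Q.tw x (Q.tp y z) * Q.ph x y z * (Q.tp (Q.tp x y) z) Q.α =
      act (x Q.α * (y Q.α * z Q.α)) (Q.aa (lam ∘ₗ z ∘ₗ Q.S) (lam ∘ₗ y ∘ₗ Q.S) (rho ∘ₗ y) (rho ∘ₗ z) *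
        Q.aa (Q.tp (lam ∘ₗ z ∘ₗ Q.S) (lam ∘ₗ y ∘ₗ Q.S)) (lam ∘ₗ x ∘ₗ Q.S) (rho ∘ₗ x)
          (Q.tp (rho ∘ₗ y) (rho ∘ₗ z)) * Q.ph (rho ∘ₗ x) (rho ∘ₗ y) (rho ∘ₗ z)) := by
    have n := Q.aa_nat (lam (Q.tw y z) : Op k B) (Q.tp (lam ∘ₗ z ∘ₗ Q.S) (lam ∘ₗ y ∘ₗ Q.S))
      (lam ∘ₗ x ∘ₗ Q.S) (rho ∘ₗ x) (Q.tp (rho ∘ₗ y) (rho ∘ₗ z))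
      (lam ∘ₗ Q.tp y z ∘ₗ Q.S) (lam ∘ₗ x ∘ₗ Q.S) (rho ∘ₗ x) (Q.tp (rho ∘ₗ y) (rho ∘ₗ z))
    have n' := Q.aa_nat (lam (x Q.α) : Op k B) (lam ∘ₗ z ∘ₗ Q.S) (lam ∘ₗ y ∘ₗ Q.S) (rho ∘ₗ y)
      (rho ∘ₗ z) (lam ∘ₗ z ∘ₗ Q.S) (lam ∘ₗ y ∘ₗ Q.S) (rho ∘ₗ y) (rho ∘ₗ z)
    have e : act (x Q.α * (y Q.α * z Q.α)) (Q.aa (lam ∘ₗ z ∘ₗ Q.S) (lam ∘ₗ y ∘ₗ Q.S) (rho ∘ₗ y)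
        (rho ∘ₗ z)) = Q.tw y z * (x Q.α * Q.tp y z Q.α) := by
      rw [act_mul_left _ _ _ n', ← lift_gam, ← tw_mul_α, ← mul_assoc, ← mul_assoc,
        (Intw.tw_comm Q y z x).intw]
    rw [act_mul, act_mul, e, ← map_ph, act_rho, mul_assoc, ph_intw, ← mul_assoc]
    have c := congrArg (act (x Q.α * Q.tp y z Q.α)) n
    rw [act_mul, act_lam, act_mul, act_lam, ← comp_tp Q (rho : B →ₗ[k] Op k B), ← lift_gam, ← tw_mul_α] at c
    rw [← comp_tp Q (rho : B →ₗ[k] Op k B), c]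
    simp only [mul_assoc]
  have right : Q.phS x y z * Q.tw x y * Q.tw (Q.tp x y) z * (Q.tp (Q.tp x y) z) Q.α =
      act (x Q.α * (y Q.α * z Q.α)) (Q.aa (lam ∘ₗ y ∘ₗ Q.S) (lam ∘ₗ x ∘ₗ Q.S) (rho ∘ₗ x) (rho ∘ₗ y) *
        Q.aa (lam ∘ₗ z ∘ₗ Q.S) (Q.tp (lam ∘ₗ y ∘ₗ Q.S) (lam ∘ₗ x ∘ₗ Q.S))
          (Q.tp (rho ∘ₗ x) (rho ∘ₗ y)) (rho ∘ₗ z) *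
        Q.ph (lam ∘ₗ z ∘ₗ Q.S) (lam ∘ₗ y ∘ₗ Q.S) (lam ∘ₗ x ∘ₗ Q.S)) := by
    have n := Q.aa_nat (lam (Q.tw x y) : Op k B) (lam ∘ₗ z ∘ₗ Q.S) (Q.tp (lam ∘ₗ y ∘ₗ Q.S)
      (lam ∘ₗ x ∘ₗ Q.S)) (Q.tp (rho ∘ₗ x) (rho ∘ₗ y)) (rho ∘ₗ z)
      (lam ∘ₗ z ∘ₗ Q.S) (lam ∘ₗ Q.tp x y ∘ₗ Q.S) (Q.tp (rho ∘ₗ x) (rho ∘ₗ y)) (rho ∘ₗ z)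
    have n' := Q.aa_nat (lam (z Q.α) : Op k B) (lam ∘ₗ y ∘ₗ Q.S) (lam ∘ₗ x ∘ₗ Q.S) (rho ∘ₗ x)
      (rho ∘ₗ y) (lam ∘ₗ y ∘ₗ Q.S) (lam ∘ₗ x ∘ₗ Q.S) (rho ∘ₗ x) (rho ∘ₗ y)
    have e : act (x Q.α * (y Q.α * z Q.α)) (Q.aa (lam ∘ₗ y ∘ₗ Q.S) (lam ∘ₗ x ∘ₗ Q.S) (rho ∘ₗ x)
        (rho ∘ₗ y)) = Q.tw x y * (Q.tp x y Q.α * z Q.α) := by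
      rw [← mul_assoc, (Intw.mul_self (u := x Q.α) (v := y Q.α) (x := z)).intw, act_mul_left _ _ _ n', ← lift_gam, ← tw_mul_α, ← mul_assoc,
        ← (Intw.tw_comm Q x y z).intw, mul_assoc, Cm.comm (x := z)]
    rw [act_mul, act_mul, e, ph_lam_S, act_lam, mul_assoc, tw_mul_α]
    have c := congrArg (act (Q.tp x y Q.α * z Q.α)) n
    rw [act_mul, act_lam, act_mul, act_lam, ← comp_tp Q (rho : B →ₗ[k] Op k B), ← lift_gam] at c
    rw [← comp_tp Q (rho : B →ₗ[k] Op k B), c]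
    simp only [mul_assoc]
  rw [left, right, key]

end Twist

/-! ### Duals formed with the inverse antipode. -/

section InverseAntipode

variable {k H B C : Type*} [Field k] [Ring H] [Algebra k H] [Ring B] [Algebra k B]
  [Ring C] [Algebra k C] (Q : QuasiHopfData k H)

instance Anti.SInv [hQ : Q.Regular] : Anti Q.SInv where
  map_one := by
    conv_lhs => rw [← hQ.ax.S_one, hQ.SInv_S]
  map_mul a b := by
    rw [← hQ.SInv_S (Q.SInv b * Q.SInv a), hQ.ax.S_mul, hQ.S_SInv, hQ.S_SInv]

/-- Left multiplication with `x(S⁻¹(h))`. -/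
abbrev cl (x : H →ₗ[k] B) : H →ₗ[k] Op k B := lam ∘ₗ x ∘ₗ Q.SInv

variable [hQ : Q.Regular]

theorem T_α (z : H) : mulMap₂ Q.SInv (LinearMap.mulLeft k (Q.SInv Q.α))
    (TensorProduct.comm k H H (Q.comul z)) = Q.counit z • Q.SInv Q.α := by
  have h := congrArg Q.SInv (hQ.ax.S_α z)
  rw [map_smul] at h
  rw [← h]
  refine LinearMap.congr_fun (f := mulMap₂ _ _ ∘ₗ (TensorProduct.comm k H H).toLinearMap)
    (g := Q.SInv ∘ₗ mulMap₂ _ _) (TensorProduct.ext' fun a b => ?_) _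
  simp [Anti.map_mul, hQ.SInv_S]

theorem β_T (z : H) : mulMap₂ (LinearMap.mulRight k (Q.SInv Q.β)) Q.SInv
    (TensorProduct.comm k H H (Q.comul z)) = Q.counit z • Q.SInv Q.β := by
  have h := congrArg Q.SInv (hQ.ax.β_S z)
  rw [map_smul] at h
  rw [← h]
  refine LinearMap.congr_fun (f := mulMap₂ _ _ ∘ₗ (TensorProduct.comm k H H).toLinearMap)
    (g := Q.SInv ∘ₗ mulMap₂ _ _) (TensorProduct.ext' fun a b => ?_) _
  simp [Anti.map_mul, hQ.SInv_S, mul_assoc]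

/-- Applying S⁻¹ to the axiom for α gives an evaluation in which x stands to the left of its dual.
This is the side on which mates of half-braidings need the dual. -/
theorem sameL_T (x : H →ₗ[k] B) [hx : Leg x] (e' : B) [he : Intw e' x x] :
    SameL (act (x (Q.SInv Q.α) * e')) (Q.tp (rho ∘ₗ x) (Q.cl x)) Q.un := by
  refine Q.sameL_act fun z => ?_
  have h := congrArg (fun t => x t * e') (Q.T_α z)
  simp only [map_smul, smul_mul_assoc] at h
  rw [← h, tp, LinearMap.comp_apply]
  refine LinearMap.congr_fun (f := act _ ∘ₗ mulMap₂ _ _) (g := LinearMap.mulRight k e' ∘ₗ x ∘ₗ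
    mulMap₂ _ _ ∘ₗ (TensorProduct.comm k H H).toLinearMap) (TensorProduct.ext' fun a b => ?_) _
  simp [act_mul, Leg.map_mul, mul_assoc, he.intw]

/-- Since S undoes S⁻¹, the defining relation of f, used for the dual legs, compares the product of
the duals of y and x with the dual of x ⊗ y. -/
instance Intw.tw_cl (x y : H →ₗ[k] B) [Leg x] [Leg y] [Cm x y] :
    Intw (Q.tw (Q.cl y) (Q.cl x)) (Q.tp (Q.cl y) (Q.cl x)) (Q.cl (Q.tp x y)) := ⟨fun z => by
  have h := (Intw.tw_S Q (Q.cl y) (Q.cl x)).intw (Q.SInv z)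
  rw [LinearMap.comp_apply, hQ.S_SInv] at h
  rw [h]
  have e : ∀ w : H →ₗ[k] B, Q.cl w ∘ₗ Q.S = lam ∘ₗ w := fun w => by
    ext1 a; simp [hQ.SInv_S]
  rw [e, e, tp_lam]
  rfl⟩

/-- The twist equation for the dual legs. Here S cancels against S⁻¹, and the reversed associator
becomes left multiplication by the associator of x, y, z. -/
theorem twist_equation_cl (x y z : H →ₗ[k] B) [Leg x] [Leg y] [Leg z] [Cm x y] [Cm x z] [Cm y z] :
    Q.tw (Q.cl y) (Q.cl x) * Q.tw (Q.cl z) (Q.tp (Q.cl y) (Q.cl x)) *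
        Q.ph (Q.cl z) (Q.cl y) (Q.cl x) =
      lam (Q.ph x y z) * Q.tw (Q.cl z) (Q.cl y) * Q.tw (Q.tp (Q.cl z) (Q.cl y)) (Q.cl x) := by
  rw [twist_equation]
  congr 2
  rw [phS, ph]
  refine LinearMap.congr_fun (f := mulMap₂ _ _) (g := (lam : B →ₗ[k] Op k B) ∘ₗ mulMap₂ _ _) ?_
    Q.Phi
  ext a b c
  refine op_ext fun e => ?_
  simp only [TensorProduct.AlgebraTensorModule.curry_apply, LinearMap.restrictScalars_self,
      TensorProduct.curry_apply, mulMap₂_tmul, LinearMap.comp_apply, act_mul, act_lam, hQ.SInv_S]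
  simp only [← mul_assoc]
  congr 1
  rw [mul_assoc (z c), ← Cm.comm (x := x) (y := y), ← Intw.intw (u := x a * y b) (x := z)]

/-- The analogue of fΔ(α) = γ for these duals: after comparison through f, the evaluation of x ⊗ y
is the evaluation of y nested inside that of x. -/
theorem act_tw_cl (x y : H →ₗ[k] B) [Leg x] [Leg y] [Cm x y] :
    act (Q.tp x y (Q.SInv Q.α)) (Q.tw (Q.cl y) (Q.cl x)) =
      act (x (Q.SInv Q.α) * y (Q.SInv Q.α)) (Q.aa (rho ∘ₗ x) (rho ∘ₗ y) (Q.cl y) (Q.cl x)) := by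
  have h := congrArg (act 1) ((Intw.tw_cl Q x y).intw Q.α)
  rw [tw_mul_α, act_mul, LinearMap.comp_apply, act_lam, mul_one, LinearMap.comp_apply] at h
  rw [← h, ← aa_eq, gam]
  generalize tmulOne Q.Phi * Q.comulIdId Q.PhiInv = w
  refine LinearMap.congr_fun (f := act (1 : B) ∘ₗ mulMap₂ (Q.cl y) (Q.cl x) ∘ₗ mulMap₂ _ _)
    (g := act _ ∘ₗ mulMap₂ _ _)
    ?_ w
  ext a b c d
  simp [inl, inr, act_mul, Leg.map_mul, Anti.map_mul, hQ.SInv_S]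
  have c (a b t) : y b * (x a * t) = x a * (y b * t) := by
    rw [← mul_assoc, ← Cm.comm a b, mul_assoc]
  simp only [mul_assoc, c, ← Cm.comm (x := x) (y := y)]

/-! ### Intertwiners and their mates -/

/-- The mate `T(X³) T(α) X² · X¹ r` of an intertwiner `r`, where `T = S⁻¹`, the components of `X²`, `X³` being
multiplied in through `x`, the component `X¹` through `v`. -/
def gm (x v : H →ₗ[k] B) (r : B) : B :=
  act (x (Q.SInv Q.α)) (Q.ph (rho ∘ₗ v) (rho ∘ₗ x) (Q.cl x) * rho r)

/-- `p ⊗ q ⊗ s ↦ x(s T(β) T(q)) g x(p₁) v(p₂)`, where `T = S⁻¹` -/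
def rcMap (x v : H →ₗ[k] B) (g : B) : T3 k H →ₗ[k] B :=
  act g ∘ₗ mulMap₂ (rho ∘ₗ Q.tp x v) (lam ∘ₗ x ∘ₗ
    mulMap₂ (LinearMap.mulRight k (Q.SInv Q.β)) Q.SInv ∘ₗ (TensorProduct.comm k H H).toLinearMap)

/-- The intertwiner with mate `g`. -/
def rc (x v : H →ₗ[k] B) (g : B) : B := Q.rcMap x v g Q.PhiInv

theorem sameR_rcMap (x v : H →ₗ[k] B) [Leg x] (g : B) :
    SameR (Q.rcMap x v g) (Q.tp (l32 k H) (l33 k H)) Q.un := by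
  refine Q.sameR_iff_comp fun z => ?_
  ext b c d
  refine Q.contract_comul (P := Q.rcMap x v g ∘ₗ LinearMap.mulLeft k (b ⊗ₜ (c ⊗ₜ d)) ∘ₗ mulMap₂ _ _)
    Q.β_T (LinearMap.mulRight k (g * Q.tp x v b) ∘ₗ x ∘ₗ LinearMap.mulLeft k d ∘ₗ
      LinearMap.mulRight k (Q.SInv c)) (g := mulMap₂ (LinearMap.mulRight k (Q.SInv Q.β)) Q.SInv ∘ₗ
      (TensorProduct.comm k H H).toLinearMap) (fun p q => ?_) ?_ z
  all_goals simp [rcMap, act_mul, l32, l33, inl, inr, Anti.map_mul, Leg.map_mul, mul_assoc]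

variable (x v : H →ₗ[k] B) [Leg x] [Leg v] [Cm x v]

/-- The mate is the composite (xv)x' → (vx)x' → v(xx') → v of r, an associator and the evaluation of
x against x'. Each of the three is a morphism. -/
theorem gm_intw (r : B) [hr : Intw r (Q.tp x v) (Q.tp v x)] (z : H) :
    v z * Q.gm x v r = act (Q.gm x v r) (Q.tp (Q.tp (rho ∘ₗ x) (rho ∘ₗ v)) (Q.cl x) z) := by
  have hr' : Intw (rho r : Op k B) (Q.tp (rho ∘ₗ x) (rho ∘ₗ v)) (Q.tp (rho ∘ₗ v) (rho ∘ₗ x)) := by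
    rw [← comp_tp, ← comp_tp]; infer_instance
  have s := (Q.sameL_T x 1).tp₂ Q (rho ∘ₗ v)
  rw [tp_un, mul_one] at s
  have n : lam (v z) * (Q.ph (rho ∘ₗ v) (rho ∘ₗ x) (Q.cl x) * rho r) =
    (Q.ph (rho ∘ₗ v) (rho ∘ₗ x) (Q.cl x) * rho r) * lam (v z) := by
    rw [← mul_assoc, Q.ph_nat (lam (v z) : Op k B) (rho ∘ₗ v) (rho ∘ₗ x) (Q.cl x) (rho ∘ₗ v)
      (rho ∘ₗ x) (Q.cl x), mul_assoc, ← Cm.comm (x := (rho : B →ₗ[k] Op k B)), mul_assoc]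
  rw [gm, ← act_mul, mul_assoc, Intw.intw (y := Q.tp (Q.tp (rho ∘ₗ v) (rho ∘ₗ x)) (Q.cl x)),
    ← mul_assoc, ph_intw, mul_assoc, s, ← act_mul_left _ _ _ n, act_mul _ ((rho ∘ₗ v) z)]
  simp [Cm.comm (x := x) (y := v)]

theorem mul_rcMap {g : B}
    (hg : ∀ z, v z * g = act g (Q.tp (Q.tp (rho ∘ₗ x) (rho ∘ₗ v)) (Q.cl x) z)) (a : H)
    (w : T3 k H) : v a * Q.rcMap x v g w = Q.rcMap x v g (Q.tp (l31 k H) (l32 k H) a * w) := by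
  refine LinearMap.congr_fun (f := LinearMap.mulLeft k (v a) ∘ₗ Q.rcMap x v g)
    (g := Q.rcMap x v g ∘ₗ LinearMap.mulLeft k _) ?_ w
  ext p q s
  have h1 : v a * Q.rcMap x v g (p ⊗ₜ (q ⊗ₜ s)) =
      x (s * Q.SInv Q.β * Q.SInv q) * (v a * g) * Q.tp x v p := by
    have : v a * x (s * Q.SInv Q.β * Q.SInv q) = x (s * Q.SInv Q.β * Q.SInv q) * v a :=
      (Cm.comm _ _).symm
    simp only [← mul_assoc, ← this]
    simp [rcMap, act_mul, mul_assoc]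
  refine h1.trans ?_
  rw [hg]
  refine LinearMap.congr_fun (f := LinearMap.mulRight k _ ∘ₗ LinearMap.mulLeft k _ ∘ₗ act g ∘ₗ
    mulMap₂ _ _) (g := Q.rcMap x v g ∘ₗ LinearMap.mulRight k (p ⊗ₜ (q ⊗ₜ s)) ∘ₗ mulMap₂ _ _)
    (TensorProduct.ext' fun b c => ?_) (Q.comul a)
  simp [rcMap, act_mul, l31, l32, inl, inr, Leg.map_mul, Anti.map_mul, mul_assoc, ← comp_tp]

/-- The coevaluation given by S⁻¹(β) contracts the last two legs of Φ⁻¹, and the hypothesis on g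
lets an element of H pass through the mate. Both are applied to the intertwining property of Φ⁻¹. -/
theorem rc_intw {g : B} (hg : ∀ z, v z * g = act g (Q.tp (Q.tp (rho ∘ₗ x) (rho ∘ₗ v)) (Q.cl x) z)) :
    Intw (Q.rc x v g) (Q.tp x v) (Q.tp v x) := ⟨fun z => by
  have h1 : Q.rc x v g * Q.tp x v z =
      Q.rcMap x v g (Q.pb (l31 k H) (l32 k H) (l33 k H) * l31 k H z) := by
    rw [pb, l3_lift, rc]
    generalize Q.PhiInv = w
    refine LinearMap.congr_fun (f := LinearMap.mulRight k _ ∘ₗ Q.rcMap x v g)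
      (g := Q.rcMap x v g ∘ₗ LinearMap.mulRight k _) ?_ w
    ext a b c
    simp [rcMap, act_mul, l31, inl, Leg.map_mul, mul_assoc]
  have h2 : Q.tp v x z * Q.rc x v g =
      Q.rcMap x v g (Q.tp (Q.tp (l31 k H) (l32 k H)) (l33 k H) z *
        Q.pb (l31 k H) (l32 k H) (l33 k H)) := by
    rw [pb, l3_lift, rc]
    generalize Q.PhiInv = w
    refine LinearMap.congr_fun (f := LinearMap.mulRight k _ ∘ₗ mulMap₂ v x)
      (g := Q.rcMap x v g ∘ₗ LinearMap.mulRight k w ∘ₗ mulMap₂ _ _)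
      (TensorProduct.ext' fun a b => ?_) (Q.comul z)
    have : x b * Q.rcMap x v g w = Q.rcMap x v g (l33 k H b * w) := by
      refine LinearMap.congr_fun (f := LinearMap.mulLeft k _ ∘ₗ Q.rcMap x v g)
        (g := Q.rcMap x v g ∘ₗ LinearMap.mulLeft k _) ?_ w
      ext p q s
      simp [rcMap, act_mul, l33, inr, Leg.map_mul, mul_assoc]
    simp only [LinearMap.comp_apply, mulMap₂_tmul, LinearMap.mulRight_apply, mul_assoc, this]
    rw [Q.mul_rcMap x v hg]
  have s := (Q.sameR_rcMap x v g).tp₂ Q (l31 k H) z (Q.pb (l31 k H) (l32 k H) (l33 k H))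
  rw [tp_un] at s
  rw [h1, h2, ← s, pb_intw]⟩

theorem rcMap_act (W w : T3 k H) : act (x (Q.SInv Q.α))
      (mulMap₂ (rho ∘ₗ v) (mulMap₂ (rho ∘ₗ x) (Q.cl x)) W * mulMap₂ (rho ∘ₗ Q.tp v x) (lam ∘ₗ x ∘ₗ
        mulMap₂ (LinearMap.mulRight k (Q.SInv Q.β)) Q.SInv ∘ₗ
          (TensorProduct.comm k H H).toLinearMap) w) =
    mulMap₂ v (x ∘ₗ act (Q.SInv Q.α) ∘ₗ mulMap₂ rho (mulMap₂ (lam ∘ₗ Q.SInv)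
      (lam ∘ₗ LinearMap.mulRight k (Q.SInv Q.β))))
      (mulMap₂ (l41 k H) (mulMap₂ (l42 k H) (l43 k H)) W *
        mulMap₂ (Q.tp (l41 k H) (l42 k H)) (mulMap₂ (l43 k H) (l44 k H)) w) := by
  have cm (a b t) : x b * (v a * t) = v a * (x b * t) := by
    rw [← mul_assoc, Cm.comm b a, mul_assoc]
  induction W using TensorProduct.induction_on with
  | zero => simp
  | add a b ha hb => simp only [add_mul, map_add, ha, hb]
  | tmul a W =>
  induction W using TensorProduct.induction_on with
  | zero => simp
  | add a b ha hb => simp only [add_mul, map_add, TensorProduct.tmul_add, ha, hb]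
  | tmul b c =>
  induction w using TensorProduct.induction_on with
  | zero => simp
  | add a b ha hb => simp only [mul_add, map_add, ha, hb]
  | tmul p w =>
  induction w using TensorProduct.induction_on with
  | zero => simp
  | add a b ha hb => simp only [mul_add, map_add, TensorProduct.tmul_add, ha, hb]
  | tmul q s =>
  simp only [mulMap₂_tmul, tp, LinearMap.comp_apply]
  generalize Q.comul p = u
  induction u using TensorProduct.induction_on with
  | zero => simp
  | add a b ha hb => simp only [mul_add, add_mul, map_add, ha, hb]
  | tmul p₁ p₂ =>
  simp [act_mul, l41, l42, l43, l44, l31, l32, l33, inl, inr, Leg.map_mul, Anti.map_mul, mul_assoc, cm]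

/-- A zigzag identity for x and its dual x'. A pentagon brings evaluation and coevaluation together,
the contractible associators vanish, and S⁻¹ applied to S(x¹)αx²βS(x³) = 1 remains. -/
theorem rc_gm (r : B) [hr : Intw r (Q.tp x v) (Q.tp v x)] : Q.rc x v (Q.gm x v r) = r := by
  set K : T4 k H →ₗ[k] B := mulMap₂ v (x ∘ₗ act (Q.SInv Q.α) ∘ₗ mulMap₂ rho (mulMap₂ (lam ∘ₗ Q.SInv)
      (lam ∘ₗ LinearMap.mulRight k (Q.SInv Q.β)))) with hK
  have hl : SameL K (Q.tp (l42 k H) (l43 k H)) Q.un := by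
    refine Q.sameL_iff_comp fun z => ?_
    ext b c d e
    refine Q.contract_comul (P := K ∘ₗ LinearMap.mulRight k (b ⊗ₜ (c ⊗ₜ (d ⊗ₜ e))) ∘ₗ mulMap₂ _ _)
      Q.T_α (LinearMap.mulLeft k (v b) ∘ₗ x ∘ₗ LinearMap.mulLeft k (e * Q.SInv Q.β * Q.SInv d) ∘ₗ
        LinearMap.mulRight k c) (g := mulMap₂ Q.SInv (LinearMap.mulLeft k (Q.SInv Q.α)) ∘ₗ
        (TensorProduct.comm k H H).toLinearMap) (fun p q => ?_) ?_ z
    all_goals simp [K, act_mul, l42, l43, l31, l32, inl, inr, Anti.map_mul, Leg.map_mul, mul_assoc]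
  have hr' : SameR K (Q.tp (l43 k H) (l44 k H)) Q.un := by
    refine Q.sameR_iff_comp fun z => ?_
    ext b c d e
    refine Q.contract_comul (P := K ∘ₗ LinearMap.mulLeft k (b ⊗ₜ (c ⊗ₜ (d ⊗ₜ e))) ∘ₗ mulMap₂ _ _)
      Q.β_T (LinearMap.mulLeft k (v b) ∘ₗ x ∘ₗ LinearMap.mulLeft k e ∘ₗ
        LinearMap.mulRight k (Q.SInv d * Q.SInv Q.α * c))
        (g := mulMap₂ (LinearMap.mulRight k (Q.SInv Q.β)) Q.SInv ∘ₗ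
        (TensorProduct.comm k H H).toLinearMap) (fun p q => ?_) ?_ z
    all_goals simp [K, act_mul, l43, l44, l32, l33, inl, inr, Anti.map_mul, Leg.map_mul, mul_assoc]
  have start : Q.rc x v (Q.gm x v r) = K (Q.ph (l41 k H) (l42 k H) (l43 k H) *
      Q.pb (Q.tp (l41 k H) (l42 k H)) (l43 k H) (l44 k H)) * r := by
    rw [ph, pb, ← rcMap_act, act_mul, ← ph, rc, gm]
    generalize Q.PhiInv = w
    refine LinearMap.congr_fun (f := Q.rcMap x v _) (g := LinearMap.mulRight k _ ∘ₗ act _ ∘ₗ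
      mulMap₂ _ _) ?_ w
    ext p q s
    simp [rcMap, act_mul, mul_assoc, hr.intw]
  have c1 := hl.pb₂ Q 1 (l41 k H) (l44 k H) (Q.pb (l42 k H) (l43 k H) (l44 k H) *
    Q.ph (l41 k H) (l42 k H) (Q.tp (l43 k H) (l44 k H)))
  have c2 := hr'.ph₃ Q (Q.pb (l42 k H) (l43 k H) (l44 k H)) (l41 k H) (l42 k H) 1
  simp only [one_mul, mul_one, ph_un₃, pb_un₂, ← mul_assoc] at c1 c2
  have fin : K (Q.pb (l42 k H) (l43 k H) (l44 k H)) = 1 := by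
    have := congrArg (fun t => x (Q.SInv t)) hQ.ax.PhiInv_antipode
    rw [Anti.map_one, Leg.map_one] at this
    rw [← this, pb]
    refine LinearMap.congr_fun (f := K ∘ₗ mulMap₂ _ _) (g := x ∘ₗ Q.SInv ∘ₗ mulMap₂ _ _) ?_ Q.PhiInv
    ext a b c
    simp [K, act_mul, l42, l43, l44, l31, l32, l33, inl, inr, Anti.map_mul, Leg.map_one, mul_assoc,
      hQ.SInv_S]
  rw [start, pentagon₃, c1, c2, fin, one_mul]

theorem gm_rcMap {g : B}
    (hg : ∀ z, v z * g = act g (Q.tp (Q.tp (rho ∘ₗ x) (rho ∘ₗ v)) (Q.cl x) z)) (W w : T3 k H) :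
    act (x (Q.SInv Q.α)) (mulMap₂ (rho ∘ₗ v) (mulMap₂ (rho ∘ₗ x) (Q.cl x)) W *
      rho (Q.rcMap x v g w)) =
    act g (mulMap₂ (rho ∘ₗ Q.tp x v) (lam ∘ₗ x ∘ₗ act (Q.SInv Q.β) ∘ₗ mulMap₂ (rho ∘ₗ Q.SInv)
      (mulMap₂ lam (lam ∘ₗ LinearMap.mulRight k (Q.SInv Q.α) ∘ₗ Q.SInv)))
      (mulMap₂ (Q.tp (l41 k H) (l42 k H)) (mulMap₂ (l43 k H) (l44 k H)) W *
        mulMap₂ (l41 k H) (mulMap₂ (l42 k H) (l43 k H)) w)) := by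
  have cm (a b t) : v a * (x b * t) = x b * (v a * t) := by
    rw [← mul_assoc, ← Cm.comm b a, mul_assoc]
  induction W using TensorProduct.induction_on with
  | zero => simp
  | add a b ha hb => simp only [add_mul, map_add, ha, hb]
  | tmul a W =>
  induction W using TensorProduct.induction_on with
  | zero => simp
  | add a b ha hb => simp only [add_mul, map_add, TensorProduct.tmul_add, ha, hb]
  | tmul b c =>
  induction w using TensorProduct.induction_on with
  | zero => simp
  | add a b ha hb => simp only [mul_add, map_add, ha, hb]
  | tmul p w =>
  induction w using TensorProduct.induction_on with
  | zero => simp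
  | add a b ha hb => simp only [mul_add, map_add, TensorProduct.tmul_add, ha, hb]
  | tmul q s =>
  have h1 : act (x (Q.SInv Q.α)) (mulMap₂ (rho ∘ₗ v) (mulMap₂ (rho ∘ₗ x) (Q.cl x))
      (a ⊗ₜ (b ⊗ₜ c)) * rho (Q.rcMap x v g (p ⊗ₜ (q ⊗ₜ s)))) =
      x (Q.SInv c * Q.SInv Q.α * b) * (v a * Q.rcMap x v g (p ⊗ₜ (q ⊗ₜ s))) := by
    simp [act_mul, mul_assoc, cm, Leg.map_mul]
  rw [h1, Q.mul_rcMap x v hg]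
  simp only [mulMap₂_tmul, tp, LinearMap.comp_apply]
  generalize Q.comul a = u
  induction u using TensorProduct.induction_on with
  | zero => simp
  | add a b ha hb => simp only [mul_add, add_mul, map_add, ha, hb]
  | tmul p₁ p₂ =>
  simp [tp, rcMap, act_mul, l41, l42, l43, l44, l31, l32, l33, inl, inr, Leg.map_mul, Anti.map_mul,
    mul_assoc]

/-- The other zigzag identity, which ends in S⁻¹ applied to X¹βS(X²)αX³ = 1. Hence passing to mates
loses no information in either direction. -/
theorem gm_rc {g : B}
    (hg : ∀ z, v z * g = act g (Q.tp (Q.tp (rho ∘ₗ x) (rho ∘ₗ v)) (Q.cl x) z)) :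
    Q.gm x v (Q.rc x v g) = g := by
  set K : T4 k H →ₗ[k] B := act g ∘ₗ (mulMap₂ (rho ∘ₗ Q.tp x v) (lam ∘ₗ x ∘ₗ act (Q.SInv Q.β) ∘ₗ
    mulMap₂ (rho ∘ₗ Q.SInv) (mulMap₂ lam (lam ∘ₗ LinearMap.mulRight k (Q.SInv Q.α) ∘ₗ Q.SInv))))
    with hK
  have hl : SameL K (Q.tp (l43 k H) (l44 k H)) Q.un := by
    refine Q.sameL_iff_comp fun z => ?_
    ext b c d e
    refine Q.contract_comul (P := K ∘ₗ LinearMap.mulRight k (b ⊗ₜ (c ⊗ₜ (d ⊗ₜ e))) ∘ₗ mulMap₂ _ _)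
      Q.T_α (LinearMap.mulRight k (g * Q.tp x v b) ∘ₗ x ∘ₗ LinearMap.mulLeft k (Q.SInv e) ∘ₗ
        LinearMap.mulRight k (d * Q.SInv Q.β * Q.SInv c))
        (g := mulMap₂ Q.SInv (LinearMap.mulLeft k (Q.SInv Q.α)) ∘ₗ
        (TensorProduct.comm k H H).toLinearMap) (fun p q => ?_) ?_ z
    all_goals simp [K, act_mul, l43, l44, l32, l33, inl, inr, Anti.map_mul, Leg.map_mul, mul_assoc]
  have hr : SameR K (Q.tp (l42 k H) (l43 k H)) Q.un := by
    refine Q.sameR_iff_comp fun z => ?_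
    ext b c d e
    refine Q.contract_comul (P := K ∘ₗ LinearMap.mulLeft k (b ⊗ₜ (c ⊗ₜ (d ⊗ₜ e))) ∘ₗ mulMap₂ _ _)
      Q.β_T (LinearMap.mulRight k (g * Q.tp x v b) ∘ₗ x ∘ₗ
        LinearMap.mulLeft k (Q.SInv e * Q.SInv Q.α * d) ∘ₗ LinearMap.mulRight k (Q.SInv c))
        (g := mulMap₂ (LinearMap.mulRight k (Q.SInv Q.β)) Q.SInv ∘ₗ
        (TensorProduct.comm k H H).toLinearMap) (fun p q => ?_) ?_ z
    all_goals simp [K, act_mul, l42, l43, l31, l32, inl, inr, Anti.map_mul, Leg.map_mul, mul_assoc]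
  have start : Q.gm x v (Q.rc x v g) = K (Q.ph (Q.tp (l41 k H) (l42 k H)) (l43 k H) (l44 k H) *
      Q.pb (l41 k H) (l42 k H) (l43 k H)) := Q.gm_rcMap x v hg _ _
  have c1 := hl.pb₃ Q 1 (l41 k H) (l42 k H) (Q.ph (l42 k H) (l43 k H) (l44 k H) *
    Q.ph (l41 k H) (Q.tp (l42 k H) (l43 k H)) (l44 k H))
  have c2 := hr.ph₂ Q (Q.ph (l42 k H) (l43 k H) (l44 k H)) (l41 k H) (l44 k H) 1
  simp only [one_mul, mul_one, ph_un₂, pb_un₃, ← mul_assoc] at c1 c2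
  have fin : K (Q.ph (l42 k H) (l43 k H) (l44 k H)) = g := by
    have := congrArg (fun t => x (Q.SInv t)) hQ.ax.Phi_antipode
    rw [Anti.map_one, Leg.map_one] at this
    rw [← one_mul g, ← this, ph]
    refine LinearMap.congr_fun (f := K ∘ₗ mulMap₂ _ _) (g := LinearMap.mulRight k g ∘ₗ x ∘ₗ
      Q.SInv ∘ₗ mulMap₂ _ _) ?_ Q.Phi
    ext a b c
    simp [K, act_mul, l42, l43, l44, l31, l32, l33, inl, inr, Anti.map_mul, Leg.map_one, mul_assoc,
      hQ.SInv_S, Leg.map_mul]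
  rw [start, pentagon₂, c1, c2, fin]

end InverseAntipode

/-! ### The hexagon as a product formula for mates. -/

section MateProduct

variable {k H B : Type*} [Field k] [Ring H] [Algebra k H] [Ring B] [Algebra k B]
  (Q : QuasiHopfData k H)

instance Intw.un (u : B) : Intw u (Q.un : H →ₗ[k] B) Q.un := ⟨fun a => by simp [un_apply]⟩

instance Intw.comp {A A' : Type*} [Ring A] [Algebra k A] [Ring A'] [Algebra k A'] (u : B)
    (x y : A →ₗ[k] B) (w : A' →ₗ[k] A) [h : Intw u x y] : Intw u (x ∘ₗ w) (y ∘ₗ w) :=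
  ⟨fun a => h.intw (w a)⟩

/-- The associator `1(2v)2'1' → (12)v(2'1')`. -/
def psi (x y v y' x' : H →ₗ[k] B) : B :=
  Q.ph (Q.tp (Q.tp x y) v) y' x' * Q.pb x y v * Q.pb x (Q.tp y v) y'

/-- The inverse of `psi`. -/
def psiInv (x y v y' x' : H →ₗ[k] B) : B :=
  Q.ph x (Q.tp y v) y' * Q.ph x y v * Q.pb (Q.tp (Q.tp x y) v) y' x'

/-- The intertwiner for `xy` composed from those for `x` and for `y`. -/
def hex (x y v : H →ₗ[k] B) (rx ry : B) : B :=
  Q.ph v x y * rx * Q.pb x v y * ry * Q.ph x y v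

instance Intw.hex [Q.Regular] (x y v : H →ₗ[k] B) [Leg x] [Leg y] [Leg v] [Cm x y] [Cm x v] [Cm y v] (rx ry : B)
    [Intw rx (Q.tp x v) (Q.tp v x)] [Intw rx y y] [Intw ry (Q.tp y v) (Q.tp v y)]
    [Intw ry x x] : Intw (Q.hex x y v rx ry) (Q.tp (Q.tp x y) v) (Q.tp v (Q.tp x y)) :=
  Intw.mul (Intw.mul (Intw.mul (Intw.mul (Intw.ph Q v x y) (y := Q.tp (Q.tp v x) y)
    (x := Q.tp (Q.tp x v) y) inferInstance) (Intw.pb Q x v y)) (x := Q.tp x (Q.tp y v))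
    inferInstance) (Intw.ph Q x y v)

variable [hQ : Q.Regular]

section Five

variable (x y v y' x' : H →ₗ[k] B) [Leg x] [Leg y] [Leg v] [Leg y'] [Leg x'] [Cm x y] [Cm x v]
  [Cm x y'] [Cm x x'] [Cm y v] [Cm y y'] [Cm y x'] [Cm v y'] [Cm v x'] [Cm y' x']

theorem psi_mul_psiInv : Q.psi x y v y' x' * Q.psiInv x y v y' x' = 1 := by
  have h1 := Q.ph_mul_pb (Q.tp (Q.tp x y) v) y' x'
  have h2 := Q.pb_mul_ph x y v
  have h3 := Q.pb_mul_ph x (Q.tp y v) y'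
  rw [psi, psiInv]
  linear_combination (norm := noncomm_ring)
    Q.ph (Q.tp (Q.tp x y) v) y' x' * Q.pb x y v * h3 *
        (Q.ph x y v * Q.pb (Q.tp (Q.tp x y) v) y' x') +
      Q.ph (Q.tp (Q.tp x y) v) y' x' * h2 * Q.pb (Q.tp (Q.tp x y) v) y' x' + h1

/-- Coherence for the strands x, y, v, y', x'. The half-braiding composed from those of x and y,
prepared for evaluation, equals the step for y performed inside the step for x; only pentagons and
naturality in the two braidings are used. -/
theorem mate_product_coherence (rx ry : B) [Intw rx (Q.tp x v) (Q.tp v x)] [Intw rx y y]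
    [Intw rx y' y'] [Intw rx x' x'] [Intw ry (Q.tp y v) (Q.tp v y)] [Intw ry x x]
    [Intw ry y' y'] [Intw ry x' x'] :
    Q.aa x y y' x' * Q.ph v (Q.tp x y) (Q.tp y' x') * Q.hex x y v rx ry * Q.psi x y v y' x' =
      Q.ph v (Q.tp x (Q.tp y y')) x' * Q.ph v x (Q.tp y y') * rx * Q.pb x v (Q.tp y y') *
        Q.ph v y y' * ry := by
  simp only [aa, hex, psi]
  have h1 := Q.ph_nat (Q.ph x y v) (Q.tp (Q.tp x y) v) y' x' (Q.tp x (Q.tp y v)) y' x'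
  have h2 := Q.ph_mul_pb x y v
  have h3 := Q.ph_nat (ry) (Q.tp x (Q.tp y v)) y' x' (Q.tp x (Q.tp v y)) y' x'
  have h4 := Q.pb_nat (ry) x (Q.tp y v) y' x (Q.tp v y) y'
  have h5 := Q.ph_nat (Q.pb x v y) (Q.tp x (Q.tp v y)) y' x' (Q.tp (Q.tp x v) y) y' x'
  have h6 := Q.ph_nat (rx) (Q.tp (Q.tp x v) y) y' x' (Q.tp (Q.tp v x) y) y' x'
  have h7 := Q.ph_nat (Q.ph v x y) (Q.tp (Q.tp v x) y) y' x' (Q.tp v (Q.tp x y)) y' x'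
  have h8 := Q.pentagon v (Q.tp x y) y' x'
  have h9 := Q.pb_mul_ph (Q.tp x y) y' x'
  have h10 := Q.ph_nat (Q.ph x y y') v (Q.tp (Q.tp x y) y') x' v (Q.tp x (Q.tp y y')) x'
  have h11 := Q.pentagon v x y y'
  have h12 := Q.ph_nat (rx) (Q.tp x v) y y' (Q.tp v x) y y'
  have h13 := Q.pentagon₂ x v y y'
  have h14 := Q.ph_mul_pb x (Q.tp v y) y'
  linear_combination (norm := noncomm_ring)
    (Q.ph x y y' * Q.pb (Q.tp x y) y' x' * Q.ph v (Q.tp x y) (Q.tp y' x') * Q.ph v x y * rx *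
        Q.pb x v y * ry) * h1 * (Q.pb x y v * Q.pb x (Q.tp y v) y')
    + (Q.ph x y y' * Q.pb (Q.tp x y) y' x' * Q.ph v (Q.tp x y) (Q.tp y' x') * Q.ph v x y * rx *
        Q.pb x v y * ry * Q.ph (Q.tp x (Q.tp y v)) y' x') * h2 * (Q.pb x (Q.tp y v) y')
    + (Q.ph x y y' * Q.pb (Q.tp x y) y' x' * Q.ph v (Q.tp x y) (Q.tp y' x') * Q.ph v x y * rx *
        Q.pb x v y) * h3 * (Q.pb x (Q.tp y v) y')
    + (Q.ph x y y' * Q.pb (Q.tp x y) y' x' * Q.ph v (Q.tp x y) (Q.tp y' x') * Q.ph v x y * rx *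
        Q.pb x v y * Q.ph (Q.tp x (Q.tp v y)) y' x') * h4
    + (Q.ph x y y' * Q.pb (Q.tp x y) y' x' * Q.ph v (Q.tp x y) (Q.tp y' x') * Q.ph v x y * rx) *
        h5 * (Q.pb x (Q.tp v y) y' * ry)
    + (Q.ph x y y' * Q.pb (Q.tp x y) y' x' * Q.ph v (Q.tp x y) (Q.tp y' x') * Q.ph v x y) * h6 *
        (Q.pb x v y * Q.pb x (Q.tp v y) y' * ry)
    + (Q.ph x y y' * Q.pb (Q.tp x y) y' x' * Q.ph v (Q.tp x y) (Q.tp y' x')) * h7 * (rx *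
        Q.pb x v y * Q.pb x (Q.tp v y) y' * ry)
    - (Q.ph x y y' * Q.pb (Q.tp x y) y' x') * h8 * (Q.ph v x y * rx * Q.pb x v y *
        Q.pb x (Q.tp v y) y' * ry)
    + (Q.ph x y y') * h9 * (Q.ph v (Q.tp (Q.tp x y) y') x' * Q.ph v (Q.tp x y) y' * Q.ph v x y *
        rx * Q.pb x v y * Q.pb x (Q.tp v y) y' * ry)
    + h10 * (Q.ph v (Q.tp x y) y' * Q.ph v x y * rx * Q.pb x v y * Q.pb x (Q.tp v y) y' * ry)
    + (Q.ph v (Q.tp x (Q.tp y y')) x') * h11 * (rx * Q.pb x v y * Q.pb x (Q.tp v y) y' * ry)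
    - (Q.ph v (Q.tp x (Q.tp y y')) x' * Q.ph v x (Q.tp y y')) * h12 * (Q.pb x v y *
        Q.pb x (Q.tp v y) y' * ry)
    + (Q.ph v (Q.tp x (Q.tp y y')) x' * Q.ph v x (Q.tp y y') * rx) * h13 *
        (Q.pb x (Q.tp v y) y' * ry)
    + (Q.ph v (Q.tp x (Q.tp y y')) x' * Q.ph v x (Q.tp y y') * rx * Q.pb x v (Q.tp y y') *
        Q.ph v y y') * h14 * (ry)

/-- Contracting y with y' removes every associator on the right-hand side of the coherence identity
that would separate the two mates. -/
theorem mate_product {M : Type*} [AddCommGroup M] [Module k M] (K : B →ₗ[k] M)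
    (h : SameL K (Q.tp y y') Q.un) (rx ry : B) [Intw rx (Q.tp x v) (Q.tp v x)] [Intw rx y y]
    [Intw rx y' y'] [Intw rx x' x'] [Intw ry (Q.tp y v) (Q.tp v y)] [Intw ry x x]
    [Intw ry y' y'] [Intw ry x' x'] :
    K (Q.aa x y y' x' * Q.ph v (Q.tp x y) (Q.tp y' x') * Q.hex x y v rx ry * Q.psi x y v y' x') =
      K (Q.ph v x x' * rx * Q.ph v y y' * ry) := by
  rw [mate_product_coherence]
  have s : SameL K (Q.tp x (Q.tp y y')) x := by simpa using h.tp₂ Q x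
  have c1 := s.ph₂ Q 1 v x' (Q.ph v x (Q.tp y y') * rx * Q.pb x v (Q.tp y y') * Q.ph v y y' * ry)
  have c2 := h.ph₃ Q (Q.ph v x x') v x (rx * Q.pb x v (Q.tp y y') * Q.ph v y y' * ry)
  have c3 := h.pb₃ Q (Q.ph v x x' * rx) x v (Q.ph v y y' * ry)
  simp only [one_mul, mul_one, ph_un₃, pb_un₃, ← mul_assoc] at c1 c2 c3
  rw [c1, c2, c3]

end Five

theorem map_hex {C : Type*} [Ring C] [Algebra k C] (π : B →ₗ[k] C) [Leg π] (x y v : H →ₗ[k] B)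
    (rx ry : B) :
    π (Q.hex x y v rx ry) = Q.hex (π ∘ₗ x) (π ∘ₗ y) (π ∘ₗ v) (π rx) (π ry) := by
  simp only [hex, Leg.map_mul, map_ph, map_pb]

theorem act_rho_mul (e b : B) (P : Op k B) (h : rho b * P = P * rho b) :
    act (e * b) P = act e P * b := by
  have := congrArg (act e) h
  simpa [act_mul] using this

instance Intw.gm_comm {A : Type*} [Ring A] [Algebra k A] (x v : H →ₗ[k] B) (r : B) (y : A →ₗ[k] B)
    [Leg x] [Leg v] [Cm x v] [Cm x y] [Cm v y] [Intw r y y] : Intw (Q.gm x v r) y y := ⟨fun a => by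
  have c : Cm y x := Cm.symm
  have c' : Cm y v := Cm.symm
  rw [gm, ← act_mul_left _ _ _, ← act_rho_mul _ _ _, Cm.comm (x := x)]
  · rw [← mul_assoc, Q.ph_nat (rho (y a) : Op k B) (rho ∘ₗ v) (rho ∘ₗ x) (Q.cl x) (rho ∘ₗ v)
      (rho ∘ₗ x) (Q.cl x), mul_assoc, ← Leg.map_mul, ← Intw.intw (x := y) (u := r), Leg.map_mul,
      mul_assoc]
  · rw [← mul_assoc, Q.ph_nat (lam (y a) : Op k B) (rho ∘ₗ v) (rho ∘ₗ x) (Q.cl x) (rho ∘ₗ v)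
      (rho ∘ₗ x) (Q.cl x), mul_assoc, ← Cm.comm (x := (rho : B →ₗ[k] Op k B)), mul_assoc]⟩

/-- The mate of a composed intertwiner. -/
theorem gm_mul_gm (x y v : H →ₗ[k] B) [Leg x] [Leg y] [Leg v] [Cm x y] [Cm x v] [Cm y v]
    (rx ry : B) [Intw rx (Q.tp x v) (Q.tp v x)] [Intw rx y y] [Intw ry (Q.tp y v) (Q.tp v y)]
    [Intw ry x x] : Q.gm x v rx * Q.gm y v ry = act (Q.gm (Q.tp x y) v (Q.hex x y v rx ry))
      (Q.tw (Q.cl y) (Q.cl x) * Q.psi (rho ∘ₗ x) (rho ∘ₗ y) (rho ∘ₗ v) (Q.cl y) (Q.cl x)) := by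
  have ix : Intw (rho rx : Op k B) (Q.tp (rho ∘ₗ x) (rho ∘ₗ v)) (Q.tp (rho ∘ₗ v) (rho ∘ₗ x)) := by
    rw [← comp_tp, ← comp_tp]; infer_instance
  have iy : Intw (rho ry : Op k B) (Q.tp (rho ∘ₗ y) (rho ∘ₗ v)) (Q.tp (rho ∘ₗ v) (rho ∘ₗ y)) := by
    rw [← comp_tp, ← comp_tp]; infer_instance
  have key := Q.mate_product (rho ∘ₗ x) (rho ∘ₗ y) (rho ∘ₗ v) (Q.cl y) (Q.cl x)
    (act (x (Q.SInv Q.α) * y (Q.SInv Q.α)))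
    (by rw [Cm.comm (x := x)]; exact Q.sameL_T y _) (rho rx) (rho ry)
  have left : act (x (Q.SInv Q.α) * y (Q.SInv Q.α)) (Q.ph (rho ∘ₗ v) (rho ∘ₗ x) (Q.cl x) * rho rx *
      Q.ph (rho ∘ₗ v) (rho ∘ₗ y) (Q.cl y) * rho ry) = Q.gm x v rx * Q.gm y v ry := by
    rw [mul_assoc _ _ (rho ry), act_mul, act_rho_mul, ← gm, act_mul_left]
    · rfl
    · rw [← mul_assoc, Q.ph_nat (lam (Q.gm x v rx) : Op k B) (rho ∘ₗ v) (rho ∘ₗ y) (Q.cl y)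
        (rho ∘ₗ v) (rho ∘ₗ y) (Q.cl y), mul_assoc, ← Cm.comm (x := (rho : B →ₗ[k] Op k B)),
        mul_assoc]
    · rw [← mul_assoc, Q.ph_nat (rho (y (Q.SInv Q.α)) : Op k B) (rho ∘ₗ v) (rho ∘ₗ x) (Q.cl x)
        (rho ∘ₗ v) (rho ∘ₗ x) (Q.cl x), mul_assoc, ← Leg.map_mul, ← Intw.intw (x := y) (u := rx),
        Leg.map_mul, mul_assoc]
  have right : act (Q.gm (Q.tp x y) v (Q.hex x y v rx ry)) (Q.tw (Q.cl y) (Q.cl x) *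
      Q.psi (rho ∘ₗ x) (rho ∘ₗ y) (rho ∘ₗ v) (Q.cl y) (Q.cl x)) =
      act (x (Q.SInv Q.α) * y (Q.SInv Q.α)) (Q.aa (rho ∘ₗ x) (rho ∘ₗ y) (Q.cl y) (Q.cl x) *
        Q.ph (rho ∘ₗ v) (Q.tp (rho ∘ₗ x) (rho ∘ₗ y)) (Q.tp (Q.cl y) (Q.cl x)) *
        Q.hex (rho ∘ₗ x) (rho ∘ₗ y) (rho ∘ₗ v) (rho rx) (rho ry) *
        Q.psi (rho ∘ₗ x) (rho ∘ₗ y) (rho ∘ₗ v) (Q.cl y) (Q.cl x)) := by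
    have n1 := Q.tw_nat (rho (Q.hex x y v rx ry) : Op k B) (Q.cl y) (Q.cl x) (Q.cl y) (Q.cl x)
    have n2 := Q.ph_nat (Q.tw (Q.cl y) (Q.cl x)) (rho ∘ₗ v) (rho ∘ₗ Q.tp x y)
      (Q.tp (Q.cl y) (Q.cl x)) (rho ∘ₗ v) (rho ∘ₗ Q.tp x y) (Q.cl (Q.tp x y))
    -- The comparison of y' ⊗ x' with the dual of x ⊗ y commutes with the braiding and moves through
    -- the associator to the front, where `act_tw_cl` turns it into the nested evaluation.
    have e : Q.ph (rho ∘ₗ v) (rho ∘ₗ Q.tp x y) (Q.cl (Q.tp x y)) * rho (Q.hex x y v rx ry) *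
        (Q.tw (Q.cl y) (Q.cl x) * Q.psi (rho ∘ₗ x) (rho ∘ₗ y) (rho ∘ₗ v) (Q.cl y) (Q.cl x)) =
        Q.tw (Q.cl y) (Q.cl x) * (Q.ph (rho ∘ₗ v) (rho ∘ₗ Q.tp x y) (Q.tp (Q.cl y) (Q.cl x)) *
          rho (Q.hex x y v rx ry) *
          Q.psi (rho ∘ₗ x) (rho ∘ₗ y) (rho ∘ₗ v) (Q.cl y) (Q.cl x)) := by
      linear_combination (norm := noncomm_ring) Q.ph (rho ∘ₗ v) (rho ∘ₗ Q.tp x y)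
        (Q.cl (Q.tp x y)) * n1 * Q.psi (rho ∘ₗ x) (rho ∘ₗ y) (rho ∘ₗ v) (Q.cl y) (Q.cl x) -
        n2 * (rho (Q.hex x y v rx ry) *
          Q.psi (rho ∘ₗ x) (rho ∘ₗ y) (rho ∘ₗ v) (Q.cl y) (Q.cl x))
    rw [gm, ← act_mul, e, act_mul, act_tw_cl, ← act_mul, map_hex, comp_tp]
    simp only [mul_assoc]
  rw [right, key, left]

end MateProduct

/-! ### Transport of operators along linear maps -/

section Transport

variable {k H A B C : Type*} [Field k] [Ring H] [Algebra k H] [Ring A] [Algebra k A]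
  [Ring B] [Algebra k B] [Ring C] [Algebra k C] (Q : QuasiHopfData k H)

/-- The linear map `π` carries the operator `P` to the operator `P'`. -/
class Tr (π : B →ₗ[k] C) (P : Op k B) (P' : Op k C) : Prop where
  tr : ∀ e, π (act e P) = act (π e) P'

/-- The linear map `π` carries the operators `x a` to the operators `x' a`. -/
class TrL {M : Type*} [AddCommMonoid M] [Module k M] (π : B →ₗ[k] C) (x : M →ₗ[k] Op k B)
    (x' : M →ₗ[k] Op k C) : Prop where
  tr : ∀ a, Tr π (x a) (x' a)

instance Tr.mul (π : B →ₗ[k] C) (P R : Op k B) (P' R' : Op k C) [h : Tr π P P'] [h' : Tr π R R'] :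
    Tr π (P * R) (P' * R') := ⟨fun e => by rw [act_mul, h'.tr, h.tr, act_mul]⟩

instance Tr.app {M : Type*} [AddCommMonoid M] [Module k M] (π : B →ₗ[k] C) (x : M →ₗ[k] Op k B)
    (x' : M →ₗ[k] Op k C) [h : TrL π x x'] (a : M) : Tr π (x a) (x' a) := h.tr a

instance TrL.comp {M M' : Type*} [AddCommMonoid M] [Module k M] [AddCommMonoid M'] [Module k M']
    (π : B →ₗ[k] C) (x : M →ₗ[k] Op k B) (x' : M →ₗ[k] Op k C) [h : TrL π x x'] (w : M' →ₗ[k] M) :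
    TrL π (x ∘ₗ w) (x' ∘ₗ w) := ⟨fun a => h.tr (w a)⟩

instance TrL.mulMap₂ {M N : Type*} [AddCommMonoid M] [Module k M] [AddCommMonoid N] [Module k N]
    (π : B →ₗ[k] C) (x : M →ₗ[k] Op k B) (x' : M →ₗ[k] Op k C) (y : N →ₗ[k] Op k B)
    (y' : N →ₗ[k] Op k C) [h : TrL π x x'] [h' : TrL π y y'] :
    TrL π (_root_.mulMap₂ x y) (_root_.mulMap₂ x' y') := ⟨fun w => ⟨fun e => by
  induction w using TensorProduct.induction_on with
  | zero => simp
  | add s t hs ht => simp [hs, ht]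
  | tmul a b => exact Tr.tr (P := x a * y b) (P' := x' a * y' b) e⟩⟩

variable (π : B →ₗ[k] C) (x y z v w : H →ₗ[k] Op k B) (x' y' z' v' w' : H →ₗ[k] Op k C)
  [TrL π x x'] [TrL π y y'] [TrL π z z'] [TrL π v v'] [TrL π w w']

instance TrL.tp : TrL π (Q.tp x y) (Q.tp x' y') := by unfold QuasiHopfData.tp; infer_instance

instance Tr.ph : Tr π (Q.ph x y z) (Q.ph x' y' z') := by unfold QuasiHopfData.ph; infer_instance

instance Tr.pb : Tr π (Q.pb x y z) (Q.pb x' y' z') := by unfold QuasiHopfData.pb; infer_instance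

instance Tr.tw : Tr π (Q.tw x y) (Q.tw x' y') := by unfold QuasiHopfData.tw; infer_instance

instance Tr.psi : Tr π (Q.psi x y z v w) (Q.psi x' y' z' v' w') := by
  unfold QuasiHopfData.psi; infer_instance

end Transport

section Transport

variable {k H A B C : Type*} [Field k] [Ring H] [Algebra k H] [Ring A] [Algebra k A]
  [Ring B] [Algebra k B] [Ring C] [Algebra k C] (Q : QuasiHopfData k H)

instance TrL.leg_rho (π : B →ₗ[k] C) [Leg π] (x : A →ₗ[k] B) :
    TrL π (rho ∘ₗ x) (rho ∘ₗ π ∘ₗ x) := ⟨fun a => ⟨fun e => by simp [Leg.map_mul]⟩⟩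

instance TrL.leg_lam (π : B →ₗ[k] C) [Leg π] (x : A →ₗ[k] B) :
    TrL π (lam ∘ₗ x) (lam ∘ₗ π ∘ₗ x) := ⟨fun a => ⟨fun e => by simp [Leg.map_mul]⟩⟩

instance TrL.mk_rho (c : C) (x : A →ₗ[k] B) : TrL (TensorProduct.mk k C B c) (QuasiHopfData.rho ∘ₗ x)
    (QuasiHopfData.rho ∘ₗ inr k ∘ₗ x) := ⟨fun a => ⟨fun e => by simp [inr]⟩⟩

instance TrL.mk_lam (c : C) (x : A →ₗ[k] B) : TrL (TensorProduct.mk k C B c) (QuasiHopfData.lam ∘ₗ x)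
    (QuasiHopfData.lam ∘ₗ inr k ∘ₗ x) := ⟨fun a => ⟨fun e => by simp [inr]⟩⟩

end Transport

/-! ### The multiplication of the double -/

section DoubleMul

variable {k H B : Type*} [Field k] [Ring H] [Algebra k H] [Ring B] [Algebra k B]
  (Q : QuasiHopfData k H)

section Seven

variable [hQ : Q.Regular] (a₁ a₂ a₃ v b₃ b₂ b₁ : H →ₗ[k] B) [Leg a₁] [Leg a₂] [Leg a₃] [Leg v] [Leg b₃]
  [Leg b₂] [Leg b₁] [Cm a₁ a₂] [Cm a₁ a₃] [Cm a₁ v] [Cm a₁ b₃] [Cm a₁ b₂] [Cm a₁ b₁] [Cm a₂ a₃]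
  [Cm a₂ v] [Cm a₂ b₃] [Cm a₂ b₂] [Cm a₂ b₁] [Cm a₃ v] [Cm a₃ b₃] [Cm a₃ b₂] [Cm a₃ b₁] [Cm v b₃]
  [Cm v b₂] [Cm v b₁] [Cm b₃ b₂] [Cm b₃ b₁] [Cm b₂ b₁]

/-- Both sides lead from the nested bracketing around v to a product of the a's, v and a product of
the b's. One groups a₁ with a₂ first and the other a₂ with a₃, whence the two associators on the
left. This is the pentagon content of associativity. -/
theorem psi_coherence : Q.ph a₁ a₂ a₃ * Q.pb b₃ b₂ b₁ * Q.psi (Q.tp a₁ a₂) a₃ v b₃ (Q.tp b₂ b₁) *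
      Q.psi a₁ a₂ (Q.tp (Q.tp a₃ v) b₃) b₂ b₁ =
    Q.psi a₁ (Q.tp a₂ a₃) v (Q.tp b₃ b₂) b₁ * Q.psi a₂ a₃ v b₃ b₂ := by
  simp only [psi]
  have h1 := Q.pentagon₁ (Q.tp (Q.tp (Q.tp a₁ a₂) a₃) v) b₃ b₂ b₁
  have h2 := Q.ph_nat (Q.pb (Q.tp a₁ a₂) (Q.tp a₃ v) b₃) (Q.tp (Q.tp a₁ a₂) (Q.tp (Q.tp a₃ v) b₃)) b₂ b₁ (Q.tp (Q.tp (Q.tp a₁ a₂) (Q.tp a₃ v)) b₃) b₂ b₁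
  have h3 := Q.ph_nat (Q.pb (Q.tp a₁ a₂) a₃ v) (Q.tp (Q.tp (Q.tp a₁ a₂) (Q.tp a₃ v)) b₃) b₂ b₁ (Q.tp (Q.tp (Q.tp (Q.tp a₁ a₂) a₃) v) b₃) b₂ b₁
  have h4 := Q.pb_mul_ph (Q.tp (Q.tp (Q.tp (Q.tp a₁ a₂) a₃) v) b₃) b₂ b₁
  have h5 := Q.ph_nat (Q.ph a₁ a₂ a₃) (Q.tp (Q.tp (Q.tp a₁ a₂) a₃) v) (Q.tp b₃ b₂) b₁ (Q.tp (Q.tp a₁ (Q.tp a₂ a₃)) v) (Q.tp b₃ b₂) b₁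
  have h6 := Q.ph_nat (Q.ph a₁ a₂ a₃) (Q.tp (Q.tp (Q.tp a₁ a₂) a₃) v) b₃ b₂ (Q.tp (Q.tp a₁ (Q.tp a₂ a₃)) v) b₃ b₂
  have h7 := Q.pentagon_inv a₁ a₂ (Q.tp a₃ v) b₃
  have h8 := Q.pentagon_inv a₁ a₂ a₃ v
  have h9 := Q.ph_mul_pb a₁ a₂ a₃
  have h10 := Q.pb_nat (Q.pb a₂ a₃ v) a₁ (Q.tp a₂ (Q.tp a₃ v)) b₃ a₁ (Q.tp (Q.tp a₂ a₃) v) b₃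
  have h11 := Q.pb_nat (Q.pb a₂ (Q.tp a₃ v) b₃) a₁ (Q.tp a₂ (Q.tp (Q.tp a₃ v) b₃)) b₂ a₁ (Q.tp (Q.tp a₂ (Q.tp a₃ v)) b₃) b₂
  have h12 := Q.pb_nat (Q.pb a₂ a₃ v) a₁ (Q.tp (Q.tp a₂ (Q.tp a₃ v)) b₃) b₂ a₁ (Q.tp (Q.tp (Q.tp a₂ a₃) v) b₃) b₂
  have h13 := Q.ph_nat (Q.pb a₁ (Q.tp a₂ a₃) v) (Q.tp a₁ (Q.tp (Q.tp a₂ a₃) v)) b₃ b₂ (Q.tp (Q.tp a₁ (Q.tp a₂ a₃)) v) b₃ b₂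
  have h14 := Q.pentagon₄ a₁ (Q.tp (Q.tp a₂ a₃) v) b₃ b₂
  linear_combination (norm := noncomm_ring)
    - (Q.ph a₁ a₂ a₃) * h1 * (Q.pb (Q.tp a₁ a₂) a₃ v * Q.pb (Q.tp a₁ a₂) (Q.tp a₃ v) b₃ *
        Q.ph (Q.tp (Q.tp a₁ a₂) (Q.tp (Q.tp a₃ v) b₃)) b₂ b₁ * Q.pb a₁ a₂ (Q.tp (Q.tp a₃ v) b₃) *
        Q.pb a₁ (Q.tp a₂ (Q.tp (Q.tp a₃ v) b₃)) b₂)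
    + (Q.ph a₁ a₂ a₃ * Q.ph (Q.tp (Q.tp (Q.tp a₁ a₂) a₃) v) (Q.tp b₃ b₂) b₁ *
        Q.ph (Q.tp (Q.tp (Q.tp a₁ a₂) a₃) v) b₃ b₂ *
        Q.pb (Q.tp (Q.tp (Q.tp (Q.tp a₁ a₂) a₃) v) b₃) b₂ b₁ * Q.pb (Q.tp a₁ a₂) a₃ v) * h2 *
        (Q.pb a₁ a₂ (Q.tp (Q.tp a₃ v) b₃) * Q.pb a₁ (Q.tp a₂ (Q.tp (Q.tp a₃ v) b₃)) b₂)
    + (Q.ph a₁ a₂ a₃ * Q.ph (Q.tp (Q.tp (Q.tp a₁ a₂) a₃) v) (Q.tp b₃ b₂) b₁ *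
        Q.ph (Q.tp (Q.tp (Q.tp a₁ a₂) a₃) v) b₃ b₂ *
        Q.pb (Q.tp (Q.tp (Q.tp (Q.tp a₁ a₂) a₃) v) b₃) b₂ b₁) * h3 *
        (Q.pb (Q.tp a₁ a₂) (Q.tp a₃ v) b₃ * Q.pb a₁ a₂ (Q.tp (Q.tp a₃ v) b₃) *
        Q.pb a₁ (Q.tp a₂ (Q.tp (Q.tp a₃ v) b₃)) b₂)
    + (Q.ph a₁ a₂ a₃ * Q.ph (Q.tp (Q.tp (Q.tp a₁ a₂) a₃) v) (Q.tp b₃ b₂) b₁ *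
        Q.ph (Q.tp (Q.tp (Q.tp a₁ a₂) a₃) v) b₃ b₂) * h4 * (Q.pb (Q.tp a₁ a₂) a₃ v *
        Q.pb (Q.tp a₁ a₂) (Q.tp a₃ v) b₃ * Q.pb a₁ a₂ (Q.tp (Q.tp a₃ v) b₃) *
        Q.pb a₁ (Q.tp a₂ (Q.tp (Q.tp a₃ v) b₃)) b₂)
    + h5 * (Q.ph (Q.tp (Q.tp (Q.tp a₁ a₂) a₃) v) b₃ b₂ * Q.pb (Q.tp a₁ a₂) a₃ v *
        Q.pb (Q.tp a₁ a₂) (Q.tp a₃ v) b₃ * Q.pb a₁ a₂ (Q.tp (Q.tp a₃ v) b₃) *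
        Q.pb a₁ (Q.tp a₂ (Q.tp (Q.tp a₃ v) b₃)) b₂)
    + (Q.ph (Q.tp (Q.tp a₁ (Q.tp a₂ a₃)) v) (Q.tp b₃ b₂) b₁) * h6 * (Q.pb (Q.tp a₁ a₂) a₃ v *
        Q.pb (Q.tp a₁ a₂) (Q.tp a₃ v) b₃ * Q.pb a₁ a₂ (Q.tp (Q.tp a₃ v) b₃) *
        Q.pb a₁ (Q.tp a₂ (Q.tp (Q.tp a₃ v) b₃)) b₂)
    - (Q.ph (Q.tp (Q.tp a₁ (Q.tp a₂ a₃)) v) (Q.tp b₃ b₂) b₁ *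
        Q.ph (Q.tp (Q.tp a₁ (Q.tp a₂ a₃)) v) b₃ b₂ * Q.ph a₁ a₂ a₃ * Q.pb (Q.tp a₁ a₂) a₃ v) *
        h7 * (Q.pb a₁ (Q.tp a₂ (Q.tp (Q.tp a₃ v) b₃)) b₂)
    - (Q.ph (Q.tp (Q.tp a₁ (Q.tp a₂ a₃)) v) (Q.tp b₃ b₂) b₁ *
        Q.ph (Q.tp (Q.tp a₁ (Q.tp a₂ a₃)) v) b₃ b₂ * Q.ph a₁ a₂ a₃) * h8 *
        (Q.pb a₁ (Q.tp a₂ (Q.tp a₃ v)) b₃ * Q.pb a₂ (Q.tp a₃ v) b₃ *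
        Q.pb a₁ (Q.tp a₂ (Q.tp (Q.tp a₃ v) b₃)) b₂)
    + (Q.ph (Q.tp (Q.tp a₁ (Q.tp a₂ a₃)) v) (Q.tp b₃ b₂) b₁ *
        Q.ph (Q.tp (Q.tp a₁ (Q.tp a₂ a₃)) v) b₃ b₂) * h9 * (Q.pb a₁ (Q.tp a₂ a₃) v *
        Q.pb a₂ a₃ v * Q.pb a₁ (Q.tp a₂ (Q.tp a₃ v)) b₃ * Q.pb a₂ (Q.tp a₃ v) b₃ *
        Q.pb a₁ (Q.tp a₂ (Q.tp (Q.tp a₃ v) b₃)) b₂)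
    + (Q.ph (Q.tp (Q.tp a₁ (Q.tp a₂ a₃)) v) (Q.tp b₃ b₂) b₁ *
        Q.ph (Q.tp (Q.tp a₁ (Q.tp a₂ a₃)) v) b₃ b₂ * Q.pb a₁ (Q.tp a₂ a₃) v) * h10 *
        (Q.pb a₂ (Q.tp a₃ v) b₃ * Q.pb a₁ (Q.tp a₂ (Q.tp (Q.tp a₃ v) b₃)) b₂)
    + (Q.ph (Q.tp (Q.tp a₁ (Q.tp a₂ a₃)) v) (Q.tp b₃ b₂) b₁ *
        Q.ph (Q.tp (Q.tp a₁ (Q.tp a₂ a₃)) v) b₃ b₂ * Q.pb a₁ (Q.tp a₂ a₃) v *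
        Q.pb a₁ (Q.tp (Q.tp a₂ a₃) v) b₃ * Q.pb a₂ a₃ v) * h11
    + (Q.ph (Q.tp (Q.tp a₁ (Q.tp a₂ a₃)) v) (Q.tp b₃ b₂) b₁ *
        Q.ph (Q.tp (Q.tp a₁ (Q.tp a₂ a₃)) v) b₃ b₂ * Q.pb a₁ (Q.tp a₂ a₃) v *
        Q.pb a₁ (Q.tp (Q.tp a₂ a₃) v) b₃) * h12 * (Q.pb a₂ (Q.tp a₃ v) b₃)
    - (Q.ph (Q.tp (Q.tp a₁ (Q.tp a₂ a₃)) v) (Q.tp b₃ b₂) b₁) * h13 *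
        (Q.pb a₁ (Q.tp (Q.tp a₂ a₃) v) b₃ * Q.pb a₁ (Q.tp (Q.tp (Q.tp a₂ a₃) v) b₃) b₂ *
        Q.pb a₂ a₃ v * Q.pb a₂ (Q.tp a₃ v) b₃)
    - (Q.ph (Q.tp (Q.tp a₁ (Q.tp a₂ a₃)) v) (Q.tp b₃ b₂) b₁ * Q.pb a₁ (Q.tp a₂ a₃) v) * h14 *
        (Q.pb a₂ a₃ v * Q.pb a₂ (Q.tp a₃ v) b₃)

instance Intw.psi : Intw (Q.psi a₁ a₂ v b₂ b₁) (Q.tp (Q.tp a₁ (Q.tp (Q.tp a₂ v) b₂)) b₁)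
    (Q.tp (Q.tp (Q.tp a₁ a₂) v) (Q.tp b₂ b₁)) :=
  Intw.mul (Intw.mul (Intw.ph Q (Q.tp (Q.tp a₁ a₂) v) b₂ b₁)
    (x := Q.tp (Q.tp (Q.tp a₁ (Q.tp a₂ v)) b₂) b₁) inferInstance) inferInstance

end Seven

/-- `φ ⊗ m ↦ φ(h) m` on `h ⊗ m` -/
def con {M : Type*} [AddCommGroup M] [Module k M] (φ : Module.Dual k H) : H ⊗[k] M →ₗ[k] M :=
  (TensorProduct.lid k M).toLinearMap ∘ₗ φ.rTensor M

@[simp]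
theorem con_tmul {M : Type*} [AddCommGroup M] [Module k M] (φ : Module.Dual k H) (h : H) (m : M) :
    con φ (h ⊗ₜ[k] m) = φ h • m := by simp [con]

/-- An element `φ ⋈ h` of the double as the map `u ↦ φ(u) h`. -/
def hat : Q.QuantumDouble →ₗ[k] H →ₗ[k] H := dualTensorHom k H H

@[simp]
theorem hat_bow (φ : Module.Dual k H) (h u : H) : Q.hat (Q.bow φ h) u = φ u • h := rfl

theorem double_induction {p : Q.QuantumDouble → Prop} (X : Q.QuantumDouble)
    (hb : ∀ φ h, p (Q.bow φ h)) (ha : ∀ X Y, p X → p Y → p (X + Y)) : p X := by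
  refine TensorProduct.induction_on (motive := p) X ?_ (fun φ h => hb φ h) (fun X Y => ha X Y)
  have := hb 0 0
  rwa [map_zero] at this

theorem hat_injective [FiniteDimensional k H] : Function.Injective Q.hat :=
  (dualTensorHomEquiv k H H).injective

/-- `y ⊗ z ↦ z g(y)` -/
def mix (g : H →ₗ[k] H) : H ⊗[k] H →ₗ[k] H :=
  LinearMap.mul' k H ∘ₗ TensorProduct.map LinearMap.id g ∘ₗ (TensorProduct.comm k H H).toLinearMap

@[simp]
theorem mix_tmul (g : H →ₗ[k] H) (y z : H) : mix g (y ⊗ₜ[k] z) = z * g y := rfl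

/-- The operator by which the product of `φ ⋈ h` with another element is formed. -/
def prodOp (a₁ a₂ v b₂ b₁ : H →ₗ[k] B) (h : H) : B :=
  Q.tw b₂ b₁ * Q.psi a₁ a₂ v b₂ b₁ * Q.tp (Q.tp a₂ v) b₂ h

theorem act_add_left (e e' : B) (P : Op k B) : act (e + e') P = act e P + act e' P :=
  map_add (MulOpposite.unop P) e e'

theorem act_zero_left (P : Op k B) : act 0 P = 0 := map_zero (MulOpposite.unop P)

/-- Written in legs, the product defining Ω is f times `psi`. The structure constants of the double
are thus the operator that multiplies mates in `gm_mul_gm`. -/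
theorem act_OmegaAt [hQ : Q.Regular] (h : H) :
    mulMap₂ (rho ∘ₗ l31 k H) (mulMap₂ (rho ∘ₗ l32 k H) (mulMap₂ (rho ∘ₗ l33 k H)
      (mulMap₂ (lam ∘ₗ l32 k H) (lam ∘ₗ l31 k H)))) (Q.OmegaAt h) =
    Q.prodOp (rho ∘ₗ l31 k H) (rho ∘ₗ l32 k H) (rho ∘ₗ l33 k H) (Q.cl (l32 k H)) (Q.cl (l31 k H))
      h := by
  set a₁ : H →ₗ[k] Op k (T3 k H) := rho ∘ₗ l31 k H
  set a₂ : H →ₗ[k] Op k (T3 k H) := rho ∘ₗ l32 k H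
  set v : H →ₗ[k] Op k (T3 k H) := rho ∘ₗ l33 k H
  set b₂ := Q.cl (l32 k H)
  set b₁ := Q.cl (l31 k H)
  set K : T5 k H →ₗ[k] Op k (T3 k H) := mulMap₂ a₁ (mulMap₂ a₂ (mulMap₂ v (mulMap₂ b₂ b₁))) with hK
  have e1 : K ∘ₗ l51 k H = a₁ := by ext1 a; simp [K, l51, inl, Leg.map_one]
  have e2 : K ∘ₗ l52 k H = a₂ := by ext1 a; simp [K, l52, l41, inl, inr, Leg.map_one]
  have e3 : K ∘ₗ l53 k H = v := by ext1 a; simp [K, l53, l42, l31, inl, inr, Leg.map_one]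
  have e4 : K ∘ₗ l54 k H = b₂ := by ext1 a; simp [K, l54, l43, l32, inl, inr, Leg.map_one]
  have e5 : K ∘ₗ l55 k H = b₁ := by ext1 a; simp [K, l55, l44, l33, inl, inr, Leg.map_one]
  have hΩ : K (Q.OmegaF * Q.OmegaX * Q.OmegaY * Q.OmegaZ) = Q.tw b₂ b₁ * Q.psi a₁ a₂ v b₂ b₁ := by
    have : Q.OmegaF * Q.OmegaX * Q.OmegaY * Q.OmegaZ = Q.tw (l54 k H) (l55 k H) *
        Q.psi (l51 k H) (l52 k H) (l53 k H) (l54 k H) (l55 k H) := by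
      simp only [psi, ← mul_assoc]; rfl
    rw [this, psi, Leg.map_mul, Leg.map_mul, Leg.map_mul, map_tw, map_ph, map_pb, map_pb, comp_tp,
      comp_tp, comp_tp, e1, e2, e3, e4, e5, psi]
  rw [prodOp, ← hΩ, OmegaAt, Omega]
  generalize Q.OmegaF * Q.OmegaX * Q.OmegaY * Q.OmegaZ = w
  simp only [comulCop, LinearMap.comp_apply, tp, LinearEquiv.coe_coe]
  generalize Q.comul h = U
  induction U using TensorProduct.induction_on with
  | zero => simp
  | add a b ha hb => simp only [mul_add, map_add, ha, hb]
  | tmul p q =>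
  simp only [TensorProduct.comm_tmul, mulMap₂_tmul, LinearMap.comp_apply]
  generalize Q.comul p = U
  induction U using TensorProduct.induction_on with
  | zero => simp
  | add a b ha hb => simp only [mul_add, add_mul, map_add, ha, hb]
  | tmul p₁ p₂ =>
  simp only [hK]
  induction w using TensorProduct.induction_on with
  | zero => simp
  | add a b ha hb => simp only [add_mul, map_add, ha, hb, LinearMap.mulRight_apply] at ha hb ⊢
                     simp only [mul_add, add_mul, map_add, ha, hb]
  | tmul a w =>
  induction w using TensorProduct.induction_on with
  | zero => simp
  | add a b ha hb => simp only [LinearMap.mulRight_apply] at ha hb ⊢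
                     simp only [TensorProduct.tmul_add, mul_add, add_mul, map_add, ha, hb]
  | tmul b w =>
  induction w using TensorProduct.induction_on with
  | zero => simp
  | add a b ha hb => simp only [LinearMap.mulRight_apply] at ha hb ⊢
                     simp only [TensorProduct.tmul_add, mul_add, add_mul, map_add, ha, hb]
  | tmul c w =>
  induction w using TensorProduct.induction_on with
  | zero => simp
  | add a b ha hb => simp only [LinearMap.mulRight_apply] at ha hb ⊢
                     simp only [TensorProduct.tmul_add, mul_add, add_mul, map_add, ha, hb]
  | tmul d d' =>
  refine op_ext fun e => ?_
  induction e using TensorProduct.induction_on with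
  | zero => simp only [act_zero_left]
  | add a b ha hb => simp only [act_add_left, ha, hb]
  | tmul e₁ e =>
  induction e using TensorProduct.induction_on with
  | zero => simp only [act_zero_left, TensorProduct.tmul_zero]
  | add a b ha hb => simp only [act_add_left, TensorProduct.tmul_add, ha, hb]
  | tmul e₂ e₃ =>
  simp [a₁, a₂, v, b₁, b₂, act_mul, l31, l32, l33, l54, l52, l53, l41, l42, l43, inl, inr, mul_assoc]

theorem hat_act5 (t : T5 k H) (φ : Module.Dual k H) (Y : Q.QuantumDouble) (u : H) :
    Q.hat (Q.convBow (Q.act5 t (φ ⊗ₜ Y))) u = mix (Q.hat Y) (con φ (act (Q.tp (l31 k H) (l32 k H) u)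
      (mulMap₂ (rho ∘ₗ l31 k H) (mulMap₂ (rho ∘ₗ l32 k H) (mulMap₂ (rho ∘ₗ l33 k H)
      (mulMap₂ (lam ∘ₗ l32 k H) (lam ∘ₗ l31 k H)))) t))) := by
  induction t using TensorProduct.induction_on with
  | zero => simp
  | add a b ha hb => simp only [map_add, LinearMap.add_apply, ha, hb]
  | tmul a t =>
  induction t using TensorProduct.induction_on with
  | zero => simp
  | add a b ha hb => simp only [TensorProduct.tmul_add, map_add, LinearMap.add_apply, ha, hb]
  | tmul b t =>
  induction t using TensorProduct.induction_on with
  | zero => simp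
  | add a b ha hb => simp only [TensorProduct.tmul_add, map_add, LinearMap.add_apply, ha, hb]
  | tmul c t =>
  induction t using TensorProduct.induction_on with
  | zero => simp
  | add a b ha hb => simp only [TensorProduct.tmul_add, map_add, LinearMap.add_apply, ha, hb]
  | tmul d d' =>
  induction Y using double_induction with
  | ha X Y hX hY =>
    have : ∀ w, mix (Q.hat X + Q.hat Y) w = mix (Q.hat X) w + mix (Q.hat Y) w := fun w =>
      LinearMap.congr_fun (f := mix (Q.hat X + Q.hat Y)) (g := mix (Q.hat X) + mix (Q.hat Y))
        (TensorProduct.ext' fun a b => by simp [mul_add]) w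
    simp only [TensorProduct.tmul_add, map_add, LinearMap.add_apply, hX, hY, this]
  | hb ψ h =>
  rw [act5_apply, convBow_apply, hat_bow, tp, LinearMap.comp_apply]
  change TensorProduct.dualDistrib k H H _ (Q.comul u) • _ = _
  generalize Q.comul u = U
  induction U using TensorProduct.induction_on with
  | zero => simp [act_zero_left]
  | add a b ha hb => simp only [map_add, add_smul, ha, hb, act_add_left]
  | tmul p q =>
  simp [act_mul, l31, l32, l33, inl, inr, hitL_apply, hitR_apply, mul_assoc, smul_smul]

/-- The multiplication seen from the other side: Δ(u) is put in the first two legs, `prodOp` acts,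
and the first leg is paired with φ while the second is handed to Y. -/
theorem hat_bow_mul [hQ : Q.Regular] (φ : Module.Dual k H) (h : H) (Y : Q.QuantumDouble) (u : H) :
    Q.hat (Q.bow φ h * Y) u = mix (Q.hat Y) (con φ (act (Q.tp (l31 k H) (l32 k H) u)
      (Q.prodOp (rho ∘ₗ l31 k H) (rho ∘ₗ l32 k H) (rho ∘ₗ l33 k H) (Q.cl (l32 k H))
        (Q.cl (l31 k H)) h))) := by
  rw [mul_def, mulD_apply, hat_act5, act_OmegaAt]

end DoubleMul

/-! ### Associativity of the double. -/

section DoubleAssoc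

variable {k H : Type*} [Field k] [Ring H] [Algebra k H] (Q : QuasiHopfData k H)

/-- The operators on `H ⊗ H` by which an element of `H` acts past a mate. -/
def pastOp : H →ₗ[k] Op k (H ⊗[k] H) :=
  Q.tp (Q.tp (rho ∘ₗ inl k) (rho ∘ₗ inr k)) (Q.cl (inl k))

instance Intw.prodOp_comm {A B : Type*} [Ring A] [Algebra k A] [Ring B] [Algebra k B]
    (x y z v w : H →ₗ[k] B) (h : H) (t : A →ₗ[k] B) [Cm x t] [Cm y t] [Cm z t] [Cm v t] [Cm w t] :
    Intw (Q.prodOp x y z v w h) t t := by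
  unfold QuasiHopfData.prodOp QuasiHopfData.psi; infer_instance

/-- `pastOp` on the last two legs of `H ⊗ H ⊗ H` -/
def pastOp₃ : H →ₗ[k] Op k (T3 k H) :=
  Q.tp (Q.tp (rho ∘ₗ l32 k H) (rho ∘ₗ l33 k H)) (Q.cl (l32 k H))

/-- `pastOp` on the last two legs of `H ⊗ H ⊗ H ⊗ H` -/
def pastOp₄ : H →ₗ[k] Op k (T4 k H) :=
  Q.tp (Q.tp (rho ∘ₗ l43 k H) (rho ∘ₗ l44 k H)) (Q.cl (l43 k H))

instance TrL.pastOp₃ (p : H) : TrL (TensorProduct.mk k H (H ⊗[k] H) p) Q.pastOp Q.pastOp₃ := by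
  have h1 : TrL (TensorProduct.mk k H (H ⊗[k] H) p) (rho ∘ₗ (inl k : H →ₗ[k] H ⊗[k] H))
    (rho ∘ₗ l32 k H) := TrL.mk_rho (k := k) p (inl k : H →ₗ[k] H ⊗[k] H)
  have h2 : TrL (TensorProduct.mk k H (H ⊗[k] H) p) (rho ∘ₗ (inr k : H →ₗ[k] H ⊗[k] H))
    (rho ∘ₗ l33 k H) := TrL.mk_rho (k := k) p (inr k : H →ₗ[k] H ⊗[k] H)
  have h3 : TrL (TensorProduct.mk k H (H ⊗[k] H) p) (Q.cl (inl k : H →ₗ[k] H ⊗[k] H))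
    (Q.cl (l32 k H)) := TrL.mk_lam (k := k) p ((inl k : H →ₗ[k] H ⊗[k] H) ∘ₗ Q.SInv)
  unfold QuasiHopfData.pastOp QuasiHopfData.pastOp₃
  infer_instance

instance TrL.pastOp₄ (p : H) : TrL (TensorProduct.mk k H (T3 k H) p) Q.pastOp₃ Q.pastOp₄ := by
  have h1 : TrL (TensorProduct.mk k H (T3 k H) p) (rho ∘ₗ l32 k H)
    (rho ∘ₗ l43 k H) := TrL.mk_rho p (l32 k H)
  have h2 : TrL (TensorProduct.mk k H (T3 k H) p) (rho ∘ₗ l33 k H)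
    (rho ∘ₗ l44 k H) := TrL.mk_rho p (l33 k H)
  have h3 : TrL (TensorProduct.mk k H (T3 k H) p) (Q.cl (l32 k H))
    (Q.cl (l43 k H)) := TrL.mk_lam p (l32 k H ∘ₗ Q.SInv)
  unfold QuasiHopfData.pastOp₃ QuasiHopfData.pastOp₄
  infer_instance

instance Tr.prodOp {A B : Type*} [Ring A] [Algebra k A] [Ring B] [Algebra k B] (π : A →ₗ[k] B)
    (x y z v w : H →ₗ[k] Op k A) (x' y' z' v' w' : H →ₗ[k] Op k B)
    [TrL π x x'] [TrL π y y'] [TrL π z z'] [TrL π v v'] [TrL π w w'] (h : H) :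
    Tr π (Q.prodOp x y z v w h) (Q.prodOp x' y' z' v' w' h) := by
  unfold QuasiHopfData.prodOp; infer_instance

/-- `x ⊗ s ↦ s ◁ g(x)`, the right factor being acted on through `pastOp`. -/
def past (g : H →ₗ[k] H) : T3 k H →ₗ[k] H ⊗[k] H :=
  TensorProduct.lift ((MulOpposite.opLinearEquiv k).symm.toLinearMap ∘ₗ Q.pastOp ∘ₗ g)

@[simp]
theorem past_tmul (g : H →ₗ[k] H) (x : H) (s : H ⊗[k] H) :
    Q.past g (x ⊗ₜ s) = act s (Q.pastOp (g x)) := TensorProduct.lift.tmul _ _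

theorem past_add (g g' : H →ₗ[k] H) : Q.past (g + g') = Q.past g + Q.past g' := by
  refine TensorProduct.ext' fun x s => ?_
  rw [LinearMap.add_apply, past_tmul, past_tmul, past_tmul, LinearMap.add_apply, map_add, map_add]

theorem act_pastOp₄ (p q : H) (t : H ⊗[k] H) (h : H) :
    act (p ⊗ₜ[k] (q ⊗ₜ[k] t)) (Q.pastOp₄ h) = p ⊗ₜ (q ⊗ₜ act t (Q.pastOp h)) := by
  have e1 := (Tr.app (TensorProduct.mk k H (H ⊗[k] H) q) Q.pastOp Q.pastOp₃ h).tr t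
  have e2 := (Tr.app (TensorProduct.mk k H (T3 k H) p) Q.pastOp₃ Q.pastOp₄ h).tr (q ⊗ₜ t)
  simp only [TensorProduct.mk_apply] at e1 e2
  rw [← e2, ← e1]

theorem lift_l43_l44 (s : H ⊗[k] H) : mulMap₂ (l43 k H) (l44 k H) s = 1 ⊗ₜ (1 ⊗ₜ s) := by
  refine LinearMap.congr_fun (g := TensorProduct.mk k H (T3 k H) 1 ∘ₗ
    TensorProduct.mk k H (H ⊗[k] H) 1) (TensorProduct.ext' fun a b => ?_) s
  simp [l43, l44, l32, l33, inl, inr]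

theorem past_bow (φ : Module.Dual k H) (h : H) (t : T3 k H) :
    Q.past (Q.hat (Q.bow φ h)) t = con φ (act t (Q.pastOp₃ h)) := by
  induction t using TensorProduct.induction_on with
  | zero => simp [act_zero_left]
  | add a b ha hb => simp only [map_add, act_add_left, ha, hb]
  | tmul x s =>
  have := (Tr.app (TensorProduct.mk k H (H ⊗[k] H) x) Q.pastOp Q.pastOp₃ h).tr s
  simp only [TensorProduct.mk_apply] at this
  rw [past_tmul, ← this]
  simp

/-- `(id ⊗ id ⊗ (t ◁ -))` -/
def pastAt (s : H ⊗[k] H) : T3 k H →ₗ[k] T4 k H :=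
  (((LinearMap.applyₗ s) ∘ₗ (MulOpposite.opLinearEquiv k).symm.toLinearMap ∘ₗ
    Q.pastOp).lTensor H).lTensor H

@[simp]
theorem pastAt_tmul (s : H ⊗[k] H) (p q r : H) :
    Q.pastAt s (p ⊗ₜ (q ⊗ₜ r)) = p ⊗ₜ (q ⊗ₜ act s (Q.pastOp r)) := rfl

variable [hQ : Q.Regular]

theorem hat_mul (X Y : Q.QuantumDouble) (u : H) :
    Q.hat (X * Y) u = mix (Q.hat Y) (Q.past (Q.hat X) (act (Q.tp (l31 k H) (l32 k H) u)
      (Q.tw (Q.cl (l32 k H)) (Q.cl (l31 k H)) * Q.psi (rho ∘ₗ l31 k H) (rho ∘ₗ l32 k H)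
        (rho ∘ₗ l33 k H) (Q.cl (l32 k H)) (Q.cl (l31 k H))))) := by
  induction X using double_induction with
  | ha X X' hX hX' => rw [add_mul, map_add, map_add, past_add, LinearMap.add_apply, hX, hX',
      LinearMap.add_apply, map_add]
  | hb φ h => rw [hat_bow_mul, prodOp, act_mul, past_bow]; rfl

instance Leg.pastOp : Leg Q.pastOp := by unfold QuasiHopfData.pastOp; infer_instance

theorem trL_pastAt (s : H ⊗[k] H) {x : H →ₗ[k] Op k (T3 k H)} {x' : H →ₗ[k] Op k (T4 k H)}
    (h : ∀ a p q r, Q.pastAt s (act (p ⊗ₜ (q ⊗ₜ r)) (x a)) =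
      act (p ⊗ₜ (q ⊗ₜ act s (Q.pastOp r))) (x' a)) : TrL (Q.pastAt s) x x' := ⟨fun a => ⟨fun e => by
  induction e using TensorProduct.induction_on with
  | zero => simp only [act_zero_left, map_zero]
  | add a b ha hb => simp only [act_add_left, map_add, ha, hb]
  | tmul p e =>
  induction e using TensorProduct.induction_on with
  | zero => simp only [act_zero_left, TensorProduct.tmul_zero, map_zero]
  | add a b ha hb => simp only [act_add_left, TensorProduct.tmul_add, map_add, ha, hb]
  | tmul q r => rw [h, pastAt_tmul]⟩⟩

/-- Since `pastOp` is itself a leg, acting through a product of two elements is again given by the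
product formula, with this leg in the place of v. -/
theorem past_mul (φ ψ : Module.Dual k H) (h h' : H) (t : T3 k H) :
    Q.past (Q.hat (Q.bow φ h * Q.bow ψ h')) t = con ψ (con φ (act
      (mulMap₂ (Q.tp (l41 k H) (l42 k H)) (mulMap₂ (l43 k H) (l44 k H)) t)
      (Q.prodOp (rho ∘ₗ l41 k H) (rho ∘ₗ l42 k H) Q.pastOp₄ (Q.cl (l42 k H)) (Q.cl (l41 k H)) h *
        Q.pastOp₄ h'))) := by
  induction t using TensorProduct.induction_on with
  | zero => simp [act_zero_left]
  | add a b ha hb => simp only [map_add, act_add_left, ha, hb]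
  | tmul x s =>
  rw [past_tmul, hat_bow_mul]
  have c : ∀ e : T3 k H, act s (Q.pastOp (mix (Q.hat (Q.bow ψ h')) (con φ e))) =
      con ψ (con φ (act (Q.pastAt s e) (Q.pastOp₄ h'))) := fun e => by
    induction e using TensorProduct.induction_on with
    | zero => simp [act_zero_left]
    | add a b ha hb => simp only [map_add, act_add_left, ha, hb]
    | tmul p e =>
    induction e using TensorProduct.induction_on with
    | zero => simp [act_zero_left]
    | add a b ha hb => simp only [map_add, TensorProduct.tmul_add, act_add_left, ha, hb]
    | tmul q r =>
    rw [pastAt_tmul, act_pastOp₄, ← act_mul, ← Leg.map_mul]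
    simp
  have h1 : TrL (Q.pastAt s) (rho ∘ₗ l31 k H) (rho ∘ₗ l41 k H) := Q.trL_pastAt s fun a p q r => by
    simp [l31, l41, inl]
  have h2 : TrL (Q.pastAt s) (rho ∘ₗ l32 k H) (rho ∘ₗ l42 k H) := Q.trL_pastAt s fun a p q r => by
    simp [l32, l31, l42, inl, inr]
  have h3 : TrL (Q.pastAt s) (rho ∘ₗ l33 k H) Q.pastOp₄ := Q.trL_pastAt s fun a p q r => by
    rw [act_pastOp₄, ← act_mul, ← Leg.map_mul]
    simp [l33, inr]
  have h4 : TrL (Q.pastAt s) (Q.cl (l31 k H)) (Q.cl (l41 k H)) := Q.trL_pastAt s fun a p q r => by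
    simp [l31, l41, inl]
  have h5 : TrL (Q.pastAt s) (Q.cl (l32 k H)) (Q.cl (l42 k H)) := Q.trL_pastAt s fun a p q r => by
    simp [l32, l31, l42, inl, inr]
  have tr := (Tr.prodOp Q (Q.pastAt s) (rho ∘ₗ l31 k H) (rho ∘ₗ l32 k H) (rho ∘ₗ l33 k H)
    (Q.cl (l32 k H)) (Q.cl (l31 k H)) (rho ∘ₗ l41 k H) (rho ∘ₗ l42 k H) Q.pastOp₄
    (Q.cl (l42 k H)) (Q.cl (l41 k H)) h).tr
  rw [c, tr, act_mul]
  congr 5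
  refine congrArg act ?_
  rw [tp, tp, LinearMap.comp_apply, mulMap₂_tmul, LinearMap.comp_apply, lift_l43_l44]
  generalize Q.comul x = u
  refine LinearMap.congr_fun (f := Q.pastAt s ∘ₗ mulMap₂ _ _) (g := LinearMap.mulRight k _ ∘ₗ
    mulMap₂ _ _) (TensorProduct.ext' fun a b => ?_) u
  simp [l31, l32, l41, l42, inl, inr, Leg.map_one]

theorem mix_con_mul (g : H →ₗ[k] H) (ψ : Module.Dual k H) (z : H) (s : T3 k H) :
    mix g (con ψ (l33 k H z * s)) = z * mix g (con ψ s) := by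
  refine LinearMap.congr_fun (f := mix g ∘ₗ con ψ ∘ₗ LinearMap.mulLeft k _)
    (g := LinearMap.mulLeft k _ ∘ₗ mix g ∘ₗ con ψ) ?_ s
  ext a b c
  simp [l33, inr, mul_assoc]

/-- The corresponding expansion when the right factor is a product: the second leg is split by Δ,
and a second `prodOp` acts on the resulting pair of legs. -/
theorem mix_hat_mul (Y : Q.QuantumDouble) (ψ : Module.Dual k H) (h : H) (t : T3 k H)
    (φ : Module.Dual k H) :
    mix (Q.hat (Q.bow ψ h * Y)) (con φ t) = mix (Q.hat Y) (con ψ (con φ (act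
      (mulMap₂ (l41 k H) (mulMap₂ (Q.tp (l42 k H) (l43 k H)) (l44 k H)) t)
      (Q.prodOp (rho ∘ₗ l42 k H) (rho ∘ₗ l43 k H) (rho ∘ₗ l44 k H) (Q.cl (l43 k H))
        (Q.cl (l42 k H)) h)))) := by
  induction t using TensorProduct.induction_on with
  | zero => simp [act_zero_left]
  | add a b ha hb => simp only [map_add, act_add_left, ha, hb]
  | tmul x t =>
  induction t using TensorProduct.induction_on with
  | zero => simp [act_zero_left]
  | add a b ha hb => simp only [map_add, TensorProduct.tmul_add, act_add_left, ha, hb]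
  | tmul y z =>
  have h1 : TrL (TensorProduct.mk k H (T3 k H) x) (rho ∘ₗ l31 k H) (rho ∘ₗ l42 k H) :=
    TrL.mk_rho x (l31 k H)
  have h2 : TrL (TensorProduct.mk k H (T3 k H) x) (rho ∘ₗ l32 k H) (rho ∘ₗ l43 k H) :=
    TrL.mk_rho x (l32 k H)
  have h3 : TrL (TensorProduct.mk k H (T3 k H) x) (rho ∘ₗ l33 k H) (rho ∘ₗ l44 k H) :=
    TrL.mk_rho x (l33 k H)
  have h4 : TrL (TensorProduct.mk k H (T3 k H) x) (Q.cl (l31 k H)) (Q.cl (l42 k H)) :=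
    TrL.mk_lam x (l31 k H ∘ₗ Q.SInv)
  have h5 : TrL (TensorProduct.mk k H (T3 k H) x) (Q.cl (l32 k H)) (Q.cl (l43 k H)) :=
    TrL.mk_lam x (l32 k H ∘ₗ Q.SInv)
  have tr := (Tr.prodOp Q (TensorProduct.mk k H (T3 k H) x) (rho ∘ₗ l31 k H) (rho ∘ₗ l32 k H)
    (rho ∘ₗ l33 k H) (Q.cl (l32 k H)) (Q.cl (l31 k H)) (rho ∘ₗ l42 k H) (rho ∘ₗ l43 k H)
    (rho ∘ₗ l44 k H) (Q.cl (l43 k H)) (Q.cl (l42 k H)) h).tr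
  have e : mulMap₂ (l41 k H) (mulMap₂ (Q.tp (l42 k H) (l43 k H)) (l44 k H)) (x ⊗ₜ (y ⊗ₜ z)) =
      TensorProduct.mk k H (T3 k H) x (l33 k H z * Q.tp (l31 k H) (l32 k H) y) := by
    rw [Cm.comm (x := l33 k H)]
    simp only [mulMap₂_tmul, tp, LinearMap.comp_apply]
    refine LinearMap.congr_fun (f := LinearMap.mulLeft k _ ∘ₗ LinearMap.mulRight k _ ∘ₗ mulMap₂ _ _)
      (g := TensorProduct.mk k H (T3 k H) x ∘ₗ LinearMap.mulRight k _ ∘ₗ mulMap₂ _ _)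
      (TensorProduct.ext' fun a b => ?_) (Q.comul y)
    simp [l41, l42, l43, l44, l31, l32, l33, inl, inr]
  have n := (Intw.prodOp_comm Q (rho ∘ₗ l31 k H) (rho ∘ₗ l32 k H) (rho ∘ₗ l33 k H)
    (Q.cl (l32 k H)) (Q.cl (l31 k H)) h (lam ∘ₗ l33 k H)).intw z
  rw [e, ← tr, act_mul_left _ _ _ n.symm]
  simp only [con_tmul, TensorProduct.mk_apply, map_smul, mix_con_mul, mix_tmul]
  rw [hat_bow_mul]

theorem psi_nat {B : Type*} [Ring B] [Algebra k B] (u : B)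
    (x y v y' x' p q w q' p' : H →ₗ[k] B) [Intw u x p] [Intw u y q] [Intw u v w] [Intw u y' q']
    [Intw u x' p'] : u * Q.psi x y v y' x' = Q.psi p q w q' p' * u := by
  have h1 := Q.ph_nat u (Q.tp (Q.tp x y) v) y' x' (Q.tp (Q.tp p q) w) q' p'
  have h2 := Q.pb_nat u x y v p q w
  have h3 := Q.pb_nat u x (Q.tp y v) y' p (Q.tp q w) q'
  simp only [psi]
  linear_combination (norm := noncomm_ring) h1 * Q.pb x y v * Q.pb x (Q.tp y v) y' +
    Q.ph (Q.tp (Q.tp p q) w) q' p' * h2 * Q.pb x (Q.tp y v) y' +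
    Q.ph (Q.tp (Q.tp p q) w) q' p' * Q.pb p q w * h3

section Assoc

variable {B : Type*} [Ring B] [Algebra k B] (x₁ x₂ x₃ y : H →ₗ[k] B) [Leg x₁] [Leg x₂] [Leg x₃]
  [Leg y] [Cm x₁ x₂] [Cm x₁ x₃] [Cm x₁ y] [Cm x₂ x₃] [Cm x₂ y] [Cm x₃ y]

/-- The common value of the two products of three factors, up to the reassociator. -/
def prodOp₃ (a₁ a₂ a₃ v b₃ b₂ b₁ : H →ₗ[k] B) (h h' : H) : B :=
  Q.tw b₃ b₂ * Q.tw (Q.tp b₃ b₂) b₁ * Q.pb b₃ b₂ b₁ *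
    Q.psi (Q.tp a₁ a₂) a₃ v b₃ (Q.tp b₂ b₁) * Q.psi a₁ a₂ (Q.tp (Q.tp a₃ v) b₃) b₂ b₁ *
    Q.tp (Q.tp a₂ (Q.tp (Q.tp a₃ v) b₃)) b₂ h * Q.tp (Q.tp a₃ v) b₃ h'

/-- The twist of x₁ and x₂ is moved forward until the twist equation applies. The associator of the
x's then comes out as a left multiplication. -/
theorem prodOp_assoc_left (a₁ a₂ a₃ v : H →ₗ[k] Op k B) [Leg a₁] [Leg a₂] [Leg a₃] [Leg v]
    [Cm a₁ a₂] [Cm a₁ a₃] [Cm a₁ v] [Cm a₂ a₃] [Cm a₂ v] [Cm a₃ v]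
    [Cm a₁ (lam : B →ₗ[k] Op k B)] [Cm a₂ (lam : B →ₗ[k] Op k B)] [Cm a₃ (lam : B →ₗ[k] Op k B)]
    [Cm v (lam : B →ₗ[k] Op k B)] (h h' : H) :
    Q.tw (Q.cl x₃) (Q.cl (Q.tp x₁ x₂)) * Q.psi (Q.tp a₁ a₂) a₃ v (Q.cl x₃) (Q.cl (Q.tp x₁ x₂)) *
      (Q.prodOp a₁ a₂ (Q.tp (Q.tp a₃ v) (Q.cl x₃)) (Q.cl x₂) (Q.cl x₁) h *
        Q.tp (Q.tp a₃ v) (Q.cl x₃) h') =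
    lam (Q.ph x₁ x₂ x₃) * Q.prodOp₃ a₁ a₂ a₃ v (Q.cl x₃) (Q.cl x₂) (Q.cl x₁) h h' := by
  have c₁ := Q.psi_nat (Q.tw (Q.cl x₂) (Q.cl x₁)) (Q.tp a₁ a₂) a₃ v (Q.cl x₃)
    (Q.tp (Q.cl x₂) (Q.cl x₁)) (Q.tp a₁ a₂) a₃ v (Q.cl x₃) (Q.cl (Q.tp x₁ x₂))
  have c₂ := Q.tw_nat (Q.tw (Q.cl x₂) (Q.cl x₁)) (Q.cl x₃) (Q.tp (Q.cl x₂) (Q.cl x₁)) (Q.cl x₃)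
    (Q.cl (Q.tp x₁ x₂))
  have c₃ := Q.twist_equation_cl x₁ x₂ x₃
  have c₄ := Q.ph_mul_pb (Q.cl x₃) (Q.cl x₂) (Q.cl x₁)
  rw [prodOp, prodOp₃]
  generalize Q.tp (Q.tp a₃ v) (Q.cl x₃) h' = t
  generalize Q.tp (Q.tp a₂ (Q.tp (Q.tp a₃ v) (Q.cl x₃))) (Q.cl x₂) h = t'
  generalize Q.psi a₁ a₂ (Q.tp (Q.tp a₃ v) (Q.cl x₃)) (Q.cl x₂) (Q.cl x₁) = t''
  linear_combination (norm := noncomm_ring) (-Q.tw (Q.cl x₃) (Q.cl (Q.tp x₁ x₂)) * c₁ - c₂ *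
      Q.psi (Q.tp a₁ a₂) a₃ v (Q.cl x₃) (Q.tp (Q.cl x₂) (Q.cl x₁)) +
      c₃ * Q.pb (Q.cl x₃) (Q.cl x₂) (Q.cl x₁) *
      Q.psi (Q.tp a₁ a₂) a₃ v (Q.cl x₃) (Q.tp (Q.cl x₂) (Q.cl x₁)) -
      Q.tw (Q.cl x₂) (Q.cl x₁) * Q.tw (Q.cl x₃) (Q.tp (Q.cl x₂) (Q.cl x₁)) * c₄ *
      Q.psi (Q.tp a₁ a₂) a₃ v (Q.cl x₃) (Q.tp (Q.cl x₂) (Q.cl x₁))) * t'' * t' * t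

/-- Here the twist of x₂ and x₃ is moved forward, and `psi_coherence` brings the associator out
through the legs aᵢ. -/
theorem prodOp_assoc_right (a₁ a₂ a₃ v : H →ₗ[k] Op k B) [Leg a₁] [Leg a₂] [Leg a₃] [Leg v]
    [Cm a₁ a₂] [Cm a₁ a₃] [Cm a₁ v] [Cm a₂ a₃] [Cm a₂ v] [Cm a₃ v]
    [Cm a₁ (lam : B →ₗ[k] Op k B)] [Cm a₂ (lam : B →ₗ[k] Op k B)] [Cm a₃ (lam : B →ₗ[k] Op k B)]
    [Cm v (lam : B →ₗ[k] Op k B)] (h h' : H) :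
    Q.prodOp a₁ (Q.tp a₂ a₃) v (Q.cl (Q.tp x₂ x₃)) (Q.cl x₁) h *
      (Q.prodOp a₂ a₃ v (Q.cl x₃) (Q.cl x₂) h') =
    Q.ph a₁ a₂ a₃ * Q.prodOp₃ a₁ a₂ a₃ v (Q.cl x₃) (Q.cl x₂) (Q.cl x₁) h h' := by
  rw [prodOp, prodOp, prodOp₃]
  have c₁ := (inferInstance : Intw (Q.tw (Q.cl x₃) (Q.cl x₂)) (Q.tp (Q.tp (Q.tp a₂ a₃) v)
    (Q.tp (Q.cl x₃) (Q.cl x₂))) (Q.tp (Q.tp (Q.tp a₂ a₃) v) (Q.cl (Q.tp x₂ x₃)))).intw h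
  have c₂ := Q.psi_nat (Q.tw (Q.cl x₃) (Q.cl x₂)) a₁ (Q.tp a₂ a₃) v (Q.tp (Q.cl x₃) (Q.cl x₂))
    (Q.cl x₁) a₁ (Q.tp a₂ a₃) v (Q.cl (Q.tp x₂ x₃)) (Q.cl x₁)
  have c₃ := Q.tw_nat (Q.tw (Q.cl x₃) (Q.cl x₂)) (Q.tp (Q.cl x₃) (Q.cl x₂)) (Q.cl x₁)
    (Q.cl (Q.tp x₂ x₃)) (Q.cl x₁)
  have c₄ := (Intw.psi Q a₂ a₃ v (Q.cl x₃) (Q.cl x₂)).intw h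
  have c₅ := Q.psi_coherence a₁ a₂ a₃ v (Q.cl x₃) (Q.cl x₂) (Q.cl x₁)
  have c₆ := Q.tw_nat (Q.ph a₁ a₂ a₃) (Q.cl x₃) (Q.cl x₂) (Q.cl x₃) (Q.cl x₂)
  have c₇ := Q.tw_nat (Q.ph a₁ a₂ a₃) (Q.tp (Q.cl x₃) (Q.cl x₂)) (Q.cl x₁)
    (Q.tp (Q.cl x₃) (Q.cl x₂)) (Q.cl x₁)
  generalize Q.tp (Q.tp a₃ v) (Q.cl x₃) h' = t
  generalize Q.tp (Q.tp a₂ (Q.tp (Q.tp a₃ v) (Q.cl x₃))) (Q.cl x₂) h = s at c₄ ⊢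
  generalize Q.tp (Q.tp (Q.tp a₂ a₃) v) (Q.tp (Q.cl x₃) (Q.cl x₂)) h = s' at c₁ c₄
  generalize Q.tp (Q.tp (Q.tp a₂ a₃) v) (Q.cl (Q.tp x₂ x₃)) h = s'' at c₁ ⊢
  generalize Q.psi a₂ a₃ v (Q.cl x₃) (Q.cl x₂) = p at c₄ c₅ ⊢
  generalize Q.psi a₁ (Q.tp a₂ a₃) v (Q.cl (Q.tp x₂ x₃)) (Q.cl x₁) = p' at c₂ ⊢
  generalize Q.psi a₁ (Q.tp a₂ a₃) v (Q.tp (Q.cl x₃) (Q.cl x₂)) (Q.cl x₁) = p'' at c₂ c₅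
  generalize Q.tw (Q.cl x₃) (Q.cl x₂) = f at c₁ c₂ c₃ c₆ ⊢
  generalize Q.tw (Q.tp (Q.cl x₃) (Q.cl x₂)) (Q.cl x₁) = f' at c₃ c₇ ⊢
  generalize Q.tw (Q.cl (Q.tp x₂ x₃)) (Q.cl x₁) = f'' at c₃ ⊢
  generalize Q.psi (Q.tp a₁ a₂) a₃ v (Q.cl x₃) (Q.tp (Q.cl x₂) (Q.cl x₁)) = q at c₅ ⊢
  generalize Q.psi a₁ a₂ (Q.tp (Q.tp a₃ v) (Q.cl x₃)) (Q.cl x₂) (Q.cl x₁) = q' at c₅ ⊢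
  linear_combination (norm := noncomm_ring) (-f'' * p' * c₁ * p - f'' * c₂ * s' * p -
    c₃ * p'' * s' * p - f * f' * p'' * c₄ - f * f' * c₅ * s -
    (f * c₇ + c₆ * f') * Q.pb (Q.cl x₃) (Q.cl x₂) (Q.cl x₁) * q * q' * s) * t

/-- The two bracketings reduce to the same operator `prodOp₃`, applied to Φ·(Δ ⊗ id)Δ(u) on one side
and to (id ⊗ Δ)Δ(u)·Φ on the other. These agree by quasi-coassociativity. -/
theorem prodOp_assoc (u h h' : H) :
    act (Q.tp (Q.tp x₁ x₂) x₃ u) (Q.tw (Q.cl x₃) (Q.cl (Q.tp x₁ x₂)) *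
      Q.psi (rho ∘ₗ Q.tp x₁ x₂) (rho ∘ₗ x₃) (rho ∘ₗ y) (Q.cl x₃) (Q.cl (Q.tp x₁ x₂)) *
      (Q.prodOp (rho ∘ₗ x₁) (rho ∘ₗ x₂) (Q.tp (Q.tp (rho ∘ₗ x₃) (rho ∘ₗ y)) (Q.cl x₃)) (Q.cl x₂)
        (Q.cl x₁) h * Q.tp (Q.tp (rho ∘ₗ x₃) (rho ∘ₗ y)) (Q.cl x₃) h')) =
    act (Q.tp x₁ (Q.tp x₂ x₃) u) (Q.prodOp (rho ∘ₗ x₁) (rho ∘ₗ Q.tp x₂ x₃) (rho ∘ₗ y)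
      (Q.cl (Q.tp x₂ x₃)) (Q.cl x₁) h *
      (Q.prodOp (rho ∘ₗ x₂) (rho ∘ₗ x₃) (rho ∘ₗ y) (Q.cl x₃) (Q.cl x₂) h')) := by
  have d₁ := Q.comp_tp (rho : B →ₗ[k] Op k B) x₁ x₂
  have d₂ := Q.comp_tp (rho : B →ₗ[k] Op k B) x₂ x₃
  rw [d₁, d₂, prodOp_assoc_left, prodOp_assoc_right, ← map_ph, act_mul _ (lam _),
    act_mul _ (rho _), act_rho, act_lam, ph_intw]

end Assoc

theorem double_mul_assoc [FiniteDimensional k H] (X Y Z : Q.QuantumDouble) :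
    X * Y * Z = X * (Y * Z) := by
  induction X using double_induction with
  | ha X X' hX hX' => simp only [add_mul, hX, hX']
  | hb φ h =>
  induction Y using double_induction with
  | ha X X' hX hX' => simp only [mul_add, add_mul, hX, hX']
  | hb ψ h' =>
  refine Q.hat_injective (LinearMap.ext fun u => ?_)
  rw [hat_mul Q _ Z, past_mul, hat_bow_mul, mix_hat_mul]
  refine congrArg (fun t => mix (Q.hat Z) (con ψ (con φ t))) ?_
  set a₁ : H →ₗ[k] Op k (T4 k H) := rho ∘ₗ l41 k H with ha₁
  set a₂ : H →ₗ[k] Op k (T4 k H) := rho ∘ₗ l42 k H with ha₂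
  set a₃ : H →ₗ[k] Op k (T4 k H) := rho ∘ₗ l43 k H with ha₃
  set v : H →ₗ[k] Op k (T4 k H) := rho ∘ₗ l44 k H with hv
  set b₁ := Q.cl (l41 k H) with hb₁
  set b₂ := Q.cl (l42 k H) with hb₂
  set b₃ := Q.cl (l43 k H) with hb₃
  -- The two maps named `π'` and `π''` below refine the three legs to four, splitting the first and
  -- the second leg by Δ respectively. The operators for three legs are transported along them.
  have p₁ : mulMap₂ (Q.tp (l41 k H) (l42 k H)) (mulMap₂ (l43 k H) (l44 k H)) ∘ₗ l31 k H =
      Q.tp (l41 k H) (l42 k H) := by ext1 a; simp [l31, inl, Leg.map_one]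
  have p₂ : mulMap₂ (Q.tp (l41 k H) (l42 k H)) (mulMap₂ (l43 k H) (l44 k H)) ∘ₗ l32 k H =
      l43 k H := by ext1 a; simp [l32, inl, inr, Leg.map_one]
  have p₃ : mulMap₂ (Q.tp (l41 k H) (l42 k H)) (mulMap₂ (l43 k H) (l44 k H)) ∘ₗ l33 k H =
      l44 k H := by ext1 a; simp [l33, inr, Leg.map_one]
  have q₁ : mulMap₂ (l41 k H) (mulMap₂ (Q.tp (l42 k H) (l43 k H)) (l44 k H)) ∘ₗ l31 k H =
      l41 k H := by ext1 a; simp [l31, inl, Leg.map_one]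
  have q₂ : mulMap₂ (l41 k H) (mulMap₂ (Q.tp (l42 k H) (l43 k H)) (l44 k H)) ∘ₗ l32 k H =
      Q.tp (l42 k H) (l43 k H) := by ext1 a; simp [l32, inl, inr, Leg.map_one]
  have q₃ : mulMap₂ (l41 k H) (mulMap₂ (Q.tp (l42 k H) (l43 k H)) (l44 k H)) ∘ₗ l33 k H =
      l44 k H := by ext1 a; simp [l33, inr, Leg.map_one]
  set π' := mulMap₂ (Q.tp (l41 k H) (l42 k H)) (mulMap₂ (l43 k H) (l44 k H))
  set π'' := mulMap₂ (l41 k H) (mulMap₂ (Q.tp (l42 k H) (l43 k H)) (l44 k H))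
  have r₁ : TrL π' (rho ∘ₗ l31 k H) (rho ∘ₗ Q.tp (l41 k H) (l42 k H)) := by
    rw [← p₁]; infer_instance
  have r₂ : TrL π' (rho ∘ₗ l32 k H) a₃ := by rw [ha₃, ← p₂]; infer_instance
  have r₃ : TrL π' (rho ∘ₗ l33 k H) v := by rw [hv, ← p₃]; infer_instance
  have r₄ : TrL π' (Q.cl (l31 k H)) (Q.cl (Q.tp (l41 k H) (l42 k H))) := by
    rw [← p₁]; exact TrL.leg_lam π' (l31 k H ∘ₗ Q.SInv)
  have r₅ : TrL π' (Q.cl (l32 k H)) b₃ := by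
    rw [hb₃, ← p₂]; exact TrL.leg_lam π' (l32 k H ∘ₗ Q.SInv)
  have s₁ : TrL π'' (rho ∘ₗ l31 k H) a₁ := by rw [ha₁, ← q₁]; infer_instance
  have s₂ : TrL π'' (rho ∘ₗ l32 k H) (rho ∘ₗ Q.tp (l42 k H) (l43 k H)) := by
    rw [← q₂]; infer_instance
  have s₃ : TrL π'' (rho ∘ₗ l33 k H) v := by rw [hv, ← q₃]; infer_instance
  have s₄ : TrL π'' (Q.cl (l31 k H)) b₁ := by
    rw [hb₁, ← q₁]; exact TrL.leg_lam π'' (l31 k H ∘ₗ Q.SInv)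
  have s₅ : TrL π'' (Q.cl (l32 k H)) (Q.cl (Q.tp (l42 k H) (l43 k H))) := by
    rw [← q₂]; exact TrL.leg_lam π'' (l32 k H ∘ₗ Q.SInv)
  have t₁ := (inferInstance : Tr π' (Q.tw (Q.cl (l32 k H)) (Q.cl (l31 k H)) *
    Q.psi (rho ∘ₗ l31 k H) (rho ∘ₗ l32 k H) (rho ∘ₗ l33 k H) (Q.cl (l32 k H)) (Q.cl (l31 k H)))
    (Q.tw b₃ (Q.cl (Q.tp (l41 k H) (l42 k H))) * Q.psi (rho ∘ₗ Q.tp (l41 k H) (l42 k H)) a₃ v b₃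
      (Q.cl (Q.tp (l41 k H) (l42 k H))))).tr (Q.tp (l31 k H) (l32 k H) u)
  have t₂ := (Tr.prodOp Q π'' (rho ∘ₗ l31 k H) (rho ∘ₗ l32 k H) (rho ∘ₗ l33 k H) (Q.cl (l32 k H))
    (Q.cl (l31 k H)) a₁ (rho ∘ₗ Q.tp (l42 k H) (l43 k H)) v (Q.cl (Q.tp (l42 k H) (l43 k H)))
    b₁ h).tr (Q.tp (l31 k H) (l32 k H) u)
  have e₁ : π' (Q.tp (l31 k H) (l32 k H) u) = Q.tp (Q.tp (l41 k H) (l42 k H)) (l43 k H) u := by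
    have := LinearMap.congr_fun (Q.comp_tp π' (l31 k H) (l32 k H)) u
    rwa [p₁, p₂] at this
  have e₂ : π'' (Q.tp (l31 k H) (l32 k H) u) = Q.tp (l41 k H) (Q.tp (l42 k H) (l43 k H)) u := by
    have := LinearMap.congr_fun (Q.comp_tp π'' (l31 k H) (l32 k H)) u
    rwa [q₁, q₂] at this
  rw [t₁, t₂, e₁, e₂, ← act_mul, ← act_mul]
  have w : pastOp₄ Q = Q.tp (Q.tp a₃ v) b₃ := rfl
  rw [w]
  exact Q.prodOp_assoc (l41 k H) (l42 k H) (l43 k H) (l44 k H) u h h'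

end DoubleAssoc

/-! ### Unit laws -/

section Units

variable {k H B C : Type*} [Field k] [Ring H] [Algebra k H] [Ring B] [Algebra k B] [Ring C]
  [Algebra k C] (Q : QuasiHopfData k H)

/-- Apply ε to the axiom S(h₁)αh₂ = ε(h)α and use ε(α) = 1. -/
theorem un_S [hQ : Q.Regular] : (Q.un : H →ₗ[k] B) ∘ₗ Q.S = Q.un := by
  ext h
  have key : Q.counit (Q.S h) = Q.counit h := by
    have e := congrArg Q.counit (hQ.ax.S_α h)
    rw [map_smul, hQ.counit_α, smul_eq_mul, mul_one] at e
    rw [← e]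
    conv_lhs => rw [← hQ.ax.lTensor_counit h]
    refine LinearMap.congr_fun (f := Q.counit ∘ₗ Q.S ∘ₗ (TensorProduct.rid k H).toLinearMap ∘ₗ
      Q.counit.lTensor H) (g := Q.counit ∘ₗ mulMap₂ _ _) (TensorProduct.ext' fun a b => ?_) _
    simp [hQ.ax.counit_mul, hQ.counit_α, mul_comm]
  simp [un_apply, key]

theorem un_SInv [hQ : Q.Regular] : (Q.un : H →ₗ[k] B) ∘ₗ Q.SInv = Q.un := by
  have : (Q.un : H →ₗ[k] B) ∘ₗ Q.S ∘ₗ Q.SInv = Q.un := by ext a; simp [hQ.S_SInv]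
  rwa [← LinearMap.comp_assoc, un_S] at this

theorem un_α [hQ : Q.Regular] : (Q.un Q.α : B) = 1 := by
  rw [un_apply, hQ.counit_α, one_smul]

theorem lam_un : (lam : B →ₗ[k] Op k B) ∘ₗ Q.un = Q.un := by
  ext1 h; refine op_ext fun e => ?_
  rw [LinearMap.comp_apply, act_lam, un_apply, un_apply]
  change _ = Q.counit h • e
  simp

theorem rho_un : (rho : B →ₗ[k] Op k B) ∘ₗ Q.un = Q.un := by
  ext1 h; refine op_ext fun e => ?_
  rw [LinearMap.comp_apply, act_rho, un_apply, un_apply]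
  change _ = Q.counit h • e
  simp

theorem aa_un_un (p s : H →ₗ[k] B) [Leg p] [Leg s] [Cm p s] [hQ : Q.Regular] :
    Q.aa p Q.un Q.un s = 1 := by
  rw [aa, ph_un₂, tp_un, pb_un₂, one_mul]

theorem aa_un_left (q r : H →ₗ[k] B) [Leg q] [Leg r] [Cm q r] [hQ : Q.Regular] :
    Q.aa Q.un q r Q.un = 1 := by
  rw [aa, ph_un₁, un_tp, pb_un₃, one_mul]

variable [hQ : Q.Regular]

/-- With one trivial leg γ reduces to α, so the invertible α cancels from fΔ(α) = γ and f is
normalized. -/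
theorem tw_un_left (y : H →ₗ[k] B) [Leg y] : Q.tw Q.un y = 1 := by
  have h := Q.tw_mul_α Q.un y
  have e : (lam : B →ₗ[k] Op k B) ∘ₗ Q.un ∘ₗ Q.S = Q.un := by rw [un_S, lam_un]
  rw [un_tp, lift_gam, e, rho_un, aa_un_un, un_α, one_mul] at h
  exact (Q.isUnit_map_α y).mul_right_cancel (by rw [h]; simp [act])

theorem tw_un_right (y : H →ₗ[k] B) [Leg y] : Q.tw y Q.un = 1 := by
  have h := Q.tw_mul_α y Q.un
  have e : (lam : B →ₗ[k] Op k B) ∘ₗ Q.un ∘ₗ Q.S = Q.un := by rw [un_S, lam_un]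
  rw [tp_un, lift_gam, e, rho_un, aa_un_left, un_α, mul_one] at h
  exact (Q.isUnit_map_α y).mul_right_cancel (by rw [h]; simp [act])

theorem psi_un_left (y v y' : H →ₗ[k] B) [Leg y] [Leg v] [Leg y'] [Cm y v] [Cm y y'] [Cm v y'] :
    Q.psi Q.un y v y' Q.un = 1 := by
  rw [psi, un_tp, ph_un₃, pb_un₁, pb_un₁, one_mul, one_mul]

theorem psi_un_right (x v x' : H →ₗ[k] B) [Leg x] [Leg v] [Leg x'] [Cm x v] [Cm x x'] [Cm v x'] :
    Q.psi x Q.un v Q.un x' = 1 := by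
  rw [psi, tp_un, un_tp, ph_un₂, pb_un₂, pb_un₃, one_mul, one_mul]

end Units

section DoubleUnits

variable {k H : Type*} [Field k] [Ring H] [Algebra k H] (Q : QuasiHopfData k H) [hQ : Q.Regular]

/-- Pairing the first leg with ε is an algebra map that makes this leg trivial. The twist and `psi`
then become 1, and only the action through `pastOp` is left. -/
theorem hat_iD_mul (h : H) (Y : Q.QuantumDouble) (u : H) :
    Q.hat (Q.iD h * Y) u = mix (Q.hat Y) (act (u ⊗ₜ 1) (Q.pastOp h)) := by
  rw [iD, hat_bow_mul]
  congr 1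
  have c : (con Q.counit : T3 k H →ₗ[k] H ⊗[k] H) = mulMap₂ Q.un LinearMap.id :=
    TensorProduct.ext' fun a b => by simp [un_apply]
  have l : Leg (con Q.counit : T3 k H →ₗ[k] H ⊗[k] H) := by rw [c]; infer_instance
  have e₁ : (con Q.counit : T3 k H →ₗ[k] H ⊗[k] H) ∘ₗ l31 k H = Q.un := by
    ext a; simp [l31, inl, un_apply]
  have e₂ : (con Q.counit : T3 k H →ₗ[k] H ⊗[k] H) ∘ₗ l32 k H = inl k := by
    ext a; simp [l32, inl, inr, hQ.ax.counit_one]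
  have e₃ : (con Q.counit : T3 k H →ₗ[k] H ⊗[k] H) ∘ₗ l33 k H = inr k := by
    ext a; simp [l33, inr, hQ.ax.counit_one]
  have t₁ : TrL (con Q.counit : T3 k H →ₗ[k] H ⊗[k] H) (rho ∘ₗ l31 k H) Q.un := by
    rw [← rho_un, ← e₁]; infer_instance
  have t₂ : TrL (con Q.counit : T3 k H →ₗ[k] H ⊗[k] H) (rho ∘ₗ l32 k H) (rho ∘ₗ inl k) := by
    rw [← e₂]; infer_instance
  have t₃ : TrL (con Q.counit : T3 k H →ₗ[k] H ⊗[k] H) (rho ∘ₗ l33 k H) (rho ∘ₗ inr k) := by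
    rw [← e₃]; infer_instance
  have t₄ : TrL (con Q.counit : T3 k H →ₗ[k] H ⊗[k] H) (Q.cl (l31 k H)) Q.un := by
    rw [← lam_un, ← un_SInv, ← e₁]; exact TrL.leg_lam _ (l31 k H ∘ₗ Q.SInv)
  have t₅ : TrL (con Q.counit : T3 k H →ₗ[k] H ⊗[k] H) (Q.cl (l32 k H)) (Q.cl (inl k)) := by
    rw [← e₂]; exact TrL.leg_lam _ (l32 k H ∘ₗ Q.SInv)
  rw [(Tr.prodOp Q (con Q.counit) (rho ∘ₗ l31 k H) (rho ∘ₗ l32 k H) (rho ∘ₗ l33 k H)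
    (Q.cl (l32 k H)) (Q.cl (l31 k H)) Q.un (rho ∘ₗ inl k) (rho ∘ₗ inr k) (Q.cl (inl k)) Q.un h).tr,
    ← LinearMap.comp_apply, comp_tp, e₁, e₂, un_tp, prodOp, tw_un_right, psi_un_left, one_mul,
    one_mul]
  rfl

variable [FiniteDimensional k H]

theorem bow_mul_iD (φ : Module.Dual k H) (h h' : H) :
    Q.bow φ h * Q.iD h' = Q.bow φ (h * h') := by
  -- The right factor has ε as its functional part, so it is the second leg that becomes trivial
  -- this time.
  let π : T3 k H →ₗ[k] H ⊗[k] H := mulMap₂ (inl k) (mulMap₂ Q.un (inr k))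
  have l : Leg π := by unfold π; infer_instance
  have e₁ : π ∘ₗ l31 k H = inl k := by
    ext1 a
    have : mulMap₂ Q.un (inr k : H →ₗ[k] H ⊗[k] H) 1 = 1 := Leg.map_one
    simp [π, l31, inl, this]
  have e₂ : π ∘ₗ l32 k H = Q.un := by
    ext1 a; simp [π, l32, inl, inr, un_apply, Algebra.TensorProduct.one_def]
  have e₃ : π ∘ₗ l33 k H = inr k := by
    ext1 a; simp [π, l33, inl, inr, un_apply, hQ.ax.counit_one]
  have t₁ : TrL π (rho ∘ₗ l31 k H) (rho ∘ₗ inl k) := by rw [← e₁]; infer_instance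
  have t₂ : TrL π (rho ∘ₗ l32 k H) Q.un := by rw [← rho_un, ← e₂]; infer_instance
  have t₃ : TrL π (rho ∘ₗ l33 k H) (rho ∘ₗ inr k) := by rw [← e₃]; infer_instance
  have t₄ : TrL π (Q.cl (l31 k H)) (Q.cl (inl k)) := by
    rw [← e₁]; exact TrL.leg_lam _ (l31 k H ∘ₗ Q.SInv)
  have t₅ : TrL π (Q.cl (l32 k H)) Q.un := by
    rw [← lam_un, ← un_SInv, ← e₂]; exact TrL.leg_lam _ (l32 k H ∘ₗ Q.SInv)
  refine Q.hat_injective (LinearMap.ext fun u => ?_)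
  rw [hat_bow_mul]
  have p : ∀ t, mix (Q.hat (Q.iD h')) (con φ t) = con φ (π t) * h' := fun t => by
    refine LinearMap.congr_fun (f := mix _ ∘ₗ con φ) (g := LinearMap.mulRight k h' ∘ₗ con φ ∘ₗ π)
      ?_ t
    ext a b c
    simp [π, iD, inl, inr, un_apply, smul_smul, mul_comm (φ a)]
  rw [p, (Tr.prodOp Q π (rho ∘ₗ l31 k H) (rho ∘ₗ l32 k H) (rho ∘ₗ l33 k H) (Q.cl (l32 k H))
    (Q.cl (l31 k H)) (rho ∘ₗ inl k) Q.un (rho ∘ₗ inr k) Q.un (Q.cl (inl k)) h).tr,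
    ← LinearMap.comp_apply (f := π), comp_tp, e₁, e₂, tp_un, prodOp, un_tp, tp_un, tw_un_left, psi_un_right,
    one_mul, one_mul]
  simp [inl, inr]

theorem iD_mul_iD (h h' : H) : Q.iD h * Q.iD h' = Q.iD (h * h') := Q.bow_mul_iD _ h h'

theorem mul_iD_one (X : Q.QuantumDouble) : X * Q.iD 1 = X := by
  induction X using double_induction with
  | ha X Y hX hY => rw [add_mul, hX, hY]
  | hb φ h => rw [bow_mul_iD, mul_one]

theorem iD_one_mul (X : Q.QuantumDouble) : Q.iD 1 * X = X := by
  refine Q.hat_injective (LinearMap.ext fun u => ?_)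
  rw [hat_iD_mul, Leg.map_one]
  change mix _ (u ⊗ₜ 1) = _
  simp

instance : Ring Q.QuantumDouble where
  mul_assoc := Q.double_mul_assoc
  one_mul := Q.iD_one_mul
  mul_one := Q.mul_iD_one
  neg_add_cancel := neg_add_cancel
  zsmul := (· • ·)
  zsmul_zero' := zero_smul ℤ
  zsmul_succ' n a := SubNegMonoid.zsmul_succ' n a
  zsmul_neg' n a := SubNegMonoid.zsmul_neg' n a
  sub_eq_add_neg := sub_eq_add_neg

instance : Algebra k Q.QuantumDouble := Algebra.ofModule smul_mul_assoc mul_smul_comm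

instance Leg.iD : Leg Q.iD := ⟨rfl, fun a b => (Q.iD_mul_iD a b).symm⟩

end DoubleUnits

/-! ### Half-braidings with values in an algebra. -/

section RMatrix

variable {k H B C E : Type*} [Field k] [Ring H] [Algebra k H] [Ring B] [Algebra k B] [Ring C]
  [Algebra k C] [Ring E] [Algebra k E] (Q : QuasiHopfData k H)

/-- Together with the algebra map `i : H → E`, the element `R ∈ H ⊗ E` makes `E` an algebra over the
quantum double. -/
structure IsR (i : H →ₗ[k] E) (R : H ⊗[k] E) : Prop where
  leg : Leg i
  intw : Intw R (Q.tp (inl k) (inr k ∘ₗ i)) (Q.tp (inr k ∘ₗ i) (inl k))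
  hex : mulMap₂ (Q.tp (inl k) (inr k ∘ₗ inl k)) (inr k ∘ₗ inr k) R =
    (Q.hex (inl k) (inr k ∘ₗ inl k) (inr k ∘ₗ inr k ∘ₗ i) (mulMap₂ (inl k) (inr k ∘ₗ inr k) R)
      (mulMap₂ (inr k ∘ₗ inl k) (inr k ∘ₗ inr k) R) : H ⊗[k] (H ⊗[k] E))
  counit : mulMap₂ Q.un LinearMap.id R = 1

theorem map_gm (π : B →ₗ[k] C) [Leg π] (x v : H →ₗ[k] B) (r : B) :
    π (Q.gm x v r) = Q.gm (π ∘ₗ x) (π ∘ₗ v) (π r) := by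
  have t₁ := TrL.leg_lam π (x ∘ₗ Q.SInv)
  have t₂ : Tr π (rho r : Op k B) (rho (π r)) := ⟨fun e => by simp [Leg.map_mul]⟩
  rw [gm, (inferInstance : Tr π (Q.ph (rho ∘ₗ v) (rho ∘ₗ x) (Q.cl x) * rho r)
    (Q.ph (rho ∘ₗ π ∘ₗ v) (rho ∘ₗ π ∘ₗ x) (Q.cl (π ∘ₗ x)) * rho (π r))).tr]
  rfl

section

variable [hQ : Q.Regular] {Q} {i : H →ₗ[k] E} {R : H ⊗[k] E}

theorem lift_comp_inl (x : H →ₗ[k] B) (j : E →ₗ[k] B) [Leg j] : mulMap₂ x j ∘ₗ inl k = x := by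
  ext1 a; simp [inl, Leg.map_one]

theorem lift_comp_inr (x : H →ₗ[k] B) (j : E →ₗ[k] B) [Leg x] : mulMap₂ x j ∘ₗ inr k = j := by
  ext1 a; simp [inr, Leg.map_one]

theorem lift_lift {M N : Type*} [AddCommGroup M] [Module k M] [AddCommGroup N] [Module k N]
    (π : B →ₗ[k] C) [Leg π] (f : M →ₗ[k] B) (g : N →ₗ[k] B) (w : M ⊗[k] N) :
    π (mulMap₂ f g w) = mulMap₂ (π ∘ₗ f) (π ∘ₗ g) w := by rw [map_mulMap₂]; rfl

variable (x y : H →ₗ[k] B) (j : E →ₗ[k] B) [Leg x] [Leg y] [Leg j] [Cm x j]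
  [Cm y j] [Cm x y]

/-- The defining properties live in the universal case of the two inclusions into a tensor product;
commuting algebra maps carry them to any target. -/
theorem IsR.lift_intw (h : Q.IsR i R) : Intw (mulMap₂ x j R) (Q.tp x (j ∘ₗ i)) (Q.tp (j ∘ₗ i) x) := by
  have := h.leg
  have := h.intw
  have := Intw.map (mulMap₂ x j) R (Q.tp (inl k) (inr k ∘ₗ i)) (Q.tp (inr k ∘ₗ i) (inl k))
  rwa [comp_tp, comp_tp, lift_comp_inl, ← LinearMap.comp_assoc, lift_comp_inr] at this


theorem IsR.lift_hex (h : Q.IsR i R) : mulMap₂ (Q.tp x y) j R =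
    Q.hex x y (j ∘ₗ i) (mulMap₂ x j R) (mulMap₂ y j R) := by
  have e := congrArg (mulMap₂ x (mulMap₂ y j)) h.hex
  rwa [map_hex, lift_lift, lift_lift, lift_lift, comp_tp, lift_comp_inl, ← LinearMap.comp_assoc,
    lift_comp_inr, lift_comp_inl, ← LinearMap.comp_assoc, lift_comp_inr, lift_comp_inr,
    ← LinearMap.comp_assoc, lift_comp_inr, ← LinearMap.comp_assoc, lift_comp_inr] at e


theorem IsR.lift_counit (h : Q.IsR i R) : mulMap₂ Q.un j R = 1 := by
  have e := congrArg j h.counit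
  rwa [lift_lift, comp_un, Leg.map_one] at e

end

end RMatrix

/-! ### The canonical half-braiding of the double. -/

section DoubleR

variable {k H B : Type*} [Field k] [Ring H] [Algebra k H] [Ring B] [Algebra k B]
  (Q : QuasiHopfData k H) [FiniteDimensional k H]

/-- `∑ eᵢ ⊗ (eⁱ ⋈ 1)` for dual bases `eᵢ`, `eⁱ` of `H`, `H^*`. -/
def gamD : H ⊗[k] Q.QuantumDouble :=
  ∑ i, Module.finBasis k H i ⊗ₜ Q.bow ((Module.finBasis k H).coord i) 1

theorem con_gamD (φ : Module.Dual k H) : con φ Q.gamD = Q.bow φ 1 := by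
  have e := congrArg (fun f => Q.bow f 1) ((Module.finBasis k H).sum_dual_apply_smul_coord φ)
  simp only [map_sum, map_smul, LinearMap.sum_apply, LinearMap.smul_apply] at e
  simp only [gamD, map_sum, con_tmul, e]

theorem mix_hat_bow (φ : Module.Dual k H) (s : H ⊗[k] H) :
    mix (Q.hat (Q.bow φ 1)) s = con φ s := by
  refine LinearMap.congr_fun (f := mix _) (g := con φ) (TensorProduct.ext' fun a b => ?_) s
  simp

theorem lTensor_hat_gamD (u : H) : (LinearMap.applyₗ u ∘ₗ Q.hat).lTensor H Q.gamD = u ⊗ₜ 1 := by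
  have e := congrArg (fun a => a ⊗ₜ[k] (1 : H)) ((Module.finBasis k H).sum_repr u)
  simp only [TensorProduct.sum_tmul, TensorProduct.smul_tmul] at e
  simp only [gamD, map_sum, ← e]
  rfl

theorem con_ext {M : Type*} [AddCommGroup M] [Module k M] {s t : H ⊗[k] M}
    (h : ∀ φ : Module.Dual k H, con φ s = con φ t) : s = t := by
  have e : ∀ w : H ⊗[k] M, w = ∑ i, Module.finBasis k H i ⊗ₜ con ((Module.finBasis k H).coord i) w :=
    fun w => by
      induction w using TensorProduct.induction_on with
      | zero => simp
      | add a b ha hb => 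
        conv_lhs => rw [ha, hb]
        simp only [map_add, TensorProduct.tmul_add, Finset.sum_add_distrib]
      | tmul a b =>
        have e := congrArg (fun a => a ⊗ₜ[k] b) ((Module.finBasis k H).sum_repr a)
        simp only [TensorProduct.sum_tmul, TensorProduct.smul_tmul] at e
        refine e.symm.trans ?_
        simp only [con_tmul]
        rfl
  rw [e s, e t]
  simp only [h]

theorem con_lTensor {M N : Type*} [AddCommGroup M] [Module k M] [AddCommGroup N] [Module k N]
    (φ : Module.Dual k H) (f : M →ₗ[k] N) (t : H ⊗[k] M) :
    con φ (f.lTensor H t) = f (con φ t) := by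
  refine LinearMap.congr_fun (f := con φ ∘ₗ f.lTensor H) (g := f ∘ₗ con φ)
    (TensorProduct.ext' fun a b => ?_) t
  simp

section

variable {E F : Type*} [Ring E] [Algebra k E] [Ring F] [Algebra k F]

theorem con_inr_mul (φ : Module.Dual k H) (a : E) (t : H ⊗[k] E) :
    con φ (inr k a * t) = a * con φ t := by
  refine LinearMap.congr_fun (f := con φ ∘ₗ LinearMap.mulLeft k (inr k a))
    (g := LinearMap.mulLeft k a ∘ₗ con φ) (TensorProduct.ext' fun b c => ?_) t
  simp [inr]

theorem con_con_mul (φ ψ : Module.Dual k H) (s t : H ⊗[k] E) :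
    con ψ (con φ (mulMap₂ (inl k) (inr k ∘ₗ inr k) s * mulMap₂ (inr k ∘ₗ inl k) (inr k ∘ₗ inr k) t :
      H ⊗[k] (H ⊗[k] E))) = con φ s * con ψ t := by
  induction s using TensorProduct.induction_on with
  | zero => simp
  | add a b ha hb => simp only [map_add, add_mul, ha, hb]
  | tmul a b =>
  induction t using TensorProduct.induction_on with
  | zero => simp
  | add a b ha hb => simp only [map_add, mul_add, ha, hb]
  | tmul c d => simp [inl, inr, smul_smul, mul_comm]

variable (θ : E →ₗ[k] F)

instance TrL.lTensor_rho_inl : TrL (θ.lTensor H) (rho ∘ₗ inl k) (rho ∘ₗ inl k) :=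
  ⟨fun a => ⟨fun e => by
    refine LinearMap.congr_fun (f := θ.lTensor H ∘ₗ LinearMap.mulRight k (inl k a))
      (g := LinearMap.mulRight k (inl k a) ∘ₗ θ.lTensor H) (TensorProduct.ext' fun a b => ?_) e
    simp [inl]⟩⟩

instance TrL.lTensor_lam_inl (w : H →ₗ[k] H) :
    TrL (θ.lTensor H) (lam ∘ₗ inl k ∘ₗ w) (lam ∘ₗ inl k ∘ₗ w) :=
  ⟨fun a => ⟨fun e => by
    refine LinearMap.congr_fun (f := θ.lTensor H ∘ₗ LinearMap.mulLeft k (inl k (w a)))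
      (g := LinearMap.mulLeft k (inl k (w a)) ∘ₗ θ.lTensor H) (TensorProduct.ext' fun a b => ?_) e
    simp [inl]⟩⟩

theorem TrL.lTensor_rho_inr (i : H →ₗ[k] E) (i' : H →ₗ[k] F) [h : TrL θ (rho ∘ₗ i) (rho ∘ₗ i')] :
    TrL (θ.lTensor H) (rho ∘ₗ inr k ∘ₗ i) (rho ∘ₗ inr k ∘ₗ i') :=
  ⟨fun a => ⟨fun e => by
    refine LinearMap.congr_fun (f := θ.lTensor H ∘ₗ LinearMap.mulRight k (inr k (i a)))
      (g := LinearMap.mulRight k (inr k (i' a)) ∘ₗ θ.lTensor H)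
      (TensorProduct.ext' fun b c => ?_) e
    have := (h.tr a).tr c
    simp only [LinearMap.comp_apply, act_rho] at this
    simp [inr, this]⟩⟩

theorem TrL.lTensor_lam_inr (i : H →ₗ[k] E) (i' : H →ₗ[k] F) [h : TrL θ (lam ∘ₗ i) (lam ∘ₗ i')] :
    TrL (θ.lTensor H) (lam ∘ₗ inr k ∘ₗ i) (lam ∘ₗ inr k ∘ₗ i') :=
  ⟨fun a => ⟨fun e => by
    refine LinearMap.congr_fun (f := θ.lTensor H ∘ₗ LinearMap.mulLeft k (inr k (i a)))
      (g := LinearMap.mulLeft k (inr k (i' a)) ∘ₗ θ.lTensor H)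
      (TensorProduct.ext' fun b c => ?_) e
    have := (h.tr a).tr c
    simp only [LinearMap.comp_apply, act_lam] at this
    simp [inr, this]⟩⟩

end

variable [hQ : Q.Regular]

theorem hat_mul_iD (X : Q.QuantumDouble) (b u : H) : Q.hat (X * Q.iD b) u = Q.hat X u * b := by
  induction X using double_induction with
  | ha X Y hX hY => simp only [add_mul, map_add, LinearMap.add_apply, hX, hY]
  | hb φ h => rw [bow_mul_iD]; simp

/-- `t ↦ (id ⊗ ⟨-, u⟩)(t)` -/
abbrev hatAt (u : H) : Q.QuantumDouble →ₗ[k] H := LinearMap.applyₗ u ∘ₗ Q.hat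

instance TrL.hatAt (u : H) : TrL (Q.hatAt u) (rho ∘ₗ Q.iD) (rho ∘ₗ (LinearMap.id : H →ₗ[k] H)) :=
  ⟨fun a => ⟨fun e => by simp [hat_mul_iD]⟩⟩

/-- This is the rule for i_D(z)(φ ⋈ 1), for all φ at once. It is precisely the morphism property
required of a mate. -/
theorem gamD_intw (z : H) : (inr k ∘ₗ Q.iD) z * Q.gamD = act Q.gamD
    (Q.tp (Q.tp (rho ∘ₗ inl k) (rho ∘ₗ inr k ∘ₗ Q.iD)) (Q.cl (inl k)) z) := by
  refine con_ext fun φ => Q.hat_injective (LinearMap.ext fun u => ?_)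
  have e : con φ ((inr k ∘ₗ Q.iD) z * Q.gamD) = Q.iD z * Q.bow φ 1 := by
    rw [← con_gamD, LinearMap.comp_apply, con_inr_mul]
  have t : TrL ((Q.hatAt u).lTensor H) (rho ∘ₗ inr k ∘ₗ Q.iD) (rho ∘ₗ inr k) :=
    TrL.lTensor_rho_inr (Q.hatAt u) Q.iD LinearMap.id
  have key := (inferInstance : Tr ((Q.hatAt u).lTensor H)
    (Q.tp (Q.tp (rho ∘ₗ inl k) (rho ∘ₗ inr k ∘ₗ Q.iD)) (Q.cl (inl k)) z)
    (Q.tp (Q.tp (rho ∘ₗ inl k) (rho ∘ₗ inr k)) (Q.cl (inl k)) z)).tr Q.gamD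
  rw [e, hat_iD_mul]
  change _ = Q.hatAt u (con φ _)
  rw [← con_lTensor, key, lTensor_hat_gamD, pastOp]
  exact Q.mix_hat_bow φ _

theorem lTensor_hat_comul (u : H) :
    ((Q.hatAt u).lTensor H).lTensor H (mulMap₂ (Q.tp (inl k) (inr k ∘ₗ inl k))
      (inr k ∘ₗ inr k) Q.gamD) = Q.tp (l31 k H) (l32 k H) u := by
  have : Q.tp (l31 k H) (l32 k H) u = mulMap₂ (Q.tp (l31 k H) (l32 k H)) (l33 k H)
    ((LinearMap.applyₗ u ∘ₗ Q.hat).lTensor H Q.gamD) := by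
    rw [lTensor_hat_gamD]; simp [Leg.map_one]
  rw [this]
  generalize Q.gamD = t
  refine LinearMap.congr_fun (f := ((Q.hatAt u).lTensor H).lTensor H ∘ₗ mulMap₂ _ _)
    (g := mulMap₂ _ _ ∘ₗ ((Q.hatAt u).lTensor H)) (TensorProduct.ext' fun a b => ?_) t
  simp only [LinearMap.comp_apply, mulMap₂_tmul, LinearMap.lTensor_tmul, tp]
  generalize Q.comul a = w
  refine LinearMap.congr_fun (f := ((Q.hatAt u).lTensor H).lTensor H ∘ₗ LinearMap.mulRight k _ ∘ₗ
    mulMap₂ _ _) (g := LinearMap.mulRight k _ ∘ₗ mulMap₂ _ _)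
    (TensorProduct.ext' fun c d => ?_) w
  simp [inl, inr, l31, l32, l33]

/-- This is the rule for (φ ⋈ 1)(ψ ⋈ 1), for all φ and ψ at once, in the shape of `gm_mul_gm`. -/
theorem gamD_mul : mulMap₂ (inl k) (inr k ∘ₗ inr k) Q.gamD *
      mulMap₂ (inr k ∘ₗ inl k) (inr k ∘ₗ inr k) Q.gamD =
    act (mulMap₂ (Q.tp (inl k) (inr k ∘ₗ inl k)) (inr k ∘ₗ inr k) Q.gamD)
      (Q.tw (Q.cl (inr k ∘ₗ inl k)) (Q.cl (inl k)) * Q.psi (rho ∘ₗ inl k) (rho ∘ₗ inr k ∘ₗ inl k)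
        (rho ∘ₗ inr k ∘ₗ inr k ∘ₗ Q.iD) (Q.cl (inr k ∘ₗ inl k)) (Q.cl (inl k)) :
        Op k (H ⊗[k] (H ⊗[k] Q.QuantumDouble))) := by
  refine con_ext fun φ => con_ext fun ψ => Q.hat_injective (LinearMap.ext fun u => ?_)
  have t₁ : TrL (((Q.hatAt u).lTensor H).lTensor H) (rho ∘ₗ inl k) (rho ∘ₗ l31 k H) :=
    TrL.lTensor_rho_inl _
  have t₂ : TrL (((Q.hatAt u).lTensor H).lTensor H) (rho ∘ₗ inr k ∘ₗ inl k) (rho ∘ₗ l32 k H) :=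
    TrL.lTensor_rho_inr ((Q.hatAt u).lTensor H) (inl k) (inl k)
  have t₃' : TrL ((Q.hatAt u).lTensor H) (rho ∘ₗ inr k ∘ₗ Q.iD) (rho ∘ₗ inr k) :=
    TrL.lTensor_rho_inr (Q.hatAt u) Q.iD LinearMap.id
  have t₃ : TrL (((Q.hatAt u).lTensor H).lTensor H) (rho ∘ₗ inr k ∘ₗ inr k ∘ₗ Q.iD)
      (rho ∘ₗ l33 k H) := TrL.lTensor_rho_inr ((Q.hatAt u).lTensor H) (inr k ∘ₗ Q.iD) (inr k)
  have t₄ : TrL (((Q.hatAt u).lTensor H).lTensor H) (Q.cl (inr k ∘ₗ inl k)) (Q.cl (l32 k H)) :=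
    TrL.lTensor_lam_inr ((Q.hatAt u).lTensor H) (inl k ∘ₗ Q.SInv) (inl k ∘ₗ Q.SInv)
  have t₅ : TrL (((Q.hatAt u).lTensor H).lTensor H) (Q.cl (inl k)) (Q.cl (l31 k H)) :=
    TrL.lTensor_lam_inl _ Q.SInv
  have key := (inferInstance : Tr (((Q.hatAt u).lTensor H).lTensor H)
    (Q.tw (Q.cl (inr k ∘ₗ inl k)) (Q.cl (inl k)) * Q.psi (rho ∘ₗ inl k) (rho ∘ₗ inr k ∘ₗ inl k)
        (rho ∘ₗ inr k ∘ₗ inr k ∘ₗ Q.iD) (Q.cl (inr k ∘ₗ inl k)) (Q.cl (inl k)))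
    (Q.tw (Q.cl (l32 k H)) (Q.cl (l31 k H)) * Q.psi (rho ∘ₗ l31 k H) (rho ∘ₗ l32 k H)
      (rho ∘ₗ l33 k H) (Q.cl (l32 k H)) (Q.cl (l31 k H)))).tr
    (mulMap₂ (Q.tp (inl k) (inr k ∘ₗ inl k)) (inr k ∘ₗ inr k) Q.gamD)
  rw [con_con_mul, con_gamD, con_gamD, hat_bow_mul, prodOp,
    Leg.map_one (x := Q.tp (Q.tp _ _) _), mul_one]
  change _ = Q.hatAt u (con ψ (con φ _))
  rw [← con_lTensor ψ (Q.hatAt u), ← con_lTensor φ ((Q.hatAt u).lTensor H), key, lTensor_hat_comul]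
  exact Q.mix_hat_bow ψ _

/-- The canonical element of `H ⊗ D(H)`. -/
def rD : H ⊗[k] Q.QuantumDouble := Q.rc (inl k) (inr k ∘ₗ Q.iD) Q.gamD

theorem gm_rD : Q.gm (inl k) (inr k ∘ₗ Q.iD) Q.rD = Q.gamD := Q.gm_rc _ _ Q.gamD_intw

instance rD_intw : Intw Q.rD (Q.tp (inl k) (inr k ∘ₗ Q.iD)) (Q.tp (inr k ∘ₗ Q.iD) (inl k)) :=
  Q.rc_intw _ _ Q.gamD_intw

/-- By `gamD_mul` and `gm_mul_gm` the mates of both sides of the hexagon have the same image under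
the operator formed by f and `psi`. This operator has a right inverse, so the mates coincide, and an
intertwiner is recovered from its mate. -/
theorem rD_hex : mulMap₂ (Q.tp (inl k) (inr k ∘ₗ inl k)) (inr k ∘ₗ inr k) Q.rD =
    (Q.hex (inl k) (inr k ∘ₗ inl k) (inr k ∘ₗ inr k ∘ₗ Q.iD)
      (mulMap₂ (inl k) (inr k ∘ₗ inr k) Q.rD)
      (mulMap₂ (inr k ∘ₗ inl k) (inr k ∘ₗ inr k) Q.rD) :
        H ⊗[k] (H ⊗[k] Q.QuantumDouble)) := by
  set x : H →ₗ[k] H ⊗[k] (H ⊗[k] Q.QuantumDouble) := inl k with hx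
  set y : H →ₗ[k] H ⊗[k] (H ⊗[k] Q.QuantumDouble) := inr k ∘ₗ inl k with hy
  set j : Q.QuantumDouble →ₗ[k] H ⊗[k] (H ⊗[k] Q.QuantumDouble) := inr k ∘ₗ inr k with hj
  change _ = Q.hex x y (j ∘ₗ Q.iD) _ _
  have lx : Leg x := by rw [hx]; infer_instance
  have ly : Leg y := by rw [hy]; infer_instance
  have lj : Leg j := by rw [hj]; infer_instance
  have cxy : Cm x y := by rw [hx, hy]; infer_instance
  have cxj : Cm x j := by rw [hx, hj]; infer_instance
  have cyj : Cm y j := by rw [hy, hj]; infer_instance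
  have g : ∀ z : H →ₗ[k] H ⊗[k] (H ⊗[k] Q.QuantumDouble), Leg z → Cm z j →
      mulMap₂ z j Q.gamD = Q.gm z (j ∘ₗ Q.iD) (mulMap₂ z j Q.rD) := fun z hz cz => by
    rw [← gm_rD, map_gm, lift_comp_inl, ← LinearMap.comp_assoc, lift_comp_inr]
  have n : ∀ z : H →ₗ[k] H ⊗[k] (H ⊗[k] Q.QuantumDouble), Leg z → Cm z j →
      Intw (mulMap₂ z j Q.rD) (Q.tp z (j ∘ₗ Q.iD)) (Q.tp (j ∘ₗ Q.iD) z) := fun z hz cz => by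
    have := Intw.map (mulMap₂ z j) Q.rD (Q.tp (inl k) (inr k ∘ₗ Q.iD))
      (Q.tp (inr k ∘ₗ Q.iD) (inl k))
    rwa [comp_tp, comp_tp, lift_comp_inl, ← LinearMap.comp_assoc, lift_comp_inr] at this
  have nx := n x lx cxj
  have ny := n y ly cyj
  have nxy := n (Q.tp x y) inferInstance inferInstance
  have e := Q.gamD_mul
  change mulMap₂ x j Q.gamD * mulMap₂ y j Q.gamD = act (mulMap₂ (Q.tp x y) j Q.gamD)
      (Q.tw (Q.cl y) (Q.cl x) * Q.psi (rho ∘ₗ x) (rho ∘ₗ y)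
        (rho ∘ₗ j ∘ₗ Q.iD) (Q.cl y) (Q.cl x)) at e
  rw [g x lx cxj, g y ly cyj, g (Q.tp x y) inferInstance inferInstance, gm_mul_gm] at e
  have e' := congrArg (fun t => act t (Q.psiInv (rho ∘ₗ x) (rho ∘ₗ y) (rho ∘ₗ j ∘ₗ Q.iD)
    (Q.cl y) (Q.cl x) * Q.ti (Q.cl y) (Q.cl x))) e
  have one : Q.tw (Q.cl y) (Q.cl x) * Q.psi (rho ∘ₗ x) (rho ∘ₗ y)
        (rho ∘ₗ j ∘ₗ Q.iD) (Q.cl y) (Q.cl x) * (Q.psiInv (rho ∘ₗ x) (rho ∘ₗ y) (rho ∘ₗ j ∘ₗ Q.iD)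
    (Q.cl y) (Q.cl x) * Q.ti (Q.cl y) (Q.cl x)) = 1 := by
    rw [mul_assoc, ← mul_assoc (Q.psi _ _ _ _ _), psi_mul_psiInv, one_mul, tw_mul_ti]
  simp only [← act_mul, one] at e'
  have e'' := congrArg (Q.rc (Q.tp x y) (j ∘ₗ Q.iD)) e'
  simp only [act_one] at e''
  rw [rc_gm, rc_gm] at e''
  exact e''.symm

theorem gm_un (v : H →ₗ[k] B) [Leg v] (r : B) : Q.gm Q.un v r = r := by
  have e : Q.cl (Q.un : H →ₗ[k] B) = Q.un := by
    change lam ∘ₗ Q.un ∘ₗ Q.SInv = _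
    rw [un_SInv, lam_un]
  rw [gm, rho_un, e, ph_un₃, one_mul, act_rho, ← LinearMap.comp_apply, un_SInv, un_α, one_mul]

theorem rD_isR : Q.IsR Q.iD Q.rD where
  leg := inferInstance
  intw := inferInstance
  hex := Q.rD_hex
  counit := by
    have h := Q.map_gm (mulMap₂ Q.un LinearMap.id) (inl k) (inr k ∘ₗ Q.iD) Q.rD
    rw [lift_comp_inl, ← LinearMap.comp_assoc, lift_comp_inr, LinearMap.id_comp, gm_un,
      gm_rD] at h
    rw [← h, ← Leg.map_one (x := Q.iD), iD, ← con_gamD]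
    generalize Q.gamD = t
    refine LinearMap.congr_fun (TensorProduct.ext' fun a b => ?_) t
    simp [un_apply]

end DoubleR

/-! ### The universal property of the double -/

section Theta

variable {k H E F : Type*} [Field k] [Ring H] [Algebra k H] [Ring E] [Algebra k E] [Ring F]
  [Algebra k F] (Q : QuasiHopfData k H)

theorem lTensor_eq {M N : Type*} [Ring M] [Algebra k M] [Ring N] [Algebra k N] (θ : M →ₗ[k] N) :
    θ.lTensor H = mulMap₂ (inl k) (inr k ∘ₗ θ) :=
  TensorProduct.ext' fun a b => by simp [inl, inr]

instance Leg.lTensor (θ : E →ₗ[k] F) [Leg θ] : Leg (θ.lTensor H) := by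
  rw [lTensor_eq]; infer_instance

theorem lTensor_comp_inl (θ : E →ₗ[k] F) [Leg θ] : θ.lTensor H ∘ₗ inl k = inl k := by
  rw [lTensor_eq, lift_comp_inl]

theorem lTensor_comp_inr (θ : E →ₗ[k] F) : θ.lTensor H ∘ₗ inr k = inr k ∘ₗ θ := by
  rw [lTensor_eq, lift_comp_inr]

/-- The map `φ ⋈ h ↦ (φ ⊗ id)(Γ) i(h)`, where `Γ` is the mate of `R`. -/
def theta (i : H →ₗ[k] E) (R : H ⊗[k] E) : Q.QuantumDouble →ₗ[k] E :=
  Q.doubleLift <| LinearMap.mk₂ k (fun φ h => con φ (Q.gm (inl k) (inr k ∘ₗ i) R) * i h)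
    (fun φ φ' h => by
      have : (con (φ + φ') : H ⊗[k] E →ₗ[k] E) = con φ + con φ' :=
        TensorProduct.ext' fun a b => by simp [add_smul]
      rw [this, LinearMap.add_apply, add_mul])
    (fun c φ h => by
      have : (con (c • φ) : H ⊗[k] E →ₗ[k] E) = c • con φ :=
        TensorProduct.ext' fun a b => by simp [smul_smul]
      rw [this, LinearMap.smul_apply, smul_mul_assoc])
    (fun φ h h' => by rw [map_add, mul_add])
    (fun c φ h => by rw [map_smul, mul_smul_comm])

theorem theta_bow (i : H →ₗ[k] E) (R : H ⊗[k] E) (φ : Module.Dual k H) (h : H) :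
    Q.theta i R (Q.bow φ h) = con φ (Q.gm (inl k) (inr k ∘ₗ i) R) * i h := rfl

variable [hQ : Q.Regular] {Q} {i : H →ₗ[k] E} {R : H ⊗[k] E} [FiniteDimensional k H]

theorem IsR.con_counit (hR : Q.IsR i R) : con Q.counit (Q.gm (inl k) (inr k ∘ₗ i) R) = 1 := by
  have := hR.leg
  have h := Q.map_gm (mulMap₂ Q.un LinearMap.id) (inl k) (inr k ∘ₗ i) R
  rw [lift_comp_inl, ← LinearMap.comp_assoc, lift_comp_inr, LinearMap.id_comp, gm_un,
    hR.counit] at h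
  rw [← h]
  refine LinearMap.congr_fun (TensorProduct.ext' fun a b => ?_) _
  simp [un_apply]

theorem IsR.theta_comp_iD (hR : Q.IsR i R) : Q.theta i R ∘ₗ Q.iD = i := by
  ext h
  rw [LinearMap.comp_apply, iD, theta_bow, hR.con_counit, one_mul]

theorem IsR.theta_iD (hR : Q.IsR i R) (h : H) : Q.theta i R (Q.iD h) = i h :=
  LinearMap.congr_fun hR.theta_comp_iD h

theorem IsR.theta_mul_iD (hR : Q.IsR i R) (X : Q.QuantumDouble) (h : H) :
    Q.theta i R (X * Q.iD h) = Q.theta i R X * i h := by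
  have := hR.leg
  induction X using double_induction with
  | ha X Y hX hY => simp only [add_mul, map_add, hX, hY]
  | hb φ h' => rw [bow_mul_iD, theta_bow, theta_bow, Leg.map_mul, mul_assoc]

theorem IsR.lTensor_theta_gamD (hR : Q.IsR i R) :
    (Q.theta i R).lTensor H Q.gamD = Q.gm (inl k) (inr k ∘ₗ i) R := by
  have := hR.leg
  refine con_ext fun φ => ?_
  rw [con_lTensor, con_gamD, theta_bow, Leg.map_one, mul_one]

theorem IsR.theta_bow_one (hR : Q.IsR i R) (φ : Module.Dual k H) :
    Q.theta i R (Q.bow φ 1) = con φ (Q.gm (inl k) (inr k ∘ₗ i) R) := by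
  have := hR.leg
  rw [theta_bow, Leg.map_one, mul_one]

theorem IsR.trL_theta (hR : Q.IsR i R) : TrL (Q.theta i R) (rho ∘ₗ Q.iD) (rho ∘ₗ i) :=
  ⟨fun a => ⟨fun X => hR.theta_mul_iD X a⟩⟩

/-- The mate of R and the canonical element obey the same commutation rule with H, and this rule
involves the target only through right multiplications by H, which `theta` respects. -/
theorem IsR.theta_iD_mul_bow (hR : Q.IsR i R) (h : H) (ψ : Module.Dual k H) :
    Q.theta i R (Q.iD h * Q.bow ψ 1) = i h * Q.theta i R (Q.bow ψ 1) := by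
  have l := hR.leg
  have n := hR.intw
  have t' := hR.trL_theta
  have t : TrL ((Q.theta i R).lTensor H) (rho ∘ₗ inr k ∘ₗ Q.iD) (rho ∘ₗ inr k ∘ₗ i) :=
    TrL.lTensor_rho_inr (Q.theta i R) Q.iD i
  have key := (inferInstance : Tr ((Q.theta i R).lTensor H)
    (Q.tp (Q.tp (rho ∘ₗ inl k) (rho ∘ₗ inr k ∘ₗ Q.iD)) (Q.cl (inl k)) h)
    (Q.tp (Q.tp (rho ∘ₗ inl k) (rho ∘ₗ inr k ∘ₗ i)) (Q.cl (inl k)) h)).tr Q.gamD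
  rw [hR.theta_bow_one, ← con_inr_mul]
  have e := Q.gm_intw (inl k) (inr k ∘ₗ i) R h
  rw [LinearMap.comp_apply] at e
  rw [e, ← hR.lTensor_theta_gamD, ← key, con_lTensor, ← gamD_intw, ← con_gamD, ← con_inr_mul]
  rfl

theorem IsR.theta_iD_mul (hR : Q.IsR i R) (h : H) (X : Q.QuantumDouble) :
    Q.theta i R (Q.iD h * X) = i h * Q.theta i R X := by
  induction X using double_induction with
  | ha X Y hX hY => simp only [mul_add, map_add, hX, hY]
  | hb φ h' =>
    rw [← one_mul h', ← bow_mul_iD, ← mul_assoc, hR.theta_mul_iD, hR.theta_iD_mul_bow,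
      hR.theta_mul_iD, mul_assoc]

/-- The hexagon for R turns the product of coefficients in E into the expression given by
`gm_mul_gm`, and in the double `gamD_mul` gives the same expression. The operators in it involve
only multiplications in the legs of H and right multiplications by the image of H. -/
theorem IsR.theta_bow_mul_bow (hR : Q.IsR i R) (φ ψ : Module.Dual k H) :
    Q.theta i R (Q.bow φ 1 * Q.bow ψ 1) = Q.theta i R (Q.bow φ 1) * Q.theta i R (Q.bow ψ 1) := by
  have l := hR.leg
  have t₀ := hR.trL_theta
  let θ := Q.theta i R
  let x : H →ₗ[k] H ⊗[k] (H ⊗[k] E) := inl k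
  let y : H →ₗ[k] H ⊗[k] (H ⊗[k] E) := inr k ∘ₗ inl k
  let j : E →ₗ[k] H ⊗[k] (H ⊗[k] E) := inr k ∘ₗ inr k
  have t₁ : TrL ((θ.lTensor H).lTensor H) (rho ∘ₗ inl k) (rho ∘ₗ x) :=
    TrL.lTensor_rho_inl _
  have t₂ : TrL ((θ.lTensor H).lTensor H) (rho ∘ₗ inr k ∘ₗ inl k) (rho ∘ₗ y) :=
    TrL.lTensor_rho_inr (θ.lTensor H) (inl k) (inl k)
  have t₃' : TrL (θ.lTensor H) (rho ∘ₗ inr k ∘ₗ Q.iD) (rho ∘ₗ inr k ∘ₗ i) :=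
    TrL.lTensor_rho_inr θ Q.iD i
  have t₃ : TrL ((θ.lTensor H).lTensor H) (rho ∘ₗ inr k ∘ₗ inr k ∘ₗ Q.iD) (rho ∘ₗ j ∘ₗ i) :=
    TrL.lTensor_rho_inr (θ.lTensor H) (inr k ∘ₗ Q.iD) (inr k ∘ₗ i)
  have t₄ : TrL ((θ.lTensor H).lTensor H) (Q.cl (inr k ∘ₗ inl k)) (Q.cl y) :=
    TrL.lTensor_lam_inr (θ.lTensor H) (inl k ∘ₗ Q.SInv) (inl k ∘ₗ Q.SInv)
  have t₅ : TrL ((θ.lTensor H).lTensor H) (Q.cl (inl k)) (Q.cl x) :=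
    TrL.lTensor_lam_inl _ Q.SInv
  have key := (inferInstance : Tr ((θ.lTensor H).lTensor H)
    (Q.tw (Q.cl (inr k ∘ₗ inl k)) (Q.cl (inl k)) * Q.psi (rho ∘ₗ inl k) (rho ∘ₗ inr k ∘ₗ inl k)
        (rho ∘ₗ inr k ∘ₗ inr k ∘ₗ Q.iD) (Q.cl (inr k ∘ₗ inl k)) (Q.cl (inl k)))
    (Q.tw (Q.cl y) (Q.cl x) * Q.psi (rho ∘ₗ x) (rho ∘ₗ y) (rho ∘ₗ j ∘ₗ i) (Q.cl y) (Q.cl x))).tr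
    (mulMap₂ (Q.tp (inl k) (inr k ∘ₗ inl k)) (inr k ∘ₗ inr k) Q.gamD)
  have g : ((θ.lTensor H).lTensor H (mulMap₂ (Q.tp (inl k) (inr k ∘ₗ inl k))
      (inr k ∘ₗ inr k) Q.gamD)) = mulMap₂ (Q.tp x y) j (Q.gm (inl k) (inr k ∘ₗ i) R) := by
    rw [← hR.lTensor_theta_gamD]
    generalize Q.gamD = t
    refine LinearMap.congr_fun (f := (θ.lTensor H).lTensor H ∘ₗ mulMap₂ _ _)
      (g := mulMap₂ _ _ ∘ₗ (θ.lTensor H)) (TensorProduct.ext' fun a b => ?_) t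
    simp only [LinearMap.comp_apply, mulMap₂_tmul, LinearMap.lTensor_tmul, tp]
    generalize Q.comul a = w
    refine LinearMap.congr_fun (f := (θ.lTensor H).lTensor H ∘ₗ LinearMap.mulRight k _ ∘ₗ
      mulMap₂ _ _) (g := LinearMap.mulRight k _ ∘ₗ mulMap₂ _ _)
      (TensorProduct.ext' fun c d => ?_) w
    simp [inl, inr, x, y, j]
  have gen : ∀ z : H →ₗ[k] H ⊗[k] (H ⊗[k] E), Leg z → Cm z j →
      mulMap₂ z j (Q.gm (inl k) (inr k ∘ₗ i) R) = Q.gm z (j ∘ₗ i) (mulMap₂ z j R) :=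
    fun z hz cz => by
    rw [map_gm, lift_comp_inl, ← LinearMap.comp_assoc, lift_comp_inr]
  have nx := hR.lift_intw x j
  have ny := hR.lift_intw y j
  rw [hR.theta_bow_one, hR.theta_bow_one, ← con_con_mul]
  change _ = con ψ (con φ (mulMap₂ x j _ * mulMap₂ y j _))
  rw [gen x inferInstance inferInstance, gen y inferInstance inferInstance, gm_mul_gm,
    ← hR.lift_hex x y j, ← gen (Q.tp x y) inferInstance inferInstance, ← g, ← key,
    con_lTensor, con_lTensor, ← gamD_mul, con_con_mul, con_gamD, con_gamD]

/-- Because φ ⋈ h = (φ ⋈ 1)i_D(h), multiplicativity reduces to products in which each factor is φ ⋈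
1 or i_D(h). -/
theorem IsR.leg_theta (hR : Q.IsR i R) : Leg (Q.theta i R) where
  map_one := by
    have := hR.leg
    rw [← Leg.map_one (x := Q.iD), hR.theta_iD, Leg.map_one]
  map_mul X Y := by
    induction X using double_induction with
    | ha X X' hX hX' => simp only [add_mul, map_add, hX, hX']
    | hb φ h =>
    induction Y using double_induction with
    | ha X X' hX hX' => simp only [mul_add, map_add, hX, hX']
    | hb ψ h' =>
    have e : ∀ Z, Q.theta i R (Q.bow φ 1 * Z) = Q.theta i R (Q.bow φ 1) * Q.theta i R Z := fun Z => by
      induction Z using double_induction with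
      | ha X X' hX hX' => simp only [mul_add, map_add, hX, hX']
      | hb ψ h' =>
        rw [← one_mul h', ← bow_mul_iD, ← mul_assoc, hR.theta_mul_iD, hR.theta_bow_mul_bow,
          hR.theta_mul_iD, mul_assoc]
    have e' : Q.bow φ h = Q.bow φ 1 * Q.iD h := by rw [bow_mul_iD, one_mul]
    rw [e', mul_assoc, e, hR.theta_iD_mul, hR.theta_mul_iD, mul_assoc]

/-- Both sides are intertwiners with the same mate. -/
theorem IsR.lTensor_theta (hR : Q.IsR i R) : (Q.theta i R).lTensor H Q.rD = R := by
  have l := hR.leg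
  have n := hR.intw
  have := hR.leg_theta
  have h := Q.map_gm ((Q.theta i R).lTensor H) (inl k) (inr k ∘ₗ Q.iD) Q.rD
  have n' := Intw.map ((Q.theta i R).lTensor H) Q.rD (Q.tp (inl k) (inr k ∘ₗ Q.iD))
    (Q.tp (inr k ∘ₗ Q.iD) (inl k))
  rw [comp_tp, comp_tp, lTensor_comp_inl, ← LinearMap.comp_assoc, lTensor_comp_inr,
    LinearMap.comp_assoc, hR.theta_comp_iD] at n'
  rw [gm_rD, hR.lTensor_theta_gamD, lTensor_comp_inl, ← LinearMap.comp_assoc, lTensor_comp_inr,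
    LinearMap.comp_assoc, hR.theta_comp_iD] at h
  have h' := congrArg (Q.rc (inl k) (inr k ∘ₗ i)) h
  rw [rc_gm, rc_gm] at h'
  exact h'.symm

/-- The image of R determines the image of its mate, whose coefficients are the elements φ ⋈ 1.
Together with i_D(H) these generate the double. -/
theorem double_hom_ext {θ θ' : Q.QuantumDouble →ₗ[k] E} [Leg θ] [Leg θ']
    (h : θ ∘ₗ Q.iD = θ' ∘ₗ Q.iD) (h' : θ.lTensor H Q.rD = θ'.lTensor H Q.rD) : θ = θ' := by
  have g : ∀ τ : Q.QuantumDouble →ₗ[k] E, Leg τ →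
      τ.lTensor H Q.gamD = Q.gm (inl k) (inr k ∘ₗ τ ∘ₗ Q.iD) (τ.lTensor H Q.rD) := fun τ hτ => by
    rw [← gm_rD, map_gm, lTensor_comp_inl, ← LinearMap.comp_assoc, lTensor_comp_inr,
      LinearMap.comp_assoc]
  have e : θ.lTensor H Q.gamD = θ'.lTensor H Q.gamD := by
    rw [g θ inferInstance, g θ' inferInstance, h, h']
  ext X
  induction X using double_induction with
  | ha X X' hX hX' => simp only [map_add, hX, hX']
  | hb φ h₀ =>
    have e₁ := congrArg (con φ) e
    rw [con_lTensor, con_lTensor, con_gamD] at e₁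
    have e₂ := LinearMap.congr_fun h h₀
    simp only [LinearMap.comp_apply] at e₂
    rw [← one_mul h₀, ← bow_mul_iD, Leg.map_mul, Leg.map_mul, e₁, e₂]

end Theta

/-! ### Tensor products -/

section Pair

variable {k H B C E F : Type*} [Field k] [Ring H] [Algebra k H] [Ring B] [Algebra k B] [Ring C]
  [Algebra k C] [Ring E] [Algebra k E] [Ring F] [Algebra k F] (Q : QuasiHopfData k H)

/-- The composite `x(vw) → (xv)w → (vx)w → v(xw) → v(wx) → (vw)x`. -/
def pair (x v w : H →ₗ[k] B) (rv rw : B) : B :=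
  Q.pb v w x * rw * Q.ph v x w * rv * Q.pb x v w

theorem map_pair (π : B →ₗ[k] C) [Leg π] (x v w : H →ₗ[k] B) (rv rw : B) :
    π (Q.pair x v w rv rw) = Q.pair (π ∘ₗ x) (π ∘ₗ v) (π ∘ₗ w) (π rv) (π rw) := by
  simp only [pair, Leg.map_mul, map_ph, map_pb]

instance Intw.lift_comm {A : Type*} [Ring A] [Algebra k A] {M N : Type*} [Ring M] [Algebra k M]
    [Ring N] [Algebra k N] (x : M →ₗ[k] B) (y : N →ₗ[k] B) (w : A →ₗ[k] B) [Cm x w] [Cm y w]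
    (t : M ⊗[k] N) : Intw (_root_.mulMap₂ x y t) w w :=
  ⟨fun a => Cm.comm (x := _root_.mulMap₂ x y) t a⟩

variable [hQ : Q.Regular]

section

variable (x v w : H →ₗ[k] B) [Leg x] [Leg v] [Leg w] [Cm x v] [Cm x w] [Cm v w]

instance Intw.pair (rv rw : B) [Intw rv (Q.tp x v) (Q.tp v x)] [Intw rv w w]
    [Intw rw (Q.tp x w) (Q.tp w x)] [Intw rw v v] :
    Intw (Q.pair x v w rv rw) (Q.tp x (Q.tp v w)) (Q.tp (Q.tp v w) x) := by
  have e₁ : Intw (Q.pb v w x * rw) (Q.tp v (Q.tp x w)) (Q.tp (Q.tp v w) x) :=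
    Intw.mul (y := Q.tp v (Q.tp w x)) inferInstance inferInstance
  have e₂ : Intw (Q.pb v w x * rw * Q.ph v x w) (Q.tp (Q.tp v x) w) (Q.tp (Q.tp v w) x) :=
    Intw.mul e₁ inferInstance
  have e₃ : Intw (Q.pb v w x * rw * Q.ph v x w * rv) (Q.tp (Q.tp x v) w) (Q.tp (Q.tp v w) x) :=
    Intw.mul e₂ inferInstance
  exact Intw.mul e₃ inferInstance

/-- Pentagons and naturality reorder the four braidings. The hypothesis `had` interchanges the two
that act on disjoint pairs of strands, x with v and y with w. -/
theorem hex_pair (y : H →ₗ[k] B) [Leg y] [Cm x y] [Cm y v] [Cm y w] (a b c d : B)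
    [Intw a (Q.tp x v) (Q.tp v x)] [Intw a w w] [Intw a y y]
    [Intw b (Q.tp x w) (Q.tp w x)] [Intw b v v] [Intw b y y]
    [Intw c (Q.tp y v) (Q.tp v y)] [Intw c w w] [Intw c x x]
    [Intw d (Q.tp y w) (Q.tp w y)] [Intw d v v] [Intw d x x] (had : a * d = d * a) :
    Q.hex x y (Q.tp v w) (Q.pair x v w a b) (Q.pair y v w c d) =
      Q.pair (Q.tp x y) v w (Q.hex x y v a c) (Q.hex x y w b d) := by
  simp only [hex, QuasiHopfData.pair]
  have h1 := Q.pentagon_inv x v w y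
  have h2 := Q.pb_nat (d) x v (Q.tp y w) x v (Q.tp w y)
  have h3 := Q.pentagon₄ x v y w
  have h4 := Q.pb_nat (c) x (Q.tp y v) w x (Q.tp v y) w
  have h5 := Q.pentagon₃ x y v w
  have h6 := Q.pb_nat (a) (Q.tp x v) w y (Q.tp v x) w y
  have h8 := Q.ph_nat (a) (Q.tp x v) y w (Q.tp v x) y w
  have h9 := Q.pentagon₃ v x w y
  have h10 := Q.ph_nat (d) v x (Q.tp y w) v x (Q.tp w y)
  have h11 := Q.pentagon v x y w
  have h12 := Q.pb_nat (b) v (Q.tp x w) y v (Q.tp w x) y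
  have h13 := Q.pentagon₂ v w x y
  have h14 := Q.ph_mul_pb v (Q.tp w x) y
  linear_combination (norm := noncomm_ring)
    (Q.ph (Q.tp v w) x y * Q.pb v w x * b * Q.ph v x w * a) * h1 * (d * Q.ph v y w * c *
        Q.pb y v w * Q.ph x y (Q.tp v w))
    - (Q.ph (Q.tp v w) x y * Q.pb v w x * b * Q.ph v x w * a * Q.pb (Q.tp x v) w y) * h2 *
        (Q.ph v y w * c * Q.pb y v w * Q.ph x y (Q.tp v w))
    + (Q.ph (Q.tp v w) x y * Q.pb v w x * b * Q.ph v x w * a * Q.pb (Q.tp x v) w y * d) * h3 *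
        (c * Q.pb y v w * Q.ph x y (Q.tp v w))
    - (Q.ph (Q.tp v w) x y * Q.pb v w x * b * Q.ph v x w * a * Q.pb (Q.tp x v) w y * d *
        Q.ph (Q.tp x v) y w * Q.pb x v y) * h4 * (Q.pb y v w * Q.ph x y (Q.tp v w))
    - (Q.ph (Q.tp v w) x y * Q.pb v w x * b * Q.ph v x w * a * Q.pb (Q.tp x v) w y * d *
        Q.ph (Q.tp x v) y w * Q.pb x v y * c) * h5
    + (Q.ph (Q.tp v w) x y * Q.pb v w x * b * Q.ph v x w) * h6 * (d * Q.ph (Q.tp x v) y w *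
        Q.pb x v y * c * Q.ph x y v * Q.pb (Q.tp x y) v w)
    + (Q.ph (Q.tp v w) x y * Q.pb v w x * b * Q.ph v x w * Q.pb (Q.tp v x) w y) * had *
        (Q.ph (Q.tp x v) y w * Q.pb x v y * c * Q.ph x y v * Q.pb (Q.tp x y) v w)
    + (Q.ph (Q.tp v w) x y * Q.pb v w x * b * Q.ph v x w * Q.pb (Q.tp v x) w y * d) * h8 *
        (Q.pb x v y * c * Q.ph x y v * Q.pb (Q.tp x y) v w)
    + (Q.ph (Q.tp v w) x y * Q.pb v w x * b) * h9 * (d * Q.ph (Q.tp v x) y w * a * Q.pb x v y *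
        c * Q.ph x y v * Q.pb (Q.tp x y) v w)
    - (Q.ph (Q.tp v w) x y * Q.pb v w x * b * Q.pb v (Q.tp x w) y * Q.pb x w y) * h10 *
        (Q.ph (Q.tp v x) y w * a * Q.pb x v y * c * Q.ph x y v * Q.pb (Q.tp x y) v w)
    - (Q.ph (Q.tp v w) x y * Q.pb v w x * b * Q.pb v (Q.tp x w) y * Q.pb x w y * d) * h11 * (a *
        Q.pb x v y * c * Q.ph x y v * Q.pb (Q.tp x y) v w)
    + (Q.ph (Q.tp v w) x y * Q.pb v w x) * h12 * (Q.pb x w y * d * Q.ph x y w *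
        Q.ph v (Q.tp x y) w * Q.ph v x y * a * Q.pb x v y * c * Q.ph x y v * Q.pb (Q.tp x y) v w)
    + h13 * (Q.pb v (Q.tp w x) y * b * Q.pb x w y * d * Q.ph x y w * Q.ph v (Q.tp x y) w *
        Q.ph v x y * a * Q.pb x v y * c * Q.ph x y v * Q.pb (Q.tp x y) v w)
    + (Q.pb v w (Q.tp x y) * Q.ph w x y) * h14 * (b * Q.pb x w y * d * Q.ph x y w *
        Q.ph v (Q.tp x y) w * Q.ph v x y * a * Q.pb x v y * c * Q.ph x y v * Q.pb (Q.tp x y) v w)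

theorem pair_un (v w : H →ₗ[k] B) [Leg v] [Leg w] [Cm v w] (rv rw : B) :
    Q.pair Q.un v w rv rw = rw * rv := by
  rw [QuasiHopfData.pair, pb_un₃, pb_un₁, ph_un₂, one_mul, mul_one, mul_one]

end

variable {Q}

/-- The element of `H ⊗ (E ⊗ F)` for the tensor product of two algebras over the double. -/
def pairR (Q : QuasiHopfData k H) (i : H →ₗ[k] E) (R : H ⊗[k] E) (i' : H →ₗ[k] F) (R' : H ⊗[k] F) :
    H ⊗[k] (E ⊗[k] F) :=
  Q.pair (inl k) (inr k ∘ₗ inl k ∘ₗ i) (inr k ∘ₗ inr k ∘ₗ i')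
    (mulMap₂ (inl k) (inr k ∘ₗ inl k) R) (mulMap₂ (inl k) (inr k ∘ₗ inr k) R')

section

variable {A M N : Type*} [Ring A] [Algebra k A] [Ring M] [Algebra k M] [AddCommGroup N] [Module k N]

theorem lift_inl_comp (x : A →ₗ[k] B) (y : M →ₗ[k] B) [Leg y] (f : N →ₗ[k] A) :
    mulMap₂ x y ∘ₗ inl k ∘ₗ f = x ∘ₗ f := by
  ext a; simp [inl, Leg.map_one]

theorem lift_inr_comp (x : A →ₗ[k] B) (y : M →ₗ[k] B) [Leg x] (f : N →ₗ[k] M) :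
    mulMap₂ x y ∘ₗ inr k ∘ₗ f = y ∘ₗ f := by
  ext a; simp [inr, Leg.map_one]

end

section

variable {i : H →ₗ[k] E} {R : H ⊗[k] E} {i' : H →ₗ[k] F} {R' : H ⊗[k] F}
  (x y : H →ₗ[k] B) [Leg x] [Leg y] [Cm x y] (j : E →ₗ[k] B) (j' : F →ₗ[k] B) [Leg j] [Leg j']
  [Cm x j] [Cm y j] [Cm x j'] [Cm y j'] [Cm j j']

theorem lift_pairR : mulMap₂ x (mulMap₂ j j') (Q.pairR i R i' R') =
    Q.pair x (j ∘ₗ i) (j' ∘ₗ i') (mulMap₂ x j R) (mulMap₂ x j' R') := by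
  rw [pairR, map_pair, lift_lift, lift_lift, lift_comp_inl]
  simp only [lift_inr_comp, lift_inl_comp, lift_comp_inl, lift_comp_inr]

theorem IsR.lift_pair_intw (h : Q.IsR i R) (h' : Q.IsR i' R') :
    Intw (Q.pair x (j ∘ₗ i) (j' ∘ₗ i') (mulMap₂ x j R) (mulMap₂ x j' R'))
      (Q.tp x (Q.tp (j ∘ₗ i) (j' ∘ₗ i'))) (Q.tp (Q.tp (j ∘ₗ i) (j' ∘ₗ i')) x) := by
  have := h.leg
  have := h'.leg
  have n₁ := h.lift_intw x j
  have n₃ := h'.lift_intw x j'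
  infer_instance

theorem IsR.lift_pairR_counit (h : Q.IsR i R) (h' : Q.IsR i' R') :
    mulMap₂ Q.un (mulMap₂ j j') (Q.pairR i R i' R') = 1 := by
  have := h.leg
  have := h'.leg
  rw [lift_pairR, pair_un, h.lift_counit j, h'.lift_counit j', one_mul]

theorem IsR.lift_pairR_hex (h : Q.IsR i R) (h' : Q.IsR i' R') :
    mulMap₂ (Q.tp x y) (mulMap₂ j j') (Q.pairR i R i' R') =
      Q.hex x y (Q.tp (j ∘ₗ i) (j' ∘ₗ i')) (mulMap₂ x (mulMap₂ j j') (Q.pairR i R i' R'))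
        (mulMap₂ y (mulMap₂ j j') (Q.pairR i R i' R')) := by
  have := h.leg
  have := h'.leg
  have n₁ := h.lift_intw x j
  have n₂ := h.lift_intw y j
  have n₃ := h'.lift_intw x j'
  have n₄ := h'.lift_intw y j'
  have had : mulMap₂ x j R * mulMap₂ y j' R' = mulMap₂ y j' R' * mulMap₂ x j R := Cm.comm _ _
  rw [lift_pairR, lift_pairR, lift_pairR, h.lift_hex x y j, h'.lift_hex x y j']
  exact (Q.hex_pair x (j ∘ₗ i) (j' ∘ₗ i') y _ _ _ _ had).symm

end

theorem pairR_intw {i : H →ₗ[k] E} {R : H ⊗[k] E} {i' : H →ₗ[k] F} {R' : H ⊗[k] F}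
    (h : Q.IsR i R) (h' : Q.IsR i' R') : Intw (Q.pairR i R i' R')
      (Q.tp (inl k) (Q.tp (inr k ∘ₗ inl k ∘ₗ i) (inr k ∘ₗ inr k ∘ₗ i')))
      (Q.tp (Q.tp (inr k ∘ₗ inl k ∘ₗ i) (inr k ∘ₗ inr k ∘ₗ i')) (inl k)) := by
  have e := h.lift_pair_intw (inl k : H →ₗ[k] H ⊗[k] (E ⊗[k] F)) (inr k ∘ₗ inl k)
    (inr k ∘ₗ inr k) h'
  rw [pairR]
  simpa only [LinearMap.comp_assoc] using e

theorem mulMap₂_un_id (f : B →ₗ[k] B) (hf : ∀ b, f b = b) {R : H ⊗[k] B}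
    (h : mulMap₂ Q.un f R = 1) : mulMap₂ Q.un LinearMap.id R = 1 := by
  rwa [show (LinearMap.id : B →ₗ[k] B) = f from LinearMap.ext fun b => (hf b).symm]

theorem pairR_counit {i : H →ₗ[k] E} {R : H ⊗[k] E} {i' : H →ₗ[k] F} {R' : H ⊗[k] F}
    (h : Q.IsR i R) (h' : Q.IsR i' R') :
    mulMap₂ Q.un (LinearMap.id : E ⊗[k] F →ₗ[k] E ⊗[k] F) (Q.pairR i R i' R') = 1 := by
  have e := h.lift_pairR_counit (B := E ⊗[k] F) (inl k) (inr k) h'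
  exact mulMap₂_un_id (Q := Q) (B := E ⊗[k] F) (mulMap₂ (inl k) (inr k))
    (fun w => lift_inl_inr w) e

/-- The tensor product of two algebras over the double. -/
theorem IsR.pair {i : H →ₗ[k] E} {R : H ⊗[k] E} {i' : H →ₗ[k] F} {R' : H ⊗[k] F}
    (h : Q.IsR i R) (h' : Q.IsR i' R') :
    Q.IsR (Q.tp (inl k ∘ₗ i) (inr k ∘ₗ i')) (Q.pairR i R i' R') where
  leg := by
    have := h.leg
    have := h'.leg
    infer_instance
  intw := by
    have := h.leg
    have := h'.leg
    rw [comp_tp]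
    exact pairR_intw h h'
  hex := by
    have e : (inr k ∘ₗ inr k : E ⊗[k] F →ₗ[k] H ⊗[k] (H ⊗[k] (E ⊗[k] F))) =
        mulMap₂ (inr k ∘ₗ inr k ∘ₗ inl k) (inr k ∘ₗ inr k ∘ₗ inr k) :=
      TensorProduct.ext' fun a b => by simp [inl, inr]
    have e' : (inr k ∘ₗ inr k ∘ₗ Q.tp (inl k ∘ₗ i) (inr k ∘ₗ i') :
        H →ₗ[k] H ⊗[k] (H ⊗[k] (E ⊗[k] F))) = Q.tp ((inr k ∘ₗ inr k ∘ₗ inl k) ∘ₗ i)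
          ((inr k ∘ₗ inr k ∘ₗ inr k) ∘ₗ i') := by
      rw [comp_tp, comp_tp]
      rfl
    rw [e', e]
    exact h.lift_pairR_hex _ _ _ _ h'
  counit := pairR_counit h h'

end Pair

/-! ### The comultiplication of the double -/

section Comul

variable {k H B : Type*} [Field k] [Ring H] [Algebra k H] [Ring B] [Algebra k B]
  (Q : QuasiHopfData k H)

instance Intw.rho_tp (b : B) (x y x' y' : H →ₗ[k] B) [h : Intw b (Q.tp x y) (Q.tp x' y')] :
    Intw (rho b : Op k B) (Q.tp (rho ∘ₗ x) (rho ∘ₗ y)) (Q.tp (rho ∘ₗ x') (rho ∘ₗ y')) := by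
  rw [← comp_tp, ← comp_tp]
  infer_instance

/-- After a pentagon the evaluation of x against x' kills one associator. The asymmetric outcome,
with the mate for w but the half-braiding for v itself, is the form behind Δ_D, where p_R recovers
that half-braiding from its mate. -/
theorem gm_pair [hQ : Q.Regular] (x v w : H →ₗ[k] B) [Leg x] [Leg v] [Leg w] [Cm x v] [Cm x w]
    [Cm v w] (a b : B) [Intw b (Q.tp x w) (Q.tp w x)] [Intw b v v] :
    Q.gm x (Q.tp v w) (Q.pair x v w a b) = act (Q.gm x w b)
      (Q.ph (rho ∘ₗ v) (Q.tp (rho ∘ₗ x) (rho ∘ₗ w)) (Q.cl x) *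
        Q.ph (rho ∘ₗ v) (rho ∘ₗ x) (rho ∘ₗ w) * rho (a * Q.pb x v w)) := by
  have K := Q.sameL_T x 1
  rw [mul_one] at K
  have h₁ := Q.pentagon₂ (rho ∘ₗ v) (rho ∘ₗ w) (rho ∘ₗ x) (Q.cl x)
  have h₂ := Q.ph_nat (rho b : Op k B) (rho ∘ₗ v) (Q.tp (rho ∘ₗ x) (rho ∘ₗ w)) (Q.cl x)
    (rho ∘ₗ v) (Q.tp (rho ∘ₗ w) (rho ∘ₗ x)) (Q.cl x)
  have e : (rho (Q.pair x v w a b) : Op k B) = Q.pb (rho ∘ₗ v) (rho ∘ₗ w) (rho ∘ₗ x) * rho b *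
      Q.ph (rho ∘ₗ v) (rho ∘ₗ x) (rho ∘ₗ w) * rho (a * Q.pb x v w) := by
    simp only [pair, Leg.map_mul, map_ph, map_pb, mul_assoc]
  have e₂ : Q.ph (rho ∘ₗ Q.tp v w) (rho ∘ₗ x) (Q.cl x) * rho (Q.pair x v w a b) =
      1 * Q.pb (rho ∘ₗ v) (rho ∘ₗ w) (Q.tp (rho ∘ₗ x) (Q.cl x)) *
        (Q.ph (rho ∘ₗ w) (rho ∘ₗ x) (Q.cl x) * rho b *
          (Q.ph (rho ∘ₗ v) (Q.tp (rho ∘ₗ x) (rho ∘ₗ w)) (Q.cl x) *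
            Q.ph (rho ∘ₗ v) (rho ∘ₗ x) (rho ∘ₗ w) * rho (a * Q.pb x v w))) := by
    rw [e, comp_tp]
    linear_combination (norm := noncomm_ring) h₁ * (rho b * Q.ph (rho ∘ₗ v) (rho ∘ₗ x) (rho ∘ₗ w) *
      rho (a * Q.pb x v w)) - Q.pb (rho ∘ₗ v) (rho ∘ₗ w) (Q.tp (rho ∘ₗ x) (Q.cl x)) *
        Q.ph (rho ∘ₗ w) (rho ∘ₗ x) (Q.cl x) * h₂ * (Q.ph (rho ∘ₗ v) (rho ∘ₗ x) (rho ∘ₗ w) *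
      rho (a * Q.pb x v w))
  rw [gm, e₂, K.pb₃ Q 1 (rho ∘ₗ v) (rho ∘ₗ w), pb_un₃, one_mul, one_mul, gm, act_mul _ (_ * _) _]

section Contraction

variable {M N : Type*} [Ring M] [Algebra k M] [Ring N] [Algebra k N]

theorem con_mul_inr (φ : Module.Dual k H) (a : M) (t : H ⊗[k] M) :
    con φ (t * inr k a) = con φ t * a := by
  refine LinearMap.congr_fun (f := con φ ∘ₗ LinearMap.mulRight k (inr k a))
    (g := LinearMap.mulRight k a ∘ₗ con φ) (TensorProduct.ext' fun b c => ?_) t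
  simp [inr]

theorem con_inl_mul_inl (φ : Module.Dual k H) (b c : H) (t : H ⊗[k] M) :
    con φ (inl k c * t * inl k b) = con (hitL k H b (hitR k H c φ)) t := by
  refine LinearMap.congr_fun (f := con φ ∘ₗ LinearMap.mulRight k (inl k b) ∘ₗ
    LinearMap.mulLeft k (inl k c)) (g := con (hitL k H b (hitR k H c φ)))
    (TensorProduct.ext' fun u m => ?_) t
  simp [inl, hitL_apply, hitR_apply, mul_assoc]

/-- Inserting φ₁ and φ₂ into two tensors amounts to applying φ to the product of their first legs.
This converts the coproduct of H^* into multiplication. -/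
theorem con_tmul_con (t : Module.Dual k H ⊗[k] Module.Dual k H) (f : Module.Dual k H →ₗ[k] M)
    (g : Module.Dual k H →ₗ[k] N) (X : H ⊗[k] M) (Y : H ⊗[k] N) (hf : ∀ φ, f φ = con φ X)
    (hg : ∀ φ, g φ = con φ Y) (φ : Module.Dual k H)
    (ht : ∀ h h', TensorProduct.dualDistrib k H H t (h ⊗ₜ h') = φ (h * h')) :
    TensorProduct.map g f (TensorProduct.comm k _ _ t) =
      con φ (mulMap₂ (inl k) (inr k ∘ₗ inr k) X * mulMap₂ (inl k) (inr k ∘ₗ inl k) Y :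
        H ⊗[k] (N ⊗[k] M)) := by
  have e : TensorProduct.map g f (TensorProduct.comm k _ _ t) =
      con (TensorProduct.dualDistrib k H H t)
        ((TensorProduct.comm k M N).toLinearMap.lTensor _
          (TensorProduct.tensorTensorTensorComm k H M H N (X ⊗ₜ Y))) := by
    clear ht
    induction t using TensorProduct.induction_on with
    | zero => simp [con]
    | add a b ha hb =>
      have : ∀ ψ ψ' : Module.Dual k (H ⊗[k] H), (con (ψ + ψ') : (H ⊗[k] H) ⊗[k] (N ⊗[k] M) →ₗ[k] _)
          = con ψ + con ψ' := fun ψ ψ' => TensorProduct.ext' fun a b => by simp [add_smul]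
      rw [map_add, map_add, ha, hb, map_add, this]; rfl
    | tmul ψ χ =>
      simp only [TensorProduct.comm_tmul, TensorProduct.map_tmul, hf, hg]
      clear hf hg
      induction X using TensorProduct.induction_on with
      | zero => simp
      | add a b ha hb => simp only [map_add, TensorProduct.add_tmul, TensorProduct.tmul_add, ha, hb]
      | tmul a m =>
        induction Y using TensorProduct.induction_on with
        | zero => simp
        | add a b ha hb => simp only [map_add, TensorProduct.add_tmul, TensorProduct.tmul_add, ha, hb]
        | tmul b n => simp [TensorProduct.smul_tmul', smul_smul]
  rw [e]
  clear e hf hg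
  induction X using TensorProduct.induction_on with
  | zero => simp
  | add a b ha hb => simp only [map_add, TensorProduct.add_tmul, add_mul, ha, hb]
  | tmul a m =>
    induction Y using TensorProduct.induction_on with
    | zero => simp
    | add a b ha hb => simp only [map_add, TensorProduct.tmul_add, mul_add, ha, hb]
    | tmul b n => simp [inl, inr, ht]

end Contraction

section Pure

variable [FiniteDimensional k H] [hQ : Q.Regular]

/-- The canonical element `∑ eᵢ ⊗ (eⁱ ⋈ 1) ⊗ 1`. -/
def gamV : H ⊗[k] (Q.QuantumDouble ⊗[k] Q.QuantumDouble) :=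
  mulMap₂ (inl k) (inr k ∘ₗ inl k) Q.gamD

/-- The canonical element `∑ eᵢ ⊗ 1 ⊗ (eⁱ ⋈ 1)`. -/
def gamW : H ⊗[k] (Q.QuantumDouble ⊗[k] Q.QuantumDouble) :=
  mulMap₂ (inl k) (inr k ∘ₗ inr k) Q.gamD

def legX : H →ₗ[k] H ⊗[k] (Q.QuantumDouble ⊗[k] Q.QuantumDouble) := inl k
def legV : H →ₗ[k] H ⊗[k] (Q.QuantumDouble ⊗[k] Q.QuantumDouble) := inr k ∘ₗ inl k ∘ₗ Q.iD
def legW : H →ₗ[k] H ⊗[k] (Q.QuantumDouble ⊗[k] Q.QuantumDouble) := inr k ∘ₗ inr k ∘ₗ Q.iD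

instance : Leg Q.legX := by unfold legX; infer_instance
instance : Leg Q.legV := by unfold legV; infer_instance
instance : Leg Q.legW := by unfold legW; infer_instance
instance : Cm Q.legX Q.legV := by unfold legX legV; infer_instance
instance : Cm Q.legX Q.legW := by unfold legX legW; infer_instance
instance : Cm Q.legV Q.legW := by unfold legV legW; infer_instance

theorem con_gamD_mul (φ : Module.Dual k H) (a b c d : H) :
    Q.iD a * Q.bow (hitL k H b (hitR k H c φ)) d =
      con φ (inr k (Q.iD a) * (inl k c * Q.gamD * inl k b) * inr k (Q.iD d)) := by
  rw [con_mul_inr, con_inr_mul, con_inl_mul_inl, con_gamD, mul_assoc, bow_mul_iD, one_mul]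

theorem comulD_tmul (φ : Module.Dual k H) (a b c d e f g : H) :
    TensorProduct.homTensorHomMap (RingHom.id k) _ _ _ _ (TensorProduct.map Q.act4 Q.act3
      ((a ⊗ₜ (b ⊗ₜ (c ⊗ₜ d))) ⊗ₜ (e ⊗ₜ (f ⊗ₜ g)))) (Q.swapBow (dualComul φ)) =
    con φ (Q.legX f * Q.gamW * Q.legX e * Q.legW g * Q.legV a * Q.legX c * Q.gamV * Q.legX b *
      Q.legV d) := by
  have h₂ : ∀ ψ, (Q.act4 (a ⊗ₜ (b ⊗ₜ (c ⊗ₜ d))) ∘ₗ Q.bow.flip 1) ψ =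
      con ψ (inr k (Q.iD a) * (inl k c * Q.gamD * inl k b) * inr k (Q.iD d)) := fun ψ => by
    rw [← con_gamD_mul, LinearMap.comp_apply, LinearMap.flip_apply, act4_apply, mul_one]
  have h₁ : ∀ ψ, (Q.act3 (e ⊗ₜ (f ⊗ₜ g)) ∘ₗ Q.bow.flip 1) ψ =
      con ψ (inr k (Q.iD 1) * (inl k f * Q.gamD * inl k e) * inr k (Q.iD g)) := fun ψ => by
    rw [← con_gamD_mul, LinearMap.comp_apply, LinearMap.flip_apply, act3_apply, mul_one, iD_one_mul]
  have e := con_tmul_con (dualComul φ) _ _ _ _ h₁ h₂ φ (dualComul_apply φ)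
  rw [TensorProduct.map_comp, LinearMap.comp_apply] at e
  refine e.trans (congrArg (con φ) ?_)
  have l₁ : Leg (mulMap₂ (inl k : H →ₗ[k] H ⊗[k] (Q.QuantumDouble ⊗[k] Q.QuantumDouble))
      (inr k ∘ₗ inr k)) := inferInstance
  have l₂ : Leg (mulMap₂ (inl k : H →ₗ[k] H ⊗[k] (Q.QuantumDouble ⊗[k] Q.QuantumDouble))
      (inr k ∘ₗ inl k)) := inferInstance
  have f₁ : ∀ u, mulMap₂ (inl k) (inr k ∘ₗ inr k) (inl k u) = Q.legX u :=
    LinearMap.congr_fun (lift_comp_inl _ _)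
  have f₂ : ∀ u, mulMap₂ (inl k) (inr k ∘ₗ inl k) (inl k u) = Q.legX u :=
    LinearMap.congr_fun (lift_comp_inl _ _)
  have f₃ : ∀ u, mulMap₂ (inl k) (inr k ∘ₗ inr k) (inr k (Q.iD u)) = Q.legW u := fun u =>
    LinearMap.congr_fun (lift_comp_inr (inl k) (inr k ∘ₗ inr k :
      Q.QuantumDouble →ₗ[k] H ⊗[k] (Q.QuantumDouble ⊗[k] Q.QuantumDouble))) (Q.iD u)
  have f₄ : ∀ u, mulMap₂ (inl k) (inr k ∘ₗ inl k) (inr k (Q.iD u)) = Q.legV u := fun u =>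
    LinearMap.congr_fun (lift_comp_inr (inl k) (inr k ∘ₗ inl k :
      Q.QuantumDouble →ₗ[k] H ⊗[k] (Q.QuantumDouble ⊗[k] Q.QuantumDouble))) (Q.iD u)
  rw [Leg.map_mul, Leg.map_mul, Leg.map_mul, Leg.map_mul, Leg.map_mul, Leg.map_mul, Leg.map_mul,
    Leg.map_mul, f₁, f₁, f₂, f₂, f₃, f₃, f₄, f₄, Leg.map_one, one_mul]
  simp only [gamV, gamW, mul_assoc]

theorem legV_mul_legX (a b : H) : Q.legV a * Q.legX b = Q.legX b * Q.legV a := Cm.comm _ _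
theorem legW_mul_legX (a b : H) : Q.legW a * Q.legX b = Q.legX b * Q.legW a := Cm.comm _ _
theorem legW_mul_legV (a b : H) : Q.legW a * Q.legV b = Q.legV b * Q.legW a := Cm.comm _ _
theorem legW_mul_gamV (a : H) : Q.legW a * Q.gamV = Q.gamV * Q.legW a := by
  have : Intw Q.gamV Q.legW Q.legW := by unfold gamV legW; infer_instance
  exact (this.intw a).symm

theorem swap_assoc {a b : B} (h : a * b = b * a) (t : B) : a * (b * t) = b * (a * t) := by
  rw [← mul_assoc, h, mul_assoc]

/-- The left-hand side of `comulD_bow`, as a linear function of the element of `T43 k H`. -/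
def comulOut (φ : Module.Dual k H) : T43 k H →ₗ[k] Q.QuantumDouble ⊗[k] Q.QuantumDouble :=
  LinearMap.applyₗ (Q.swapBow (dualComul φ)) ∘ₗ TensorProduct.homTensorHomMap (RingHom.id k) _ _ _ _
    ∘ₗ TensorProduct.map Q.act4 Q.act3

theorem comulOut_tmul (φ : Module.Dual k H) (a b c d e f g : H) :
    Q.comulOut φ ((a ⊗ₜ (b ⊗ₜ (c ⊗ₜ d))) ⊗ₜ (e ⊗ₜ (f ⊗ₜ g))) =
    con φ (Q.legX f * Q.gamW * Q.legX e * Q.legW g * Q.legV a * Q.legX c * Q.gamV * Q.legX b *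
      Q.legV d) := Q.comulD_tmul φ a b c d e f g

/-- Checked on elementary tensors: the factors with X and Y produce two associators, the factor with
p_R rebuilds the half-braiding of the first leg from its mate, and the last factor from Φ⁻¹ is the
remaining inverse associator. -/
theorem comulOut_mul (φ : Module.Dual k H) (U U' P Z : T3 k H) (w : H ⊗[k] H) :
    Q.comulOut φ (mulMap₂ (l71 k H) (mulMap₂ (mulMap₂ (l75 k H) (l77 k H) ∘ₗ Q.comul)
        (l76 k H ∘ₗ Q.SInv)) U *
      mulMap₂ (l71 k H) (mulMap₂ (l73 k H) (l77 k H)) U' *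
      mulMap₂ (mulMap₂ (l72 k H) (l74 k H) ∘ₗ Q.comul) (l73 k H ∘ₗ Q.SInv)
        ((mulMap₂ (LinearMap.mulRight k Q.β) Q.S).lTensor H P) *
      mulMap₂ (l72 k H) (mulMap₂ (l74 k H) (l77 k H)) Z * mulMap₂ (l74 k H) (l77 k H) w) =
    con φ (act Q.gamW (mulMap₂ (rho ∘ₗ Q.legV) (mulMap₂ (Q.tp (rho ∘ₗ Q.legX) (rho ∘ₗ Q.legW))
        (Q.cl Q.legX)) U * mulMap₂ (rho ∘ₗ Q.legV) (mulMap₂ (rho ∘ₗ Q.legX) (rho ∘ₗ Q.legW)) U' *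
        rho (Q.rcMap Q.legX Q.legV Q.gamV P * mulMap₂ Q.legX (mulMap₂ Q.legV Q.legW) Z)) *
      mulMap₂ Q.legV Q.legW w) := by
  induction U using TensorProduct.induction_on with
  | zero => simp only [map_zero, zero_mul]
  | add a b ha hb => simp only [map_add, add_mul, ha, hb]
  | tmul u₁ U =>
  induction U using TensorProduct.induction_on with
  | zero => simp only [map_zero, zero_mul, TensorProduct.tmul_zero]
  | add a b ha hb => simp only [map_add, add_mul, TensorProduct.tmul_add, ha, hb]
  | tmul u₂ u₃ =>
  simp only [mulMap₂_tmul, tp, LinearMap.comp_apply]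
  generalize Q.comul u₂ = U
  induction U using TensorProduct.induction_on with
  | zero => simp only [map_zero, zero_mul, mul_zero]
  | add a b ha hb => simp only [map_add, add_mul, mul_add, ha, hb]
  | tmul u₂ u₄ =>
  induction U' using TensorProduct.induction_on with
  | zero => simp only [map_zero, zero_mul, mul_zero]
  | add a b ha hb => simp only [map_add, add_mul, mul_add, ha, hb]
  | tmul a₁ U =>
  induction U using TensorProduct.induction_on with
  | zero => simp only [map_zero, zero_mul, mul_zero, TensorProduct.tmul_zero]
  | add a b ha hb => simp only [map_add, add_mul, mul_add, TensorProduct.tmul_add, ha, hb]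
  | tmul a₂ a₃ =>
  induction P using TensorProduct.induction_on with
  | zero => simp only [map_zero, zero_mul, mul_zero]
  | add a b ha hb => simp only [map_add, add_mul, mul_add, ha, hb]
  | tmul p₁ U =>
  induction U using TensorProduct.induction_on with
  | zero => simp only [map_zero, zero_mul, mul_zero, TensorProduct.tmul_zero]
  | add a b ha hb => simp only [map_add, add_mul, mul_add, TensorProduct.tmul_add, ha, hb]
  | tmul p₂ p₃ =>
  simp only [mulMap₂_tmul, tp, LinearMap.comp_apply, LinearMap.lTensor_tmul, rcMap]
  generalize Q.comul p₁ = U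
  induction U using TensorProduct.induction_on with
  | zero => simp only [map_zero, zero_mul, mul_zero]
  | add a b ha hb => simp only [map_add, add_mul, mul_add, ha, hb]
  | tmul p₁ p₄ =>
  induction Z using TensorProduct.induction_on with
  | zero => simp only [map_zero, zero_mul, mul_zero]
  | add a b ha hb => simp only [map_add, add_mul, mul_add, ha, hb]
  | tmul z₁ U =>
  induction U using TensorProduct.induction_on with
  | zero => simp only [map_zero, zero_mul, mul_zero, TensorProduct.tmul_zero]
  | add a b ha hb => simp only [map_add, add_mul, mul_add, TensorProduct.tmul_add, ha, hb]
  | tmul z₂ z₃ =>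
  induction w using TensorProduct.induction_on with
  | zero => simp only [map_zero, mul_zero]
  | add a b ha hb => simp only [map_add, mul_add, ha, hb]
  | tmul w₁ w₂ =>
  simp only [mulMap₂_tmul, LinearMap.comp_apply, l71, l72, l73, l74, l75, l76, l77, l31, l32, l33,
    l41, l42, l43, l44, inl, inr, LinearMap.flip_apply, TensorProduct.mk_apply,
    Algebra.TensorProduct.tmul_mul_tmul, mul_one, one_mul, comulOut_tmul, act_mul, act_rho, act_lam,
    LinearMap.mulRight_apply, LinearEquiv.coe_coe, TensorProduct.comm_tmul,
    Anti.map_mul (x := Q.SInv), hQ.SInv_S, Leg.map_mul, Algebra.TensorProduct.one_def]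
  simp only [mul_assoc, legV_mul_legX, legW_mul_legX, legW_mul_legV, legW_mul_gamV,
    swap_assoc (Q.legV_mul_legX _ _), swap_assoc (Q.legW_mul_legX _ _),
    swap_assoc (Q.legW_mul_legV _ _), swap_assoc (Q.legW_mul_gamV _)]

theorem gm_legW : Q.gm Q.legX Q.legW (mulMap₂ (inl k) (inr k ∘ₗ inr k) Q.rD) = Q.gamW := by
  have e := Q.map_gm (mulMap₂ (inl k : H →ₗ[k] H ⊗[k] (Q.QuantumDouble ⊗[k] Q.QuantumDouble))
    (inr k ∘ₗ inr k)) (inl k) (inr k ∘ₗ Q.iD) Q.rD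
  rw [gm_rD, lift_comp_inl, lift_inr_comp] at e
  exact e.symm

theorem gm_legV : Q.gm Q.legX Q.legV (mulMap₂ (inl k) (inr k ∘ₗ inl k) Q.rD) = Q.gamV := by
  have e := Q.map_gm (mulMap₂ (inl k : H →ₗ[k] H ⊗[k] (Q.QuantumDouble ⊗[k] Q.QuantumDouble))
    (inr k ∘ₗ inl k)) (inl k) (inr k ∘ₗ Q.iD) Q.rD
  rw [gm_rD, lift_comp_inl, lift_inr_comp] at e
  exact e.symm

theorem gm_pair_eq (x v w : H →ₗ[k] B) [Leg x] [Leg v] [Leg w] [Cm x v] [Cm x w]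
    [Cm v w] {a b Gv Gw : B} (ha : Intw a (Q.tp x v) (Q.tp v x)) (hb : Intw b (Q.tp x w) (Q.tp w x))
    (hb' : Intw b v v) (hv : Q.gm x v a = Gv) (hw : Q.gm x w b = Gw) :
    Q.gm x (Q.tp v w) (Q.pair x v w a b) = act Gw
      (Q.ph (rho ∘ₗ v) (Q.tp (rho ∘ₗ x) (rho ∘ₗ w)) (Q.cl x) *
        Q.ph (rho ∘ₗ v) (rho ∘ₗ x) (rho ∘ₗ w) * rho (Q.rc x v Gv * Q.pb x v w)) := by
  rw [gm_pair, hw, ← hv, rc_gm]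

theorem intw_rV : Intw (mulMap₂ (inl k) (inr k ∘ₗ inl k) Q.rD) (Q.tp Q.legX Q.legV)
    (Q.tp Q.legV Q.legX) := by
  have h := Q.rD_isR.lift_intw (inl k) (inr k ∘ₗ inl k :
      Q.QuantumDouble →ₗ[k] H ⊗[k] (Q.QuantumDouble ⊗[k] Q.QuantumDouble))
  unfold legX legV
  simpa only [LinearMap.comp_assoc] using h

theorem intw_rW : Intw (mulMap₂ (inl k) (inr k ∘ₗ inr k) Q.rD) (Q.tp Q.legX Q.legW)
    (Q.tp Q.legW Q.legX) := by
  have h := Q.rD_isR.lift_intw (inl k) (inr k ∘ₗ inr k :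
      Q.QuantumDouble →ₗ[k] H ⊗[k] (Q.QuantumDouble ⊗[k] Q.QuantumDouble))
  unfold legX legW
  simpa only [LinearMap.comp_assoc] using h

theorem intw_rW_legV : Intw (mulMap₂ (inl k) (inr k ∘ₗ inr k) Q.rD :
      H ⊗[k] (Q.QuantumDouble ⊗[k] Q.QuantumDouble)) Q.legV Q.legV := by
  unfold legV
  infer_instance

theorem pairR_rD : Q.pairR Q.iD Q.rD Q.iD Q.rD = Q.pair Q.legX Q.legV Q.legW
    (mulMap₂ (inl k) (inr k ∘ₗ inl k) Q.rD) (mulMap₂ (inl k) (inr k ∘ₗ inr k) Q.rD) := rfl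

theorem gm_pairR_rD :
    Q.gm Q.legX (Q.tp Q.legV Q.legW) (Q.pairR Q.iD Q.rD Q.iD Q.rD) = act Q.gamW
      (Q.ph (rho ∘ₗ Q.legV) (Q.tp (rho ∘ₗ Q.legX) (rho ∘ₗ Q.legW)) (Q.cl Q.legX) *
        Q.ph (rho ∘ₗ Q.legV) (rho ∘ₗ Q.legX) (rho ∘ₗ Q.legW) *
        rho (Q.rc Q.legX Q.legV Q.gamV * Q.pb Q.legX Q.legV Q.legW)) := by
  rw [pairR_rD]
  exact Q.gm_pair_eq _ _ _ Q.intw_rV Q.intw_rW Q.intw_rW_legV Q.gm_legV Q.gm_legW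

theorem comulElt_eq (h : H) : Q.comulElt h =
    mulMap₂ (l71 k H) (mulMap₂ (mulMap₂ (l75 k H) (l77 k H) ∘ₗ Q.comul)
        (l76 k H ∘ₗ Q.SInv)) Q.Phi *
      mulMap₂ (l71 k H) (mulMap₂ (l73 k H) (l77 k H)) Q.Phi *
      mulMap₂ (mulMap₂ (l72 k H) (l74 k H) ∘ₗ Q.comul) (l73 k H ∘ₗ Q.SInv)
        ((mulMap₂ (LinearMap.mulRight k Q.β) Q.S).lTensor H Q.PhiInv) *
      mulMap₂ (l72 k H) (mulMap₂ (l74 k H) (l77 k H)) Q.PhiInv *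
        mulMap₂ (l74 k H) (l77 k H) (Q.comul h) := rfl

theorem comulD_eq_comulOut (φ : Module.Dual k H) (h : H) :
    Q.comulD (Q.bow φ h) = Q.comulOut φ (Q.comulElt h) := rfl

theorem inr_tp_iD : inr k ∘ₗ Q.tp (inl k ∘ₗ Q.iD) (inr k ∘ₗ Q.iD) = Q.tp Q.legV Q.legW := by
  rw [comp_tp]
  rfl

theorem legVW_comul (h : H) : mulMap₂ Q.legV Q.legW (Q.comul h) =
    inr k (Q.tp (inl k ∘ₗ Q.iD) (inr k ∘ₗ Q.iD) h) := by
  rw [← LinearMap.comp_apply (inr k), inr_tp_iD]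
  rfl

/-- The explicit formula for Δ_D is the mate of the tensor square of the canonical half-braiding,
expanded by `gm_pairR_rD`. All further properties of Δ_D follow from this description. -/
theorem comulD_eq_theta : Q.comulD = Q.theta (Q.tp (inl k ∘ₗ Q.iD) (inr k ∘ₗ Q.iD))
    (Q.pairR Q.iD Q.rD Q.iD Q.rD) := by
  refine LinearMap.ext fun X => ?_
  induction X using double_induction with
  | ha a b ha hb => rw [map_add, map_add, ha, hb]
  | hb φ h =>
  rw [theta_bow, inr_tp_iD, comulD_eq_comulOut, comulElt_eq, comulOut_mul, legVW_comul,
    con_mul_inr]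
  congr 2
  exact Q.gm_pairR_rD.symm

end Pure

end Comul

/-! ### The double as a quasi-bialgebra -/

section Bialgebra

variable {k H B C E : Type*} [Field k] [Ring H] [Algebra k H] [Ring B] [Algebra k B] [Ring C]
  [Algebra k C] [Ring E] [Algebra k E] (Q : QuasiHopfData k H) [FiniteDimensional k H]

/-- The diagonal action of the double on two legs. -/
def tpD (j j' : Q.QuantumDouble →ₗ[k] B) : Q.QuantumDouble →ₗ[k] B := mulMap₂ j j' ∘ₗ Q.comulD

/-- The trivial action of the double. -/
def unD : Q.QuantumDouble →ₗ[k] B := Algebra.linearMap k B ∘ₗ Q.counitD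

theorem comp_tpD (π : B →ₗ[k] C) [Leg π] (j j' : Q.QuantumDouble →ₗ[k] B) :
    π ∘ₗ Q.tpD j j' = Q.tpD (π ∘ₗ j) (π ∘ₗ j') := by
  rw [tpD, tpD, ← LinearMap.comp_assoc, map_mulMap₂]

theorem comp_unD (π : B →ₗ[k] C) [Leg π] :
    π ∘ₗ (Q.unD : Q.QuantumDouble →ₗ[k] B) = Q.unD := by
  ext1 X
  simp only [unD, LinearMap.comp_apply, Algebra.linearMap_apply, Algebra.algebraMap_eq_smul_one,
    map_smul, Leg.map_one]

variable [hQ : Q.Regular]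

instance Leg.comulD : Leg Q.comulD := by
  rw [comulD_eq_theta]
  exact (Q.rD_isR.pair Q.rD_isR).leg_theta

instance Leg.tpD (j j' : Q.QuantumDouble →ₗ[k] B) [Leg j] [Leg j'] [Cm j j'] :
    Leg (Q.tpD j j') := by unfold QuasiHopfData.tpD; infer_instance

instance Cm.tpD_left {A : Type*} [Ring A] [Algebra k A] (j j' : Q.QuantumDouble →ₗ[k] B)
    (z : A →ₗ[k] B) [Cm j z] [Cm j' z] : Cm (Q.tpD j j') z := by
  unfold tpD; infer_instance

instance Cm.tpD_right {A : Type*} [Ring A] [Algebra k A] (j j' : Q.QuantumDouble →ₗ[k] B)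
    (z : A →ₗ[k] B) [Cm z j] [Cm z j'] : Cm z (Q.tpD j j') := by
  unfold tpD; infer_instance

theorem mulMap₂_comp_tp_iD (j j' : Q.QuantumDouble →ₗ[k] B) [Leg j] [Leg j'] [Cm j j'] :
    mulMap₂ j j' ∘ₗ Q.tp (inl k ∘ₗ Q.iD) (inr k ∘ₗ Q.iD) = Q.tp (j ∘ₗ Q.iD) (j' ∘ₗ Q.iD) := by
  rw [comp_tp, lift_inl_comp, lift_inr_comp]

theorem tpD_iD (j j' : Q.QuantumDouble →ₗ[k] B) [Leg j] [Leg j'] [Cm j j'] :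
    Q.tpD j j' ∘ₗ Q.iD = Q.tp (j ∘ₗ Q.iD) (j' ∘ₗ Q.iD) := by
  rw [tpD, LinearMap.comp_assoc, comulD_eq_theta, (Q.rD_isR.pair Q.rD_isR).theta_comp_iD,
    mulMap₂_comp_tp_iD]

theorem lTensor_comulD : Q.comulD.lTensor H Q.rD = Q.pairR Q.iD Q.rD Q.iD Q.rD := by
  rw [comulD_eq_theta, (Q.rD_isR.pair Q.rD_isR).lTensor_theta]

theorem lift_tpD (x : H →ₗ[k] B) [Leg x] (j j' : Q.QuantumDouble →ₗ[k] B) [Leg j] [Leg j']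
    [Cm x j] [Cm x j'] [Cm j j'] : mulMap₂ x (Q.tpD j j') Q.rD =
      Q.pair x (j ∘ₗ Q.iD) (j' ∘ₗ Q.iD) (mulMap₂ x j Q.rD) (mulMap₂ x j' Q.rD) := by
  rw [tpD, ← mulMap₂_lTensor, lTensor_comulD, lift_pairR]

variable {Q} in
theorem double_hom_ext' {θ θ' : Q.QuantumDouble →ₗ[k] E} [Leg θ] [Leg θ']
    (h : θ ∘ₗ Q.iD = θ' ∘ₗ Q.iD) (h' : mulMap₂ (inl k) (inr k ∘ₗ θ) Q.rD =
      (mulMap₂ (inl k) (inr k ∘ₗ θ') Q.rD : H ⊗[k] E)) : θ = θ' :=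
  double_hom_ext h (by rw [lTensor_eq, lTensor_eq, h'])

/-! #### The counit -/

theorem isR_un : Q.IsR (Q.un : H →ₗ[k] B) (1 : H ⊗[k] B) where
  leg := inferInstance
  intw := ⟨fun a => by rw [comp_un, tp_un, un_tp, one_mul, mul_one]⟩
  hex := by
    rw [Leg.map_one, Leg.map_one, Leg.map_one, comp_un, comp_un]
    simp only [hex, ph_un₁, pb_un₂, ph_un₃, mul_one]
  counit := Leg.map_one

theorem gm_un_one (x : H →ₗ[k] B) [Leg x] : Q.gm x Q.un 1 = x (Q.SInv Q.α) := by
  rw [gm, comp_un, ph_un₁, one_mul, Leg.map_one, act_one]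

/-- The trivial half-braiding 1 has mate S⁻¹(α), which explains the factor φ(S⁻¹(α)) in ε_D. -/
theorem unD_eq_theta : (Q.unD : Q.QuantumDouble →ₗ[k] B) = Q.theta Q.un 1 := by
  refine LinearMap.ext fun X => ?_
  induction X using double_induction with
  | ha a b ha hb => rw [map_add, map_add, ha, hb]
  | hb φ h =>
  rw [theta_bow, comp_un, gm_un_one, unD, LinearMap.comp_apply, counitD_bow]
  simp [inl, un_apply, Algebra.algebraMap_eq_smul_one, smul_smul, mul_comm]

instance Leg.unD : Leg (Q.unD : Q.QuantumDouble →ₗ[k] B) := by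
  rw [unD_eq_theta]
  exact Q.isR_un.leg_theta

instance Cm.unD_left {A : Type*} [Ring A] [Algebra k A] (x : A →ₗ[k] B) :
    Cm (Q.unD : Q.QuantumDouble →ₗ[k] B) x := ⟨fun a b => Algebra.commutes _ _⟩

theorem unD_iD : (Q.unD : Q.QuantumDouble →ₗ[k] B) ∘ₗ Q.iD = Q.un := by
  rw [unD_eq_theta, Q.isR_un.theta_comp_iD]

theorem lift_unD (x : H →ₗ[k] B) [Leg x] : mulMap₂ x Q.unD Q.rD = 1 := by
  have e : (Q.unD : Q.QuantumDouble →ₗ[k] B) = Algebra.linearMap k B ∘ₗ Q.unD := by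
    ext1 X; simp [unD]
  have l : Leg (Algebra.linearMap k B) := ⟨map_one (algebraMap k B), map_mul (algebraMap k B)⟩
  have c : Cm x (Algebra.linearMap k B) := ⟨fun a b => (Algebra.commutes _ _).symm⟩
  rw [e, ← mulMap₂_lTensor, unD_eq_theta, Q.isR_un.lTensor_theta, Leg.map_one]

theorem pair_un_right (x v : H →ₗ[k] B) [Leg x] [Leg v] [Cm x v] (r s : B) :
    Q.pair x v Q.un r s = s * r := by
  rw [pair, pb_un₂, ph_un₃, pb_un₃, one_mul, mul_one, mul_one]

theorem pair_un_left (x v : H →ₗ[k] B) [Leg x] [Leg v] [Cm x v] (r s : B) :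
    Q.pair x Q.un v r s = s * r := by
  rw [pair, pb_un₁, ph_un₁, pb_un₂, one_mul, mul_one, mul_one]

theorem tpD_unD : Q.tpD LinearMap.id Q.unD = LinearMap.id := by
  refine double_hom_ext' ?_ ?_
  · rw [tpD_iD, unD_iD, tp_un]
  · rw [comp_tpD, lift_tpD, comp_unD, unD_iD, pair_un_right, lift_unD, one_mul]

theorem unD_tpD : Q.tpD Q.unD LinearMap.id = LinearMap.id := by
  refine double_hom_ext' ?_ ?_
  · rw [tpD_iD, unD_iD, un_tp]
  · rw [comp_tpD, lift_tpD, comp_unD, unD_iD, pair_un_left, lift_unD, mul_one]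

/-! #### Quasi-coassociativity -/

/-- The associator of three H-modules is compatible with their half-braidings; this is why Φ_D can
be taken to be the image of Φ. -/
theorem pair_assoc (x v w z : H →ₗ[k] B) [Leg x] [Leg v] [Leg w] [Leg z] [Cm x v] [Cm x w] [Cm x z]
    [Cm v w] [Cm v z] [Cm w z] (rv rw rz : B)
    [Intw rv (Q.tp x v) (Q.tp v x)] [Intw rv w w] [Intw rv z z]
    [Intw rw (Q.tp x w) (Q.tp w x)] [Intw rw v v] [Intw rw z z]
    [Intw rz (Q.tp x z) (Q.tp z x)] [Intw rz v v] [Intw rz w w] :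
    Q.ph v w z * Q.pair x (Q.tp v w) z (Q.pair x v w rv rw) rz * Q.pb v w z =
      Q.pair x v (Q.tp w z) rv (Q.pair x w z rw rz) := by
  simp only [pair]
  have h1 := Q.pentagon_inv x v w z
  have h2 := Q.pb_nat (rv) (Q.tp x v) w z (Q.tp v x) w z
  have h3 := Q.pentagon₃ v x w z
  have h4 := Q.pb_nat (rw) v (Q.tp x w) z v (Q.tp w x) z
  have h5 := Q.pentagon₄ v w x z
  have h6 := Q.pb_nat (rz) v w (Q.tp x z) v w (Q.tp z x)
  have h7 := Q.pentagon₃ v w z x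
  have h8 := Q.ph_mul_pb v w (Q.tp z x)
  linear_combination (norm := noncomm_ring)
    (Q.ph v w z * Q.pb (Q.tp v w) z x * rz * Q.ph (Q.tp v w) x z * Q.pb v w x * rw *
        Q.ph v x w * rv) * h1
    + (Q.ph v w z * Q.pb (Q.tp v w) z x * rz * Q.ph (Q.tp v w) x z * Q.pb v w x * rw *
        Q.ph v x w) * h2 * (Q.pb x v (Q.tp w z))
    + (Q.ph v w z * Q.pb (Q.tp v w) z x * rz * Q.ph (Q.tp v w) x z * Q.pb v w x * rw) * h3 *
        (rv * Q.pb x v (Q.tp w z))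
    + (Q.ph v w z * Q.pb (Q.tp v w) z x * rz * Q.ph (Q.tp v w) x z * Q.pb v w x) * h4 *
        (Q.pb x w z * Q.ph v x (Q.tp w z) * rv * Q.pb x v (Q.tp w z))
    - (Q.ph v w z * Q.pb (Q.tp v w) z x * rz) * h5 * (rw * Q.pb x w z * Q.ph v x (Q.tp w z) *
        rv * Q.pb x v (Q.tp w z))
    + (Q.ph v w z * Q.pb (Q.tp v w) z x) * h6 * (Q.ph w x z * rw * Q.pb x w z *
        Q.ph v x (Q.tp w z) * rv * Q.pb x v (Q.tp w z))
    + h7 * (Q.pb v w (Q.tp z x) * rz * Q.ph w x z * rw * Q.pb x w z * Q.ph v x (Q.tp w z) * rv *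
        Q.pb x v (Q.tp w z))
    + (Q.pb v (Q.tp w z) x * Q.pb w z x) * h8 * (rz * Q.ph w x z * rw * Q.pb x w z *
        Q.ph v x (Q.tp w z) * rv * Q.pb x v (Q.tp w z))

/-- The conjugate of an algebra map by a unit. -/
theorem Leg.conj (θ : C →ₗ[k] B) [Leg θ] {u u' : B} (h : u' * u = 1) (h' : u * u' = 1) :
    Leg (LinearMap.mulLeft k u ∘ₗ LinearMap.mulRight k u' ∘ₗ θ) where
  map_one := by simp [Leg.map_one, h']
  map_mul a b := by
    simp only [LinearMap.comp_apply, LinearMap.mulLeft_apply, LinearMap.mulRight_apply,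
      Leg.map_mul]
    linear_combination (norm := noncomm_ring) -(u * θ a) * h * (θ b * u')

instance intw_lift_rD (x : H →ₗ[k] B) (j : Q.QuantumDouble →ₗ[k] B) [Leg x] [Leg j] [Cm x j] :
    Intw (mulMap₂ x j Q.rD) (Q.tp x (j ∘ₗ Q.iD)) (Q.tp (j ∘ₗ Q.iD) x) :=
  Q.rD_isR.lift_intw x j

theorem inr_conj (θ : C →ₗ[k] B) (u u' : B) (w : H ⊗[k] C) :
    mulMap₂ (inl k) (inr k ∘ₗ LinearMap.mulLeft k u ∘ₗ LinearMap.mulRight k u' ∘ₗ θ) w =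
      (inr k u * mulMap₂ (inl k) (inr k ∘ₗ θ) w * inr k u' : H ⊗[k] B) := by
  induction w using TensorProduct.induction_on with
  | zero => simp
  | add a b ha hb => simp only [map_add, ha, hb, mul_add, add_mul]
  | tmul a b => simp [inl, inr, mul_assoc]

theorem lift_assoc (x : H →ₗ[k] B) [Leg x] (j₁ j₂ j₃ : Q.QuantumDouble →ₗ[k] B) [Leg j₁] [Leg j₂]
    [Leg j₃] [Cm x j₁] [Cm x j₂] [Cm x j₃] [Cm j₁ j₂] [Cm j₁ j₃] [Cm j₂ j₃] :
    Q.ph (j₁ ∘ₗ Q.iD) (j₂ ∘ₗ Q.iD) (j₃ ∘ₗ Q.iD) * mulMap₂ x (Q.tpD (Q.tpD j₁ j₂) j₃) Q.rD *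
      Q.pb (j₁ ∘ₗ Q.iD) (j₂ ∘ₗ Q.iD) (j₃ ∘ₗ Q.iD) = mulMap₂ x (Q.tpD j₁ (Q.tpD j₂ j₃)) Q.rD := by
  rw [lift_tpD, lift_tpD, lift_tpD, lift_tpD, tpD_iD, tpD_iD, pair_assoc]

/-- Conjugation by the associator preserves algebra maps, so both sides are algebra maps on the
double. They agree on H by quasi-coassociativity and on R by `pair_assoc`. -/
theorem tpD_assoc (j₁ j₂ j₃ : Q.QuantumDouble →ₗ[k] B) [Leg j₁] [Leg j₂]
    [Leg j₃] [Cm j₁ j₂] [Cm j₁ j₃] [Cm j₂ j₃] (X : Q.QuantumDouble) :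
    Q.tpD j₁ (Q.tpD j₂ j₃) X = Q.ph (j₁ ∘ₗ Q.iD) (j₂ ∘ₗ Q.iD) (j₃ ∘ₗ Q.iD) *
      Q.tpD (Q.tpD j₁ j₂) j₃ X * Q.pb (j₁ ∘ₗ Q.iD) (j₂ ∘ₗ Q.iD) (j₃ ∘ₗ Q.iD) := by
  set u := Q.ph (j₁ ∘ₗ Q.iD) (j₂ ∘ₗ Q.iD) (j₃ ∘ₗ Q.iD) with hu
  set u' := Q.pb (j₁ ∘ₗ Q.iD) (j₂ ∘ₗ Q.iD) (j₃ ∘ₗ Q.iD) with hu'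
  have h : u' * u = 1 := Q.pb_mul_ph _ _ _
  have h' : u * u' = 1 := Q.ph_mul_pb _ _ _
  have l := Leg.conj (Q.tpD (Q.tpD j₁ j₂) j₃) h h'
  have e : Q.tpD j₁ (Q.tpD j₂ j₃) =
      LinearMap.mulLeft k u ∘ₗ LinearMap.mulRight k u' ∘ₗ Q.tpD (Q.tpD j₁ j₂) j₃ := by
    refine double_hom_ext' ?_ ?_
    · rw [LinearMap.comp_assoc, LinearMap.comp_assoc, tpD_iD, tpD_iD, tpD_iD, tpD_iD]
      ext1 a
      simp only [LinearMap.comp_apply, LinearMap.mulLeft_apply, LinearMap.mulRight_apply]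
      rw [← mul_assoc, hu, Q.ph_intw, mul_assoc, h', mul_one]
    · rw [inr_conj, comp_tpD, comp_tpD, comp_tpD, comp_tpD, hu, hu', map_ph, map_pb,
        ← LinearMap.comp_assoc, ← LinearMap.comp_assoc, ← LinearMap.comp_assoc, lift_assoc]
  have e' := LinearMap.congr_fun e X
  simpa [mul_assoc] using e'

end Bialgebra

/-! ### The antipode of the double -/

section AntiMaps

variable {k A A' B C E F H : Type*} [Field k] [Ring A] [Algebra k A] [Ring A'] [Algebra k A']
  [Ring B] [Algebra k B] [Ring C] [Algebra k C] [Ring E] [Algebra k E] [Ring F] [Algebra k F]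
  [Ring H] [Algebra k H]

instance Anti.map (f : A →ₗ[k] A') (g : B →ₗ[k] C) [Anti f] [Anti g] :
    Anti (TensorProduct.map f g) where
  map_one := by
    rw [Algebra.TensorProduct.one_def, TensorProduct.map_tmul, Anti.map_one (x := f),
      Anti.map_one (x := g), Algebra.TensorProduct.one_def]
  map_mul a b := by
    induction a using TensorProduct.induction_on with
    | zero => simp
    | add a a' ha ha' => simp only [add_mul, mul_add, map_add, ha, ha']
    | tmul a a' =>
    induction b using TensorProduct.induction_on with
    | zero => simp
    | add a a' ha ha' => simp only [add_mul, mul_add, map_add, ha, ha']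
    | tmul b b' => simp [Anti.map_mul (x := f), Anti.map_mul (x := g)]

theorem Anti.comp_anti (x : A →ₗ[k] B) (y : B →ₗ[k] C) [Leg x] [Anti y] : Anti (y ∘ₗ x) :=
  ⟨by simp [Leg.map_one, Anti.map_one], fun a b => by simp [Leg.map_mul, Anti.map_mul (x := y)]⟩

theorem anti_mulMap₂ {M N : Type*} [AddCommGroup M] [Module k M] [AddCommGroup N] [Module k N]
    (J : B →ₗ[k] C) [Anti J] (p : M →ₗ[k] B) (q : N →ₗ[k] B) (h : ∀ a b, p a * q b = q b * p a)
    (w : M ⊗[k] N) : J (mulMap₂ p q w) = mulMap₂ (J ∘ₗ p) (J ∘ₗ q) w := by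
  induction w using TensorProduct.induction_on with
  | zero => simp
  | add a b ha hb => simp only [map_add, ha, hb]
  | tmul a b => simp only [mulMap₂_tmul, h, Anti.map_mul (x := J), LinearMap.comp_apply]

variable (Q : QuasiHopfData k H)

theorem anti_tp (J : B →ₗ[k] C) [Anti J] (p q : H →ₗ[k] B) [Cm p q] (z : H) :
    J (Q.tp p q z) = Q.tp (J ∘ₗ p) (J ∘ₗ q) z := anti_mulMap₂ J p q Cm.comm _

theorem anti_ph (J : B →ₗ[k] C) [Anti J] (p q r : H →ₗ[k] B) [Cm p q] [Cm p r] [Cm q r] :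
    J (Q.ph p q r) = Q.ph (J ∘ₗ p) (J ∘ₗ q) (J ∘ₗ r) := by
  rw [ph, anti_mulMap₂ J p (mulMap₂ q r) Cm.comm, show J ∘ₗ mulMap₂ q r = mulMap₂ (J ∘ₗ q) (J ∘ₗ r)
    from LinearMap.ext (anti_mulMap₂ J q r Cm.comm)]
  rfl

theorem anti_pb (J : B →ₗ[k] C) [Anti J] (p q r : H →ₗ[k] B) [Cm p q] [Cm p r] [Cm q r] :
    J (Q.pb p q r) = Q.pb (J ∘ₗ p) (J ∘ₗ q) (J ∘ₗ r) := by
  rw [pb, anti_mulMap₂ J p (mulMap₂ q r) Cm.comm, show J ∘ₗ mulMap₂ q r = mulMap₂ (J ∘ₗ q) (J ∘ₗ r)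
    from LinearMap.ext (anti_mulMap₂ J q r Cm.comm)]
  rfl

/-- The canonical anti-morphism onto the opposite algebra. -/
def opL : E →ₗ[k] Eᵐᵒᵖ := (MulOpposite.opLinearEquiv k).toLinearMap

/-- The canonical anti-morphism from the opposite algebra. -/
def unopL : Eᵐᵒᵖ →ₗ[k] E := (MulOpposite.opLinearEquiv k).symm.toLinearMap

variable (k) in
theorem unopL_opL (a : E) : unopL (k := k) (opL (k := k) a) = a := rfl

variable (k) in
theorem opL_unopL (a : Eᵐᵒᵖ) : opL (k := k) (unopL (k := k) a) = a := rfl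

instance Anti.opL : Anti (opL : E →ₗ[k] Eᵐᵒᵖ) := ⟨rfl, fun _ _ => rfl⟩
instance Anti.unopL : Anti (unopL : Eᵐᵒᵖ →ₗ[k] E) := ⟨rfl, fun _ _ => rfl⟩

/-- The element `Σ y(S x¹) ⋯` obtained from `Φ⁻¹`; compare `phS`. -/
def pbS (x y z : H →ₗ[k] B) : B :=
  mulMap₂ (z ∘ₗ Q.S) (mulMap₂ (y ∘ₗ Q.S) (x ∘ₗ Q.S)) Q.PhiInv

variable [hQ : Q.Regular]

theorem pb_lam_S (x y z : H →ₗ[k] B) [Leg x] [Leg y] [Leg z] [Cm x y] [Cm x z] [Cm y z] :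
    Q.pb (lam ∘ₗ z ∘ₗ Q.S) (lam ∘ₗ y ∘ₗ Q.S) (lam ∘ₗ x ∘ₗ Q.S) = lam (Q.pbS x y z) := by
  change _ = lam (Q.pb (z ∘ₗ Q.S) (y ∘ₗ Q.S) (x ∘ₗ Q.S))
  rw [Q.anti_pb (lam : B →ₗ[k] Op k B) (z ∘ₗ Q.S) (y ∘ₗ Q.S) (x ∘ₗ Q.S)]

theorem pbS_mul_phS (x y z : H →ₗ[k] B) [Leg x] [Leg y] [Leg z] [Cm x y] [Cm x z] [Cm y z] :
    Q.pbS x y z * Q.phS x y z = 1 := by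
  have h := Q.ph_mul_pb (lam ∘ₗ z ∘ₗ Q.S) (lam ∘ₗ y ∘ₗ Q.S) (lam ∘ₗ x ∘ₗ Q.S)
  rw [ph_lam_S, pb_lam_S, ← Anti.map_mul] at h
  simpa using congrArg (act 1) h

/-- The hexagon for the image of the R-matrix under the antipodes. -/
theorem antipode_hex [FiniteDimensional k H] (x y v : H →ₗ[k] B) [Leg x] [Leg y] [Leg v] [Cm x y]
    [Cm x v] [Cm y v] (rx ry : B) [Intw rx (Q.tp x v) (Q.tp v x)] [Intw rx y y]
    [Intw ry (Q.tp y v) (Q.tp v y)] [Intw ry x x] :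
    Q.tw y x * (Q.tw v (Q.tp y x) * Q.hex y x v ry rx * Q.ti (Q.tp y x) v) * Q.ti y x =
      Q.phS v y x * (Q.tw v y * ry * Q.ti y v) * Q.pbS y v x * (Q.tw v x * rx * Q.ti x v) *
        Q.phS y x v := by
  rw [hex]
  have h₁ := Q.twist_equation v y x
  have h₂ := Q.tw_nat ry (Q.tp y v) x (Q.tp v y) x
  have h₃ := Q.twist_equation y v x
  have h₄ := Q.tw_nat rx y (Q.tp x v) y (Q.tp v x)
  have h₅ := Q.twist_equation y x v
  have c₁ := Q.ph_mul_pb y v x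
  have c₂ := Q.pbS_mul_phS y v x
  have c₃ := Q.ti_mul_tw y v
  have c₄ := Q.ti_mul_tw x v
  have c₅ := Q.tw_mul_ti (Q.tp y x) v
  have c₆ := Q.tw_mul_ti y x
  -- This relation and the next are the twist equations for (y, v, x) and (y, x, v), solved for the
  -- twists that meet the associators of the hexagon.
  have e₃ : Q.tw (Q.tp y v) x * Q.pb y v x =
      Q.ti y v * Q.pbS y v x * Q.tw v x * Q.tw y (Q.tp v x) := by
    linear_combination (norm := noncomm_ring)
      - c₃ * Q.tw (Q.tp y v) x * Q.pb y v x
      - Q.ti y v * c₂ * Q.tw y v * Q.tw (Q.tp y v) x * Q.pb y v x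
      - Q.ti y v * Q.pbS y v x * h₃ * Q.pb y v x
      + Q.ti y v * Q.pbS y v x * Q.tw v x * Q.tw y (Q.tp v x) * c₁
  have e₅ : Q.tw y (Q.tp x v) * Q.ph y x v =
      Q.ti x v * Q.phS y x v * Q.tw y x * Q.tw (Q.tp y x) v := by
    linear_combination (norm := noncomm_ring)
      - c₄ * Q.tw y (Q.tp x v) * Q.ph y x v + Q.ti x v * h₅
  linear_combination (norm := noncomm_ring)
    h₁ * (ry * Q.pb y v x * rx * Q.ph y x v * Q.ti (Q.tp y x) v * Q.ti y x)
    - Q.phS v y x * Q.tw v y * h₂ * (Q.pb y v x * rx * Q.ph y x v * Q.ti (Q.tp y x) v * Q.ti y x)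
    + Q.phS v y x * Q.tw v y * ry * e₃ * (rx * Q.ph y x v * Q.ti (Q.tp y x) v * Q.ti y x)
    - Q.phS v y x * Q.tw v y * ry * Q.ti y v * Q.pbS y v x * Q.tw v x * h₄ *
        (Q.ph y x v * Q.ti (Q.tp y x) v * Q.ti y x)
    + Q.phS v y x * Q.tw v y * ry * Q.ti y v * Q.pbS y v x * Q.tw v x * rx * e₅ *
        (Q.ti (Q.tp y x) v * Q.ti y x)
    + Q.phS v y x * Q.tw v y * ry * Q.ti y v * Q.pbS y v x * Q.tw v x * rx * Q.ti x v *
        Q.phS y x v * Q.tw y x * c₅ * Q.ti y x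
    + Q.phS v y x * Q.tw v y * ry * Q.ti y v * Q.pbS y v x * Q.tw v x * rx * Q.ti x v *
        Q.phS y x v * c₆

end AntiMaps

/-! ### Duals of half-braidings. -/

section IsR

variable {k B E H : Type*} [Field k] [Ring B] [Algebra k B] [Ring E] [Algebra k E]
  [Ring H] [Algebra k H] (Q : QuasiHopfData k H)

/-- The element `f₂₁ R f⁻¹`. -/
def conjR (i : H →ₗ[k] E) (R : H ⊗[k] E) : H ⊗[k] E :=
  Q.tw (inr k ∘ₗ i) (inl k) * R * Q.ti (inl k) (inr k ∘ₗ i)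

/-- The element `(S⁻¹ ⊗ id)(f₂₁ R f⁻¹)` of `H ⊗ Eᵒᵖ`. -/
def dualR (i : H →ₗ[k] E) (R : H ⊗[k] E) : H ⊗[k] Eᵐᵒᵖ :=
  TensorProduct.map Q.SInv opL (Q.conjR i R)

variable [hQ : Q.Regular]

theorem map_S_dualR (i : H →ₗ[k] E) (R : H ⊗[k] E) :
    TensorProduct.map Q.S unopL (Q.dualR i R) = Q.conjR i R := by
  rw [dualR]
  generalize Q.conjR i R = w
  induction w using TensorProduct.induction_on with
  | zero => simp
  | add a b ha hb => simp only [map_add, ha, hb]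
  | tmul a b => simp [hQ.S_SInv, unopL_opL]

/-- Identities with values in the opposite algebra can be checked after this anti-morphism, which
removes S⁻¹ and the passage to the opposite. -/
theorem map_S_injective : Function.Injective
    (TensorProduct.map Q.S unopL : H ⊗[k] Eᵐᵒᵖ →ₗ[k] H ⊗[k] E) := by
  refine Function.LeftInverse.injective (g := TensorProduct.map Q.SInv opL) fun w => ?_
  induction w using TensorProduct.induction_on with
  | zero => simp
  | add a b ha hb => simp only [map_add, ha, hb]
  | tmul a b => simp [hQ.SInv_S, opL_unopL]

theorem map_SS_injective : Function.Injective (TensorProduct.map Q.S (TensorProduct.map Q.S unopL) :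
    H ⊗[k] (H ⊗[k] Eᵐᵒᵖ) →ₗ[k] H ⊗[k] (H ⊗[k] E)) := by
  refine Function.LeftInverse.injective
    (g := TensorProduct.map Q.SInv (TensorProduct.map Q.SInv opL)) fun w => ?_
  induction w using TensorProduct.induction_on with
  | zero => simp
  | add a b ha hb => simp only [map_add, ha, hb]
  | tmul a w =>
  induction w using TensorProduct.induction_on with
  | zero => simp
  | add a b ha hb => simp only [map_add, ha, hb, TensorProduct.tmul_add]
  | tmul b c => simp [hQ.SInv_S, opL_unopL]

/-- The twist exchanges Δ(S(z)) with (S ⊗ S)Δᶜᵒᵖ(z), so conjugating with it turns the intertwining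
relation of r at S(z) into one for the antipode images. -/
theorem intw_conjR [FiniteDimensional k H] (x v : H →ₗ[k] B) [Leg x] [Leg v] [Cm x v] (r : B)
    [hr : Intw r (Q.tp x v) (Q.tp v x)] (z : H) :
    Q.tp (x ∘ₗ Q.S) (v ∘ₗ Q.S) z * (Q.tw v x * r * Q.ti x v) =
      Q.tw v x * r * Q.ti x v * Q.tp (v ∘ₗ Q.S) (x ∘ₗ Q.S) z := by
  have h₁ := (Intw.tw_S Q x v).intw z
  have h₂ := (Intw.tw_S Q v x).intw z
  have h₃ := hr.intw (Q.S z)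
  have c₁ := Q.ti_mul_tw x v
  have c₂ := Q.tw_mul_ti x v
  simp only [LinearMap.comp_apply] at h₁ h₂ h₃ 
  linear_combination (norm := noncomm_ring)
    - h₂ * (r * Q.ti x v) - Q.tw v x * h₃ * Q.ti x v
    + Q.tw v x * r * Q.ti x v * h₁ * Q.ti x v
    - Q.tw v x * r * c₁ * Q.tp x v (Q.S z) * Q.ti x v
    + Q.tw v x * r * Q.ti x v * Q.tp (v ∘ₗ Q.S) (x ∘ₗ Q.S) z * c₂

theorem lift_conjR (x : H →ₗ[k] B) (j : E →ₗ[k] B) [Leg x] [Leg j] [Cm x j] (i : H →ₗ[k] E)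
    (R : H ⊗[k] E) : mulMap₂ x j (Q.conjR i R) =
      Q.tw (j ∘ₗ i) x * mulMap₂ x j R * Q.ti x (j ∘ₗ i) := by
  rw [conjR, Leg.map_mul, Leg.map_mul, map_tw, map_ti, lift_comp_inl, ← LinearMap.comp_assoc,
    lift_comp_inr]

theorem leg_opL_comp_S (i : H →ₗ[k] E) [Leg i] : Leg (opL ∘ₗ i ∘ₗ Q.S) :=
  Leg.anti_anti (i ∘ₗ Q.S) opL

theorem map_comp_inl {A A' C C' : Type*} [Ring A] [Algebra k A] [Ring A'] [Algebra k A'] [Ring C]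
    [Algebra k C] [Ring C'] [Algebra k C'] (f : A →ₗ[k] A') (g : C →ₗ[k] C') [Anti g] :
    TensorProduct.map f g ∘ₗ inl k = inl k ∘ₗ f := by
  ext1 a; simp [inl, Anti.map_one (x := g)]

theorem map_comp_inr {A A' C C' : Type*} [Ring A] [Algebra k A] [Ring A'] [Algebra k A'] [Ring C]
    [Algebra k C] [Ring C'] [Algebra k C'] (f : A →ₗ[k] A') (g : C →ₗ[k] C') [Anti f] :
    TensorProduct.map f g ∘ₗ inr k = inr k ∘ₗ g := by
  ext1 a; simp [inr, Anti.map_one (x := f)]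

variable [FiniteDimensional k H] {Q} {i : H →ₗ[k] E} {R : H ⊗[k] E}

theorem IsR.intw_conjR (h : Q.IsR i R) (z : H) :
    Q.tp (inl k ∘ₗ Q.S) (inr k ∘ₗ i ∘ₗ Q.S) z * Q.conjR i R =
      Q.conjR i R * Q.tp (inr k ∘ₗ i ∘ₗ Q.S) (inl k ∘ₗ Q.S) z := by
  have := h.leg
  have := h.intw
  have e := Q.intw_conjR (inl k) (inr k ∘ₗ i) R z
  simp only [LinearMap.comp_assoc] at e
  exact e

theorem IsR.intw_dualR (h : Q.IsR i R) : Intw (Q.dualR i R)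
    (Q.tp (inl k) (inr k ∘ₗ opL ∘ₗ i ∘ₗ Q.S)) (Q.tp (inr k ∘ₗ opL ∘ₗ i ∘ₗ Q.S) (inl k)) := by
  refine ⟨fun z => Q.map_S_injective ?_⟩
  rw [Anti.map_mul, Anti.map_mul, map_S_dualR, anti_tp, anti_tp, map_comp_inl,
    ← LinearMap.comp_assoc, map_comp_inr]
  exact h.intw_conjR z

theorem IsR.lift_conjR_hex (h : Q.IsR i R) (x y : H →ₗ[k] B) [Leg x] [Leg y] [Cm x y]
    (j : E →ₗ[k] B) [Leg j] [Cm x j] [Cm y j] :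
    mulMap₂ (Q.tp (x ∘ₗ Q.S) (y ∘ₗ Q.S) ∘ₗ Q.SInv) j (Q.conjR i R) =
      Q.phS (j ∘ₗ i) y x * mulMap₂ y j (Q.conjR i R) * Q.pbS y (j ∘ₗ i) x *
        mulMap₂ x j (Q.conjR i R) * Q.phS y x (j ∘ₗ i) := by
  have := h.leg
  have n₁ := h.lift_intw x j
  have n₂ := h.lift_intw y j
  have e : Q.tp (x ∘ₗ Q.S) (y ∘ₗ Q.S) ∘ₗ Q.SInv =
      LinearMap.mulLeft k (Q.tw y x) ∘ₗ LinearMap.mulRight k (Q.ti y x) ∘ₗ Q.tp y x := by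
    ext1 a
    have h₁ := (Intw.tw_S Q y x).intw (Q.SInv a)
    have h₂ := Q.tw_mul_ti y x
    simp only [LinearMap.comp_apply, hQ.S_SInv, LinearMap.mulLeft_apply,
      LinearMap.mulRight_apply] at h₁ ⊢
    rw [← mul_assoc, h₁, mul_assoc, h₂, mul_one]
  have e' : ∀ w : H ⊗[k] E, mulMap₂ (LinearMap.mulLeft k (Q.tw y x) ∘ₗ
      LinearMap.mulRight k (Q.ti y x) ∘ₗ Q.tp y x) j w =
        Q.tw y x * mulMap₂ (Q.tp y x) j w * Q.ti y x := fun w => by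
    have c : ∀ b, j b * Q.ti y x = Q.ti y x * j b :=
      fun b => ((inferInstance : Intw (Q.ti y x) j j).intw b).symm
    induction w using TensorProduct.induction_on with
    | zero => simp
    | add a b ha hb => simp only [map_add, ha, hb, mul_add, add_mul]
    | tmul a b =>
      simp only [mulMap₂_tmul, LinearMap.comp_apply, LinearMap.mulLeft_apply,
        LinearMap.mulRight_apply, mul_assoc, c]
  rw [e, e', lift_conjR, lift_conjR, lift_conjR, h.lift_hex y x j, antipode_hex]

theorem anti_lift_dualR {B' : Type*} [Ring B'] [Algebra k B'] (J : B' →ₗ[k] B) [Anti J]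
    (p : H →ₗ[k] B') (q : Eᵐᵒᵖ →ₗ[k] B') [Cm p q] : J (mulMap₂ p q (Q.dualR i R)) =
      mulMap₂ (J ∘ₗ p ∘ₗ Q.SInv) (J ∘ₗ q ∘ₗ opL) (Q.conjR i R) := by
  rw [anti_mulMap₂ J p q Cm.comm, dualR, mulMap₂_map]
  rfl

theorem lift_un_conjR (h : Q.IsR i R) : mulMap₂ Q.un LinearMap.id (Q.conjR i R) = 1 := by
  have := h.leg
  rw [lift_conjR, h.counit, LinearMap.id_comp, tw_un_right, one_mul, one_mul]
  have e := Q.ti_mul_tw Q.un i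
  rwa [tw_un_left, mul_one] at e

/-- An injective anti-morphism reverses the products in the hexagon and reduces it to
`lift_conjR_hex`, a consequence of three twist equations. -/
theorem IsR.dual_hex (h : Q.IsR i R) :
    mulMap₂ (Q.tp (inl k) (inr k ∘ₗ inl k)) (inr k ∘ₗ inr k) (Q.dualR i R) =
    (Q.hex (inl k) (inr k ∘ₗ inl k) (inr k ∘ₗ inr k ∘ₗ opL ∘ₗ i ∘ₗ Q.S)
      (mulMap₂ (inl k) (inr k ∘ₗ inr k) (Q.dualR i R))
      (mulMap₂ (inr k ∘ₗ inl k) (inr k ∘ₗ inr k) (Q.dualR i R)) : H ⊗[k] (H ⊗[k] Eᵐᵒᵖ)) := by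
  have := h.leg
  apply Q.map_SS_injective
  generalize hJ : (TensorProduct.map Q.S (TensorProduct.map Q.S unopL) :
    H ⊗[k] (H ⊗[k] Eᵐᵒᵖ) →ₗ[k] H ⊗[k] (H ⊗[k] E)) = J
  have aJ : Anti J := by rw [← hJ]; infer_instance
  have j₁ : J ∘ₗ inl k = inl k ∘ₗ Q.S := by rw [← hJ, map_comp_inl]
  have j₂ : J ∘ₗ inr k ∘ₗ inl k = inr k ∘ₗ inl k ∘ₗ Q.S := by
    rw [← hJ, ← LinearMap.comp_assoc, map_comp_inr, LinearMap.comp_assoc, map_comp_inl]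
  have j₃ : J ∘ₗ inr k ∘ₗ inr k = inr k ∘ₗ inr k ∘ₗ unopL := by
    rw [← hJ, ← LinearMap.comp_assoc, map_comp_inr, LinearMap.comp_assoc, map_comp_inr]
  have s : ∀ f : H →ₗ[k] H ⊗[k] (H ⊗[k] E), (f ∘ₗ Q.S) ∘ₗ Q.SInv = f := fun f => by
    ext1 a; simp [hQ.S_SInv]
  have j₄ : J ∘ₗ inr k ∘ₗ inr k ∘ₗ opL ∘ₗ i ∘ₗ Q.S = inr k ∘ₗ inr k ∘ₗ i ∘ₗ Q.S := by
    rw [← LinearMap.comp_assoc, ← LinearMap.comp_assoc, LinearMap.comp_assoc (f := inr k), j₃]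
    rfl
  have j₅ : J ∘ₗ (inr k ∘ₗ inr k) ∘ₗ opL = inr k ∘ₗ inr k := by
    rw [← LinearMap.comp_assoc, j₃]
    rfl
  have j₆ : J ∘ₗ Q.tp (inl k) (inr k ∘ₗ inl k) = Q.tp (inl k ∘ₗ Q.S) (inr k ∘ₗ inl k ∘ₗ Q.S) := by
    ext1 z
    rw [LinearMap.comp_apply, anti_tp, j₁, j₂]
  have key := h.lift_conjR_hex (inl k) (inr k ∘ₗ inl k) (inr k ∘ₗ inr k :
    E →ₗ[k] H ⊗[k] (H ⊗[k] E))
  have s₁ : J ∘ₗ inl k ∘ₗ Q.SInv = inl k := by rw [← LinearMap.comp_assoc, j₁, s]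
  have s₂ : J ∘ₗ (inr k ∘ₗ inl k) ∘ₗ Q.SInv = inr k ∘ₗ inl k := by
    rw [← LinearMap.comp_assoc, j₂, ← LinearMap.comp_assoc, s]
  have s₃ : J ∘ₗ Q.tp (inl k) (inr k ∘ₗ inl k) ∘ₗ Q.SInv =
      Q.tp (inl k ∘ₗ Q.S) ((inr k ∘ₗ inl k) ∘ₗ Q.S) ∘ₗ Q.SInv := by
    rw [← LinearMap.comp_assoc, j₆]
    rfl
  rw [QuasiHopfData.hex, Anti.map_mul, Anti.map_mul, Anti.map_mul, Anti.map_mul, anti_lift_dualR,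
    anti_lift_dualR, anti_lift_dualR, anti_ph, anti_ph, anti_pb, j₅, s₁, s₂, s₃, j₁, j₂, j₄, key]
  simp only [phS, pbS, ph, pb, mul_assoc, LinearMap.comp_assoc]

/-- The dual of an algebra over the double is an algebra over the double. -/
theorem IsR.dual (h : Q.IsR i R) : Q.IsR (opL ∘ₗ i ∘ₗ Q.S) (Q.dualR i R) where
  leg := by
    have := h.leg
    exact Q.leg_opL_comp_S i
  intw := h.intw_dualR
  hex := h.dual_hex
  counit := by
    have e := congrArg (opL : E →ₗ[k] Eᵐᵒᵖ) (lift_un_conjR h)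
    rw [Anti.map_one, anti_mulMap₂ (opL : E →ₗ[k] Eᵐᵒᵖ) Q.un LinearMap.id Cm.comm] at e
    rw [dualR, mulMap₂_map, un_SInv]
    refine Eq.trans ?_ e
    congr 2

end IsR

/-! ### The antipode formula as a dual half-braiding. -/

section Antipode

variable {k H B : Type*} [Field k] [Ring H] [Algebra k H] [Ring B] [Algebra k B]
  (Q : QuasiHopfData k H) [FiniteDimensional k H] [hQ : Q.Regular]

/-- Under an anti-morphism extending S, the associator and the α in the definition of the mate
combine into q_R with its two legs exchanged. This is where the element U of S_D comes from. -/
theorem anti_gm {E : Type*} [Ring E] [Algebra k E] (J : E →ₗ[k] B) [Anti J] (x v : H →ₗ[k] E)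
    [Leg x] [Leg v] [Cm x v] (x' v' : H →ₗ[k] B) [Leg x'] [Cm x' v'] (hx : J ∘ₗ x = x' ∘ₗ Q.S) (hv : J ∘ₗ v = v' ∘ₗ Q.S)
    (r : E) : J (Q.gm x v r) = J r * mulMap₂ x' v' (Q.SS (TensorProduct.comm k H H Q.qR)) := by
  have hx' : ∀ a, J (x a) = x' (Q.S a) := LinearMap.congr_fun hx
  have hv' : ∀ a, J (v a) = v' (Q.S a) := LinearMap.congr_fun hv
  rw [gm, act_mul, act_rho, Anti.map_mul, ph, qR]
  congr 1
  generalize Q.Phi = w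
  induction w using TensorProduct.induction_on with
  | zero => simp
  | add a b ha hb => simp only [map_add, ha, hb]
  | tmul a w =>
  induction w using TensorProduct.induction_on with
  | zero => simp
  | add a b ha hb => simp only [map_add, ha, hb, TensorProduct.tmul_add]
  | tmul b c =>
  simp only [mulMap₂_tmul, LinearMap.comp_apply, act_mul, act_rho, act_lam, LinearMap.lTensor_tmul,
    LinearEquiv.coe_coe, TensorProduct.comm_tmul, SS, TensorProduct.map_tmul, Anti.map_mul (x := J),
    LinearMap.mulLeft_apply, hx', hv', Anti.map_mul (x := Q.SInv), hQ.S_SInv, Anti.map_mul (x := Q.S),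
    LinearMap.id_apply]
  have c : ∀ u t, v' u * x' t = x' t * v' u := Cm.comm
  simp only [Leg.map_mul, mul_assoc, c]

theorem act4_bow (φ : Module.Dual k H) (a b c d : H) :
    Q.act4 (a ⊗ₜ (b ⊗ₜ (c ⊗ₜ d))) (Q.bow φ 1) =
      con φ (inr k (Q.iD a) * (inl k c * Q.gamD * inl k b) * inr k (Q.iD d)) := by
  rw [← con_gamD_mul, act4_apply, mul_one]

theorem act4_mul (φ : Module.Dual k H) (s : H) (F U : H ⊗[k] H) (P : T3 k H) :
    Q.act4 (l41 k H s * (mulMap₂ (l41 k H) (l43 k H) F *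
      mulMap₂ (mulMap₂ (l42 k H) (l44 k H) ∘ₗ Q.comul) (l43 k H ∘ₗ Q.SInv)
        ((mulMap₂ (LinearMap.mulRight k Q.β) Q.S).lTensor H P) *
      mulMap₂ (l42 k H) (l44 k H) U)) (Q.bow φ 1) =
    con φ ((inr k ∘ₗ Q.iD) s * (mulMap₂ (inr k ∘ₗ Q.iD) (inl k) F *
      Q.rcMap (inl k) (inr k ∘ₗ Q.iD) Q.gamD P * mulMap₂ (inl k) (inr k ∘ₗ Q.iD) U)) := by
  generalize hx : (inl k : H →ₗ[k] H ⊗[k] Q.QuantumDouble) = x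
  generalize hv : (inr k ∘ₗ Q.iD : H →ₗ[k] H ⊗[k] Q.QuantumDouble) = v
  have lx : Leg x := by rw [← hx]; infer_instance
  have lv : Leg v := by rw [← hv]; infer_instance
  have c : ∀ a b, v a * x b = x b * v a := by
    rw [← hx, ← hv]
    exact Cm.comm
  have o : ∀ a b c d, Q.act4 (a ⊗ₜ (b ⊗ₜ (c ⊗ₜ d))) (Q.bow φ 1) =
      con φ (v a * (x c * Q.gamD * x b) * v d) := by
    rw [← hx, ← hv]
    exact Q.act4_bow φ
  clear hx hv
  induction F using TensorProduct.induction_on with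
  | zero => simp only [map_zero, zero_mul, mul_zero, LinearMap.zero_apply]
  | add a b ha hb => simp only [map_add, add_mul, mul_add, LinearMap.add_apply, ha, hb]
  | tmul f₁ f₂ =>
  induction P using TensorProduct.induction_on with
  | zero => simp only [map_zero, zero_mul, mul_zero, LinearMap.zero_apply, rcMap]
  | add a b ha hb => simp only [map_add, add_mul, mul_add, LinearMap.add_apply, ha, hb]
  | tmul p₁ P =>
  induction P using TensorProduct.induction_on with
  | zero => simp only [map_zero, zero_mul, mul_zero, LinearMap.zero_apply, TensorProduct.tmul_zero]
  | add a b ha hb =>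
    simp only [map_add, add_mul, mul_add, LinearMap.add_apply, TensorProduct.tmul_add, ha, hb]
  | tmul p₂ p₃ =>
  simp only [mulMap₂_tmul, tp, LinearMap.comp_apply, LinearMap.lTensor_tmul, rcMap]
  generalize Q.comul p₁ = P
  induction P using TensorProduct.induction_on with
  | zero => simp only [map_zero, zero_mul, mul_zero, LinearMap.zero_apply]
  | add a b ha hb => simp only [map_add, add_mul, mul_add, LinearMap.add_apply, ha, hb]
  | tmul p₁ p₄ =>
  induction U using TensorProduct.induction_on with
  | zero => simp only [map_zero, mul_zero, LinearMap.zero_apply]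
  | add a b ha hb => simp only [map_add, mul_add, LinearMap.add_apply, ha, hb]
  | tmul u₁ u₂ =>
  simp only [mulMap₂_tmul, LinearMap.comp_apply, l31, l32, l33,
    l41, l42, l43, l44, inl, inr, LinearMap.flip_apply, TensorProduct.mk_apply,
    Algebra.TensorProduct.tmul_mul_tmul, mul_one, one_mul, o, act_mul, act_rho, act_lam,
    LinearMap.mulRight_apply, LinearEquiv.coe_coe, TensorProduct.comm_tmul,
    Anti.map_mul (x := Q.SInv), hQ.SInv_S, Leg.map_mul, Algebra.TensorProduct.one_def]
  simp only [mul_assoc, c, swap_assoc (c _ _)]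

theorem antipodeD_bow_eq (φ : Module.Dual k H) (h : H) : Q.antipodeD (Q.bow φ h) =
    Q.iD (Q.S h) * con (φ ∘ₗ Q.SInv) (Q.conjR Q.iD Q.rD *
      mulMap₂ (inl k) (inr k ∘ₗ Q.iD) (Q.SS (TensorProduct.comm k H H Q.qR))) := by
  have e : Q.antipodeD (Q.bow φ h) = _ :=
    Q.act4_mul (φ ∘ₗ Q.SInv) (Q.S h) Q.twist Q.U Q.PhiInv
  have e' : Q.rcMap (inl k) (inr k ∘ₗ Q.iD) Q.gamD Q.PhiInv = Q.rD := rfl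
  have eU := Leg.map_mul (x := (mulMap₂ (inl k) (inr k ∘ₗ Q.iD) : H ⊗[k] H →ₗ[k]
    H ⊗[k] Q.QuantumDouble)) Q.twistInv (Q.SS (TensorProduct.comm k H H Q.qR))
  rw [e, LinearMap.comp_apply, con_inr_mul, e', U,
    eU, conjR, tw, ti]
  simp only [mul_assoc]

theorem unopL_con {E : Type*} [Ring E] [Algebra k E] (φ : Module.Dual k H) (w : H ⊗[k] Eᵐᵒᵖ) :
    (unopL : Eᵐᵒᵖ →ₗ[k] E) (con φ w) = con (φ ∘ₗ Q.SInv) (TensorProduct.map Q.S (unopL : Eᵐᵒᵖ →ₗ[k] E) w) := by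
  induction w using TensorProduct.induction_on with
  | zero => simp
  | add a b ha hb => simp only [map_add, ha, hb]
  | tmul a b => simp [hQ.SInv_S]

/-- In the formula for S_D the p_R part rebuilds R from its mate, the two twists form f₂₁Rf⁻¹, and
the remaining q_R part passes to the mate again. The outcome is the map classified by the dual of
the canonical half-braiding. -/
theorem antipodeD_eq_theta :
    Q.antipodeD = unopL ∘ₗ Q.theta (opL ∘ₗ Q.iD ∘ₗ Q.S) (Q.dualR Q.iD Q.rD) := by
  refine LinearMap.ext fun X => ?_
  induction X using double_induction with
  | ha a b ha hb => rw [map_add, map_add, ha, hb]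
  | hb φ h =>
  have e₁ : TensorProduct.map Q.S (unopL : Q.QuantumDoubleᵐᵒᵖ →ₗ[k] Q.QuantumDouble) ∘ₗ inl k =
      inl k ∘ₗ Q.S := map_comp_inl _ _
  have e₂ : TensorProduct.map Q.S (unopL : Q.QuantumDoubleᵐᵒᵖ →ₗ[k] Q.QuantumDouble) ∘ₗ inr k ∘ₗ
      opL ∘ₗ Q.iD ∘ₗ Q.S = (inr k ∘ₗ Q.iD) ∘ₗ Q.S := by
    rw [← LinearMap.comp_assoc, map_comp_inr]
    rfl
  have l := Q.leg_opL_comp_S Q.iD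
  rw [antipodeD_bow_eq, LinearMap.comp_apply, theta_bow,
    Anti.map_mul (x := (unopL : Q.QuantumDoubleᵐᵒᵖ →ₗ[k] Q.QuantumDouble)), Q.unopL_con,
    Q.anti_gm _ _ _ (inl k) (inr k ∘ₗ Q.iD) e₁ e₂, map_S_dualR]
  rfl

instance Anti.antipodeD : Anti Q.antipodeD := by
  rw [antipodeD_eq_theta]
  have := Q.rD_isR.dual.leg_theta
  exact Anti.comp_anti _ _

theorem antipodeD_iD : Q.antipodeD ∘ₗ Q.iD = Q.iD ∘ₗ Q.S := by
  rw [antipodeD_eq_theta, LinearMap.comp_assoc, Q.rD_isR.dual.theta_comp_iD]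
  rfl

/-- `(S ⊗ S_D)(R) = f₂₁ R f⁻¹` -/
theorem map_antipodeD_rD : TensorProduct.map Q.S Q.antipodeD Q.rD = Q.conjR Q.iD Q.rD := by
  have e := congrArg (TensorProduct.map Q.S unopL) Q.rD_isR.dual.lTensor_theta
  rw [map_S_dualR] at e
  rw [← e, antipodeD_eq_theta, ← LinearMap.comp_apply, LinearMap.map_comp_lTensor]

theorem lift_antipodeD (x : H →ₗ[k] B) (j : Q.QuantumDouble →ₗ[k] B) [Leg x] [Leg j] [Cm x j] :
    mulMap₂ (x ∘ₗ Q.S) (j ∘ₗ Q.antipodeD) Q.rD =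
      Q.tw (j ∘ₗ Q.iD) x * mulMap₂ x j Q.rD * Q.ti x (j ∘ₗ Q.iD) := by
  rw [← lift_conjR, ← map_antipodeD_rD, mulMap₂_map]

end Antipode

/-! ### The antipode of the double -/

section Duality

variable {k H B M : Type*} [Field k] [Ring H] [Algebra k H] [Ring B] [Algebra k B]
  [AddCommGroup M] [Module k M] (Q : QuasiHopfData k H) [hQ : Q.Regular] {K : B →ₗ[k] M}
  (x y p q : H →ₗ[k] B) [Leg x] [Leg y] [Leg p] [Leg q] [Cm x y] [Cm x p] [Cm x q] [Cm y p]
  [Cm y q] [Cm p q] (rx ry s : B)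

/-- An evaluation of dual pairs is invariant under the braiding. -/
theorem pair_evaluation [Intw rx (Q.tp x p) (Q.tp p x)] [Intw rx y y] [Intw rx q q]
    [Intw ry (Q.tp y q) (Q.tp q y)] [Intw ry x x] [Intw ry p p]
    [Intw s (Q.tp y p) (Q.tp p y)] [Intw s x x] [Intw s q q]
    (hxy : SameL K (Q.tp x y) Q.un) (hpq : SameL K (Q.tp p q) Q.un)
    (slide : ∀ b, K (Q.aa p x y q * rx * b) = K (Q.aa x p q y * ry * b))
    (hexagon : ∀ b, K (Q.hex x y p rx s * b) = K b) : K (Q.pair y p q s ry) = K 1 := by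
  have e₁ : Q.pair y p q s ry = Q.pb p q y * Q.ph x p (Q.tp q y) * ry *
      (Q.pb x p (Q.tp y q) * Q.ph p y q * s * Q.pb y p q) := by
    rw [pair]
    have h1 := Q.ph_nat (ry) x p (Q.tp y q) x p (Q.tp q y)
    have h2 := Q.ph_mul_pb x p (Q.tp y q)
    linear_combination (norm := noncomm_ring)
      (Q.pb p q y) * h1 * (Q.pb x p (Q.tp y q) * Q.ph p y q * s * Q.pb y p q)
      - (Q.pb p q y * ry) * h2 * (Q.ph p y q * s * Q.pb y p q)
  have e₂ : ∀ b, K (Q.pb p q y * Q.ph x p (Q.tp q y) * b) = K (Q.aa x p q y * b) := fun b => by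
    have h := hpq.pb₂ Q 1 x y (Q.pb p q y * Q.ph x p (Q.tp q y) * b)
    rw [pb_un₂, one_mul, one_mul, one_mul] at h
    rw [← h, aa, pentagon₃]
    simp only [mul_assoc]
  have e₃ : Q.aa p x y q * rx * (Q.pb x p (Q.tp y q) * Q.ph p y q * s * Q.pb y p q) =
      Q.hex x y p rx s * (Q.pb (Q.tp x y) p q * Q.pb x y (Q.tp p q)) := by
    rw [aa, hex]
    have h1 := Q.pentagon₄ x p y q
    have h2 := Q.ph_nat (rx) (Q.tp x p) y q (Q.tp p x) y q
    have h3 := Q.pb_mul_ph (Q.tp p x) y q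
    have h4 := Q.pb_nat (s) x (Q.tp y p) q x (Q.tp p y) q
    have h5 := Q.ph_mul_pb x y p
    have h6 := Q.pentagon_inv x y p q
    linear_combination (norm := noncomm_ring)
      (Q.ph p x y * Q.pb (Q.tp p x) y q * rx) * h1 * (s * Q.pb y p q)
      + (Q.ph p x y * Q.pb (Q.tp p x) y q) * h2 * (Q.pb x p y * Q.pb x (Q.tp p y) q * s *
          Q.pb y p q)
      + (Q.ph p x y) * h3 * (rx * Q.pb x p y * Q.pb x (Q.tp p y) q * s * Q.pb y p q)
      - (Q.ph p x y * rx * Q.pb x p y) * h4 * (Q.pb y p q)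
      - (Q.ph p x y * rx * Q.pb x p y * s) * h5 * (Q.pb x (Q.tp y p) q * Q.pb y p q)
      + (Q.ph p x y * rx * Q.pb x p y * s * Q.ph x y p) * h6
  have h₁ := hxy.pb₁ Q 1 p q (Q.pb x y (Q.tp p q))
  have h₂ := hpq.pb₃ Q 1 x y 1
  simp only [pb_un₁, pb_un₃, one_mul, mul_one] at h₁ h₂
  -- `slide` trades the braiding of y with q for that of x with p. Together with s this is the
  -- braiding of p with the contractible product of x and y, which `hexagon` removes.
  rw [e₁, mul_assoc _ ry, e₂, ← mul_assoc, ← slide, e₃, hexagon, h₁, h₂]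

/-- A coevaluation of dual pairs is invariant under the braiding. -/
theorem pair_coevaluation (rp : B) [Intw rx (Q.tp x q) (Q.tp q x)] [Intw rx y y] [Intw rx p p]
    [Intw rp (Q.tp y p) (Q.tp p y)] [Intw rp x x] [Intw rp q q]
    [Intw s (Q.tp y q) (Q.tp q y)] [Intw s x x] [Intw s p p]
    (hyx : SameR K (Q.tp y x) Q.un) (hpq : SameR K (Q.tp p q) Q.un)
    (slide : ∀ b, K (b * rp * Q.ab y p q x) = K (b * rx * Q.ab p y x q))
    (hexagon : ∀ b, K (b * Q.hex y x q s rx) = K b) : K (Q.pair y p q rp s) = K 1 := by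
  have e₁ : Q.pair y p q rp s = Q.pb p q y * s * Q.ph p y q * Q.pb (Q.tp p y) q x * rp *
      Q.ab y p q x := by
    rw [pair, ab]
    have h1 := Q.pb_mul_ph (Q.tp y p) q x
    have h2 := Q.pb_nat (rp) (Q.tp y p) q x (Q.tp p y) q x
    linear_combination (norm := noncomm_ring)
      - (Q.pb p q y * s * Q.ph p y q * rp) * h1 * (Q.pb y p q)
      + (Q.pb p q y * s * Q.ph p y q) * h2 * (Q.ph (Q.tp y p) q x * Q.pb y p q)
  have e₂ : Q.pb p q y * s * Q.ph p y q * Q.pb (Q.tp p y) q x * rx * Q.ab p y x q =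
      Q.pb (Q.tp p q) y x * Q.pb p q (Q.tp y x) * Q.hex y x q s rx * Q.ph p (Q.tp y x) q := by
    rw [ab, hex]
    have h1 := Q.pentagon₃ p y q x
    have h2 := Q.ph_nat (rx) p y (Q.tp x q) p y (Q.tp q x)
    have h3 := Q.pentagon p y x q
    have h4 := Q.ph_mul_pb p y x
    have h5 := Q.pb_nat (s) p (Q.tp y q) x p (Q.tp q y) x
    have h6 := Q.pb_mul_ph q y x
    have h7 := Q.pentagon_inv p q y x
    linear_combination (norm := noncomm_ring)
      (Q.pb p q y * s) * h1 * (rx * Q.ph (Q.tp p y) x q * Q.pb p y x)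
      - (Q.pb p q y * s * Q.pb p (Q.tp y q) x * Q.pb y q x) * h2 * (Q.ph (Q.tp p y) x q *
          Q.pb p y x)
      - (Q.pb p q y * s * Q.pb p (Q.tp y q) x * Q.pb y q x * rx) * h3 * (Q.pb p y x)
      + (Q.pb p q y * s * Q.pb p (Q.tp y q) x * Q.pb y q x * rx * Q.ph y x q *
          Q.ph p (Q.tp y x) q) * h4
      + (Q.pb p q y) * h5 * (Q.pb y q x * rx * Q.ph y x q * Q.ph p (Q.tp y x) q)
      - (Q.pb p q y * Q.pb p (Q.tp q y) x) * h6 * (s * Q.pb y q x * rx * Q.ph y x q *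
          Q.ph p (Q.tp y x) q)
      + h7 * (Q.ph q y x * s * Q.pb y q x * rx * Q.ph y x q * Q.ph p (Q.tp y x) q)
  have h₁ := hyx.ph₂ Q (Q.pb (Q.tp p q) y x * Q.pb p q (Q.tp y x) * Q.hex y x q s rx) p q 1
  have h₂ := hyx.pb₃ Q (Q.pb (Q.tp p q) y x) p q 1
  have h₃ := hpq.pb₁ Q 1 y x 1
  simp only [ph_un₂, pb_un₁, pb_un₃, one_mul, mul_one] at h₁ h₂ h₃
  rw [e₁, slide, e₂, h₁, hexagon, h₂, h₃]

end Duality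

/-! ### Evaluation and coevaluation are compatible with the half-braidings. -/

section AntipodeAxioms

variable {k H B : Type*} [Field k] [Ring H] [Algebra k H] [Ring B] [Algebra k B]
  (Q : QuasiHopfData k H) [FiniteDimensional k H] [hQ : Q.Regular]
  (a : H →ₗ[k] B) (j : Q.QuantumDouble →ₗ[k] B) [Leg a] [Leg j] [Cm a j]

theorem lam_antipodeD_iD (j : Q.QuantumDouble →ₗ[k] B) :
    (lam ∘ₗ j ∘ₗ Q.antipodeD) ∘ₗ Q.iD = lam ∘ₗ (j ∘ₗ Q.iD) ∘ₗ Q.S := by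
  simp only [LinearMap.comp_assoc, antipodeD_iD]

theorem rmul_antipodeD_iD (j : Q.QuantumDouble →ₗ[k] B) :
    (rmul ∘ₗ j ∘ₗ Q.antipodeD) ∘ₗ Q.iD = rmul ∘ₗ (j ∘ₗ Q.iD) ∘ₗ Q.S := by
  simp only [LinearMap.comp_assoc, antipodeD_iD]

instance intw_lam_rD (x : H →ₗ[k] Op k B) [Leg x] [Cm x (lam ∘ₗ j ∘ₗ Q.antipodeD)] :
    Intw (mulMap₂ x (lam ∘ₗ j ∘ₗ Q.antipodeD) Q.rD) (Q.tp x (lam ∘ₗ (j ∘ₗ Q.iD) ∘ₗ Q.S))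
      (Q.tp (lam ∘ₗ (j ∘ₗ Q.iD) ∘ₗ Q.S) x) := by
  have := Q.intw_lift_rD x (lam ∘ₗ j ∘ₗ Q.antipodeD)
  rwa [lam_antipodeD_iD] at this

instance intw_rmul_rD (x : H →ₗ[k] Module.End k B) [Leg x] [Cm x (rmul ∘ₗ j ∘ₗ Q.antipodeD)] :
    Intw (mulMap₂ x (rmul ∘ₗ j ∘ₗ Q.antipodeD) Q.rD) (Q.tp x (rmul ∘ₗ (j ∘ₗ Q.iD) ∘ₗ Q.S))
      (Q.tp (rmul ∘ₗ (j ∘ₗ Q.iD) ∘ₗ Q.S) x) := by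
  have := Q.intw_lift_rD x (rmul ∘ₗ j ∘ₗ Q.antipodeD)
  rwa [rmul_antipodeD_iD] at this

/-- Substituting f₂₁Rf⁻¹ for (S ⊗ S_D)(R) and fΔ(α) for γ, both sides equal f₂₁RΔ(α), because R
intertwines Δ with Δᶜᵒᵖ. -/
theorem lift_antipodeD_mul_gam : mulMap₂ (a ∘ₗ Q.S) (j ∘ₗ Q.antipodeD) Q.rD *
    mulMap₂ a (j ∘ₗ Q.iD) Q.gam = mulMap₂ (j ∘ₗ Q.iD) a Q.gam * mulMap₂ a j Q.rD := by
  rw [lift_antipodeD, ← tw_mul_α, ← tw_mul_α]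
  have h := Q.ti_mul_tw a (j ∘ₗ Q.iD)
  have h' := (Q.intw_lift_rD a j).intw Q.α
  linear_combination (norm := noncomm_ring)
    Q.tw (j ∘ₗ Q.iD) a * mulMap₂ a j Q.rD * h * Q.tp a (j ∘ₗ Q.iD) Q.α +
      Q.tw (j ∘ₗ Q.iD) a * h'

theorem del_mul_tw (x y : H →ₗ[k] B) [Leg x] [Leg y] [Cm x y] :
    mulMap₂ x y Q.del * Q.tw x y = Q.tp x y Q.β := by
  rw [tw, ← Leg.map_mul, del_mul_twist]; rfl

theorem rD_mul_lift_del : mulMap₂ a j Q.rD * mulMap₂ a (j ∘ₗ Q.iD) Q.del =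
    mulMap₂ (j ∘ₗ Q.iD) a Q.del * mulMap₂ (a ∘ₗ Q.S) (j ∘ₗ Q.antipodeD) Q.rD := by
  rw [lift_antipodeD]
  have h := Q.tw_mul_ti a (j ∘ₗ Q.iD)
  have h' := (Q.intw_lift_rD a j).intw Q.β
  have d := Q.del_mul_tw a (j ∘ₗ Q.iD)
  have d' := Q.del_mul_tw (j ∘ₗ Q.iD) a
  linear_combination (norm := noncomm_ring)
    - mulMap₂ a j Q.rD * mulMap₂ a (j ∘ₗ Q.iD) Q.del * h
    + mulMap₂ a j Q.rD * d * Q.ti a (j ∘ₗ Q.iD) + h' * Q.ti a (j ∘ₗ Q.iD)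
    - d' * mulMap₂ a j Q.rD * Q.ti a (j ∘ₗ Q.iD)

theorem act_aa_slide (b : Op k B) : act (a Q.α * j (Q.iD Q.α))
    (Q.aa (lam ∘ₗ (j ∘ₗ Q.iD) ∘ₗ Q.S) (lam ∘ₗ a ∘ₗ Q.S) (rho ∘ₗ a) (rho ∘ₗ j ∘ₗ Q.iD) *
      mulMap₂ (lam ∘ₗ a ∘ₗ Q.S) (lam ∘ₗ j ∘ₗ Q.antipodeD) Q.rD * b) =
    act (a Q.α * j (Q.iD Q.α))
    (Q.aa (lam ∘ₗ a ∘ₗ Q.S) (lam ∘ₗ (j ∘ₗ Q.iD) ∘ₗ Q.S) (rho ∘ₗ j ∘ₗ Q.iD) (rho ∘ₗ a) *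
      mulMap₂ (rho ∘ₗ a) (rho ∘ₗ j) Q.rD * b) := by
  have e₁ : mulMap₂ (lam ∘ₗ a ∘ₗ Q.S) (lam ∘ₗ j ∘ₗ Q.antipodeD) Q.rD =
      (lam (mulMap₂ (a ∘ₗ Q.S) (j ∘ₗ Q.antipodeD) Q.rD) : Op k B) :=
    (anti_mulMap₂ _ _ _ Cm.comm _).symm
  have e₂ : mulMap₂ (rho ∘ₗ a) (rho ∘ₗ j) Q.rD = (rho (mulMap₂ a j Q.rD) : Op k B) :=
    (lift_lift _ _ _ _).symm
  have g₁ := Q.lift_gam a (j ∘ₗ Q.iD)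
  have g₂ := Q.lift_gam (j ∘ₗ Q.iD) a
  rw [LinearMap.comp_apply] at g₁ g₂
  rw [← Cm.comm (x := a) (y := j)] at g₂
  rw [e₁, e₂, act_mul _ _ b, act_mul, act_mul _ _ b, act_mul _ _ (rho _), act_lam, act_rho, ← g₁,
    ← g₂, lift_antipodeD_mul_gam]

theorem ev_ab_slide (b : Module.End k B) : ev (a Q.β * j (Q.iD Q.β))
    (b * mulMap₂ (lmul ∘ₗ a) (lmul ∘ₗ j) Q.rD *
      Q.ab (lmul ∘ₗ a) (lmul ∘ₗ j ∘ₗ Q.iD) (rmul ∘ₗ (j ∘ₗ Q.iD) ∘ₗ Q.S) (rmul ∘ₗ a ∘ₗ Q.S)) =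
    ev (a Q.β * j (Q.iD Q.β))
    (b * mulMap₂ (rmul ∘ₗ a ∘ₗ Q.S) (rmul ∘ₗ j ∘ₗ Q.antipodeD) Q.rD *
      Q.ab (lmul ∘ₗ j ∘ₗ Q.iD) (lmul ∘ₗ a) (rmul ∘ₗ a ∘ₗ Q.S) (rmul ∘ₗ (j ∘ₗ Q.iD) ∘ₗ Q.S)) := by
  have e₁ : mulMap₂ (rmul ∘ₗ a ∘ₗ Q.S) (rmul ∘ₗ j ∘ₗ Q.antipodeD) Q.rD =
      (rmul (mulMap₂ (a ∘ₗ Q.S) (j ∘ₗ Q.antipodeD) Q.rD) : Module.End k B) :=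
    (anti_mulMap₂ _ _ _ Cm.comm _).symm
  have e₂ : mulMap₂ (lmul ∘ₗ a) (lmul ∘ₗ j) Q.rD = (lmul (mulMap₂ a j Q.rD) : Module.End k B) :=
    (lift_lift _ _ _ _).symm
  have g₁ := Q.lift_del a (j ∘ₗ Q.iD)
  have g₂ := Q.lift_del (j ∘ₗ Q.iD) a
  rw [LinearMap.comp_apply] at g₁ g₂
  rw [← Cm.comm (x := a) (y := j)] at g₂
  rw [e₁, e₂, ev_mul, ev_mul _ b, ev_mul, ev_mul _ b, ev_lmul, ev_rmul, ← g₁, ← g₂,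
    rD_mul_lift_del]

/-- By the hexagon this is R with its first leg split over a and its dual. The pair contracts to the
trivial leg, where R becomes 1. -/
theorem act_hex_rD (b : Op k B) : act (a Q.α * j (Q.iD Q.α))
    (Q.hex (lam ∘ₗ a ∘ₗ Q.S) (rho ∘ₗ a) (lam ∘ₗ (j ∘ₗ Q.iD) ∘ₗ Q.S)
      (mulMap₂ (lam ∘ₗ a ∘ₗ Q.S) (lam ∘ₗ j ∘ₗ Q.antipodeD) Q.rD)
      (mulMap₂ (rho ∘ₗ a) (lam ∘ₗ j ∘ₗ Q.antipodeD) Q.rD) * b) =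
    act (a Q.α * j (Q.iD Q.α)) b := by
  have e := Q.rD_isR.lift_hex (lam ∘ₗ a ∘ₗ Q.S) (rho ∘ₗ a) (lam ∘ₗ j ∘ₗ Q.antipodeD)
  rw [lam_antipodeD_iD] at e
  rw [← e, (Q.sameL_S a (j (Q.iD Q.α))).mulMap₂,
    Q.rD_isR.lift_counit (lam ∘ₗ j ∘ₗ Q.antipodeD), one_mul]

theorem ev_hex_rD (b : Module.End k B) : ev (a Q.β * j (Q.iD Q.β))
    (b * Q.hex (lmul ∘ₗ a) (rmul ∘ₗ a ∘ₗ Q.S) (rmul ∘ₗ (j ∘ₗ Q.iD) ∘ₗ Q.S)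
      (mulMap₂ (lmul ∘ₗ a) (rmul ∘ₗ j ∘ₗ Q.antipodeD) Q.rD)
      (mulMap₂ (rmul ∘ₗ a ∘ₗ Q.S) (rmul ∘ₗ j ∘ₗ Q.antipodeD) Q.rD)) =
    ev (a Q.β * j (Q.iD Q.β)) b := by
  have e := Q.rD_isR.lift_hex (lmul ∘ₗ a) (rmul ∘ₗ a ∘ₗ Q.S) (rmul ∘ₗ j ∘ₗ Q.antipodeD)
  rw [rmul_antipodeD_iD] at e
  rw [← e, ← mulMap₂_comm _ _ (fun _ _ => Cm.comm _ _),
    (Q.sameR_S a (j (Q.iD Q.β))).mulMap₂, mulMap₂_comm _ _ (fun _ _ => Cm.comm _ _),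
    Q.rD_isR.lift_counit (rmul ∘ₗ j ∘ₗ Q.antipodeD), mul_one]

theorem sameL_iD : SameL (act (a Q.α * j (Q.iD Q.α)))
    (Q.tp (lam ∘ₗ (j ∘ₗ Q.iD) ∘ₗ Q.S) (rho ∘ₗ j ∘ₗ Q.iD)) Q.un := by
  have hp := Q.sameL_S (j ∘ₗ Q.iD) (a Q.α)
  rwa [LinearMap.comp_apply, ← Cm.comm (x := a) (y := j)] at hp

theorem sameR_iD : SameR (ev (a Q.β * j (Q.iD Q.β)))
    (Q.tp (lmul ∘ₗ j ∘ₗ Q.iD) (rmul ∘ₗ (j ∘ₗ Q.iD) ∘ₗ Q.S)) Q.un := by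
  have hp := Q.sameR_S (j ∘ₗ Q.iD) (a Q.β)
  rwa [LinearMap.comp_apply, ← Cm.comm (x := a) (y := j)] at hp

theorem act_pair_rD : act (a Q.α * j (Q.iD Q.α)) (Q.pair (rho ∘ₗ a) (lam ∘ₗ (j ∘ₗ Q.iD) ∘ₗ Q.S)
    (rho ∘ₗ j ∘ₗ Q.iD) (mulMap₂ (rho ∘ₗ a) (lam ∘ₗ j ∘ₗ Q.antipodeD) Q.rD)
    (mulMap₂ (rho ∘ₗ a) (rho ∘ₗ j) Q.rD)) =
      act (a Q.α * j (Q.iD Q.α)) (1 : Op k B) := by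
  have := Q.intw_lift_rD (rho ∘ₗ a : H →ₗ[k] Op k B) (rho ∘ₗ j)
  rw [LinearMap.comp_assoc] at this
  exact Q.pair_evaluation (lam ∘ₗ a ∘ₗ Q.S) (rho ∘ₗ a) (lam ∘ₗ (j ∘ₗ Q.iD) ∘ₗ Q.S)
    (rho ∘ₗ j ∘ₗ Q.iD) (mulMap₂ (lam ∘ₗ a ∘ₗ Q.S) (lam ∘ₗ j ∘ₗ Q.antipodeD) Q.rD)
    (mulMap₂ (rho ∘ₗ a) (rho ∘ₗ j) Q.rD) (mulMap₂ (rho ∘ₗ a) (lam ∘ₗ j ∘ₗ Q.antipodeD) Q.rD)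
    (Q.sameL_S a (j (Q.iD Q.α))) (Q.sameL_iD a j) (Q.act_aa_slide a j) (Q.act_hex_rD a j)

theorem ev_pair_rD : ev (a Q.β * j (Q.iD Q.β)) (Q.pair (lmul ∘ₗ a) (lmul ∘ₗ j ∘ₗ Q.iD)
    (rmul ∘ₗ (j ∘ₗ Q.iD) ∘ₗ Q.S) (mulMap₂ (lmul ∘ₗ a) (lmul ∘ₗ j) Q.rD)
    (mulMap₂ (lmul ∘ₗ a) (rmul ∘ₗ j ∘ₗ Q.antipodeD) Q.rD)) =
      ev (a Q.β * j (Q.iD Q.β)) (1 : Module.End k B) := by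
  have := Q.intw_lift_rD (lmul ∘ₗ a : H →ₗ[k] Module.End k B) (lmul ∘ₗ j)
  rw [LinearMap.comp_assoc] at this
  exact Q.pair_coevaluation (rmul ∘ₗ a ∘ₗ Q.S) (lmul ∘ₗ a) (lmul ∘ₗ j ∘ₗ Q.iD)
    (rmul ∘ₗ (j ∘ₗ Q.iD) ∘ₗ Q.S) (mulMap₂ (rmul ∘ₗ a ∘ₗ Q.S) (rmul ∘ₗ j ∘ₗ Q.antipodeD) Q.rD)
    (mulMap₂ (lmul ∘ₗ a) (rmul ∘ₗ j ∘ₗ Q.antipodeD) Q.rD)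
    (mulMap₂ (lmul ∘ₗ a) (lmul ∘ₗ j) Q.rD) (Q.sameR_S a (j (Q.iD Q.β))) (Q.sameR_iD a j) (Q.ev_ab_slide a j)
    (Q.ev_hex_rD a j)

/-- The axiom S_D(X₁)αX₂ = ε_D(X)α on the coefficients of R, with an auxiliary α in the leg of H.
That factor is needed for the evaluation of x against its dual in `pair_evaluation`. -/
theorem act_tpD_rD : act (a Q.α * j (Q.iD Q.α))
    (mulMap₂ (rho ∘ₗ a) (Q.tpD (lam ∘ₗ j ∘ₗ Q.antipodeD) (rho ∘ₗ j)) Q.rD) =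
      a Q.α * j (Q.iD Q.α) := by
  have := Q.lift_tpD (rho ∘ₗ a : H →ₗ[k] Op k B) (lam ∘ₗ j ∘ₗ Q.antipodeD) (rho ∘ₗ j)
  rw [lam_antipodeD_iD, LinearMap.comp_assoc Q.iD] at this
  rw [this, act_pair_rD, act_one]

theorem ev_tpD_rD : ev (a Q.β * j (Q.iD Q.β))
    (mulMap₂ (lmul ∘ₗ a) (Q.tpD (lmul ∘ₗ j) (rmul ∘ₗ j ∘ₗ Q.antipodeD)) Q.rD) =
      a Q.β * j (Q.iD Q.β) := by
  have := Q.lift_tpD (lmul ∘ₗ a) (lmul ∘ₗ j) (rmul ∘ₗ j ∘ₗ Q.antipodeD)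
  rw [rmul_antipodeD_iD, LinearMap.comp_assoc Q.iD] at this
  rw [this, ev_pair_rD, ev_one]

end AntipodeAxioms

/-! ### Removing the auxiliary α or β from the leg of H. -/

section Cancel

variable {k B : Type*} [Field k] [Ring B] [Algebra k B]

theorem act_smul (c : k) (e : B) (P : Op k B) : act (c • e) P = c • act e P :=
  P.unop.map_smul c e

theorem ev_smul (c : k) (e : B) (P : Module.End k B) : ev (c • e) P = c • ev e P := P.map_smul c e

theorem ev_mul_right (e c : B) (P : Module.End k B) (h : rmul c * P = P * rmul c) :
    ev (e * c) P = ev e P * c := by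
  have := congrArg (ev e) h
  simpa [ev_mul] using this.symm

variable {H : Type*} [Ring H] [Algebra k H] (Q : QuasiHopfData k H) [FiniteDimensional k H]
  [hQ : Q.Regular] (a : H →ₗ[k] B) (j : Q.QuantumDouble →ₗ[k] B) [Leg a] [Leg j] [Cm a j]

/-- The operator commutes with left multiplications from the leg of H, so the auxiliary invertible α
comes out and is cancelled. For β the argument uses right multiplications. -/
theorem act_tpD_rD_right : act (j (Q.iD Q.α))
    (mulMap₂ (rho ∘ₗ a) (Q.tpD (lam ∘ₗ j ∘ₗ Q.antipodeD) (rho ∘ₗ j)) Q.rD) = j (Q.iD Q.α) := by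
  have h := Q.act_tpD_rD a j
  rw [act_mul_left] at h
  · exact (Q.isUnit_map_α a).mul_left_cancel h
  · have : Intw (mulMap₂ (rho ∘ₗ a : H →ₗ[k] Op k B) (Q.tpD (lam ∘ₗ j ∘ₗ Q.antipodeD) (rho ∘ₗ j))
        Q.rD) (lam ∘ₗ a) (lam ∘ₗ a) := inferInstance
    exact (this.intw Q.α).symm

theorem ev_tpD_rD_right (hβ : IsUnit Q.β) : ev (j (Q.iD Q.β))
    (mulMap₂ (lmul ∘ₗ a) (Q.tpD (lmul ∘ₗ j) (rmul ∘ₗ j ∘ₗ Q.antipodeD)) Q.rD) =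
      j (Q.iD Q.β) := by
  have h := Q.ev_tpD_rD a j
  have hu : IsUnit (a Q.β) := by
    obtain ⟨b, h₁, h₂⟩ := isUnit_iff_exists.1 hβ
    exact isUnit_iff_exists.2 ⟨a b, by rw [← Leg.map_mul, h₁, Leg.map_one],
      by rw [← Leg.map_mul, h₂, Leg.map_one]⟩
  rw [Cm.comm (x := a) (y := j), ev_mul_right] at h
  · exact hu.mul_right_cancel h
  · have : Intw (mulMap₂ (lmul ∘ₗ a : H →ₗ[k] Module.End k B)
        (Q.tpD (lmul ∘ₗ j) (rmul ∘ₗ j ∘ₗ Q.antipodeD)) Q.rD) (rmul ∘ₗ a) (rmul ∘ₗ a) := by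
      have c : Cm (lmul ∘ₗ j : _ →ₗ[k] Module.End k B) (rmul ∘ₗ a) := inferInstance
      have c' : Cm (rmul ∘ₗ j ∘ₗ Q.antipodeD : _ →ₗ[k] Module.End k B) (rmul ∘ₗ a) :=
        ⟨fun X h => LinearMap.ext fun e => by
          simp [rmul, mul_assoc, Cm.comm (x := a) (y := j)]⟩
      infer_instance
    exact (this.intw Q.β).symm

end Cancel

/-! ### The antipode axioms of the double, checked on generators. -/

section DoubleAntipode

variable {k H : Type*} [Field k] [Ring H] [Algebra k H]
  (Q : QuasiHopfData k H) [FiniteDimensional k H] [hQ : Q.Regular]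

/-- The double is generated by `H` and the coefficients of its universal intertwiner. -/
theorem mem_of_generators {A : Subalgebra k Q.QuantumDouble} (hi : ∀ h, Q.iD h ∈ A)
    (hr : ∀ φ, con φ Q.rD ∈ A) (X : Q.QuantumDouble) : X ∈ A := by
  -- A coefficient of the mate of R is a sum of products i_D(a)·(ψ ⊗ id)(R): the factors in the leg
  -- of H only change the functional with which R is paired.
  have key : ∀ (φ : Module.Dual k H) (c : H) (w : T3 k H),
      con φ (act (inl k c) (mulMap₂ (rho ∘ₗ inr k ∘ₗ Q.iD) (mulMap₂ (rho ∘ₗ inl k) (Q.cl (inl k))) w *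
        rho Q.rD)) ∈ A := fun φ c w => by
    induction w using TensorProduct.induction_on with
    | zero => simp
    | add s t hs ht => rw [map_add, add_mul, map_add, map_add]; exact A.add_mem hs ht
    | tmul a w =>
      induction w using TensorProduct.induction_on with
      | zero => simp
      | add s t hs ht =>
        rw [TensorProduct.tmul_add, map_add, add_mul, map_add, map_add]; exact A.add_mem hs ht
      | tmul b d =>
        have e : act (inl k c) (mulMap₂ (rho ∘ₗ inr k ∘ₗ Q.iD) (mulMap₂ (rho ∘ₗ inl k)
            (Q.cl (inl k))) (a ⊗ₜ (b ⊗ₜ d)) * rho Q.rD) =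
            inr k (Q.iD a) * (inl k (Q.SInv d * c * b) * Q.rD * inl k 1) := by
          have h₁ : (inl k c * inr k (Q.iD a) : H ⊗[k] Q.QuantumDouble) =
            inr k (Q.iD a) * inl k c := Cm.comm _ _
          have h₂ : (inl k (Q.SInv d) * inr k (Q.iD a) : H ⊗[k] Q.QuantumDouble) =
            inr k (Q.iD a) * inl k (Q.SInv d) := Cm.comm _ _
          simp only [mulMap₂_tmul, LinearMap.comp_apply, act_mul, act_rho, cl, act_lam, h₁,
            Leg.map_one, Leg.map_mul, mul_one]
          simp only [← mul_assoc, h₂]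
        rw [e, con_inr_mul, con_inl_mul_inl]
        exact A.mul_mem (hi a) (hr _)
  induction X using double_induction with
  | ha X Y hX hY => exact A.add_mem hX hY
  | hb φ h =>
    rw [← one_mul h, ← bow_mul_iD, ← con_gamD, ← gm_rD]
    exact A.mul_mem (key φ _ _) (hi h)

theorem counitD_mul (X Y : Q.QuantumDouble) : Q.counitD (X * Y) = Q.counitD X * Q.counitD Y :=
  Leg.map_mul (x := (Q.unD : Q.QuantumDouble →ₗ[k] k)) X Y

theorem counitD_one : Q.counitD 1 = 1 := Leg.map_one (x := (Q.unD : Q.QuantumDouble →ₗ[k] k))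

theorem counitD_iD (h : H) : Q.counitD (Q.iD h) = Q.counit h := by
  have := LinearMap.congr_fun (Q.unD_iD (B := k)) h
  simpa [unD, un_apply] using this

theorem counitD_con_rD (φ : Module.Dual k H) : Q.counitD (con φ Q.rD) = φ 1 := by
  rw [← Q.lift_unD (LinearMap.id : H →ₗ[k] H)]
  generalize Q.rD = w
  induction w using TensorProduct.induction_on with
  | zero => simp
  | add s t hs ht => simp only [map_add, hs, ht]
  | tmul h X => simp [unD, Algebra.algebraMap_eq_smul_one, mul_comm]

/-- `X ↦ (d ↦ S(X₁) d X₂)` -/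
def cupD : Q.QuantumDouble →ₗ[k] Op k Q.QuantumDouble := Q.tpD (lam ∘ₗ Q.antipodeD) rho

/-- `X ↦ (d ↦ X₁ d S(X₂))` -/
def capD : Q.QuantumDouble →ₗ[k] Module.End k Q.QuantumDouble := Q.tpD lmul (rmul ∘ₗ Q.antipodeD)

instance Leg.cupD : Leg Q.cupD := by unfold QuasiHopfData.cupD; infer_instance

instance Leg.capD : Leg Q.capD := by unfold QuasiHopfData.capD; infer_instance

theorem cupD_iD (h : H) : act (Q.iD Q.α) (Q.cupD (Q.iD h)) = Q.counit h • Q.iD Q.α := by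
  have e := LinearMap.congr_fun (Q.tpD_iD (lam ∘ₗ Q.antipodeD) (rho : _ →ₗ[k] Op k Q.QuantumDouble)) h
  have e' := Q.act_tp_S Q.iD 1 h
  rw [mul_one] at e'
  rw [← e', cupD]
  rw [LinearMap.comp_assoc, antipodeD_iD] at e
  exact congrArg _ e

theorem capD_iD (h : H) : ev (Q.iD Q.β) (Q.capD (Q.iD h)) = Q.counit h • Q.iD Q.β := by
  have e := LinearMap.congr_fun
    (Q.tpD_iD (lmul : _ →ₗ[k] Module.End k Q.QuantumDouble) (rmul ∘ₗ Q.antipodeD)) h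
  have e' := Q.ev_tp_S Q.iD 1 h
  rw [mul_one] at e'
  rw [← e', capD]
  rw [LinearMap.comp_assoc, antipodeD_iD] at e
  exact congrArg _ e

theorem act_lift_cupD (e : Q.QuantumDouble) (w : H ⊗[k] Q.QuantumDouble) :
    act (inr k e) (mulMap₂ (rho ∘ₗ inl k) (Q.tpD (lam ∘ₗ inr k ∘ₗ Q.antipodeD) (rho ∘ₗ inr k)) w :
      Op k (H ⊗[k] Q.QuantumDouble)) = (act e ∘ₗ Q.cupD).lTensor H w := by
  have key : ∀ (h : H) (t : Q.QuantumDouble ⊗[k] Q.QuantumDouble),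
      act (inr k e) (rho (inl k h) * mulMap₂ (lam ∘ₗ inr k ∘ₗ Q.antipodeD) (rho ∘ₗ inr k) t :
      Op k (H ⊗[k] Q.QuantumDouble)) = h ⊗ₜ act e (mulMap₂ (lam ∘ₗ Q.antipodeD) rho t) := by
    intro h t
    induction t using TensorProduct.induction_on with
    | zero => simp
    | add s t hs ht => simp only [map_add, mul_add, hs, ht, TensorProduct.tmul_add]
    | tmul X Y => simp [act_mul, inl, inr]
  induction w using TensorProduct.induction_on with
  | zero => simp
  | add s t hs ht => simp only [map_add, hs, ht]
  | tmul h X => exact key h (Q.comulD X)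

theorem ev_lift_capD (e : Q.QuantumDouble) (w : H ⊗[k] Q.QuantumDouble) :
    ev (inr k e) (mulMap₂ (lmul ∘ₗ inl k) (Q.tpD (lmul ∘ₗ inr k) (rmul ∘ₗ inr k ∘ₗ Q.antipodeD)) w :
      Module.End k (H ⊗[k] Q.QuantumDouble)) = (ev e ∘ₗ Q.capD).lTensor H w := by
  have key : ∀ (h : H) (t : Q.QuantumDouble ⊗[k] Q.QuantumDouble),
      ev (inr k e) (lmul (inl k h) * mulMap₂ (lmul ∘ₗ inr k) (rmul ∘ₗ inr k ∘ₗ Q.antipodeD) t :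
      Module.End k (H ⊗[k] Q.QuantumDouble)) =
        h ⊗ₜ ev e (mulMap₂ lmul (rmul ∘ₗ Q.antipodeD) t) := by
    intro h t
    induction t using TensorProduct.induction_on with
    | zero => simp
    | add s t hs ht => simp only [map_add, mul_add, hs, ht, TensorProduct.tmul_add]
    | tmul X Y => simp [ev_mul, inl, inr]
  induction w using TensorProduct.induction_on with
  | zero => simp
  | add s t hs ht => simp only [map_add, hs, ht]
  | tmul h X => exact key h (Q.comulD X)

theorem act_cupD_rD : (act (Q.iD Q.α) ∘ₗ Q.cupD).lTensor H Q.rD = inr k (Q.iD Q.α) := by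
  rw [← act_lift_cupD]
  exact Q.act_tpD_rD_right (inl k : H →ₗ[k] H ⊗[k] Q.QuantumDouble) (inr k)

theorem ev_capD_rD (hβ : IsUnit Q.β) :
    (ev (Q.iD Q.β) ∘ₗ Q.capD).lTensor H Q.rD = inr k (Q.iD Q.β) := by
  rw [← ev_lift_capD]
  exact Q.ev_tpD_rD_right (inl k : H →ₗ[k] H ⊗[k] Q.QuantumDouble) (inr k) hβ

/-- The operation d ↦ S_D(X₁)dX₂ is multiplicative in X, as is ε_D, so the elements for which α is
an eigenvector with eigenvalue ε_D(X) form a subalgebra. It contains i_D(H) and the coefficients of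
R. -/
theorem act_cupD (X : Q.QuantumDouble) :
    act (Q.iD Q.α) (Q.cupD X) = Q.counitD X • Q.iD Q.α := by
  let A : Subalgebra k Q.QuantumDouble :=
    { carrier := {X | act (Q.iD Q.α) (Q.cupD X) = Q.counitD X • Q.iD Q.α}
      mul_mem' := fun {X Y} hX hY => by
        simp only [Set.mem_ofPred_eq] at hX hY ⊢
        rw [Leg.map_mul, act_mul, hX, counitD_mul, act_smul, hY, smul_smul]
      add_mem' := fun {X Y} hX hY => by
        simp only [Set.mem_ofPred_eq] at hX hY ⊢
        rw [map_add, map_add, hX, hY, map_add, add_smul]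
      algebraMap_mem' := fun r => by
        simp only [Set.mem_ofPred_eq, Algebra.algebraMap_eq_smul_one, map_smul, Leg.map_one,
          act_one, counitD_one, smul_eq_mul, mul_one] }
  refine Q.mem_of_generators (A := A) (fun h => ?_) (fun φ => ?_) X
  · change act (Q.iD Q.α) (Q.cupD (Q.iD h)) = _
    rw [cupD_iD, counitD_iD]
  · change (act (Q.iD Q.α) ∘ₗ Q.cupD) (con φ Q.rD) = _
    rw [← con_lTensor, act_cupD_rD, counitD_con_rD, inr, TensorProduct.mk_apply, con_tmul]

theorem ev_capD (hβ : IsUnit Q.β) (X : Q.QuantumDouble) :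
    ev (Q.iD Q.β) (Q.capD X) = Q.counitD X • Q.iD Q.β := by
  let A : Subalgebra k Q.QuantumDouble :=
    { carrier := {X | ev (Q.iD Q.β) (Q.capD X) = Q.counitD X • Q.iD Q.β}
      mul_mem' := fun {X Y} hX hY => by
        simp only [Set.mem_ofPred_eq] at hX hY ⊢
        rw [Leg.map_mul, ev_mul, hY, counitD_mul, ev_smul, hX, smul_smul, mul_comm]
      add_mem' := fun {X Y} hX hY => by
        simp only [Set.mem_ofPred_eq] at hX hY ⊢
        rw [map_add, map_add, hX, hY, map_add, add_smul]
      algebraMap_mem' := fun r => by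
        simp only [Set.mem_ofPred_eq, Algebra.algebraMap_eq_smul_one, map_smul, Leg.map_one,
          ev_one, counitD_one, smul_eq_mul, mul_one] }
  refine Q.mem_of_generators (A := A) (fun h => ?_) (fun φ => ?_) X
  · change ev (Q.iD Q.β) (Q.capD (Q.iD h)) = _
    rw [capD_iD, counitD_iD]
  · change (ev (Q.iD Q.β) ∘ₗ Q.capD) (con φ Q.rD) = _
    rw [← con_lTensor, Q.ev_capD_rD hβ, counitD_con_rD, inr, TensorProduct.mk_apply, con_tmul]

end DoubleAntipode

/-! ### Involutory quasi-Hopf algebras -/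

section Involutory

variable {k H B : Type*} [Field k] [Ring H] [Algebra k H] [Ring B] [Algebra k B]
  (Q : QuasiHopfData k H) [FiniteDimensional k H]

theorem mul_eq_one_swap {A : Type*} [Ring A] [Algebra k A] [FiniteDimensional k A] {a b : A}
    (h : a * b = 1) : b * a = 1 := by
  have hs : Function.Surjective (LinearMap.mulLeft k a) := fun c => ⟨b * c, by simp [← mul_assoc, h]⟩
  have hi := LinearMap.injective_iff_surjective.2 hs
  exact hi (by simp [← mul_assoc, h])

variable {Q} in
-- At h = 1 the involutory condition shows that S(β)α has right inverse βS(α), which is two-sided by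
-- finite dimension. So S² is injective, hence bijective, and the same identity exhibits an inverse
-- of α.
theorem regular_of_involutory (hQ : Q.IsQuasiHopf) (hα : Q.counit Q.α = 1) (hi : Q.IsInvolutory) :
    Q.Regular := by
  have h₁ : Q.S Q.β * Q.α * (Q.β * Q.S Q.α) = 1 := by
    have := hi 1
    rw [hQ.S_one, hQ.S_one, mul_one, mul_assoc] at this
    exact this.symm
  have h₂ := mul_eq_one_swap (k := k) h₁
  have bij : Function.Bijective (Q.S ∘ₗ Q.S) := by
    have inj : Function.Injective (Q.S ∘ₗ Q.S) := fun a b hab => by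
      simp only [LinearMap.comp_apply, hi a, hi b] at hab
      have e : ∀ c, c = Q.β * Q.S Q.α * (Q.S Q.β * Q.α * c * Q.β * Q.S Q.α) *
          (Q.S Q.β * Q.α) := fun c => by
        linear_combination (norm := noncomm_ring) - h₂ * c - Q.β * Q.S Q.α * Q.S Q.β * Q.α * c * h₂
      rw [e a, e b, hab]
    exact ⟨inj, LinearMap.injective_iff_surjective.1 inj⟩
  have hS : IsUnit (Q.S : Module.End k H) :=
    (Module.End.isUnit_iff _).2 ⟨Function.Injective.of_comp (f := Q.S) bij.1,
      Function.Surjective.of_comp (g := Q.S) bij.2⟩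
  exact
    { ax := hQ
      S_SInv := LinearMap.congr_fun (Ring.mul_inverse_cancel _ hS)
      SInv_S := LinearMap.congr_fun (Ring.inverse_mul_cancel _ hS)
      isUnit_α := by
        have h : Q.β * Q.S Q.α * Q.S Q.β * Q.α = 1 := by rw [← h₂]; noncomm_ring
        exact isUnit_iff_exists.2 ⟨_, mul_eq_one_swap (k := k) h, h⟩
      counit_α := hα }

variable {Q} in
theorem isUnit_β_of_involutory (hQ : Q.IsQuasiHopf) (hi : Q.IsInvolutory) : IsUnit Q.β := by
  have h₁ : Q.S Q.β * Q.α * (Q.β * Q.S Q.α) = 1 := by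
    have := hi 1
    rw [hQ.S_one, hQ.S_one, mul_one, mul_assoc] at this
    exact this.symm
  have h₂ := mul_eq_one_swap (k := k) h₁
  rw [mul_assoc] at h₂
  exact isUnit_iff_exists.2 ⟨_, h₂, mul_eq_one_swap (k := k) h₂⟩

variable [hQ : Q.Regular] {u w : H}

/-- The hypothesis on Δ(u), solved for f⁻¹(S ⊗ S)(f₂₁) and read in the legs x and v. It enters the
proof only in this form. -/
theorem tp_mul_leg_mul (x v : H →ₗ[k] B) [Leg x] [Leg v] [Cm x v] (huw : u * w = 1)
    (htwist : Q.comul u = Q.twistInv * Q.SS Q.twist21 * (u ⊗ₜ[k] u)) :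
    Q.tp x v u * (x w * v w) = Q.ti x v * mulMap₂ (v ∘ₗ Q.S) (x ∘ₗ Q.S) Q.twist := by
  have e₁ : mulMap₂ x v (Q.SS Q.twist21) = mulMap₂ (v ∘ₗ Q.S) (x ∘ₗ Q.S) Q.twist := by
    rw [SS, mulMap₂_map, twist21, mulMap₂_comm _ _ (fun _ _ => Cm.comm _ _)]
  have e₂ : Q.tp x v u = Q.ti x v * mulMap₂ (v ∘ₗ Q.S) (x ∘ₗ Q.S) Q.twist * (x u * v u) := by
    rw [← e₁, tp, LinearMap.comp_apply, htwist, Leg.map_mul, Leg.map_mul, mulMap₂_tmul, ti]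
  have e₃ : x u * v u * (x w * v w) = 1 := by
    have h₁ : x u * x w = 1 := by rw [← Leg.map_mul, huw, Leg.map_one]
    have h₂ : v u * v w = 1 := by rw [← Leg.map_mul, huw, Leg.map_one]
    have h₃ := Cm.comm (x := x) (y := v) w u
    linear_combination (norm := noncomm_ring) - x u * h₃ * v w + h₁ * v u * v w + h₂
  rw [e₂, mul_assoc, e₃, mul_one]

/-- The same relation with its legs exchanged and inverted. -/
theorem leg_mul_tp_mul (x v : H →ₗ[k] B) [Leg x] [Leg v] [Cm x v] (huw : u * w = 1)
    (hwu : w * u = 1) (htwist : Q.comul u = Q.twistInv * Q.SS Q.twist21 * (u ⊗ₜ[k] u)) :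
    x u * v u * Q.tp v x w = mulMap₂ (x ∘ₗ Q.S) (v ∘ₗ Q.S) Q.twistInv * Q.tw v x := by
  have n := Q.tp_mul_leg_mul v x huw htwist
  set c := mulMap₂ (x ∘ₗ Q.S) (v ∘ₗ Q.S) Q.twist with hc
  set a := mulMap₂ (x ∘ₗ Q.S) (v ∘ₗ Q.S) Q.twistInv with ha
  have e₁ : a * c = 1 := by
    have h : ∀ t, mulMap₂ (x ∘ₗ Q.S) (v ∘ₗ Q.S) t = mulMap₂ x v (Q.SS t) := fun t => by
      rw [SS, mulMap₂_map]
    have hs : Anti Q.SS := Anti.map Q.S Q.S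
    rw [ha, hc, h, h, ← Leg.map_mul, ← Anti.map_mul (x := Q.SS), twist_mul_twistInv,
      Anti.map_one (x := Q.SS), Leg.map_one]
  have e₂ := Q.tw_mul_ti v x
  have e₃ : Q.tp v x u * Q.tp v x w = 1 := by rw [← Leg.map_mul, huw, Leg.map_one]
  have h₁ : x w * x u = 1 := by rw [← Leg.map_mul, hwu, Leg.map_one]
  have h₂ : v w * v u = 1 := by rw [← Leg.map_mul, hwu, Leg.map_one]
  linear_combination (norm := noncomm_ring)
    - e₁ * x u * v u * Q.tp v x w - a * e₂ * c * x u * v u * Q.tp v x w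
    - a * Q.tw v x * n * x u * v u * Q.tp v x w
    + a * Q.tw v x * Q.tp v x u * v w * h₁ * v u * Q.tp v x w
    + a * Q.tw v x * Q.tp v x u * h₂ * Q.tp v x w + a * Q.tw v x * e₃

/-- Write J = S ⊗ S_D, an anti-morphism with J(R) = f₂₁Rf⁻¹. Then J²(R) = J(f⁻¹)·f₂₁Rf⁻¹·J(f₂₁), and
the two preceding lemmas rewrite the outer parts as (u ⊗ u)Δᶜᵒᵖ(w) and Δ(u)(w ⊗ w). Moving Δ(u)
through R cancels it against Δᶜᵒᵖ(w). -/
theorem map_antipodeD_sq_rD (huw : u * w = 1) (hwu : w * u = 1)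
    (htwist : Q.comul u = Q.twistInv * Q.SS Q.twist21 * (u ⊗ₜ[k] u)) :
    TensorProduct.map (Q.S ∘ₗ Q.S) (Q.antipodeD ∘ₗ Q.antipodeD) Q.rD =
      inl k u * inr k (Q.iD u) * Q.rD * (inl k w * inr k (Q.iD w)) := by
  set x : H →ₗ[k] H ⊗[k] Q.QuantumDouble := inl k with hx
  set v : H →ₗ[k] H ⊗[k] Q.QuantumDouble := inr k ∘ₗ Q.iD with hv
  set J := TensorProduct.map Q.S Q.antipodeD with hJ
  have j₁ : J ∘ₗ x = x ∘ₗ Q.S := map_comp_inl _ _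
  have j₂ : J ∘ₗ v = v ∘ₗ Q.S := by
    rw [hv, ← LinearMap.comp_assoc, map_comp_inr, LinearMap.comp_assoc, antipodeD_iD,
      LinearMap.comp_assoc]
  have e : J Q.rD = Q.tw v x * Q.rD * Q.ti x v := Q.map_antipodeD_rD
  have f₁ : J (Q.ti x v) = mulMap₂ (x ∘ₗ Q.S) (v ∘ₗ Q.S) Q.twistInv := by
    rw [ti, anti_mulMap₂ J x v Cm.comm, j₁, j₂]
  have f₂ : J (Q.tw v x) = mulMap₂ (v ∘ₗ Q.S) (x ∘ₗ Q.S) Q.twist := by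
    rw [tw, anti_mulMap₂ J v x Cm.comm, j₁, j₂]
  have g₁ := Q.tp_mul_leg_mul x v huw htwist
  have g₂ := Q.leg_mul_tp_mul x v huw hwu htwist
  have g₃ : Q.rD * Q.tp x v u = Q.tp v x u * Q.rD := Q.rD_intw.intw u
  have g₄ : Q.tp v x w * Q.tp v x u = 1 := by rw [← Leg.map_mul, hwu, Leg.map_one]
  rw [TensorProduct.map_comp, LinearMap.comp_apply, ← hJ, e, Anti.map_mul, Anti.map_mul, e, f₁, f₂]
  change _ = x u * v u * Q.rD * (x w * v w)
  linear_combination (norm := noncomm_ring)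
    - g₂ * Q.rD * Q.ti x v * mulMap₂ (v ∘ₗ Q.S) (x ∘ₗ Q.S) Q.twist
    - x u * v u * Q.tp v x w * Q.rD * g₁ + x u * v u * Q.tp v x w * g₃ * x w * v w
    + x u * v u * g₄ * Q.rD * x w * v w

/-- Both sides are algebra maps in X. They agree on H by assumption; on R they agree by
`map_antipodeD_sq_rD`, once the conjugation by u that S² performs on the leg of H is undone. -/
theorem antipodeD_sq (huw : u * w = 1) (hwu : w * u = 1)
    (htwist : Q.comul u = Q.twistInv * Q.SS Q.twist21 * (u ⊗ₜ[k] u))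
    (hS : ∀ h, Q.S (Q.S h) = u * h * w) (X : Q.QuantumDouble) :
    Q.antipodeD (Q.antipodeD X) = Q.iD u * X * Q.iD w := by
  have h₁ : Q.iD u * Q.iD w = 1 := by rw [← Leg.map_mul, huw, Leg.map_one]
  have h₂ : Q.iD w * Q.iD u = 1 := by rw [← Leg.map_mul, hwu, Leg.map_one]
  have l₁ : Leg (Q.antipodeD ∘ₗ Q.antipodeD) := Leg.anti_anti _ _
  have l₂ := Leg.conj (LinearMap.id : Q.QuantumDouble →ₗ[k] Q.QuantumDouble) h₂ h₁
  have key : Q.antipodeD ∘ₗ Q.antipodeD = LinearMap.mulLeft k (Q.iD u) ∘ₗ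
      LinearMap.mulRight k (Q.iD w) ∘ₗ LinearMap.id := by
    refine double_hom_ext' ?_ ?_
    · rw [LinearMap.comp_assoc, antipodeD_iD, ← LinearMap.comp_assoc, antipodeD_iD]
      ext h
      simp [hS, Leg.map_mul, mul_assoc]
    · rw [inr_conj, LinearMap.comp_id, lift_inl_inr]
      have m := Q.map_antipodeD_sq_rD huw hwu htwist
      have m' : ∀ t : H ⊗[k] Q.QuantumDouble,
          TensorProduct.map (Q.S ∘ₗ Q.S) (Q.antipodeD ∘ₗ Q.antipodeD) t =
          inl k u * mulMap₂ (inl k)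
            ((inr k : _ →ₗ[k] H ⊗[k] Q.QuantumDouble) ∘ₗ Q.antipodeD ∘ₗ Q.antipodeD) t * inl k w := fun t => by
        induction t using TensorProduct.induction_on with
        | zero => simp
        | add s t hs ht => simp only [map_add, mul_add, add_mul, hs, ht]
        | tmul h X => simp [inl, inr, hS]
      rw [m'] at m
      have c₁ : (inl k w * inl k u : H ⊗[k] Q.QuantumDouble) = 1 := by
        rw [← Leg.map_mul, hwu, Leg.map_one]
      have c₂ : (inl k w * inr k (Q.iD w) : H ⊗[k] Q.QuantumDouble) = inr k (Q.iD w) * inl k w :=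
        Cm.comm _ _
      generalize mulMap₂ (inl k)
            ((inr k : _ →ₗ[k] H ⊗[k] Q.QuantumDouble) ∘ₗ Q.antipodeD ∘ₗ Q.antipodeD) Q.rD = t at m ⊢
      linear_combination (norm := noncomm_ring)
        inl k w * m * inl k u - c₁ * t * inl k w * inl k u - t * c₁
        + c₁ * inr k (Q.iD u) * Q.rD * inl k w * inr k (Q.iD w) * inl k u
        + inr k (Q.iD u) * Q.rD * c₂ * inl k u + inr k (Q.iD u) * Q.rD * inr k (Q.iD w) * c₁
  exact LinearMap.congr_fun key X |>.trans (by simp [mul_assoc])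

end Involutory

/-! ### The axioms for the double -/

section DoubleAxioms

variable {k H B : Type*} [Field k] [Ring H] [Algebra k H] [Ring B] [Algebra k B]
  (Q : QuasiHopfData k H) [FiniteDimensional k H] [hQ : Q.Regular]

local notation "D" => Q.QuantumDouble

theorem apply_map_iD (F : D ⊗[k] (D ⊗[k] D) →ₗ[k] B) (f₁ f₂ f₃ : D →ₗ[k] B)
    (h : ∀ a b c, F (a ⊗ₜ (b ⊗ₜ c)) = f₁ a * (f₂ b * f₃ c)) (w : T3 k H) :
    F (TensorProduct.map Q.iD (TensorProduct.map Q.iD Q.iD) w) =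
      mulMap₂ (f₁ ∘ₗ Q.iD) (mulMap₂ (f₂ ∘ₗ Q.iD) (f₃ ∘ₗ Q.iD)) w := by
  induction w using TensorProduct.induction_on with
  | zero => simp
  | add s t hs ht => rw [map_add, map_add, map_add, hs, ht]
  | tmul a w =>
    induction w using TensorProduct.induction_on with
    | zero => simp
    | add s t hs ht => rw [TensorProduct.tmul_add, map_add, map_add, map_add, hs, ht]
    | tmul b c => exact h _ _ _

theorem apply_double_Phi (F : D ⊗[k] (D ⊗[k] D) →ₗ[k] B) (f₁ f₂ f₃ : D →ₗ[k] B)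
    (h : ∀ a b c, F (a ⊗ₜ (b ⊗ₜ c)) = f₁ a * (f₂ b * f₃ c)) :
    F Q.double.Phi = Q.ph (f₁ ∘ₗ Q.iD) (f₂ ∘ₗ Q.iD) (f₃ ∘ₗ Q.iD) := Q.apply_map_iD F f₁ f₂ f₃ h _

theorem double_Phi : Q.double.Phi = Q.ph ((inl k : D →ₗ[k] D ⊗[k] (D ⊗[k] D)) ∘ₗ Q.iD)
    ((inr k ∘ₗ inl k) ∘ₗ Q.iD) ((inr k ∘ₗ inr k) ∘ₗ Q.iD) :=
  Q.apply_double_Phi LinearMap.id _ _ _ fun a b c => by simp [inl, inr]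

theorem double_PhiInv : Q.double.PhiInv = Q.pb ((inl k : D →ₗ[k] D ⊗[k] (D ⊗[k] D)) ∘ₗ Q.iD)
    ((inr k ∘ₗ inl k) ∘ₗ Q.iD) ((inr k ∘ₗ inr k) ∘ₗ Q.iD) :=
  Q.apply_map_iD LinearMap.id _ _ _ (fun a b c => by simp [inl, inr]) _

theorem assoc_eq_mulMap₂ {A A' A'' : Type*} [Ring A] [Algebra k A] [Ring A'] [Algebra k A']
    [Ring A''] [Algebra k A''] (t : A ⊗[k] A') (c : A'') :
    TensorProduct.assoc k A A' A'' (t ⊗ₜ c) =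
      mulMap₂ (inl k : A →ₗ[k] A ⊗[k] (A' ⊗[k] A'')) (inr k ∘ₗ inl k) t * inr k (inr k c) := by
  induction t using TensorProduct.induction_on with
  | zero => simp
  | add s t hs ht => simp only [TensorProduct.add_tmul, map_add, add_mul, hs, ht]
  | tmul a b => simp [inl, inr]

theorem double_coassoc (X : D) : Q.comulD.lTensor D (Q.comulD X) = Q.double.Phi *
    TensorProduct.assoc k D D D (Q.comulD.rTensor D (Q.comulD X)) * Q.double.PhiInv := by
  have h := Q.tpD_assoc (inl k : D →ₗ[k] D ⊗[k] (D ⊗[k] D)) (inr k ∘ₗ inl k) (inr k ∘ₗ inr k) X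
  rw [double_Phi, double_PhiInv]
  have e₁ : ∀ w : D ⊗[k] D, Q.comulD.lTensor D w =
      mulMap₂ (inl k : D →ₗ[k] D ⊗[k] (D ⊗[k] D)) (Q.tpD (inr k ∘ₗ inl k) (inr k ∘ₗ inr k)) w := by
    intro w
    rw [lTensor_eq, tpD, map_mulMap₂]
    congr 3
    exact LinearMap.ext fun t => by rw [LinearMap.comp_apply, lift_inl_inr]
  have e₂ : ∀ w : D ⊗[k] D, TensorProduct.assoc k D D D (Q.comulD.rTensor D w) =
      mulMap₂ (Q.tpD (inl k : D →ₗ[k] D ⊗[k] (D ⊗[k] D)) (inr k ∘ₗ inl k)) (inr k ∘ₗ inr k) w := by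
    intro w
    induction w using TensorProduct.induction_on with
    | zero => simp
    | add s t hs ht => simp only [map_add, hs, ht]
    | tmul a b => exact assoc_eq_mulMap₂ _ _
  rw [e₁, e₂]
  exact h

theorem double_counit_right (X : D) :
    TensorProduct.rid k D (Q.counitD.lTensor D (Q.comulD X)) = X := by
  conv_rhs => rw [← LinearMap.id_apply (R := k) X, ← tpD_unD, tpD, LinearMap.comp_apply]
  generalize Q.comulD X = w
  induction w using TensorProduct.induction_on with
  | zero => simp
  | add s t hs ht => simp only [map_add, hs, ht]
  | tmul a b => simp [unD, Algebra.algebraMap_eq_smul_one]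

theorem double_counit_left (X : D) :
    TensorProduct.lid k D (Q.counitD.rTensor D (Q.comulD X)) = X := by
  conv_rhs => rw [← LinearMap.id_apply (R := k) X, ← unD_tpD, tpD, LinearMap.comp_apply]
  generalize Q.comulD X = w
  induction w using TensorProduct.induction_on with
  | zero => simp
  | add s t hs ht => simp only [map_add, hs, ht]
  | tmul a b => simp [unD, Algebra.algebraMap_eq_smul_one]

/-- Every term is an associator of legs that factor through i_D, and Δ_D restricts to `tp` along
i_D. The identity is therefore the pentagon for H itself. -/
theorem double_cocycle :
    ((1 : D) ⊗ₜ[k] Q.double.Phi) *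
        (((TensorProduct.assoc k D D D).toLinearMap ∘ₗ Q.comulD.rTensor D).lTensor D Q.double.Phi) *
        ((((TensorProduct.mk k D D).flip 1).lTensor D).lTensor D Q.double.Phi) =
      ((Q.comulD.lTensor D).lTensor D Q.double.Phi) *
        (TensorProduct.assoc k D D (D ⊗[k] D) (Q.comulD.rTensor (D ⊗[k] D) Q.double.Phi)) := by
  set e₁ : D →ₗ[k] D ⊗[k] (D ⊗[k] (D ⊗[k] D)) := inl k with he₁
  set e₂ : D →ₗ[k] D ⊗[k] (D ⊗[k] (D ⊗[k] D)) := inr k ∘ₗ inl k with he₂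
  set e₃ : D →ₗ[k] D ⊗[k] (D ⊗[k] (D ⊗[k] D)) := inr k ∘ₗ inr k ∘ₗ inl k with he₃
  set e₄ : D →ₗ[k] D ⊗[k] (D ⊗[k] (D ⊗[k] D)) := inr k ∘ₗ inr k ∘ₗ inr k with he₄
  have m : ∀ t : D ⊗[k] D, inr k (inr k t) = mulMap₂ e₃ e₄ t := fun t => by
    induction t using TensorProduct.induction_on with
    | zero => simp
    | add s t hs ht => simp only [map_add, hs, ht]
    | tmul a b => simp [e₃, e₄, inl, inr]
  have g : ∀ (a c : D) (t : D ⊗[k] (D ⊗[k] D)),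
      a ⊗ₜ (t * inr k (inr k c)) = e₁ a * (inr k t * e₄ c) := fun a c t => by
    simp [e₁, e₄, inl, inr]
  have f₁ := Q.apply_double_Phi (inr k) e₂ e₃ e₄ fun a b c => by simp [e₂, e₃, e₄, inl, inr]
  have f₂ := Q.apply_double_Phi
    (((TensorProduct.assoc k D D D).toLinearMap ∘ₗ Q.comulD.rTensor D).lTensor D)
    e₁ (Q.tpD e₂ e₃) e₄ fun a b c => by
      have : Q.tpD e₂ e₃ b = inr k (mulMap₂ (inl k) (inr k ∘ₗ inl k) (Q.comulD b)) := by
        rw [tpD, LinearMap.comp_apply, lift_lift]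
      change a ⊗ₜ TensorProduct.assoc k D D D (Q.comulD b ⊗ₜ c) = _
      rw [assoc_eq_mulMap₂, this]
      exact g _ _ _
  have f₃ := Q.apply_double_Phi ((((TensorProduct.mk k D D).flip 1).lTensor D).lTensor D)
    e₁ e₂ e₃ fun a b c => by simp [e₁, e₂, e₃, inl, inr]
  have f₄ := Q.apply_double_Phi ((Q.comulD.lTensor D).lTensor D) e₁ e₂ (Q.tpD e₃ e₄)
    fun a b c => by
      change a ⊗ₜ (b ⊗ₜ Q.comulD c) = e₁ a * (e₂ b * mulMap₂ e₃ e₄ (Q.comulD c))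
      rw [← m]
      simp [e₁, e₂, inl, inr]
  have f₅ := Q.apply_double_Phi ((TensorProduct.assoc k D D (D ⊗[k] D)).toLinearMap ∘ₗ
      Q.comulD.rTensor (D ⊗[k] D)) (Q.tpD e₁ e₂) e₃ e₄ fun a b c => by
      change TensorProduct.assoc k D D (D ⊗[k] D) (Q.comulD a ⊗ₜ (b ⊗ₜ c)) =
        mulMap₂ e₁ e₂ (Q.comulD a) * (e₃ b * e₄ c)
      rw [assoc_eq_mulMap₂]
      congr 1
      simp [e₃, e₄, inl, inr]
  rw [tpD_iD] at f₂ f₄ f₅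
  have p := Q.pentagon (e₁ ∘ₗ Q.iD) (e₂ ∘ₗ Q.iD) (e₃ ∘ₗ Q.iD) (e₄ ∘ₗ Q.iD)
  rw [← f₁, ← f₂, ← f₃, ← f₄, ← f₅] at p
  exact p

theorem double_Phi_counit :
    ((TensorProduct.lid k D).toLinearMap ∘ₗ Q.counitD.rTensor D).lTensor D Q.double.Phi = 1 ⊗ₜ 1 := by
  rw [Q.apply_double_Phi _ (inl k) Q.unD (inr k) fun a b c => by
    simp [inl, inr, unD, Algebra.algebraMap_eq_smul_one], unD_iD, ph_un₂]
  rfl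

theorem double_S_α (X : D) :
    mulMap₂ (LinearMap.mulRight k (Q.iD Q.α) ∘ₗ Q.antipodeD) LinearMap.id (Q.comulD X) =
      Q.counitD X • Q.iD Q.α := by
  rw [← act_cupD, cupD, tpD, LinearMap.comp_apply]
  generalize Q.comulD X = w
  induction w using TensorProduct.induction_on with
  | zero => simp
  | add s t hs ht => simp only [map_add, hs, ht]
  | tmul a b => rfl

theorem double_β_S (hβ : IsUnit Q.β) (X : D) :
    mulMap₂ (LinearMap.mulRight k (Q.iD Q.β)) Q.antipodeD (Q.comulD X) =
      Q.counitD X • Q.iD Q.β := by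
  rw [← Q.ev_capD hβ, capD, tpD, LinearMap.comp_apply]
  generalize Q.comulD X = w
  induction w using TensorProduct.induction_on with
  | zero => simp
  | add s t hs ht => simp only [map_add, hs, ht]
  | tmul a b => exact mul_assoc _ _ _

theorem antipodeD_iD_apply (h : H) : Q.antipodeD (Q.iD h) = Q.iD (Q.S h) :=
  LinearMap.congr_fun Q.antipodeD_iD h

theorem double_zig (w : T3 k H) : mulMap₂ (LinearMap.mulRight k (Q.iD Q.β))
      (mulMap₂ (LinearMap.mulRight k (Q.iD Q.α) ∘ₗ Q.antipodeD) LinearMap.id)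
      (TensorProduct.map Q.iD (TensorProduct.map Q.iD Q.iD) w) =
    Q.iD (mulMap₂ (LinearMap.mulRight k Q.β) (mulMap₂ (LinearMap.mulRight k Q.α ∘ₗ Q.S)
      LinearMap.id) w) := by
  rw [Q.apply_map_iD _ (LinearMap.mulRight k (Q.iD Q.β))
    (LinearMap.mulRight k (Q.iD Q.α) ∘ₗ Q.antipodeD) LinearMap.id fun a b c => rfl, lift_lift,
    ← map_mulMap₂]
  congr 3
  · ext a; simp [Leg.map_mul]
  · ext a; simp [Leg.map_mul, antipodeD_iD_apply]

theorem double_zag (w : T3 k H) : mulMap₂ (LinearMap.mulRight k (Q.iD Q.α) ∘ₗ Q.antipodeD)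
      (mulMap₂ (LinearMap.mulRight k (Q.iD Q.β)) Q.antipodeD)
      (TensorProduct.map Q.iD (TensorProduct.map Q.iD Q.iD) w) =
    Q.iD (mulMap₂ (LinearMap.mulRight k Q.α ∘ₗ Q.S) (mulMap₂ (LinearMap.mulRight k Q.β) Q.S) w) := by
  rw [Q.apply_map_iD _ (LinearMap.mulRight k (Q.iD Q.α) ∘ₗ Q.antipodeD)
    (LinearMap.mulRight k (Q.iD Q.β)) Q.antipodeD fun a b c => rfl, lift_lift,
    ← map_mulMap₂, antipodeD_iD]
  congr 3
  · ext a; simp [Leg.map_mul, antipodeD_iD_apply]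
  · ext a; simp [Leg.map_mul]

theorem map_iD_mul (s t : T3 k H) :
    TensorProduct.map Q.iD (TensorProduct.map Q.iD Q.iD) (s * t) =
      TensorProduct.map Q.iD (TensorProduct.map Q.iD Q.iD) s *
        TensorProduct.map Q.iD (TensorProduct.map Q.iD Q.iD) t := by
  have e : (TensorProduct.map Q.iD (TensorProduct.map Q.iD Q.iD) : T3 k H →ₗ[k] D ⊗[k] (D ⊗[k] D)) =
      mulMap₂ (inl k ∘ₗ Q.iD) (mulMap₂ ((inr k ∘ₗ inl k) ∘ₗ Q.iD) ((inr k ∘ₗ inr k) ∘ₗ Q.iD)) :=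
    LinearMap.ext fun w => Q.apply_map_iD LinearMap.id _ _ _ (fun a b c => by simp [inl, inr]) w
  rw [e, Leg.map_mul]

theorem double_isQuasiHopf (hβ : IsUnit Q.β) : Q.double.IsQuasiHopf where
  mul_assoc := mul_assoc
  one_mul := one_mul
  mul_one := mul_one
  comul_mul := Leg.map_mul (x := Q.comulD)
  comul_one := Leg.map_one (x := Q.comulD)
  counit_mul := Q.counitD_mul
  counit_one := Q.counitD_one
  Phi_mul_PhiInv := by
    refine (Q.map_iD_mul _ _).symm.trans ?_
    rw [hQ.ax.Phi_mul_PhiInv]; rfl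
  PhiInv_mul_Phi := by
    refine (Q.map_iD_mul _ _).symm.trans ?_
    rw [hQ.ax.PhiInv_mul_Phi]; rfl
  quasi_coassoc := Q.double_coassoc
  lTensor_counit := Q.double_counit_right
  rTensor_counit := Q.double_counit_left
  cocycle := Q.double_cocycle
  Phi_counit := Q.double_Phi_counit
  S_mul := Anti.map_mul (x := Q.antipodeD)
  S_one := Anti.map_one (x := Q.antipodeD)
  S_α := Q.double_S_α
  β_S := Q.double_β_S hβ
  Phi_antipode := (Q.double_zig _).trans (by rw [hQ.ax.Phi_antipode]; rfl)
  PhiInv_antipode := (Q.double_zag _).trans (by rw [hQ.ax.PhiInv_antipode]; rfl)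

/-- With u = S(β)α the inverse is βS(α), and i_D carries them to S_D(β_D)α_D and β_DS_D(α_D).
Conjugation by i_D(u) is thus the required formula for S_D². -/
theorem double_isInvolutory (hi : Q.IsInvolutory)
    (htwist : Q.comul (Q.S Q.β * Q.α) =
      Q.twistInv * Q.SS Q.twist21 * ((Q.S Q.β * Q.α) ⊗ₜ[k] (Q.S Q.β * Q.α))) :
    Q.double.IsInvolutory := by
  intro X
  have h₁ : Q.S Q.β * Q.α * (Q.β * Q.S Q.α) = 1 := by
    have := hi 1
    rw [hQ.ax.S_one, hQ.ax.S_one, mul_one, mul_assoc] at this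
    exact this.symm
  have key := Q.antipodeD_sq h₁ (mul_eq_one_swap (k := k) h₁) htwist
    (fun h => by rw [hi h]; simp only [mul_assoc]) X
  refine key.trans ?_
  change _ = Q.antipodeD (Q.iD Q.β) * Q.iD Q.α * X * Q.iD Q.β * Q.antipodeD (Q.iD Q.α)
  simp only [antipodeD_iD_apply, Leg.map_mul, mul_assoc]

end DoubleAxioms

end QuasiHopfData

end

theorem proposition2p15 {k H : Type*} [Field k] [Ring H] [Algebra k H] [FiniteDimensional k H]
    (Q : QuasiHopfData k H) (hQ : Q.IsQuasiHopf)
    (hα : Q.counit Q.α = 1) (hβ : Q.counit Q.β = 1)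
    (hinv : Q.IsInvolutory)
    (htwist : Q.comul (Q.S Q.β * Q.α) =
      Q.twistInv * Q.SS Q.twist21 * ((Q.S Q.β * Q.α) ⊗ₜ[k] (Q.S Q.β * Q.α))) :
    Q.double.IsQuasiHopf ∧ Q.double.IsInvolutory := by
  have := QuasiHopfData.regular_of_involutory hQ hα hinv
  exact ⟨Q.double_isQuasiHopf (QuasiHopfData.isUnit_β_of_involutory hQ hinv),
    Q.double_isInvolutory hinv htwist⟩
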